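/- Let $n\ge 3$ be an integer and let $\mathcal A$ be an additive category. "Subcategory" means full subcategory closed under isomorphisms, finite direct sums and direct summands. **Sequences.** For an endofunctor $\Sigma$ of an additive category, an $n$-$\Sigma$-sequence is a sequence of morphisms $A_1\xrightarrow{f_1}A_2\xrightarrow{f_2}\cdots\xrightarrow{f_{n-1}}A_n\xrightarrow{f_n}\Sigma A_1$. A morphism of such sequences is a tuple $(\varphi_1,\dots,\varphi_n)$ commuting with the $f_i$ (the last square involves $\Sigma\varphi_1$); it is an isomorphism if all $\varphi_i$ are. The left rotation of the sequence is $A_2\xrightarrow{f_2}\cdots\to A_n\xrightarrow{f_n}\Sigma A_1\xrightarrow{(-1)^n\Sigma f_1}\Sigma A_2$. *Octahedral condition.* Given three sequences $A_\bullet$ (morphisms $f_i$), $B_\bullet$ (morphisms $g_i$), $C_\bullet$ (morphisms $h_i$) with $B_1=A_1$, $C_1=A_2$, $C_2=B_2$ and $h_1f_1=g_1$, put $\varphi_2=h_1$. A class $\Theta$ satisfies the octahedral condition at these sequences if there are morphisms $\varphi_i:A_i\to B_i$, $\theta_i:B_i\to C_i$ ($3\le i\le n$) and $\psi_i:A_i\to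 C_{i-1}$ ($4\le i\le n$) such that $(1,\varphi_2,\varphi_3,\dots,\varphi_n)$ and $(f_1,1,\theta_3,\dots,\theta_n)$ are morphisms of sequences $A_\bullet\to B_\bullet$, $B_\bullet\to C_\bullet$, and the sequence $$A_3\to A_4\oplus B_3\to A_5\oplus B_4\oplus C_3\to A_6\oplus B_5\oplus C_4\to\cdots\to A_n\oplus B_{n-1}\oplus C_{n-2}\to B_n\oplus C_{n-1}\to C_n\xrightarrow{\Sigma f_2\circ h_n}\Sigma A_3$$ belongs to $\Theta$, where the first map is $\left[\begin{smallmatrix}f_3\\ \varphi_3\end{smallmatrix}\right]$, the second is $\left[\begin{smallmatrix}-f_4&0\\ \varphi_4&-g_3\\ \psi_4&\theta_3\end{smallmatrix}\right]$, the map out of $A_i\oplus B_{i-1}\oplus C_{i-2}$ ($i\ge5$) is $\left[\begin{smallmatrix}-f_i&0&0\\ (-1)^i\varphi_i&-g_{i-1}&0\\ \psi_i&\theta_{i-1}&h_{i-2}\end{smallmatrix}\right]$, and $A_i$, $B_i$, $C_i$ and all components from or to them are read as $0$ for $i>n$. **$n$-angulated categories.** Let $\mathcal D$ be an additive category, $\mathbb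 T$ an endofunctor of $\mathcal D$ and $\Theta$ a class of $n$-$\mathbb T$-sequences. $(\mathcal D,\mathbb T,\Theta)$ is right $n$-angulated if: (RN1) $\Theta$ is closed under isomorphisms and direct sums, contains $A\xrightarrow{1}A\to0\to\cdots\to0\to\mathbb TA$ for every $A$, and every morphism of $\mathcal D$ is the first morphism of a member of $\Theta$; (RN2) $\Theta$ is closed under left rotation; (RN3) for two members of $\Theta$, every commutative square between their first morphisms extends to a morphism of sequences; (RN4) $\Theta$ satisfies the octahedral condition at all triples of its members as above. It is $n$-angulated if, moreover, $\mathbb T$ is an additive equivalence, a sequence belongs to $\Theta$ if and only if its left rotation does, and $\Theta$ is closed under direct summands. **One-sided $n$-suspended categories.** Let $\Sigma$ be an additive endofunctor of $\mathcal A$ and $\mathcal X\subseteq\mathcal C$ subcategories of $\mathcal A$. A morphism $f:A\to B$ of $\mathcal C$ is $\mathcal X$-monic if every morphism from $A$ to an object of $\mathcal X$ factors through $f$; it is a left $\mathcal X$-approximation of $A$ if moreover $B\in\mathcal X$. $\mathcal X$-epics and right $\mathcal X$-approximations are dual. An $n$-$\Sigma$-sequence is a right $n$-$\mathcal C$-sequence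 if $A_3,\dots,A_n\in\mathcal C$ and $f_{i+1}$ is a weak cokernel of $f_i$ for $1\le i\le n-1$. $(\mathcal A,R_n(\mathcal C,\Sigma),\mathcal X)$ is a right $n$-suspended category if $R=R_n(\mathcal C,\Sigma)$ is a class of right $n$-$\mathcal C$-sequences such that: - (RSN1) $R$ is closed under isomorphisms and direct sums; for every $f:A\to B$ in $\mathcal C$ it contains $A\xrightarrow{\left[\begin{smallmatrix}1\\f\end{smallmatrix}\right]}A\oplus B\xrightarrow{[f\ -1]}B\to0\to\cdots\to0\to\Sigma A$; for each $A\in\mathcal C$ there is a sequence $A\xrightarrow{x}X_2\to\cdots\to X_{n-1}\to B\to\Sigma A$ in $R$ with all $X_i\in\mathcal X$ and $x$ a left $\mathcal X$-approximation of $A$; and for each such sequence and each $f:A\to B'$ in $\mathcal C$ there is a sequence $A\xrightarrow{\left[\begin{smallmatrix}x\\f\end{smallmatrix}\right]}X_2\oplus B'\to C_3\to\cdots\to C_n\to\Sigma A$ in $R$. - (RSN2) If $(a,a_2,\dots,a_{n-1},b)$ is a morphism in $R$ from $A_1\xrightarrow{f_1}\cdots\to A_n\to\Sigma A_1$ to $B\xrightarrow{x_1}X_2\to\cdots\to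 X_{n-1}\xrightarrow{x_{n-1}}C\to\Sigma B$ with all $X_i\in\mathcal X$, and $a$ factors through $f_1$, then $b$ factors through $x_{n-1}$. - (RSN3) For two members of $R$, every commutative square between their first morphisms extends to a morphism of sequences. - (RSN4) At all triples of members of $R$ as in the octahedral condition for which $f_1$ and $\varphi_2$ are $\mathcal X$-monic, the octahedral condition holds with the resulting sequence in $R$ and its first morphism $\left[\begin{smallmatrix}f_3\\ \varphi_3\end{smallmatrix}\right]$ an $\mathcal X$-monic. Left $n$-suspended categories $(\mathcal A,L_n(\mathcal C,\Omega),\mathcal X)$, whose sequences have the form $\Omega A_n\to A_1\to\cdots\to A_n$, are defined dually. **The quotient.** Let $\mathcal C/\mathcal X$ be the quotient of $\mathcal C$ by the ideal of morphisms factoring through an object of $\mathcal X$; write $\underline f$ for the class of $f$. For a right $n$-suspended category fix for every $A\in\mathcal C$ a sequence $A\xrightarrow{x}X_2\to\cdots\to X_{n-1}\xrightarrow{x_{n-1}}\mathbb GA\to\Sigma A$ in $R_n(\mathcal C,\Sigma)$ with all $X_i\in\mathcal X$ and $x$ a left $\mathcal X$-approximation of $A$. Then $A\mapsto\mathbb GA$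 is an endofunctor of $\mathcal C/\mathcal X$, with $\mathbb G\underline f=\underline h$ where $h$ is the last component of any morphism of the fixed sequences with first component $f$. A standard right $n$-angle is an $n$-$\mathbb G$-sequence in $\mathcal C/\mathcal X$ isomorphic to some $A_1\xrightarrow{\underline{f_1}}A_2\to\cdots\xrightarrow{\underline{f_{n-1}}}A_n\xrightarrow{\underline h}\mathbb GA_1$, where $A_1\xrightarrow{f_1}A_2\to\cdots\to A_n\to\Sigma A_1$ is a sequence in $R_n(\mathcal C,\Sigma)$ with terms $A_i\in\mathcal C$ and $f_1$ an $\mathcal X$-monic, and $h$ is the last component of a morphism from it to the fixed sequence of $A_1$ with first component $1_{A_1}$. Let $\Theta'$ be the class of standard right $n$-angles. **Frobenius $n$-prile categories.** $(\mathcal A,L_n(\mathcal C,\Omega),R_n(\mathcal C,\Sigma),\mathcal X)$ is a Frobenius $n$-prile category if $(\mathcal A,R_n(\mathcal C,\Sigma),\mathcal X)$ is right $n$-suspended, $(\mathcal A,L_n(\mathcal C,\Omega),\mathcal X)$ is left $n$-suspended, and - (a) $\Omega$ is left adjoint to $\Sigma$, with adjunction isomorphism $\psi_{A,B}:\operatorname{Hom}(\Omega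 A,B)\to\operatorname{Hom}(A,\Sigma B)$; - (b) for $A_1,\dots,A_n\in\mathcal C$, a sequence $\Omega A_n\xrightarrow{f}A_1\to A_2\to\cdots\to A_n$ is in $L_n(\mathcal C,\Omega)$ if and only if $A_1\to A_2\to\cdots\to A_n\xrightarrow{\psi_{A_n,A_1}(f)}\Sigma A_1$ is in $R_n(\mathcal C,\Sigma)$; - (c) for every $A\in\mathcal C$, in the fixed sequence $A\to X_2\to\cdots\to X_{n-1}\xrightarrow{x_{n-1}}\mathbb GA\to\Sigma A$ the morphism $x_{n-1}$ is a right $\mathcal X$-approximation of $\mathbb GA$, and in the (likewise fixed) sequence $\Omega A\to\mathbb HA\xrightarrow{x_1'}X_2'\to\cdots\to X_{n-1}'\to A$ in $L_n(\mathcal C,\Omega)$, with $X_i'\in\mathcal X$ and $X_{n-1}'\to A$ a right $\mathcal X$-approximation of $A$, the morphism $x_1'$ is a left $\mathcal X$-approximation of $\mathbb HA$. **Theorem.** Let $(\mathcal A,L_n(\mathcal C,\Omega),R_n(\mathcal C,\Sigma),\mathcal X)$ be a Frobenius $n$-prile category. Then the quotient $\mathcal C/\mathcal X$ is an $n$-angulated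 category with suspension $\mathbb G$: $(\mathcal C/\mathcal X,\mathbb G,\Theta)$ is $n$-angulated, where $\Theta$ is the class of all direct summands of standard right $n$-angles. If moreover idempotents split in $\mathcal A$, then already $(\mathcal C/\mathcal X,\mathbb G,\Theta')$ is $n$-angulated. -/

import Mathlib

open CategoryTheory CategoryTheory.Limits

universe v u

namespace NAng

/-! ### Sequences `A₁ ⟶ A₂ ⟶ ⋯ ⟶ Aₙ ⟶ Σ A₁` -/

section Sequences

variable {A : Type u} [Category.{v} A] [Preadditive A]

/-- An `n`-`S`-sequence `A₁ ⟶ A₂ ⟶ ⋯ ⟶ Aₙ ⟶ S A₁`.  The objects are `obj 1, …, obj n`, padded by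
zero objects in the positions `0` and `> n`; the morphism `Aᵢ ⟶ Aᵢ₊₁` is `d i (i + 1)` (and
`d i j = 0` if `j ≠ i + 1`); the last morphism `Aₙ ⟶ S A₁` is `conn`. -/
structure NSeq (n : ℕ) (S : A ⥤ A) where
  obj : ℕ → A
  d : ∀ i j, obj i ⟶ obj j
  shape : ∀ i j, i + 1 ≠ j → d i j = 0
  isZero : ∀ i, (i = 0 ∨ n < i) → IsZero (obj i)
  conn : obj n ⟶ S.obj (obj 1)

namespace NSeq

variable {n : ℕ} {S : A ⥤ A}

/-- A morphism of `n`-`S`-sequences. -/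
structure Hom (P Q : NSeq n S) where
  app : ∀ i, P.obj i ⟶ Q.obj i
  comm : ∀ i j, P.d i j ≫ app j = app i ≫ Q.d i j
  comm_conn : P.conn ≫ S.map (app 1) = app n ≫ Q.conn

/-- A morphism of `n`-`S`-sequences is an isomorphism if all its components are. -/
def Hom.IsIso {P Q : NSeq n S} (φ : Hom P Q) : Prop :=
  ∀ i, CategoryTheory.IsIso (φ.app i)

/-- Identity morphism. -/
def Hom.id (P : NSeq n S) : Hom P P where
  app i := 𝟙 (P.obj i)
  comm i j := by simp
  comm_conn := by simp

/-- Composition of morphisms. -/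
def Hom.comp {P Q R : NSeq n S} (φ : Hom P Q) (ψ : Hom Q R) : Hom P R where
  app i := φ.app i ≫ ψ.app i
  comm i j := by rw [← Category.assoc, φ.comm, Category.assoc, ψ.comm, Category.assoc]
  comm_conn := by
    rw [S.map_comp, ← Category.assoc, φ.comm_conn, Category.assoc, ψ.comm_conn, Category.assoc]

/-- Difference of morphisms, for an additive endofunctor `S`. -/
def Hom.sub [S.Additive] {P Q : NSeq n S} (φ ψ : Hom P Q) : Hom P Q where
  app i := φ.app i - ψ.app i
  comm i j := by rw [Preadditive.comp_sub, Preadditive.sub_comp, φ.comm, ψ.comm]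
  comm_conn := by
    rw [S.map_sub, Preadditive.comp_sub, Preadditive.sub_comp, φ.comm_conn, ψ.comm_conn]

/-- The sequence with given objects and given morphisms between consecutive objects. -/
def ofSucc (obj : ℕ → A) (map : ∀ i, obj i ⟶ obj (i + 1))
    (isZero : ∀ i, (i = 0 ∨ n < i) → IsZero (obj i)) (conn : obj n ⟶ S.obj (obj 1)) :
    NSeq n S where
  obj := obj
  d i j := if h : i + 1 = j then map i ≫ eqToHom (congrArg obj h) else 0
  shape _ _ h := dif_neg h
  isZero := isZero
  conn := conn

/-- The direct sum of two `n`-`S`-sequences. -/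
noncomputable def sum [HasBinaryBiproducts A] (P Q : NSeq n S) : NSeq n S where
  obj i := P.obj i ⊞ Q.obj i
  d i j := biprod.map (P.d i j) (Q.d i j)
  shape i j h := by rw [P.shape i j h, Q.shape i j h]; ext <;> simp
  isZero i h := by
    rw [IsZero.iff_id_eq_zero]
    ext
    · exact (P.isZero i h).eq_of_src _ _
    · exact (P.isZero i h).eq_of_src _ _
    · exact (Q.isZero i h).eq_of_src _ _
    · exact (Q.isZero i h).eq_of_src _ _
  conn := biprod.desc (P.conn ≫ S.map biprod.inl) (Q.conn ≫ S.map biprod.inr)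

/-- `P'` is (isomorphic to) the left rotation
`A₂ ⟶ A₃ ⟶ ⋯ ⟶ Aₙ ⟶ S A₁ ⟶ S A₂` of `P`, with last morphism `(-1)ⁿ S f₁`; here `n = m + 3`. -/
def IsLeftRotation {m : ℕ} (P P' : NSeq (m + 3) S) : Prop :=
  ∃ (a : ∀ i, 1 ≤ i → i ≤ m + 2 → (P'.obj i ≅ P.obj (i + 1)))
    (b : P'.obj (m + 3) ≅ S.obj (P.obj 1)),
    (∀ i (h₁ : 1 ≤ i) (h₂ : i + 1 ≤ m + 2),
      P'.d i (i + 1) ≫ (a (i + 1) (by omega) h₂).hom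
        = (a i h₁ (by omega)).hom ≫ P.d (i + 1) (i + 2)) ∧
    P'.d (m + 2) (m + 3) ≫ b.hom = (a (m + 2) (by omega) le_rfl).hom ≫ P.conn ∧
    P'.conn ≫ S.map (a 1 le_rfl (by omega)).hom
      = ((-1 : ℤ) ^ (m + 3)) • (b.hom ≫ S.map (P.d 1 2))

section Explicit

variable [HasZeroObject A] [HasBinaryBiproducts A]

open scoped ZeroObject

/-- Objects of the trivial sequence. -/
noncomputable def trivialObj (X : A) : ℕ → A
  | 1 => X
  | 2 => X
  | _ => 0

/-- Morphisms of the trivial sequence. -/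
noncomputable def trivialMap (X : A) : ∀ i, trivialObj X i ⟶ trivialObj X (i + 1)
  | 1 => 𝟙 X
  | 0 => 0
  | _ + 2 => 0

/-- The trivial sequence `X ⟶ X ⟶ 0 ⟶ ⋯ ⟶ 0 ⟶ S X` with first morphism the identity. -/
noncomputable def trivial (m : ℕ) (S : A ⥤ A) (X : A) : NSeq (m + 3) S :=
  ofSucc (trivialObj X) (trivialMap X)
    (by
      rintro (_ | _ | _ | i) h
      · exact isZero_zero A
      · omega
      · omega
      · exact isZero_zero A)
    0

/-- Objects of the graph sequence of a morphism `X ⟶ Y`. -/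
noncomputable def graphObj (X Y : A) : ℕ → A
  | 1 => X
  | 2 => X ⊞ Y
  | 3 => Y
  | _ => 0

/-- Morphisms of the graph sequence of a morphism `X ⟶ Y`. -/
noncomputable def graphMap {X Y : A} (f : X ⟶ Y) : ∀ i, graphObj X Y i ⟶ graphObj X Y (i + 1)
  | 1 => biprod.lift (𝟙 X) f
  | 2 => biprod.desc f (-𝟙 Y)
  | 0 => 0
  | _ + 3 => 0

/-- The sequence `X ⟶ X ⊞ Y ⟶ Y ⟶ 0 ⟶ ⋯ ⟶ 0 ⟶ S X` attached to `f : X ⟶ Y`, with first two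
morphisms `(1, f)` and `(f, -1)`, and with last morphism zero. -/
noncomputable def graph (m : ℕ) (S : A ⥤ A) {X Y : A} (f : X ⟶ Y) : NSeq (m + 3) S :=
  ofSucc (graphObj X Y) (graphMap f)
    (by
      rintro (_ | _ | _ | _ | i) h
      · exact isZero_zero A
      · omega
      · omega
      · omega
      · exact isZero_zero A)
    0

/-- Objects of the octahedral sequence:
`A₃`, `A₄ ⊞ B₃`, `A₅ ⊞ B₄ ⊞ C₃`, `A₆ ⊞ B₅ ⊞ C₄`, … (recall that `Aᵢ = Bᵢ = Cᵢ = 0` for `i > n`). -/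
noncomputable def octObj (P Q R : NSeq n S) : ℕ → A
  | 0 => 0
  | 1 => P.obj 3
  | 2 => P.obj 4 ⊞ Q.obj 3
  | k + 3 => P.obj (k + 5) ⊞ (Q.obj (k + 4) ⊞ R.obj (k + 3))

/-- Morphisms of the octahedral sequence.  With `f, g, h` the morphisms of `P, Q, R`, they are
`[f₃; φ₃]`, `[-f₄, 0; φ₄, -g₃; ψ₄, θ₃]` and, from position `k ≥ 3` to position `k + 1`, the matrix
`[-fₖ₊₂, 0, 0; (-1)ᵏ⁺² φₖ₊₂, -gₖ₊₁, 0; ψₖ₊₂, θₖ₊₁, hₖ]`.  Here `ψ k : Aₖ₊₁ ⟶ Cₖ` is what is usually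
written `ψₖ₊₁`. -/
noncomputable def octMap {P Q R : NSeq n S} (φ : ∀ i, P.obj i ⟶ Q.obj i)
    (θ : ∀ i, Q.obj i ⟶ R.obj i) (ψ : ∀ i, P.obj (i + 1) ⟶ R.obj i) :
    ∀ i, octObj P Q R i ⟶ octObj P Q R (i + 1)
  | 0 => 0
  | 1 => biprod.lift (P.d 3 4) (φ 3)
  | 2 => biprod.desc
      (biprod.lift (-P.d 4 5) (biprod.lift (φ 4) (ψ 3)))
      (biprod.lift 0 (biprod.lift (-Q.d 3 4) (θ 3)))
  | k + 3 => biprod.desc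
      (biprod.lift (-P.d (k + 5) (k + 6))
        (biprod.lift (((-1 : ℤ) ^ (k + 5)) • φ (k + 5)) (ψ (k + 4))))
      (biprod.desc
        (biprod.lift 0 (biprod.lift (-Q.d (k + 4) (k + 5)) (θ (k + 4))))
        (biprod.lift 0 (biprod.lift 0 (R.d (k + 3) (k + 4)))))

/-- The octahedral sequence
`A₃ ⟶ A₄ ⊞ B₃ ⟶ A₅ ⊞ B₄ ⊞ C₃ ⟶ ⋯ ⟶ Aₙ ⊞ Bₙ₋₁ ⊞ Cₙ₋₂ ⟶ Bₙ ⊞ Cₙ₋₁ ⟶ Cₙ ⟶ S A₃`,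
with last morphism `S f₂ ∘ hₙ`, where `b : A₂ ≅ C₁` identifies `A₂` with `C₁`; here `n = m + 3`. -/
noncomputable def oct {m : ℕ} {P Q R : NSeq (m + 3) S} (b : P.obj 2 ≅ R.obj 1)
    (φ : ∀ i, P.obj i ⟶ Q.obj i) (θ : ∀ i, Q.obj i ⟶ R.obj i)
    (ψ : ∀ i, P.obj (i + 1) ⟶ R.obj i) : NSeq (m + 3) S :=
  ofSucc (octObj P Q R) (octMap φ θ ψ)
    (by
      rintro (_ | _ | _ | k) h
      · exact isZero_zero A
      · omega
      · omega
      · rw [IsZero.iff_id_eq_zero]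
        have h₁ := P.isZero (k + 5) (by omega)
        have h₂ := Q.isZero (k + 4) (by omega)
        have h₃ := R.isZero (k + 3) (by omega)
        apply biprod.hom_ext'
        · exact h₁.eq_of_src _ _
        · apply biprod.hom_ext'
          · exact h₂.eq_of_src _ _
          · exact h₃.eq_of_src _ _)
    ((biprod.snd ≫ biprod.snd : P.obj (m + 5) ⊞ (Q.obj (m + 4) ⊞ R.obj (m + 3)) ⟶ R.obj (m + 3)) ≫
      R.conn ≫ S.map b.inv ≫ S.map (P.d 2 3))

/-- A class of sequences satisfies the octahedral condition at the rows `P` (objects `Aᵢ`), `Q`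
(objects `Bᵢ`), `R` (objects `Cᵢ`) with identifications `a : A₁ ≅ B₁`, `b : A₂ ≅ C₁`, `c : B₂ ≅ C₂`:
there are morphisms of sequences `φ` from `P` to `Q` with `φ₁ = 1` and second component the first
morphism of `R`, and `θ` from `Q` to `R` with first component the first morphism of `P` and
`θ₂ = 1`, and morphisms `ψᵢ : Aᵢ ⟶ Cᵢ₋₁`, such that the octahedral sequence satisfies `good`. -/
def HasOct {m : ℕ} (good : NSeq (m + 3) S → Prop) (P Q R : NSeq (m + 3) S)
    (a : P.obj 1 ≅ Q.obj 1) (b : P.obj 2 ≅ R.obj 1) (c : Q.obj 2 ≅ R.obj 2) : Prop :=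
  ∃ (φ : Hom P Q) (θ : Hom Q R) (ψ : ∀ i, P.obj (i + 1) ⟶ R.obj i),
    φ.app 1 = a.hom ∧ φ.app 2 = b.hom ≫ R.d 1 2 ≫ c.inv ∧
    θ.app 1 = a.inv ≫ P.d 1 2 ≫ b.hom ∧ θ.app 2 = c.hom ∧
    good (oct b φ.app θ.app ψ)

end Explicit

end NSeq

end Sequences

/-! ### `n`-angulated categories -/

section NAngulated

variable {D : Type u} [Category.{v} D] [Preadditive D] [HasZeroObject D] [HasBinaryBiproducts D]

/-- `(D, T, Θ)` is a right `n`-angulated category, `n = m + 3`. -/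
structure IsRightNAngulated (m : ℕ) (T : D ⥤ D) (Θ : NSeq (m + 3) T → Prop) : Prop where
  iso_closed : ∀ {P Q : NSeq (m + 3) T} (φ : NSeq.Hom P Q), φ.IsIso → Θ P → Θ Q
  sum_closed : ∀ {P Q : NSeq (m + 3) T}, Θ P → Θ Q → Θ (P.sum Q)
  trivial_mem : ∀ X : D, Θ (NSeq.trivial m T X)
  exists_first : ∀ {X Y : D} (f : X ⟶ Y), ∃ P : NSeq (m + 3) T, Θ P ∧
    ∃ (e₁ : P.obj 1 ≅ X) (e₂ : P.obj 2 ≅ Y), P.d 1 2 ≫ e₂.hom = e₁.hom ≫ f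
  rotate : ∀ {P P' : NSeq (m + 3) T}, P.IsLeftRotation P' → Θ P → Θ P'
  complete : ∀ {P Q : NSeq (m + 3) T}, Θ P → Θ Q →
    ∀ (a : P.obj 1 ⟶ Q.obj 1) (b : P.obj 2 ⟶ Q.obj 2), P.d 1 2 ≫ b = a ≫ Q.d 1 2 →
      ∃ φ : NSeq.Hom P Q, φ.app 1 = a ∧ φ.app 2 = b
  octahedral : ∀ {P Q R : NSeq (m + 3) T}, Θ P → Θ Q → Θ R →
    ∀ (a : P.obj 1 ≅ Q.obj 1) (b : P.obj 2 ≅ R.obj 1) (c : Q.obj 2 ≅ R.obj 2),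
      P.d 1 2 ≫ b.hom ≫ R.d 1 2 = a.hom ≫ Q.d 1 2 ≫ c.hom → NSeq.HasOct Θ P Q R a b c

/-- `(D, T, Θ)` is an `n`-angulated category, `n = m + 3`: a right `n`-angulated category whose
suspension `T` is an (additive) equivalence, such that a sequence belongs to `Θ` if and only if its
left rotation does, and such that `Θ` is closed under direct summands. -/
structure IsNAngulated (m : ℕ) (T : D ⥤ D) (Θ : NSeq (m + 3) T → Prop) : Prop
    extends IsRightNAngulated m T Θ where
  additive : T.Additive
  isEquivalence : T.IsEquivalence
  rotate_inv : ∀ {P P' : NSeq (m + 3) T}, P.IsLeftRotation P' → Θ P' → Θ P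
  summand_closed : ∀ {P Q : NSeq (m + 3) T}, Θ (P.sum Q) → Θ P

end NAngulated

/-! ### One-sided `n`-suspended categories -/

section Suspended

variable {A : Type u} [Category.{v} A] [Preadditive A]

/-- `g` is a weak cokernel of `f`. -/
def IsWeakCokernel {X Y Z : A} (f : X ⟶ Y) (g : Y ⟶ Z) : Prop :=
  f ≫ g = 0 ∧ ∀ ⦃W : A⦄ (h : Y ⟶ W), f ≫ h = 0 → ∃ p : Z ⟶ W, g ≫ p = h

/-- The morphism `f` of `C` is `X`-monic: every morphism from its source to an object of `X`
factors through `f`. -/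
def IsXMonic (C X : ObjectProperty A) {M N : A} (f : M ⟶ N) : Prop :=
  C M ∧ C N ∧ ∀ ⦃Z : A⦄, X Z → ∀ g : M ⟶ Z, ∃ h : N ⟶ Z, f ≫ h = g

/-- The morphism `f` of `C` is `X`-epic: every morphism from an object of `X` to its target
factors through `f`. -/
def IsXEpic (C X : ObjectProperty A) {M N : A} (f : M ⟶ N) : Prop :=
  C M ∧ C N ∧ ∀ ⦃Z : A⦄, X Z → ∀ g : Z ⟶ N, ∃ h : Z ⟶ M, h ≫ f = g

/-- The full subcategory of objects satisfying `P` is an additive subcategory closed under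
isomorphisms, direct sums and direct summands. -/
class IsAdditiveSubcategory [HasBinaryBiproducts A] (P : ObjectProperty A) : Prop where
  iso_mem : ∀ {M N : A}, (M ≅ N) → P M → P N
  zero_mem : ∀ {Z : A}, IsZero Z → P Z
  biprod_mem : ∀ {M N : A}, P M → P N → P (M ⊞ N)
  summand_mem : ∀ {M N : A}, P (M ⊞ N) → P M

/-- A right `n`-`C`-sequence, `n = m + 3`: `A₃, …, Aₙ ∈ C` and each of the morphisms `f₂, …, fₙ` is a
weak cokernel of the preceding one. -/
structure IsRightCSeq (C : ObjectProperty A) {m : ℕ} {S : A ⥤ A} (P : NSeq (m + 3) S) : Prop where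
  mem : ∀ i, 3 ≤ i → i ≤ m + 3 → C (P.obj i)
  weakCokernel : ∀ i, 1 ≤ i → i ≤ m + 1 → IsWeakCokernel (P.d i (i + 1)) (P.d (i + 1) (i + 2))
  weakCokernel_conn : IsWeakCokernel (P.d (m + 2) (m + 3)) P.conn

/-- A sequence `M ⟶ X₂ ⟶ ⋯ ⟶ Xₙ₋₁ ⟶ B ⟶ S M` of the class `R` with `X₂, …, Xₙ₋₁ ∈ X` whose first
morphism is a left `X`-approximation of `M` (where `M` is in `C`). -/
structure ApproxSeq (C X : ObjectProperty A) {m : ℕ} {S : A ⥤ A} (R : NSeq (m + 3) S → Prop)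
    (M : A) where
  seq : NSeq (m + 3) S
  mem : R seq
  e : seq.obj 1 ≅ M
  mem_X : ∀ i, 2 ≤ i → i ≤ m + 2 → X (seq.obj i)
  monic : IsXMonic C X (seq.d 1 2)

variable [HasZeroObject A] [HasBinaryBiproducts A]

/-- `(A, R, X)` is a right `n`-suspended category (`n = m + 3`), where `R` is a class of right
`n`-`C`-sequences for the endofunctor `S`.  -/
structure IsRightSuspended (m : ℕ) (S : A ⥤ A) (C X : ObjectProperty A)
    (R : NSeq (m + 3) S → Prop) : Prop where
  isRightCSeq : ∀ {P : NSeq (m + 3) S}, R P → IsRightCSeq C P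
  iso_closed : ∀ {P Q : NSeq (m + 3) S} (φ : NSeq.Hom P Q), φ.IsIso → R P → R Q
  sum_closed : ∀ {P Q : NSeq (m + 3) S}, R P → R Q → R (P.sum Q)
  graph_mem : ∀ {M N : A} (f : M ⟶ N), C M → C N → R (NSeq.graph m S f)
  exists_approx : ∀ M : A, C M → Nonempty (ApproxSeq C X R M)
  exists_cone : ∀ {M N : A} (Q : ApproxSeq C X R M) (f : M ⟶ N), C M → C N →
    ∃ P : NSeq (m + 3) S, R P ∧ ∃ (e₁ : P.obj 1 ≅ M) (e₂ : P.obj 2 ≅ Q.seq.obj 2 ⊞ N),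
      P.d 1 2 ≫ e₂.hom = e₁.hom ≫ biprod.lift (Q.e.inv ≫ Q.seq.d 1 2) f
  factor : ∀ {P Q : NSeq (m + 3) S}, R P → R Q → (∀ i, 2 ≤ i → i ≤ m + 2 → X (Q.obj i)) →
    ∀ φ : NSeq.Hom P Q, (∃ u : P.obj 2 ⟶ Q.obj 1, P.d 1 2 ≫ u = φ.app 1) →
      ∃ w : P.obj (m + 3) ⟶ Q.obj (m + 2), w ≫ Q.d (m + 2) (m + 3) = φ.app (m + 3)
  complete : ∀ {P Q : NSeq (m + 3) S}, R P → R Q →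
    ∀ (a : P.obj 1 ⟶ Q.obj 1) (b : P.obj 2 ⟶ Q.obj 2), P.d 1 2 ≫ b = a ≫ Q.d 1 2 →
      ∃ φ : NSeq.Hom P Q, φ.app 1 = a ∧ φ.app 2 = b
  octahedral : ∀ {P Q T : NSeq (m + 3) S}, R P → R Q → R T →
    ∀ (a : P.obj 1 ≅ Q.obj 1) (b : P.obj 2 ≅ T.obj 1) (c : Q.obj 2 ≅ T.obj 2),
      P.d 1 2 ≫ b.hom ≫ T.d 1 2 = a.hom ≫ Q.d 1 2 ≫ c.hom →
      IsXMonic C X (P.d 1 2) → IsXMonic C X (T.d 1 2) →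
      NSeq.HasOct (fun W => R W ∧ IsXMonic C X (W.d 1 2)) P Q T a b c

end Suspended

/-! ### The quotient category `C/X` -/

section Quotient

variable {A : Type u} [Category.{v} A] [Preadditive A] [HasZeroObject A] [HasBinaryBiproducts A]

open scoped ZeroObject

/-- Two morphisms of `C` are identified in `C/X` if their difference factors through an object
of `X`. -/
def idealRel (C X : ObjectProperty A) : HomRel C.FullSubcategory :=
  fun M N f g => ∃ (Z : A) (_ : X Z) (p : M.obj ⟶ Z) (q : Z ⟶ N.obj), f.hom - g.hom = p ≫ q

variable (C X : ObjectProperty A)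

lemma idealRel_add [IsAdditiveSubcategory X] ⦃M N : C.FullSubcategory⦄ (f₁ f₂ g₁ g₂ : M ⟶ N)
    (h₁ : idealRel C X f₁ f₂) (h₂ : idealRel C X g₁ g₂) :
    idealRel C X (f₁ + g₁) (f₂ + g₂) := by
  obtain ⟨Z, hZ, p, q, e⟩ := h₁
  obtain ⟨Z', hZ', p', q', e'⟩ := h₂
  refine ⟨Z ⊞ Z', IsAdditiveSubcategory.biprod_mem hZ hZ', biprod.lift p p', biprod.desc q q', ?_⟩
  rw [biprod.lift_desc, ← e, ← e']
  change (f₁.hom + g₁.hom) - (f₂.hom + g₂.hom) = _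
  abel

instance [IsAdditiveSubcategory X] : Congruence (idealRel C X) where
  comp_left := by
    rintro M N K f g g' ⟨Z, hZ, p, q, e⟩
    exact ⟨Z, hZ, f.hom ≫ p, q, by
      change f.hom ≫ g.hom - f.hom ≫ g'.hom = _
      rw [← Preadditive.comp_sub, e, Category.assoc]⟩
  comp_right := by
    rintro M N K f f' g ⟨Z, hZ, p, q, e⟩
    exact ⟨Z, hZ, p, q ≫ g.hom, by
      change f.hom ≫ g.hom - f'.hom ≫ g.hom = _
      rw [← Preadditive.sub_comp, e, Category.assoc]⟩
  equivalence :=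
    { refl := fun f => ⟨0, IsAdditiveSubcategory.zero_mem (isZero_zero A), 0, 0, by simp⟩
      symm := by
        rintro f g ⟨Z, hZ, p, q, e⟩
        exact ⟨Z, hZ, -p, q, by rw [Preadditive.neg_comp, ← e]; abel⟩
      trans := by
        rintro f g h ⟨Z, hZ, p, q, e⟩ ⟨Z', hZ', p', q', e'⟩
        refine ⟨Z ⊞ Z', IsAdditiveSubcategory.biprod_mem hZ hZ', biprod.lift p p',
          biprod.desc q q', ?_⟩
        rw [biprod.lift_desc, ← e, ← e']
        abel }

/-- The quotient category `C/X`. -/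
abbrev QuotCat : Type u := CategoryTheory.Quotient (idealRel C X)

noncomputable instance [IsAdditiveSubcategory X] : Preadditive (QuotCat C X) :=
  CategoryTheory.Quotient.preadditive _ (idealRel_add C X)

/-- The quotient functor from `C` to `C/X`. -/
abbrev quotFunctor : C.FullSubcategory ⥤ QuotCat C X :=
  CategoryTheory.Quotient.functor (idealRel C X)

instance [IsAdditiveSubcategory X] : (quotFunctor C X).Additive :=
  CategoryTheory.Quotient.functor_additive _ (idealRel_add C X)

variable {C X} in
/-- The object of `C/X` given by an object of `C`. -/
abbrev QuotCat.mk (M : A) (h : C M) : QuotCat C X := (quotFunctor C X).obj ⟨M, h⟩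

variable {C X} in
/-- The class in `C/X` of a morphism of `C`. -/
abbrev QuotCat.homMk {M N : A} {hM : C M} {hN : C N} (f : M ⟶ N) :
    (QuotCat.mk M hM : QuotCat C X) ⟶ QuotCat.mk N hN :=
  (quotFunctor C X).map (ObjectProperty.homMk f)

instance [IsAdditiveSubcategory C] [IsAdditiveSubcategory X] : HasZeroObject (QuotCat C X) := by
  refine ⟨QuotCat.mk 0 (IsAdditiveSubcategory.zero_mem (isZero_zero A)), ?_⟩
  rw [IsZero.iff_id_eq_zero]
  have h : (𝟙 (⟨0, IsAdditiveSubcategory.zero_mem (isZero_zero A)⟩ : C.FullSubcategory)) = 0 := by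
    ext
  have h' := congrArg (quotFunctor C X).map h
  rw [CategoryTheory.Functor.map_id, Functor.map_zero] at h'
  exact h'

instance [IsAdditiveSubcategory C] [IsAdditiveSubcategory X] :
    HasBinaryBiproducts (QuotCat C X) where
  has_binary_biproduct := by
    rintro ⟨M⟩ ⟨N⟩
    let W : C.FullSubcategory :=
      ⟨M.obj ⊞ N.obj, IsAdditiveSubcategory.biprod_mem M.property N.property⟩
    let F := quotFunctor C X
    let i₁ : M ⟶ W := ObjectProperty.homMk biprod.inl
    let i₂ : N ⟶ W := ObjectProperty.homMk biprod.inr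
    let p₁ : W ⟶ M := ObjectProperty.homMk biprod.fst
    let p₂ : W ⟶ N := ObjectProperty.homMk biprod.snd
    have h₁₁ : i₁ ≫ p₁ = 𝟙 M := by ext; exact biprod.inl_fst
    have h₁₂ : i₁ ≫ p₂ = 0 := by ext; exact biprod.inl_snd
    have h₂₁ : i₂ ≫ p₁ = 0 := by ext; exact biprod.inr_fst
    have h₂₂ : i₂ ≫ p₂ = 𝟙 N := by ext; exact biprod.inr_snd
    have ht : p₁ ≫ i₁ + p₂ ≫ i₂ = 𝟙 W := by ext1; exact biprod.total
    let b : BinaryBicone (F.obj M) (F.obj N) :=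
      { pt := F.obj W
        fst := F.map p₁
        snd := F.map p₂
        inl := F.map i₁
        inr := F.map i₂
        inl_fst := by rw [← F.map_comp, h₁₁, F.map_id]
        inl_snd := by rw [← F.map_comp, h₁₂, F.map_zero]
        inr_fst := by rw [← F.map_comp, h₂₁, F.map_zero]
        inr_snd := by rw [← F.map_comp, h₂₂, F.map_id] }
    refine HasBinaryBiproduct.mk ⟨b, isBinaryBilimitOfTotal b ?_⟩
    change F.map p₁ ≫ F.map i₁ + F.map p₂ ≫ F.map i₂ = 𝟙 (F.obj W)
    rw [← F.map_comp, ← F.map_comp, ← F.map_add, ht, F.map_id]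

end Quotient

/-! ### The suspension and the standard angles of `C/X` -/

section Standard

variable {A : Type u} [Category.{v} A] [Preadditive A] [HasZeroObject A] [HasBinaryBiproducts A]
variable {m : ℕ} {S : A ⥤ A} {C X : ObjectProperty A} {R : NSeq (m + 3) S → Prop}

open scoped ZeroObject

lemma ApproxSeq.exists_lift (hR : IsRightSuspended m S C X R) {M N : A}
    (P : ApproxSeq C X R M) (Q : ApproxSeq C X R N) (f : M ⟶ N) :
    ∃ φ : NSeq.Hom P.seq Q.seq, φ.app 1 = P.e.hom ≫ f ≫ Q.e.inv := by
  obtain ⟨b, hb⟩ := P.monic.2.2 (Q.mem_X 2 le_rfl (by omega))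
    ((P.e.hom ≫ f ≫ Q.e.inv) ≫ Q.seq.d 1 2)
  obtain ⟨φ, h₁, -⟩ := hR.complete P.mem Q.mem (P.e.hom ≫ f ≫ Q.e.inv) b hb
  exact ⟨φ, h₁⟩

lemma ApproxSeq.factor_of_factor [S.Additive] (hR : IsRightSuspended m S C X R) {P : NSeq (m + 3) S}
    (hP : R P) (hP' : IsXMonic C X (P.d 1 2)) {N : A} (Q : ApproxSeq C X R N)
    (φ ψ : NSeq.Hom P Q.seq)
    (h : ∃ (Z : A) (_ : X Z) (p : P.obj 1 ⟶ Z) (q : Z ⟶ Q.seq.obj 1),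
      φ.app 1 - ψ.app 1 = p ≫ q) :
    ∃ (Z : A) (_ : X Z) (p : P.obj (m + 3) ⟶ Z) (q : Z ⟶ Q.seq.obj (m + 3)),
      φ.app (m + 3) - ψ.app (m + 3) = p ≫ q := by
  obtain ⟨Z, hZ, p, q, e⟩ := h
  obtain ⟨r, hr⟩ := hP'.2.2 hZ p
  obtain ⟨w, hw⟩ := hR.factor hP Q.mem Q.mem_X (φ.sub ψ)
    ⟨r ≫ q, by rw [← Category.assoc, hr]; exact e.symm⟩
  exact ⟨_, Q.mem_X (m + 2) (by omega) le_rfl, w, _, hw.symm⟩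

lemma ApproxSeq.mem_last (hR : IsRightSuspended m S C X R) {M : A} (P : ApproxSeq C X R M) :
    C (P.seq.obj (m + 3)) :=
  (hR.isRightCSeq P.mem).mem (m + 3) (by omega) le_rfl

variable [S.Additive] [IsAdditiveSubcategory X]

/-- For fixed sequences `M ⟶ X₂ ⟶ ⋯ ⟶ Xₙ₋₁ ⟶ G M ⟶ S M`, one for each `M` in `C`, this is the functor
`C ⥤ C/X` which sends `M` to `G M`, and `f : M ⟶ N` to the class of the last component of any
morphism from the fixed sequence of `M` to that of `N` whose first component is `f`. -/
noncomputable def suspAux (hR : IsRightSuspended m S C X R)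
    (fix : ∀ M : A, C M → ApproxSeq C X R M) : C.FullSubcategory ⥤ QuotCat C X where
  obj M := QuotCat.mk ((fix M.obj M.property).seq.obj (m + 3)) (ApproxSeq.mem_last hR _)
  map {M N} f := QuotCat.homMk
    ((ApproxSeq.exists_lift hR (fix M.obj M.property) (fix N.obj N.property) f.hom).choose.app
      (m + 3))
  map_id M := by
    refine Eq.trans ?_ ((quotFunctor C X).map_id _)
    refine CategoryTheory.Quotient.sound _ ?_
    refine ApproxSeq.factor_of_factor hR (fix M.obj M.property).mem (fix M.obj M.property).monic
      (fix M.obj M.property) _ (NSeq.Hom.id _)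
      ⟨0, IsAdditiveSubcategory.zero_mem (isZero_zero A), 0, 0, ?_⟩
    rw [(ApproxSeq.exists_lift hR _ _ _).choose_spec]
    simp [NSeq.Hom.id]
  map_comp {M N K} f g := by
    refine Eq.trans ?_ ((quotFunctor C X).map_comp _ _)
    refine CategoryTheory.Quotient.sound _ ?_
    refine ApproxSeq.factor_of_factor hR (fix M.obj M.property).mem (fix M.obj M.property).monic
      (fix K.obj K.property) _
      ((ApproxSeq.exists_lift hR (fix M.obj M.property) (fix N.obj N.property) f.hom).choose.comp
        (ApproxSeq.exists_lift hR (fix N.obj N.property) (fix K.obj K.property) g.hom).choose)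
      ⟨0, IsAdditiveSubcategory.zero_mem (isZero_zero A), 0, 0, ?_⟩
    dsimp only [NSeq.Hom.comp]
    rw [(ApproxSeq.exists_lift hR _ _ _).choose_spec,
      (ApproxSeq.exists_lift hR _ _ _).choose_spec, (ApproxSeq.exists_lift hR _ _ _).choose_spec]
    simp

/-- The endofunctor `G` of `C/X` induced by `suspAux`. -/
noncomputable def susp (hR : IsRightSuspended m S C X R)
    (fix : ∀ M : A, C M → ApproxSeq C X R M) : QuotCat C X ⥤ QuotCat C X :=
  CategoryTheory.Quotient.lift (idealRel C X) (suspAux hR fix) (by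
    rintro M N f g ⟨Z, hZ, p, q, e⟩
    refine CategoryTheory.Quotient.sound _ ?_
    refine ApproxSeq.factor_of_factor hR (fix M.obj M.property).mem (fix M.obj M.property).monic
      (fix N.obj N.property) _ _
      ⟨Z, hZ, (fix M.obj M.property).e.hom ≫ p, q ≫ (fix N.obj N.property).e.inv, ?_⟩
    rw [(ApproxSeq.exists_lift hR _ _ _).choose_spec, (ApproxSeq.exists_lift hR _ _ _).choose_spec,
      ← Preadditive.comp_sub, ← Preadditive.sub_comp, e]
    simp)

/-- The `n`-`G`-sequence `A₁ ⟶ A₂ ⟶ ⋯ ⟶ Aₙ ⟶ G A₁` in `C/X` given by the classes of the morphisms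
`f₁, …, fₙ₋₁` of a sequence in `C`, and by the class of `h : Aₙ ⟶ G A₁`. -/
noncomputable def toQuot [IsAdditiveSubcategory C] (hR : IsRightSuspended m S C X R)
    (fix : ∀ M : A, C M → ApproxSeq C X R M) (P : NSeq (m + 3) S) (hP : ∀ i, C (P.obj i))
    (h : P.obj (m + 3) ⟶ (fix (P.obj 1) (hP 1)).seq.obj (m + 3)) :
    NSeq (m + 3) (susp hR fix) where
  obj i := QuotCat.mk (P.obj i) (hP i)
  d i j := QuotCat.homMk (P.d i j)
  shape i j hij := by
    rw [P.shape i j hij]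
    exact (quotFunctor C X).map_zero _ _
  isZero i hi := by
    rw [IsZero.iff_id_eq_zero, ← CategoryTheory.Functor.map_id, ← (quotFunctor C X).map_zero]
    congr 1
    ext
    exact (P.isZero i hi).eq_of_src _ _
  conn := QuotCat.homMk h

/-- The standard right `n`-angles of `C/X`: the sequences isomorphic in `C/X` to a sequence
`A₁ ⟶ A₂ ⟶ ⋯ ⟶ Aₙ ⟶ G A₁` which comes from a sequence `P` of the class `R` in `C` whose first morphism
is `X`-monic, the last morphism being the last component of a morphism from `P` to the fixed
sequence of `A₁` with first component the identity. -/
def IsStandard [IsAdditiveSubcategory C] (hR : IsRightSuspended m S C X R)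
    (fix : ∀ M : A, C M → ApproxSeq C X R M) (W : NSeq (m + 3) (susp hR fix)) : Prop :=
  ∃ (P : NSeq (m + 3) S) (hP : ∀ i, C (P.obj i))
    (φ : NSeq.Hom P (fix (P.obj 1) (hP 1)).seq),
    R P ∧ IsXMonic C X (P.d 1 2) ∧ φ.app 1 = (fix (P.obj 1) (hP 1)).e.inv ∧
    ∃ α : NSeq.Hom (toQuot hR fix P hP (φ.app (m + 3))) W, α.IsIso

/-- The `n`-angles of `C/X`: the direct summands of the standard right `n`-angles. -/
def IsAngle [IsAdditiveSubcategory C] (hR : IsRightSuspended m S C X R)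
    (fix : ∀ M : A, C M → ApproxSeq C X R M) (W : NSeq (m + 3) (susp hR fix)) : Prop :=
  ∃ W' : NSeq (m + 3) (susp hR fix), IsStandard hR fix (W.sum W')

end Standard

/-! ### Frobenius `n`-prile categories -/

section Prile

variable {A : Type u} [Category.{v} A] [Preadditive A]

/-- A left `n`-`Ω`-sequence `Ω Aₙ ⟶ A₁ ⟶ A₂ ⟶ ⋯ ⟶ Aₙ` in `A` is, read backwards, an `n`-sequence
`Aₙ ⟶ ⋯ ⟶ A₁ ⟶ Ω Aₙ` in the opposite category for the endofunctor `Ω.op`.  For an adjunction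
`Ω ⊣ S`, this is the left sequence attached to `A₁ ⟶ A₂ ⟶ ⋯ ⟶ Aₙ ⟶ S A₁`: the last morphism is
replaced by its adjoint `Ω Aₙ ⟶ A₁`, and the other ones are unchanged. -/
def NSeq.toLeft {m : ℕ} {Ω S : A ⥤ A} (adj : Ω ⊣ S) (P : NSeq (m + 3) S) :
    NSeq (A := Aᵒᵖ) (m + 3) Ω.op where
  obj j := Opposite.op (P.obj (m + 4 - j))
  d i j := (P.d (m + 4 - j) (m + 4 - i)).op
  shape i j h := by
    apply Quiver.Hom.unop_inj
    by_cases hj : m + 4 ≤ j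
    · exact (P.isZero _ (by omega)).eq_of_src _ _
    · exact P.shape _ _ (by omega)
  isZero i h := (P.isZero (m + 4 - i) (by omega)).op
  conn := ((adj.homEquiv _ _).symm P.conn ≫
    eqToHom (congrArg P.obj (show 1 = m + 4 - (m + 3) by omega))).op

variable [HasZeroObject A] [HasBinaryBiproducts A]

/-- A left `n`-suspended category `(A, L, X)`, where `L` is a class of left `n`-`C`-sequences: the
dual of a right `n`-suspended category. -/
abbrev IsLeftSuspended (m : ℕ) (Ω : A ⥤ A) (C X : ObjectProperty A)
    (L : NSeq (A := Aᵒᵖ) (m + 3) Ω.op → Prop) : Prop :=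
  IsRightSuspended m Ω.op C.op X.op L

/-- A sequence `Ω M ⟶ B ⟶ X₂ ⟶ ⋯ ⟶ Xₙ₋₁ ⟶ M` of the class `L` with `X₂, …, Xₙ₋₁ ∈ X` whose last
morphism is a right `X`-approximation of `M`. -/
abbrev LeftApproxSeq (C X : ObjectProperty A) {m : ℕ} {Ω : A ⥤ A}
    (L : NSeq (A := Aᵒᵖ) (m + 3) Ω.op → Prop) (M : A) :=
  ApproxSeq C.op X.op L (Opposite.op M)

/-- A Frobenius `n`-prile category `(A, L, R, X)` (`n = m + 3`), with its fixed approximation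
sequences.  In `epic_fixR`, the morphism is `Xₙ₋₁ ⟶ B` in the fixed sequence
`M ⟶ X₂ ⟶ ⋯ ⟶ Xₙ₋₁ ⟶ B ⟶ S M`, and it is a right `X`-approximation of `B`; in `monic_fixL`, it is
`B ⟶ X₂` in the fixed sequence `Ω M ⟶ B ⟶ X₂ ⟶ ⋯ ⟶ Xₙ₋₁ ⟶ M`, and it is a left `X`-approximation
of `B`. -/
structure FrobeniusPrile (m : ℕ) {Ω S : A ⥤ A} (adj : Ω ⊣ S) (C X : ObjectProperty A)
    (L : NSeq (A := Aᵒᵖ) (m + 3) Ω.op → Prop) (R : NSeq (m + 3) S → Prop) where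
  le : X ≤ C
  right : IsRightSuspended m S C X R
  left : IsLeftSuspended m Ω C X L
  fixR : ∀ M : A, C M → ApproxSeq C X R M
  fixL : ∀ M : A, C M → LeftApproxSeq C X L M
  exchange : ∀ P : NSeq (m + 3) S, (∀ i, C (P.obj i)) → (L (P.toLeft adj) ↔ R P)
  epic_fixR : ∀ (M : A) (hM : C M),
    IsXEpic C X ((fixR M hM).seq.d (m + 2) (m + 3))
  monic_fixL : ∀ (M : A) (hM : C M),
    IsXMonic C X ((fixL M hM).seq.d (m + 2) (m + 3)).unop

end Prile

end NAng

/-! The theorem splits into a part about one- and two-sided suspended categories, which produces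
properties of the class of standard angles in `C/X`, and a formal part, which holds for any class of
sequences with these properties. The interface is the structure `IsAngleBase`. Here
`n = m + 3`.

**Standard angles.** The octahedral axiom of the right suspended structure is used in a single way.
Let `B` and `T` be sequences in `R`, let `y : B₁ ⟶ Y`, and let `B₁ ⊞ Y ≅ T₁ ⊞ B₂` be compatible with
the first morphism of `B`. The octahedral axiom at the sequences of `(1, y) : B₁ ⟶ B₁ ⊞ Y`, of `B`
plus a trivial summand and of `T` plus a trivial summand gives a morphism `B ⟶ T` whose mapping
cone, with its first two terms cancelled to `Y`, is in `R` (`exists_cone_mem`). If `T` is a fixed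
approximation sequence, its middle terms vanish in `C/X`, and the cone becomes a rotation of the
angle of `B` (`isBistandard_of_isRotationAlong`; with `y = f₁` the left rotation). If `Y = B₂` and
the isomorphism is the identity of `B₂` on the second summand, one obtains mapping cones in the
usual sense (`exists_redCone_mem`, `isStandard_redCone`). The rotations have in addition an `X`-epic
morphism `fₙ₋₁`. The Frobenius condition exchanges `R` with `L`, so that commutative squares on the
morphisms `fₙ₋₁` extend by the axioms of the left suspended structure
(`FrobeniusPrile.complete_last`). Together with condition (c), this shows that the suspension is an
equivalence (`susp_isEquivalence`), and that squares on the last morphisms of rotated standard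
angles extend.

**Passing to direct summands.** Sums of the contractible sequences `Z ⟶ Z`, here called disks,
belong to the class (`disks_mem`), and adding them turns retracts into direct summands and homotopy
retracts into retracts. So the class of direct summands of members of the class has the same
properties (`IsAngleBase.summands`) and is closed under homotopy retracts (`mem_of_homotopy`). Its
members are weakly exact (`isWeakExact`), so that two angles with the same first morphism are
homotopy equivalent (`exists_homotopyEquiv`). The two remaining axioms follow. A *single* angle with
a mapping cone in the class is available over any two composable morphisms; for other angles with
the same first morphisms, it induces a morphism whose mapping cone is, by triangular matrices, a
homotopy retract of the given one (`exists_redCone`). The octahedral sequence is a direct summand of an iterated mapping cone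
(`octahedral`). If the rotation of a sequence is an angle, then squares on its first morphism
extend, hence the sequence is a homotopy retract of an angle with the same first morphism
(`rotate_inv`).

**Split idempotents.** It has to be shown that a direct summand `W` of a standard angle is standard.
By a homotopy and correction one position at a time, `W` becomes standard after adding disks
(`IsAngleBase.exists_sum_disks_mem_of_summands`). Since idempotents split in `A`, decompositions in
`C/X` lift to `C` after adding objects of `X` (`exists_strict_rotation_data`), so standard angles
are closed under the generalized rotations along data in `C/X` (`IsStandard.of_isRotationAlong`).
Such a rotation rotates `W` and the disks, but absorbs the disk in the first position
(`sum_disks_mem_of_isLeftRotation`). Applied `n` times, starting with the `n`-fold inverse rotation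
of `W`, which is again a direct summand of a standard angle, this removes all disks
(`IsAngleBase.mem_of_summands`). -/

namespace NAng

/-! ### Morphisms of sequences, direct sums, retracts -/

section General

variable {A : Type u} [Category.{v} A] [Preadditive A] {n : ℕ} {S : A ⥤ A}

namespace NSeq

lemma ofSucc_d_succ (obj : ℕ → A) (map : ∀ i, obj i ⟶ obj (i + 1))
    (h : ∀ i, (i = 0 ∨ n < i) → IsZero (obj i)) (conn : obj n ⟶ S.obj (obj 1)) (i : ℕ) :
    (ofSucc obj map h conn).d i (i + 1) = map i := by
  simp [ofSucc]

/-- A morphism of sequences is determined by components which commute with the morphisms between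
consecutive objects in the positions `1, …, n`. -/
def Hom.mk' {P Q : NSeq n S} (app : ∀ i, P.obj i ⟶ Q.obj i)
    (h : ∀ i, 1 ≤ i → i < n → P.d i (i + 1) ≫ app (i + 1) = app i ≫ Q.d i (i + 1))
    (hc : P.conn ≫ S.map (app 1) = app n ≫ Q.conn) : Hom P Q where
  app := app
  comm i j := by
    by_cases hij : i + 1 = j
    · subst hij
      by_cases h₁ : 1 ≤ i
      · by_cases h₂ : i < n
        · exact h i h₁ h₂
        · exact (Q.isZero (i + 1) (by omega)).eq_of_tgt _ _
      · exact (P.isZero i (by omega)).eq_of_src _ _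
    · rw [P.shape i j hij, Q.shape i j hij, zero_comp, comp_zero]
  comm_conn := hc

@[simp] lemma Hom.id_app (P : NSeq n S) (i : ℕ) : (Hom.id P).app i = 𝟙 _ := rfl

@[simp] lemma Hom.comp_app {P Q R : NSeq n S} (φ : Hom P Q) (ψ : Hom Q R) (i : ℕ) :
    (φ.comp ψ).app i = φ.app i ≫ ψ.app i := rfl

/-- The inverse of an isomorphism of sequences. -/
noncomputable def Hom.inv {P Q : NSeq n S} (φ : Hom P Q) (h : φ.IsIso) : Hom Q P :=
  haveI : ∀ i, CategoryTheory.IsIso (φ.app i) := h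
  { app := fun i => CategoryTheory.inv (φ.app i)
    comm := fun i j => by
      rw [IsIso.eq_inv_comp, ← Category.assoc, ← φ.comm, Category.assoc, IsIso.hom_inv_id,
        Category.comp_id]
    comm_conn := by
      rw [IsIso.eq_inv_comp, ← Category.assoc, ← φ.comm_conn, Category.assoc, ← S.map_comp,
        IsIso.hom_inv_id, S.map_id, Category.comp_id] }

lemma Hom.comp_inv_app {P Q : NSeq n S} (φ : Hom P Q) (h : φ.IsIso) (i : ℕ) :
    φ.app i ≫ (φ.inv h).app i = 𝟙 _ := by
  have : CategoryTheory.IsIso (φ.app i) := h i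
  exact IsIso.hom_inv_id (φ.app i)

lemma Hom.inv_comp_app {P Q : NSeq n S} (φ : Hom P Q) (h : φ.IsIso) (i : ℕ) :
    (φ.inv h).app i ≫ φ.app i = 𝟙 _ := by
  have : CategoryTheory.IsIso (φ.app i) := h i
  exact IsIso.inv_hom_id (φ.app i)

lemma Hom.inv_isIso {P Q : NSeq n S} (φ : Hom P Q) (h : φ.IsIso) : (φ.inv h).IsIso := fun i =>
  ⟨φ.app i, φ.inv_comp_app h i, φ.comp_inv_app h i⟩

lemma Hom.comp_isIso {P Q R : NSeq n S} {φ : Hom P Q} {ψ : Hom Q R} (h : φ.IsIso)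
    (h' : ψ.IsIso) : (φ.comp ψ).IsIso := fun i => by
  have : CategoryTheory.IsIso (φ.app i) := h i
  have : CategoryTheory.IsIso (ψ.app i) := h' i
  exact inferInstanceAs (CategoryTheory.IsIso (φ.app i ≫ ψ.app i))

lemma Hom.isIso_of_range {P Q : NSeq n S} (φ : Hom P Q)
    (h : ∀ i, 1 ≤ i → i ≤ n → CategoryTheory.IsIso (φ.app i)) : φ.IsIso := fun i => by
  by_cases hi : 1 ≤ i ∧ i ≤ n
  · exact h i hi.1 hi.2
  · exact ⟨0, (P.isZero i (by omega)).eq_of_src _ _, (Q.isZero i (by omega)).eq_of_src _ _⟩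

lemma Hom.id_isIso (P : NSeq n S) : (Hom.id P).IsIso := fun i =>
  inferInstanceAs (CategoryTheory.IsIso (𝟙 (P.obj i)))

/-- `W` is a retract of `Q`. -/
def IsRetract (W Q : NSeq n S) : Prop :=
  ∃ (i : Hom W Q) (p : Hom Q W), ∀ k, i.app k ≫ p.app k = 𝟙 _

lemma isRetract_of_isIso {W Q E : NSeq n S} (i : Hom W Q) (p : Hom Q E) (α : Hom E W)
    (h : ((i.comp p).comp α).IsIso) : IsRetract W Q :=
  ⟨i, (p.comp α).comp (((i.comp p).comp α).inv h), fun k => by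
    have := Hom.comp_inv_app _ h k
    simpa using this⟩

section Sum

variable [HasBinaryBiproducts A]

/-- The first inclusion into a direct sum. -/
noncomputable def sumInl (P Q : NSeq n S) : Hom P (P.sum Q) where
  app i := (biprod.inl : P.obj i ⟶ P.obj i ⊞ Q.obj i)
  comm i j := by
    change P.d i j ≫ (biprod.inl : _ ⟶ P.obj j ⊞ Q.obj j) =
      biprod.inl ≫ biprod.map (P.d i j) (Q.d i j)
    simp
  comm_conn := by
    change P.conn ≫ S.map (biprod.inl : _ ⟶ P.obj 1 ⊞ Q.obj 1) =
      biprod.inl ≫ biprod.desc (P.conn ≫ S.map biprod.inl) (Q.conn ≫ S.map biprod.inr)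
    simp

/-- The second inclusion into a direct sum. -/
noncomputable def sumInr (P Q : NSeq n S) : Hom Q (P.sum Q) where
  app i := (biprod.inr : Q.obj i ⟶ P.obj i ⊞ Q.obj i)
  comm i j := by
    change Q.d i j ≫ (biprod.inr : _ ⟶ P.obj j ⊞ Q.obj j) =
      biprod.inr ≫ biprod.map (P.d i j) (Q.d i j)
    simp
  comm_conn := by
    change Q.conn ≫ S.map (biprod.inr : _ ⟶ P.obj 1 ⊞ Q.obj 1) =
      biprod.inr ≫ biprod.desc (P.conn ≫ S.map biprod.inl) (Q.conn ≫ S.map biprod.inr)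
    simp

/-- The morphism out of a direct sum. -/
noncomputable def sumDesc {P Q W : NSeq n S} (α : Hom P W) (β : Hom Q W) : Hom (P.sum Q) W where
  app i := biprod.desc (α.app i) (β.app i)
  comm i j := by
    change biprod.map (P.d i j) (Q.d i j) ≫ biprod.desc (α.app j) (β.app j) =
      biprod.desc (α.app i) (β.app i) ≫ W.d i j
    apply biprod.hom_ext' <;> simp [α.comm, β.comm]
  comm_conn := by
    change biprod.desc (P.conn ≫ S.map (biprod.inl : _ ⟶ P.obj 1 ⊞ Q.obj 1))
        (Q.conn ≫ S.map biprod.inr) ≫ S.map (biprod.desc (α.app 1) (β.app 1)) =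
      biprod.desc (α.app n) (β.app n) ≫ W.conn
    apply biprod.hom_ext' <;> simp [← α.comm_conn, ← β.comm_conn, ← S.map_comp]

section

variable [S.Additive]

/-- The morphism into a direct sum. -/
noncomputable def sumLift {P Q W : NSeq n S} (α : Hom W P) (β : Hom W Q) : Hom W (P.sum Q) where
  app i := biprod.lift (α.app i) (β.app i)
  comm i j := by
    change W.d i j ≫ biprod.lift (α.app j) (β.app j) =
      biprod.lift (α.app i) (β.app i) ≫ biprod.map (P.d i j) (Q.d i j)
    apply biprod.hom_ext <;> simp [α.comm, β.comm]
  comm_conn := by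
    change W.conn ≫ S.map (biprod.lift (α.app 1) (β.app 1)) =
      biprod.lift (α.app n) (β.app n) ≫
        biprod.desc (P.conn ≫ S.map biprod.inl) (Q.conn ≫ S.map biprod.inr)
    rw [biprod.lift_desc, ← Category.assoc, ← Category.assoc, ← α.comm_conn, ← β.comm_conn,
      Category.assoc, Category.assoc, ← S.map_comp, ← S.map_comp, ← Preadditive.comp_add,
      ← S.map_add]
    congr 2
    apply biprod.hom_ext <;> simp

/-- The first projection of a direct sum. -/
noncomputable def sumFst (P Q : NSeq n S) : Hom (P.sum Q) P where
  app i := (biprod.fst : P.obj i ⊞ Q.obj i ⟶ _)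
  comm i j := by
    change biprod.map (P.d i j) (Q.d i j) ≫ biprod.fst = biprod.fst ≫ P.d i j
    simp
  comm_conn := by
    change biprod.desc (P.conn ≫ S.map (biprod.inl : _ ⟶ P.obj 1 ⊞ Q.obj 1))
        (Q.conn ≫ S.map biprod.inr) ≫ S.map biprod.fst = biprod.fst ≫ P.conn
    apply biprod.hom_ext' <;> simp [← S.map_comp]

/-- The second projection of a direct sum. -/
noncomputable def sumSnd (P Q : NSeq n S) : Hom (P.sum Q) Q where
  app i := (biprod.snd : P.obj i ⊞ Q.obj i ⟶ _)
  comm i j := by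
    change biprod.map (P.d i j) (Q.d i j) ≫ biprod.snd = biprod.snd ≫ Q.d i j
    simp
  comm_conn := by
    change biprod.desc (P.conn ≫ S.map (biprod.inl : _ ⟶ P.obj 1 ⊞ Q.obj 1))
        (Q.conn ≫ S.map biprod.inr) ≫ S.map biprod.snd = biprod.snd ≫ Q.conn
    apply biprod.hom_ext' <;> simp [← S.map_comp]

end

/-- The direct sum of two morphisms. -/
noncomputable def sumMap {P Q P' Q' : NSeq n S} (α : Hom P P') (β : Hom Q Q') :
    Hom (P.sum Q) (P'.sum Q') :=
  sumDesc (α.comp (sumInl _ _)) (β.comp (sumInr _ _))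

lemma sumMap_app {P Q P' Q' : NSeq n S} (α : Hom P P') (β : Hom Q Q') (k : ℕ) :
    (sumMap α β).app k = biprod.map (α.app k) (β.app k) := by
  change biprod.desc (α.app k ≫ biprod.inl) (β.app k ≫ biprod.inr) = _
  apply biprod.hom_ext' <;> simp

lemma sumMap_isIso {P Q P' Q' : NSeq n S} {α : Hom P P'} {β : Hom Q Q'} (h : α.IsIso)
    (h' : β.IsIso) : (sumMap α β).IsIso := fun k => by
  have : CategoryTheory.IsIso (α.app k) := h k
  have : CategoryTheory.IsIso (β.app k) := h' k
  rw [sumMap_app]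
  exact inferInstanceAs (CategoryTheory.IsIso (biprod.mapIso (asIso (α.app k))
    (asIso (β.app k))).hom)

/-- Associativity of direct sums. -/
noncomputable def sumAssoc (P Q W : NSeq n S) : Hom ((P.sum Q).sum W) (P.sum (Q.sum W)) :=
  sumDesc (sumDesc (sumInl _ _) ((sumInl _ _).comp (sumInr _ _))) ((sumInr _ _).comp (sumInr _ _))

lemma sumAssoc_isIso (P Q W : NSeq n S) : (sumAssoc P Q W).IsIso := fun k => by
  have h : (sumAssoc P Q W).app k = (biprod.associator (P.obj k) (Q.obj k) (W.obj k)).hom := by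
    change biprod.desc (biprod.desc biprod.inl
      ((biprod.inl : _ ⟶ Q.obj k ⊞ W.obj k) ≫ (biprod.inr : _ ⟶ P.obj k ⊞ (Q.obj k ⊞ W.obj k))))
      (biprod.inr ≫ biprod.inr) = _
    apply biprod.hom_ext'
    · apply biprod.hom_ext' <;> apply biprod.hom_ext <;> try apply biprod.hom_ext
      all_goals simp
    · apply biprod.hom_ext <;> try apply biprod.hom_ext
      all_goals simp
  rw [h]
  exact (biprod.associator (P.obj k) (Q.obj k) (W.obj k)).isIso_hom

variable [S.Additive]

/-- `i` is isomorphic to the inclusion of a direct summand. -/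
def IsComplemented {M N : A} (i : M ⟶ N) : Prop :=
  ∃ (U : A) (e : M ⊞ U ≅ N), biprod.inl ≫ e.hom = i

omit [S.Additive] in
/-- A retract whose inclusion is complemented in each position is a direct summand. -/
lemma exists_sum_iso_of_retract [S.Additive] {W Q : NSeq n S} (i : Hom W Q) (p : Hom Q W)
    (hip : ∀ k, i.app k ≫ p.app k = 𝟙 _) (hc : ∀ k, IsComplemented (i.app k)) :
    ∃ (U : NSeq n S) (φ : Hom (W.sum U) Q), φ.IsIso := by
  choose U e he using hc
  -- the kernel of the retraction `p k` is a copy of the complement `U k`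
  let j : ∀ k, U k ⟶ Q.obj k := fun k =>
    biprod.inr ≫ (e k).hom - (biprod.inr ≫ (e k).hom) ≫ p.app k ≫ i.app k
  let q : ∀ k, Q.obj k ⟶ U k := fun k => (e k).inv ≫ biprod.snd
  have hiq : ∀ k, i.app k ≫ q k = 0 := fun k => by simp [q, ← he]
  have hiq' : ∀ k {Z : A} (f : U k ⟶ Z), i.app k ≫ q k ≫ f = 0 := fun k Z f => by
    rw [← Category.assoc, hiq, zero_comp]
  have hjq : ∀ k, j k ≫ q k = 𝟙 _ := fun k => by
    simp only [j, Preadditive.sub_comp, Category.assoc, hiq, comp_zero, sub_zero]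
    simp [q]
  have hjp : ∀ k, j k ≫ p.app k = 0 := fun k => by
    simp [j, Preadditive.sub_comp, hip]
  have hinv : ∀ k, (e k).inv = p.app k ≫ biprod.inl + q k ≫ biprod.inr
      - (q k ≫ biprod.inr ≫ (e k).hom ≫ p.app k) ≫ biprod.inl := fun k => by
    rw [← cancel_epi (e k).hom]
    apply biprod.hom_ext'
    · have h₁ : biprod.inl ≫ (e k).hom ≫ p.app k = 𝟙 _ := by rw [← Category.assoc, he, hip]
      simp [q, Preadditive.comp_sub, reassoc_of% h₁]
    · simp [q, Preadditive.comp_sub]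
  have hqj : ∀ k, q k ≫ j k = 𝟙 _ - p.app k ≫ i.app k := fun k => by
    have h₁ : 𝟙 (Q.obj k) = (e k).inv ≫ (e k).hom := by simp
    rw [h₁, hinv k]
    simp only [j, Preadditive.comp_sub, Preadditive.sub_comp, Preadditive.add_comp, Category.assoc,
      he]
    abel
  have hji : ∀ k, j k ≫ p.app k ≫ i.app k = 0 := fun k => by
    rw [← Category.assoc, hjp, zero_comp]
  have hd : ∀ a b, (j a ≫ Q.d a b) ≫ p.app b ≫ i.app b = 0 := fun a b => by
    rw [Category.assoc, ← Category.assoc (Q.d a b), p.comm, Category.assoc, i.comm,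
      ← Category.assoc (j a), hjp, zero_comp]
  have hz : ∀ k, (k = 0 ∨ n < k) → IsZero (U k) := fun k hk => by
    rw [IsZero.iff_id_eq_zero, ← hjq k, (Q.isZero k hk).eq_of_tgt (j k) 0, zero_comp]
  let V : NSeq n S :=
    { obj := U
      d := fun a b => j a ≫ Q.d a b ≫ q b
      shape := fun a b h => by rw [Q.shape a b h, zero_comp, comp_zero]
      isZero := hz
      conn := j n ≫ Q.conn ≫ S.map (q 1) }
  let J : Hom V Q :=
    { app := j
      comm := fun a b => by
        change (j a ≫ Q.d a b ≫ q b) ≫ j b = _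
        rw [Category.assoc, Category.assoc, hqj, Preadditive.comp_sub, Category.comp_id,
          Preadditive.comp_sub, ← Category.assoc, hd, sub_zero]
      comm_conn := by
        change (j n ≫ Q.conn ≫ S.map (q 1)) ≫ S.map (j 1) = _
        rw [Category.assoc, Category.assoc, ← S.map_comp, hqj, S.map_sub, S.map_id, S.map_comp,
          Preadditive.comp_sub, Category.comp_id, Preadditive.comp_sub,
          ← Category.assoc Q.conn, p.comm_conn, Category.assoc, i.comm_conn, ← Category.assoc (j n),
          hjp, zero_comp, sub_zero] }
  refine ⟨V, sumDesc i J, fun k => ⟨biprod.lift (p.app k) (q k), ?_, ?_⟩⟩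
  · change biprod.desc (i.app k) (j k) ≫ biprod.lift (p.app k) (q k) = 𝟙 _
    apply biprod.hom_ext' <;> apply biprod.hom_ext
    · simp [hip]
    · simp [hiq]
    · simpa using hjp k
    · simpa using hjq k
  · change biprod.lift (p.app k) (q k) ≫ biprod.desc (i.app k) (j k) = 𝟙 _
    have : p.app k ≫ i.app k + q k ≫ j k = 𝟙 _ := by rw [hqj]; abel
    rwa [biprod.lift_desc]

omit [S.Additive] in
lemma isComplemented_lift {M N Y : A} {i : M ⟶ N} (h : IsComplemented i) (a : M ⟶ Y) :
    IsComplemented (biprod.lift i a) := by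
  obtain ⟨U, e, he⟩ := h
  have he' : i ≫ e.inv = biprod.inl := by rw [← he]; simp
  refine ⟨U ⊞ Y, ⟨biprod.desc (biprod.lift i a)
      (biprod.desc (biprod.lift (biprod.inr ≫ e.hom) 0) biprod.inr),
    biprod.desc (e.inv ≫ biprod.lift biprod.fst
      (biprod.lift biprod.snd (-(biprod.fst ≫ a))))
      (biprod.inr ≫ biprod.inr), ?_, ?_⟩, by simp⟩
  · apply biprod.hom_ext'
    · simp only [biprod.inl_desc_assoc, biprod.lift_desc, Category.comp_id, reassoc_of% he']
      apply biprod.hom_ext <;> try apply biprod.hom_ext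
      all_goals simp
    · apply biprod.hom_ext' <;> apply biprod.hom_ext <;> try apply biprod.hom_ext
      all_goals simp
  · apply biprod.hom_ext'
    · have h2 : e.inv ≫ biprod.fst ≫ i + e.inv ≫ biprod.snd ≫ biprod.inr ≫ e.hom = 𝟙 _ := by
        rw [← he]
        rw [← Category.assoc biprod.snd, ← Category.assoc biprod.fst, ← Preadditive.comp_add,
          ← Preadditive.add_comp, biprod.total]
        simp
      apply biprod.hom_ext
      · simpa using h2
      · simp
    · simp

omit [S.Additive] in
lemma isComplemented_lift_of_isIso {M N Y : A} (i : M ⟶ N) (a : M ⟶ Y)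
    [CategoryTheory.IsIso a] : IsComplemented (biprod.lift i a) := by
  refine ⟨N, ⟨biprod.desc (biprod.lift i a) (biprod.lift (𝟙 N) 0),
    biprod.desc biprod.inr (biprod.lift (CategoryTheory.inv a) (-(CategoryTheory.inv a ≫ i))),
    ?_, ?_⟩, by simp⟩
  · apply biprod.hom_ext' <;> apply biprod.hom_ext <;> simp
  · apply biprod.hom_ext' <;> apply biprod.hom_ext <;> simp

end Sum

end NSeq

end General

/-! ### Complexes, disks and cones -/

section Disks

variable {A : Type u} [Category.{v} A] [Preadditive A] {m : ℕ} {S : A ⥤ A}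

namespace NSeq

/-- All composites of consecutive morphisms of the sequence vanish. -/
structure IsComplex (P : NSeq (m + 3) S) : Prop where
  d_comp : ∀ i, P.d i (i + 1) ≫ P.d (i + 1) (i + 2) = 0
  d_conn : P.d (m + 2) (m + 3) ≫ P.conn = 0
  conn_d : P.conn ≫ S.map (P.d 1 2) = 0

/-- Each morphism of the sequence, up to the last one, is a weak cokernel of the preceding one. -/
structure IsWeakExact (P : NSeq (m + 3) S) : Prop where
  weakCokernel : ∀ i, 1 ≤ i → i ≤ m + 1 → IsWeakCokernel (P.d i (i + 1)) (P.d (i + 1) (i + 2))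
  weakCokernel_conn : IsWeakCokernel (P.d (m + 2) (m + 3)) P.conn
  conn_d : P.conn ≫ S.map (P.d 1 2) = 0

lemma IsWeakExact.isComplex {P : NSeq (m + 3) S} (h : P.IsWeakExact) : P.IsComplex where
  d_comp i := by
    by_cases h₁ : 1 ≤ i
    · by_cases h₂ : i ≤ m + 1
      · exact (h.weakCokernel i h₁ h₂).1
      · exact (P.isZero (i + 2) (by omega)).eq_of_tgt _ _
    · exact (P.isZero i (by omega)).eq_of_src _ _
  d_conn := h.weakCokernel_conn.1
  conn_d := h.conn_d

lemma _root_.NAng.IsWeakCokernel.of_retract {X Y Z X' Y' Z' : A} {f : X ⟶ Y} {g : Y ⟶ Z}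
    {f' : X' ⟶ Y'} {g' : Y' ⟶ Z'} (h : IsWeakCokernel f' g') (i₁ : X ⟶ X') (p₁ : X' ⟶ X)
    (i₂ : Y ⟶ Y') (p₂ : Y' ⟶ Y) (i₃ : Z ⟶ Z') (p₃ : Z' ⟶ Z) (hf : f ≫ i₂ = i₁ ≫ f')
    (hf' : f' ≫ p₂ = p₁ ≫ f) (hg : g ≫ i₃ = i₂ ≫ g')
    (h₂ : i₂ ≫ p₂ = 𝟙 _) (h₃ : i₃ ≫ p₃ = 𝟙 _) : IsWeakCokernel f g := by
  refine ⟨?_, fun W u hu => ?_⟩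
  · rw [← Category.comp_id g, ← h₃, ← Category.assoc g, hg, ← Category.assoc, ← Category.assoc,
      hf, Category.assoc i₁, h.1, comp_zero, zero_comp]
  · obtain ⟨t, ht⟩ := h.2 (p₂ ≫ u) (by rw [← Category.assoc, hf', Category.assoc, hu, comp_zero])
    refine ⟨i₃ ≫ t, ?_⟩
    rw [← Category.assoc, hg, Category.assoc, ht, ← Category.assoc, h₂, Category.id_comp]

lemma IsWeakExact.of_retract {W Q : NSeq (m + 3) S} (h : Q.IsWeakExact) (hr : IsRetract W Q) :
    W.IsWeakExact := by
  obtain ⟨i, p, hip⟩ := hr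
  refine ⟨fun k h₁ h₂ => ?_, ?_, ?_⟩
  · exact (h.weakCokernel k h₁ h₂).of_retract (i.app _) (p.app _) (i.app _) (p.app _) (i.app _)
      (p.app _) (i.comm _ _) (p.comm _ _) (i.comm _ _) (hip _) (hip _)
  · exact h.weakCokernel_conn.of_retract (i.app _) (p.app _) (i.app _) (p.app _)
      (S.map (i.app _)) (S.map (p.app _)) (i.comm _ _) (p.comm _ _) i.comm_conn (hip _)
      (by rw [← S.map_comp, hip, S.map_id])
  · rw [← Category.comp_id (S.map _), ← S.map_id, ← hip, S.map_comp, ← S.map_comp_assoc, i.comm,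
      S.map_comp, Category.assoc, ← Category.assoc, i.comm_conn, Category.assoc,
      ← Category.assoc Q.conn, h.conn_d, zero_comp, comp_zero]

variable [HasZeroObject A] [HasBinaryBiproducts A]

open scoped ZeroObject

/-- Objects of `disks`. -/
noncomputable def disksObj (Z : ℕ → A) : ℕ → A
  | 0 => Z 0
  | k + 1 => Z (k + 1) ⊞ Z k

/-- Morphisms of `disks`. -/
noncomputable def disksMap (Z : ℕ → A) : ∀ i, disksObj Z i ⟶ disksObj Z (i + 1)
  | 0 => 0
  | _ + 1 => biprod.lift 0 biprod.fst

/-- The direct sum of the contractible sequences `Z k ⟶ Z k` placed in the positions `k, k + 1`, for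
`1 ≤ k ≤ n - 1`. -/
noncomputable def disks (S : A ⥤ A) (Z : ℕ → A)
    (hZ : ∀ k, (k = 0 ∨ m + 3 ≤ k) → IsZero (Z k)) : NSeq (m + 3) S :=
  ofSucc (disksObj Z) (disksMap Z)
    (by
      rintro (_ | k) h
      · exact hZ 0 (Or.inl rfl)
      · exact biprod_isZero_iff _ _ |>.2 ⟨hZ _ (by omega), hZ _ (by omega)⟩)
    0

variable {Z : ℕ → A} {hZ : ∀ k, (k = 0 ∨ m + 3 ≤ k) → IsZero (Z k)}

omit [HasZeroObject A] in
lemma disks_d (k : ℕ) : (disks S Z hZ).d (k + 1) (k + 2) =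
    (biprod.lift 0 biprod.fst : Z (k + 1) ⊞ Z k ⟶ Z (k + 2) ⊞ Z (k + 1)) :=
  ofSucc_d_succ _ _ _ _ _

/-- Components of `toDisks`. -/
noncomputable def toDisksApp (W : NSeq (m + 3) S) (b : ∀ k, W.obj (k + 1) ⟶ Z k) :
    ∀ k, W.obj k ⟶ disksObj Z k
  | 0 => 0
  | k + 1 => biprod.lift (W.d (k + 1) (k + 2) ≫ b (k + 1)) (b k)

/-- The morphism from a complex to a sum of disks given by morphisms `W (k + 1) ⟶ Z k`. -/
noncomputable def toDisks [S.Additive] {W : NSeq (m + 3) S} (hW : W.IsComplex)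
    (b : ∀ k, W.obj (k + 1) ⟶ Z k) : Hom W (disks S Z hZ) :=
  Hom.mk' (toDisksApp W b)
    (by
      rintro (_ | k) h₁ h₂
      · omega
      · rw [disks_d]
        change W.d (k + 1) (k + 2) ≫
            biprod.lift (W.d (k + 2) (k + 3) ≫ b (k + 2)) (b (k + 1)) =
          biprod.lift (W.d (k + 1) (k + 2) ≫ b (k + 1)) (b k) ≫ biprod.lift 0 biprod.fst
        apply biprod.hom_ext
        · simp only [Category.assoc, biprod.lift_fst, comp_zero]
          rw [← Category.assoc, hW.d_comp, zero_comp]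
        · simp)
    (by
      have h₀ : b 0 = 0 := (hZ 0 (Or.inl rfl)).eq_of_tgt _ _
      have h₁ : biprod.lift (W.d 1 2 ≫ b 1) (b 0) = W.d 1 2 ≫ b 1 ≫ biprod.inl := by
        apply biprod.hom_ext <;> simp [h₀]
      change W.conn ≫ S.map (biprod.lift (W.d 1 2 ≫ b 1) (b 0)) = _ ≫ 0
      rw [h₁, S.map_comp, ← Category.assoc, hW.conn_d, zero_comp]
      exact comp_zero.symm)

/-- Components of `fromDisks`. -/
noncomputable def fromDisksApp (W : NSeq (m + 3) S) (a : ∀ k, Z k ⟶ W.obj k) :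
    ∀ k, disksObj Z k ⟶ W.obj k
  | 0 => a 0
  | k + 1 => biprod.desc (a (k + 1)) (a k ≫ W.d k (k + 1))

/-- The morphism from a sum of disks to a complex given by morphisms `Z k ⟶ W k`. -/
noncomputable def fromDisks {W : NSeq (m + 3) S} (hW : W.IsComplex)
    (a : ∀ k, Z k ⟶ W.obj k) : Hom (disks S Z hZ) W :=
  Hom.mk' (fromDisksApp W a)
    (by
      rintro (_ | k) h₁ h₂
      · omega
      · rw [disks_d]
        change biprod.lift 0 biprod.fst ≫
            biprod.desc (a (k + 2)) (a (k + 1) ≫ W.d (k + 1) (k + 2)) =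
          biprod.desc (a (k + 1)) (a k ≫ W.d k (k + 1)) ≫ W.d (k + 1) (k + 2)
        apply biprod.hom_ext'
        · simp
        · simp [hW.d_comp])
    (by
      refine Eq.trans zero_comp ?_
      have h₀ : a (m + 3) = 0 := (hZ (m + 3) (Or.inr le_rfl)).eq_of_src _ _
      change 0 = biprod.desc (a (m + 3)) (a (m + 2) ≫ W.d (m + 2) (m + 3)) ≫ W.conn
      apply biprod.hom_ext'
      · simp [h₀]
      · simp [hW.d_conn])

/-- Components of `disksHom`. -/
noncomputable def disksHomApp {Z' : ℕ → A} (g : ∀ k, Z k ⟶ Z' k) :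
    ∀ k, disksObj Z k ⟶ disksObj Z' k
  | 0 => g 0
  | k + 1 => biprod.map (g (k + 1)) (g k)

/-- Functoriality of `disks`. -/
noncomputable def disksHom {Z' : ℕ → A} {hZ' : ∀ k, (k = 0 ∨ m + 3 ≤ k) → IsZero (Z' k)}
    (g : ∀ k, Z k ⟶ Z' k) : Hom (disks (m := m) S Z hZ) (disks S Z' hZ') :=
  Hom.mk' (disksHomApp g)
    (by
      rintro (_ | k) h₁ h₂
      · omega
      · rw [disks_d, disks_d]
        change biprod.lift 0 biprod.fst ≫ biprod.map (g (k + 2)) (g (k + 1)) =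
          biprod.map (g (k + 1)) (g k) ≫ biprod.lift 0 biprod.fst
        apply biprod.hom_ext <;> simp)
    (Eq.trans zero_comp comp_zero.symm)

/-- Objects of `cone`. -/
noncomputable def coneObj (Y : A) (P Q : NSeq (m + 3) S) : ℕ → A
  | 0 => 0
  | 1 => Y
  | k + 2 => P.obj (k + 3) ⊞ Q.obj (k + 2)

/-- Morphisms of `cone`. -/
noncomputable def coneMap {Y : A} {P Q : NSeq (m + 3) S} (φ : ∀ i, P.obj i ⟶ Q.obj i)
    (first : Y ⟶ P.obj 3 ⊞ Q.obj 2) : ∀ i, coneObj Y P Q i ⟶ coneObj Y P Q (i + 1)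
  | 0 => 0
  | 1 => first
  | k + 2 => biprod.desc (biprod.lift (-P.d (k + 3) (k + 4)) (φ (k + 3)))
      (biprod.lift 0 (Q.d (k + 2) (k + 3)))

/-- The sequence `Y ⟶ A₃ ⊞ B₂ ⟶ A₄ ⊞ B₃ ⟶ ⋯ ⟶ Aₙ ⊞ Bₙ₋₁ ⟶ Bₙ ⟶ S Y` which is the mapping cone of
`φ : P ⟶ Q` from its second term on; its first and last morphisms are arbitrary. -/
noncomputable def cone {Y : A} {P Q : NSeq (m + 3) S} (φ : ∀ i, P.obj i ⟶ Q.obj i)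
    (first : Y ⟶ P.obj 3 ⊞ Q.obj 2) (last : Q.obj (m + 3) ⟶ S.obj Y) : NSeq (m + 3) S :=
  ofSucc (coneObj Y P Q) (coneMap φ first)
    (by
      rintro (_ | _ | k) h
      · exact isZero_zero A
      · omega
      · exact biprod_isZero_iff _ _ |>.2 ⟨P.isZero _ (by omega), Q.isZero _ (by omega)⟩)
    ((biprod.snd : P.obj (m + 4) ⊞ Q.obj (m + 3) ⟶ _) ≫ last)

section

variable {Y : A} {P Q : NSeq (m + 3) S} (φ : ∀ i, P.obj i ⟶ Q.obj i)
    (first : Y ⟶ P.obj 3 ⊞ Q.obj 2) (last : Q.obj (m + 3) ⟶ S.obj Y)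

lemma cone_d_one : (cone φ first last).d 1 2 = first := ofSucc_d_succ _ _ _ _ _

lemma cone_d (k : ℕ) : (cone φ first last).d (k + 2) (k + 3) =
    biprod.desc (biprod.lift (-P.d (k + 3) (k + 4)) (φ (k + 3)))
      (biprod.lift 0 (Q.d (k + 2) (k + 3))) := ofSucc_d_succ _ _ _ _ _

lemma cone_conn : (cone φ first last).conn =
  (biprod.snd : P.obj (m + 4) ⊞ Q.obj (m + 3) ⟶ _) ≫ last := rfl

end

/-- The mapping cone of a morphism `φ : P ⟶ Q` whose first component `a` is an isomorphism, with the
contractible direct summand given by `a` removed: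
`A₂ ⟶ A₃ ⊞ B₂ ⟶ A₄ ⊞ B₃ ⟶ ⋯ ⟶ Aₙ ⊞ Bₙ₋₁ ⟶ Bₙ ⟶ S A₂`. -/
noncomputable def redCone {P Q : NSeq (m + 3) S} (a : P.obj 1 ≅ Q.obj 1) (φ : Hom P Q) :
    NSeq (m + 3) S :=
  cone φ.app (biprod.lift (-P.d 2 3) (φ.app 2)) (Q.conn ≫ S.map (a.inv ≫ P.d 1 2))

end NSeq

end Disks

/-! ### Rotations -/

section Rotation

variable {D : Type u} [Category.{v} D] [Preadditive D] {m : ℕ} {T : D ⥤ D}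

namespace NSeq

/-- The isomorphisms `a` and `b` identify `P'` with the left rotation of `P`. -/
def IsRotationBy (P P' : NSeq (m + 3) T) (a : ∀ i, 1 ≤ i → i ≤ m + 2 → (P'.obj i ≅ P.obj (i + 1)))
    (b : P'.obj (m + 3) ≅ T.obj (P.obj 1)) : Prop :=
  (∀ i (h₁ : 1 ≤ i) (h₂ : i + 1 ≤ m + 2),
      P'.d i (i + 1) ≫ (a (i + 1) (by omega) h₂).hom
        = (a i h₁ (by omega)).hom ≫ P.d (i + 1) (i + 2)) ∧
    P'.d (m + 2) (m + 3) ≫ b.hom = (a (m + 2) (by omega) le_rfl).hom ≫ P.conn ∧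
    P'.conn ≫ T.map (a 1 le_rfl (by omega)).hom
      = ((-1 : ℤ) ^ (m + 3)) • (b.hom ≫ T.map (P.d 1 2))

/-- Glues components in the positions `1, …, n - 1` and one in the position `n`, which rotations
treat separately.  -/
lemma exists_components {P Q : NSeq (m + 3) T} (f : ∀ i, 1 ≤ i → i ≤ m + 2 → (P.obj i ⟶ Q.obj i))
    (g : P.obj (m + 3) ⟶ Q.obj (m + 3)) :
    ∃ app : ∀ i, P.obj i ⟶ Q.obj i, (∀ i h₁ h₂, app i = f i h₁ h₂) ∧ app (m + 3) = g := by
  refine ⟨fun i => if h : 1 ≤ i ∧ i ≤ m + 2 then f i h.1 h.2 else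
    if h' : i = m + 3 then eqToHom (by rw [h']) ≫ g ≫ eqToHom (by rw [h']) else 0, ?_, ?_⟩
  · intro i h₁ h₂
    exact dif_pos ⟨h₁, h₂⟩
  · have : ¬ (1 ≤ m + 3 ∧ m + 3 ≤ m + 2) := by omega
    simp

lemma neg_one_pow_smul_smul {X Y : D} (f : X ⟶ Y) :
    ((-1 : ℤ) ^ m) • ((-1 : ℤ) ^ m) • f = f := by
  rw [smul_smul, ← mul_pow]
  simp

variable {P P' Q Q' : NSeq (m + 3) T}
  {a : ∀ i, 1 ≤ i → i ≤ m + 2 → (P'.obj i ≅ P.obj (i + 1))} {b : P'.obj (m + 3) ≅ T.obj (P.obj 1)}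
  {a' : ∀ i, 1 ≤ i → i ≤ m + 2 → (Q'.obj i ≅ Q.obj (i + 1))} {b' : Q'.obj (m + 3) ≅ T.obj (Q.obj 1)}

/-- Rotation of morphisms. -/
lemma IsRotationBy.exists_hom (h : IsRotationBy P P' a b) (h' : IsRotationBy Q Q' a' b')
    (φ : Hom P Q) : ∃ ψ : Hom P' Q',
      (∀ i h₁ h₂, ψ.app i = (a i h₁ h₂).hom ≫ φ.app (i + 1) ≫ (a' i h₁ h₂).inv) ∧
      ψ.app (m + 3) = b.hom ≫ T.map (φ.app 1) ≫ b'.inv := by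
  obtain ⟨app, h₁, h₂⟩ := exists_components
    (fun i h₁ h₂ => (a i h₁ h₂).hom ≫ φ.app (i + 1) ≫ (a' i h₁ h₂).inv)
    (b.hom ≫ T.map (φ.app 1) ≫ b'.inv)
  obtain ⟨e₁, e₂, e₃⟩ := h
  obtain ⟨e₁', e₂', e₃'⟩ := h'
  refine ⟨Hom.mk' app ?_ ?_, h₁, h₂⟩
  · intro i hi hi'
    by_cases hi₂ : i + 1 ≤ m + 2
    · rw [h₁ i hi (by omega), h₁ (i + 1) (by omega) hi₂, ← Category.assoc, e₁ i hi hi₂,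
        Category.assoc, ← Category.assoc (P.d _ _), φ.comm, Category.assoc, Category.assoc,
        Category.assoc]
      congr 2
      rw [Iso.comp_inv_eq, Category.assoc, e₁' i hi hi₂, Iso.inv_hom_id_assoc]
    · obtain rfl : i = m + 2 := by omega
      rw [h₁ _ (by omega) le_rfl, h₂, ← Category.assoc, e₂, Category.assoc,
        ← Category.assoc P.conn, φ.comm_conn, Category.assoc, Category.assoc, Category.assoc]
      congr 2
      rw [Iso.comp_inv_eq, Category.assoc, e₂', Iso.inv_hom_id_assoc]
  · rw [h₁ 1 le_rfl (by omega), h₂, T.map_comp, ← Category.assoc, e₃, T.map_comp,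
      Preadditive.zsmul_comp, Category.assoc, ← Category.assoc (T.map _), ← T.map_comp, φ.comm,
      T.map_comp, Category.assoc, Category.assoc, Category.assoc, ← Preadditive.comp_zsmul,
      ← Preadditive.comp_zsmul]
    congr 2
    rw [← cancel_mono (T.map (a' 1 le_rfl (by omega)).hom), Category.assoc, e₃',
      Preadditive.comp_zsmul, Iso.inv_hom_id_assoc, Preadditive.zsmul_comp, Category.assoc,
      ← T.map_comp, Iso.inv_hom_id, T.map_id, Category.comp_id]

/-- Rotation of morphisms backwards, for a fully faithful suspension. -/
lemma IsRotationBy.exists_hom_of_rotation [T.Full] [T.Faithful] (h : IsRotationBy P P' a b)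
    (h' : IsRotationBy Q Q' a' b') (ψ : Hom P' Q') : ∃ φ : Hom P Q,
      (∀ i h₁ h₂, φ.app (i + 1) = (a i h₁ h₂).inv ≫ ψ.app i ≫ (a' i h₁ h₂).hom) ∧
      T.map (φ.app 1) = b.inv ≫ ψ.app (m + 3) ≫ b'.hom := by
  let app : ∀ i, P.obj i ⟶ Q.obj i := fun i => match i with
    | 0 => 0
    | 1 => T.preimage (b.inv ≫ ψ.app (m + 3) ≫ b'.hom)
    | k + 2 => if h : k + 1 ≤ m + 2 then
        (a (k + 1) (by omega) h).inv ≫ ψ.app (k + 1) ≫ (a' (k + 1) (by omega) h).hom else 0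
  have h₁ : ∀ i h₁ h₂, app (i + 1) = (a i h₁ h₂).inv ≫ ψ.app i ≫ (a' i h₁ h₂).hom := by
    rintro (_ | i) h₁ h₂
    · omega
    · exact dif_pos h₂
  have h₂ : T.map (app 1) = b.inv ≫ ψ.app (m + 3) ≫ b'.hom := T.map_preimage _
  obtain ⟨e₁, e₂, e₃⟩ := h
  obtain ⟨e₁', e₂', e₃'⟩ := h'
  refine ⟨Hom.mk' app ?_ ?_, h₁, h₂⟩
  · rintro (_ | _ | i) hi hi'
    · omega
    · apply T.map_injective
      have key := ψ.comm_conn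
      rw [← cancel_mono (T.map (a' 1 le_rfl (by omega)).hom), Category.assoc, Category.assoc, e₃',
        ← T.map_comp, ← Iso.hom_inv_id_assoc (a 1 le_rfl (by omega))
          (ψ.app 1 ≫ (a' 1 le_rfl (by omega)).hom), T.map_comp, ← Category.assoc, e₃,
        Preadditive.comp_zsmul, Preadditive.zsmul_comp] at key
      replace key := congrArg (fun f => b.inv ≫ (((-1 : ℤ) ^ (m + 3)) • f)) key
      simp only [neg_one_pow_smul_smul] at key
      rw [T.map_comp, T.map_comp, h₂]
      change T.map (P.d 1 2) ≫ T.map (app (1 + 1)) = _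
      rw [h₁ 1 le_rfl (by omega)]
      simpa using key
    · rw [h₁ (i + 1) (by omega) (by omega), h₁ (i + 1 + 1) (by omega) (by omega)]
      have k₁ := e₁ (i + 1) (by omega) (by omega)
      have k₂ := e₁' (i + 1) (by omega) (by omega)
      rw [Category.assoc, Category.assoc]
      change _ = _ ≫ _ ≫ _ ≫ Q.d (i + 1 + 1) (i + 1 + 2)
      rw [← k₂, ← Category.assoc (ψ.app (i + 1)), ← ψ.comm]
      change P.d (i + 1 + 1) (i + 1 + 2) ≫ _ = _
      rw [← Iso.inv_comp_eq] at k₁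
      rw [← k₁]
      simp
  · rw [h₂]
    change _ = app (m + 2 + 1) ≫ _
    rw [h₁ (m + 2) (by omega) le_rfl, Category.assoc, Category.assoc, ← e₂',
      ← Category.assoc (ψ.app (m + 2)), ← ψ.comm]
    have k₁ := e₂
    rw [← Iso.inv_comp_eq] at k₁
    rw [← k₁]
    simp

/-- Rotation preserves retracts. -/
lemma IsRetract.rotation (hr : IsRetract P Q) (h : P.IsLeftRotation P') (h' : Q.IsLeftRotation Q') :
    IsRetract P' Q' := by
  obtain ⟨a, b, h⟩ := h
  obtain ⟨a', b', h'⟩ := h'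
  obtain ⟨i, p, hip⟩ := hr
  obtain ⟨i', hi, hi'⟩ := IsRotationBy.exists_hom h h' i
  obtain ⟨p', hp, hp'⟩ := IsRotationBy.exists_hom h' h p
  have key : ((i'.comp p')).IsIso := by
    refine Hom.isIso_of_range _ fun k h₁ h₂ => ?_
    by_cases hk : k ≤ m + 2
    · have : (i'.comp p').app k = 𝟙 _ := by
        simp [hi k h₁ hk, hp k h₁ hk, reassoc_of% (hip (k + 1))]
      rw [this]
      infer_instance
    · obtain rfl : k = m + 3 := by omega
      have : (i'.comp p').app (m + 3) = 𝟙 _ := by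
        rw [Hom.comp_app, hi', hp']
        simp [← T.map_comp_assoc, hip]
      rw [this]
      infer_instance
  exact isRetract_of_isIso i' p' (Hom.id _) (Hom.comp_isIso key (Hom.id_isIso _))

section Exists

variable [HasZeroObject D]

open scoped ZeroObject

omit [HasZeroObject D] in
omit [Preadditive D] in
lemma eqToHom_conj_comp {X X' Y Y' : D} (p : X' = X) (f : X ⟶ Y) (q : Y = Y') (r : Y' = Y) :
    (eqToHom p ≫ f ≫ eqToHom q) ≫ eqToHom r = eqToHom p ≫ f := by
  subst p q
  simp

omit [HasZeroObject D] in
omit [Preadditive D] in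
lemma comp_eqToHom_conj {X X' Y Y' : D} (p : X' = X) (p' : X = X') (f : X ⟶ Y) (q : Y = Y') :
    f ≫ eqToHom q = eqToHom p' ≫ eqToHom p ≫ f ≫ eqToHom q := by
  subst p q
  simp

/-- Objects of the left rotation. -/
noncomputable def rotObj (P : NSeq (m + 3) T) : ℕ → D
  | 0 => 0
  | k + 1 => if k = m + 2 then T.obj (P.obj 1) else P.obj (k + 2)

/-- Morphisms of the left rotation. -/
noncomputable def rotMap (P : NSeq (m + 3) T) : ∀ i, rotObj P i ⟶ rotObj P (i + 1)
  | 0 => 0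
  | k + 1 => if h : k = m + 2 then 0 else
      if h' : k + 1 = m + 2 then
        eqToHom ((if_neg h).trans (congrArg P.obj (by omega : k + 2 = m + 3))) ≫ P.conn ≫
          eqToHom (if_pos h').symm
      else eqToHom (if_neg h) ≫ P.d (k + 2) (k + 3) ≫ eqToHom (if_neg h').symm

lemma exists_leftRotation (P : NSeq (m + 3) T) : ∃ P', P.IsLeftRotation P' := by
  have e₀ : rotObj P 1 = P.obj 2 :=
    if_neg (t := T.obj (P.obj 1)) (by omega : ¬ 0 = m + 2)
  have e₁ : rotObj P (m + 3) = T.obj (P.obj 1) := if_pos rfl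
  refine ⟨ofSucc (rotObj P) (rotMap P) ?_
    (((-1 : ℤ) ^ (m + 3)) • (eqToHom e₁ ≫ T.map (P.d 1 2) ≫ T.map (eqToHom e₀.symm))),
    fun i h₁ h₂ => eqToIso ?_, eqToIso e₁, ?_, ?_, ?_⟩
  · rintro (_ | k) h
    · exact isZero_zero D
    · have : rotObj P (k + 1) = P.obj (k + 2) := if_neg (by omega)
      rw [this]
      exact P.isZero _ (by omega)
  · rcases i with _ | k
    · omega
    · exact if_neg (by omega)
  · rintro (_ | k) h₁ h₂
    · omega
    · rw [ofSucc_d_succ]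
      dsimp only [rotMap]
      rw [dif_neg (by omega), dif_neg (by omega)]
      exact eqToHom_conj_comp _ _ _
        (if_neg (t := T.obj (P.obj 1)) (by omega : ¬ k + 1 = m + 2))
  · rw [ofSucc_d_succ]
    dsimp only [rotMap]
    rw [dif_neg (by omega), dif_pos rfl]
    exact eqToHom_conj_comp _ _ _ e₁
  · change (((-1 : ℤ) ^ (m + 3)) • (eqToHom e₁ ≫ T.map (P.d 1 2) ≫ T.map (eqToHom e₀.symm))) ≫
      T.map (eqToHom e₀) = ((-1 : ℤ) ^ (m + 3)) • (eqToHom e₁ ≫ T.map (P.d 1 2))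
    rw [Preadditive.zsmul_comp, Category.assoc, Category.assoc, ← T.map_comp]
    simp

/-- Each sequence is a left rotation, if the suspension is an equivalence. -/
lemma exists_isLeftRotation [T.Additive] [T.Full] [T.EssSurj] (P : NSeq (m + 3) T) :
    ∃ W : NSeq (m + 3) T, W.IsLeftRotation P := by
  let Y := T.objPreimage (P.obj (m + 3))
  let e : T.obj Y ≅ P.obj (m + 3) := T.objObjPreimageIso _
  let f : Y ⟶ P.obj 1 := ((-1 : ℤ) ^ (m + 3)) • T.preimage (e.hom ≫ P.conn)
  let obj : ℕ → D := fun i => match i with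
    | 0 => 0
    | 1 => Y
    | k + 2 => if k = m + 2 then 0 else P.obj (k + 1)
  have e₂ : ∀ k, k ≠ m + 2 → obj (k + 2) = P.obj (k + 1) := fun k hk => if_neg hk
  let map : ∀ i, obj i ⟶ obj (i + 1) := fun i => match i with
    | 0 => 0
    | 1 => f ≫ eqToHom (e₂ 0 (by omega)).symm
    | k + 2 => if h : k + 1 < m + 2 then eqToHom (e₂ k (by omega)) ≫ P.d (k + 1) (k + 2) ≫
        eqToHom (e₂ (k + 1) (by omega)).symm else 0
  refine ⟨ofSucc obj map ?_
    (eqToHom (e₂ (m + 1) (by omega)) ≫ P.d (m + 2) (m + 3) ≫ e.inv),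
    fun i h₁ h₂ => eqToIso ?_, e.symm, ?_, ?_, ?_⟩
  · rintro (_ | _ | k) h
    · exact isZero_zero D
    · omega
    · by_cases hk : k = m + 2
      · have : obj (k + 2) = 0 := if_pos hk
        rw [this]
        exact isZero_zero D
      · rw [e₂ k hk]
        exact P.isZero _ (by omega)
  · rcases i with _ | k
    · omega
    · exact (e₂ k (by omega)).symm
  · rintro (_ | k) h₁ h₂
    · omega
    · rw [ofSucc_d_succ]
      dsimp only [map]
      rw [dif_pos (by omega)]
      exact comp_eqToHom_conj _ (e₂ k (by omega)).symm _ _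
  · simp [ofSucc]
  · rw [ofSucc_d_succ]
    change P.conn ≫ T.map (eqToHom (e₂ 0 (by omega)).symm) =
      ((-1 : ℤ) ^ (m + 3)) • (e.inv ≫ T.map (f ≫ eqToHom (e₂ 0 (by omega)).symm))
    rw [T.map_comp, Functor.map_zsmul, T.map_preimage, Preadditive.zsmul_comp,
      Preadditive.comp_zsmul, neg_one_pow_smul_smul]
    simp

end Exists

end NSeq

end Rotation

open scoped ZeroObject

/-! ### Closure of a class of angles under direct summands -/

section Base

variable {D : Type u} [Category.{v} D] [Preadditive D] [HasZeroObject D] [HasBinaryBiproducts D]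

/-- The properties of the class of standard angles from which it follows that the class of their
direct summands is `n`-angulated: the axioms of a right `n`-angulated category but for the
octahedral one, which is replaced by the existence, for any two composable morphisms, of *one*
morphism of sequences whose reduced mapping cone is in the class; that the suspension is an
equivalence; and that for *rotations* of members of the class commutative squares on the morphisms
`fₙ₋₁` extend to morphisms of sequences. -/
structure IsAngleBase (m : ℕ) (T : D ⥤ D) (Θ : NSeq (m + 3) T → Prop) : Prop where
  iso_closed : ∀ {P Q : NSeq (m + 3) T} (φ : NSeq.Hom P Q), φ.IsIso → Θ P → Θ Q
  sum_closed : ∀ {P Q : NSeq (m + 3) T}, Θ P → Θ Q → Θ (P.sum Q)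
  trivial_mem : ∀ X : D, Θ (NSeq.trivial m T X)
  rotate : ∀ {P P' : NSeq (m + 3) T}, P.IsLeftRotation P' → Θ P → Θ P'
  complete : ∀ {P Q : NSeq (m + 3) T}, Θ P → Θ Q →
    ∀ (a : P.obj 1 ⟶ Q.obj 1) (b : P.obj 2 ⟶ Q.obj 2), P.d 1 2 ≫ b = a ≫ Q.d 1 2 →
      ∃ φ : NSeq.Hom P Q, φ.app 1 = a ∧ φ.app 2 = b
  exists_cone : ∀ {X Y Z : D} (f : X ⟶ Y) (g : Y ⟶ Z), ∃ P Q : NSeq (m + 3) T, Θ P ∧ Θ Q ∧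
    ∃ (e₁ : P.obj 1 ≅ X) (e₂ : P.obj 2 ≅ Y) (a : P.obj 1 ≅ Q.obj 1) (e₃ : Q.obj 2 ≅ Z)
      (φ : NSeq.Hom P Q), P.d 1 2 ≫ e₂.hom = e₁.hom ≫ f ∧ φ.app 1 = a.hom ∧
      φ.app 2 ≫ e₃.hom = e₂.hom ≫ g ∧ Θ (NSeq.redCone a φ)
  complete_last : ∀ {P P' Q Q' : NSeq (m + 3) T}, Θ P → Θ Q → P.IsLeftRotation P' →
    Q.IsLeftRotation Q' → ∀ (a : P'.obj (m + 2) ⟶ Q'.obj (m + 2))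
      (b : P'.obj (m + 3) ⟶ Q'.obj (m + 3)),
      P'.d (m + 2) (m + 3) ≫ b = a ≫ Q'.d (m + 2) (m + 3) →
      ∃ φ : NSeq.Hom P' Q', φ.app (m + 2) = a ∧ φ.app (m + 3) = b
  additive : T.Additive
  isEquivalence : T.IsEquivalence

namespace NSeq

variable {m : ℕ} {T : D ⥤ D} {Θ : NSeq (m + 3) T → Prop}

omit [HasBinaryBiproducts D] in
/-- Objects of `spike`. -/
noncomputable def spikeObj (m : ℕ) (T : D ⥤ D) (Y : D) : ℕ → D
  | 0 => 0
  | 1 => Y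
  | k + 2 => if k = m + 1 then T.obj Y else 0

/-- The sequence `Y ⟶ 0 ⟶ ⋯ ⟶ 0 ⟶ T Y ⟶ T Y` with last morphism the identity. -/
noncomputable def spike (m : ℕ) (T : D ⥤ D) (Y : D) : NSeq (m + 3) T :=
  ofSucc (spikeObj m T Y) (fun _ => 0)
    (by
      rintro (_ | _ | k) h
      · exact isZero_zero D
      · omega
      · have : spikeObj m T Y (k + 2) = 0 := if_neg (by omega)
        rw [this]
        exact isZero_zero D)
    (eqToHom (if_pos rfl))

omit [HasBinaryBiproducts D] in
lemma spike_isZero (Y : D) (k : ℕ) (h : k ≠ m + 1) : IsZero ((spike m T Y).obj (k + 2)) := by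
  have : spikeObj m T Y (k + 2) = 0 := if_neg h
  change IsZero (spikeObj m T Y (k + 2))
  rw [this]
  exact isZero_zero D

/-- The last morphism of `spike` as an isomorphism. -/
noncomputable def spikeIso (m : ℕ) (T : D ⥤ D) (Y : D) :
    (spike m T Y).obj (m + 3) ≅ T.obj Y := eqToIso (if_pos rfl)

omit [HasBinaryBiproducts D] in
lemma spike_conn (Y : D) : (spike m T Y).conn = (spikeIso m T Y).hom := rfl

/-- Components of `toSpike`. -/
noncomputable def toSpikeApp (W : NSeq (m + 3) T) : ∀ i, W.obj i ⟶ (spike m T (W.obj 1)).obj i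
  | 0 => 0
  | 1 => 𝟙 _
  | k + 2 => if h : k = m + 1 then eqToHom (by rw [h]) ≫ W.conn ≫
      (spikeIso m T (W.obj 1)).inv ≫ eqToHom (by rw [h]) else 0

omit [HasBinaryBiproducts D] in
lemma toSpikeApp_last (W : NSeq (m + 3) T) :
    toSpikeApp W (m + 3) = W.conn ≫ (spikeIso m T (W.obj 1)).inv :=
  (dif_pos rfl).trans (by simp)

/-- The morphism from a complex to the sequence `spike` of its first term. -/
noncomputable def toSpike {W : NSeq (m + 3) T} (hW : W.IsComplex) :
    Hom W (spike m T (W.obj 1)) :=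
  Hom.mk' (toSpikeApp W)
    (by
      intro i h₁ h₂
      have hd : (spike m T (W.obj 1)).d i (i + 1) = 0 := ofSucc_d_succ _ _ _ _ _
      rw [hd, comp_zero]
      by_cases hi : i = m + 2
      · subst hi
        change W.d (m + 2) (m + 3) ≫ toSpikeApp W (m + 3) = 0
        rw [toSpikeApp_last, ← Category.assoc, hW.d_conn, zero_comp]
      · obtain ⟨k, rfl⟩ : ∃ k, i = k + 1 := ⟨i - 1, by omega⟩
        exact (spike_isZero (W.obj 1) k (by omega)).eq_of_tgt _ _)
    (by
      have h₁ : (W.conn ≫ (spikeIso m T (W.obj 1)).inv) ≫ (spikeIso m T (W.obj 1)).hom =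
          W.conn := by simp
      have h₂ : W.conn ≫ T.map (𝟙 (W.obj 1)) = W.conn := by simp
      rw [toSpikeApp_last]
      exact h₂.trans h₁.symm)

/-- An isomorphism, multiplied by `(-1) ^ k`. -/
def signIso (k : ℕ) {X Y : D} (e : X ≅ Y) : X ≅ Y where
  hom := ((-1 : ℤ) ^ k) • e.hom
  inv := ((-1 : ℤ) ^ k) • e.inv
  hom_inv_id := by
    rw [Preadditive.zsmul_comp, Preadditive.comp_zsmul, neg_one_pow_smul_smul, Iso.hom_inv_id]
  inv_hom_id := by
    rw [Preadditive.zsmul_comp, Preadditive.comp_zsmul, neg_one_pow_smul_smul, Iso.inv_hom_id]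

omit [HasBinaryBiproducts D] in
lemma trivial_isLeftRotation_spike (Y : D) : (trivial m T Y).IsLeftRotation (spike m T Y) := by
  refine ⟨fun i h₁ h₂ => match i, h₁, h₂ with
    | 1, _, _ => Iso.refl Y
    | k + 2, _, h => IsZero.iso (spike_isZero Y k (by omega)) (isZero_zero D),
    signIso (m + 3) (spikeIso m T Y), ?_, ?_, ?_⟩
  · rintro (_ | i) h₁ h₂
    · omega
    · exact (isZero_zero D).eq_of_tgt _ _
  · exact (spike_isZero Y m (by omega)).eq_of_src _ _
  · have h : (trivial m T Y).d 1 2 = 𝟙 Y := ofSucc_d_succ _ _ _ _ _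
    rw [h]
    change (spikeIso m T Y).hom ≫ T.map (𝟙 Y) = ((-1 : ℤ) ^ (m + 3)) •
      ((((-1 : ℤ) ^ (m + 3)) • (spikeIso m T Y).hom) ≫ T.map (𝟙 Y))
    rw [Preadditive.zsmul_comp, neg_one_pow_smul_smul]

/-- Part of a family of objects. -/
noncomputable def cut (p : ℕ → Prop) [DecidablePred p] (Z : ℕ → D) (k : ℕ) : D :=
  if p k then Z k else 0

section Cut

variable (p : ℕ → Prop) [DecidablePred p] (Z : ℕ → D)

/-- The projection onto a part of a family. -/
noncomputable def toCut (k : ℕ) : Z k ⟶ cut p Z k :=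
  if h : p k then eqToHom (if_pos h).symm else 0

/-- The inclusion of a part of a family. -/
noncomputable def fromCut (k : ℕ) : cut p Z k ⟶ Z k :=
  if h : p k then eqToHom (if_pos h) else 0

variable {p}

omit [HasBinaryBiproducts D] [Preadditive D] in
lemma cut_isZero_of_not {k : ℕ} (h : ¬ p k) : IsZero (cut p Z k) := by
  have : cut p Z k = 0 := if_neg h
  rw [this]
  exact isZero_zero D

omit [HasBinaryBiproducts D] [Preadditive D] in
variable {Z} in
lemma cut_isZero {k : ℕ} (h : IsZero (Z k)) : IsZero (cut p Z k) := by
  by_cases hk : p k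
  · have : cut p Z k = Z k := if_pos hk
    rwa [this]
  · exact cut_isZero_of_not Z hk

omit [HasBinaryBiproducts D] in
lemma fromCut_toCut (k : ℕ) : fromCut p Z k ≫ toCut p Z k = 𝟙 _ := by
  by_cases h : p k
  · rw [fromCut, toCut, dif_pos h, dif_pos h]
    exact (eqToHom_trans _ _).trans (eqToHom_refl _ _)
  · exact (cut_isZero_of_not Z h).eq_of_src _ _

omit [HasBinaryBiproducts D] in
lemma toCut_fromCut {k : ℕ} (h : p k) : toCut p Z k ≫ fromCut p Z k = 𝟙 _ := by
  rw [fromCut, toCut, dif_pos h, dif_pos h]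
  exact (eqToHom_trans _ _).trans (eqToHom_refl _ _)

omit [HasBinaryBiproducts D] in
lemma toCut_fromCut_of_not {k : ℕ} (h : ¬ p k) : toCut p Z k ≫ fromCut p Z k = 0 := by
  simp [fromCut, toCut, h]

end Cut

end NSeq

open NSeq

namespace IsAngleBase

variable {m : ℕ} {T : D ⥤ D} {Θ : NSeq (m + 3) T → Prop} (h : IsAngleBase m T Θ)

include h

lemma spike_mem (Y : D) : Θ (spike m T Y) :=
  h.rotate (trivial_isLeftRotation_spike Y) (h.trivial_mem Y)

lemma mem_of_isZero {P : NSeq (m + 3) T} (hP : ∀ i, IsZero (P.obj i)) : Θ P := by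
  have h₀ : ∀ i, IsZero ((NSeq.trivial m T (0 : D)).obj i) := by
    rintro (_ | _ | _ | i) <;> exact isZero_zero D
  refine h.iso_closed (P := NSeq.trivial m T 0) (Hom.mk' (fun _ => 0) (fun i _ _ => ?_) ?_)
    (fun i => ⟨0, (h₀ i).eq_of_src _ _, (hP i).eq_of_src _ _⟩) (h.trivial_mem 0)
  · simp
  · exact (h₀ _).eq_of_src _ _

/-- A disk in the last two positions: it is isomorphic to `spike`, since each object is isomorphic
to some `T Y`.  -/
lemma disks_mem_of_last {Z : ℕ → D} (hZ : ∀ k, (k = 0 ∨ m + 3 ≤ k) → IsZero (Z k))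
    (hZ' : ∀ k, k ≠ m + 2 → IsZero (Z k)) : Θ (disks T Z hZ) := by
  have := h.additive
  have := h.isEquivalence
  let Y := T.objPreimage (Z (m + 2))
  let ε : Z (m + 2) ≅ T.obj Y := (T.objObjPreimageIso _).symm
  have hz₁ := hZ' (m + 1) (by omega)
  have hz₃ := hZ' (m + 3) (by omega)
  let e : (disks (m := m) T Z hZ).obj (m + 2) ≅ (spike m T Y).obj (m + 3) :=
    { hom := (biprod.fst : Z (m + 2) ⊞ Z (m + 1) ⟶ _) ≫ ε.hom ≫ (spikeIso m T Y).inv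
      inv := (spikeIso m T Y).hom ≫ ε.inv ≫ (biprod.inl : _ ⟶ Z (m + 2) ⊞ Z (m + 1))
      hom_inv_id := by
        change ((biprod.fst : Z (m + 2) ⊞ Z (m + 1) ⟶ _) ≫ ε.hom ≫ (spikeIso m T Y).inv) ≫
          (spikeIso m T Y).hom ≫ ε.inv ≫ (biprod.inl : _ ⟶ Z (m + 2) ⊞ Z (m + 1)) = 𝟙 _
        apply biprod.hom_ext'
        · simp
        · exact hz₁.eq_of_src _ _
      inv_hom_id := by
        change ((spikeIso m T Y).hom ≫ ε.inv ≫ (biprod.inl : _ ⟶ Z (m + 2) ⊞ Z (m + 1))) ≫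
          (biprod.fst : Z (m + 2) ⊞ Z (m + 1) ⟶ _) ≫ ε.hom ≫ (spikeIso m T Y).inv = 𝟙 _
        simp }
  let b : (disks (m := m) T Z hZ).obj (m + 3) ≅ T.obj Y :=
    { hom := (biprod.snd : Z (m + 3) ⊞ Z (m + 2) ⟶ _) ≫ ε.hom
      inv := ε.inv ≫ (biprod.inr : _ ⟶ Z (m + 3) ⊞ Z (m + 2))
      hom_inv_id := by
        change ((biprod.snd : Z (m + 3) ⊞ Z (m + 2) ⟶ _) ≫ ε.hom) ≫ ε.inv ≫
          (biprod.inr : _ ⟶ Z (m + 3) ⊞ Z (m + 2)) = 𝟙 _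
        apply biprod.hom_ext'
        · exact hz₃.eq_of_src _ _
        · simp
      inv_hom_id := by
        change (ε.inv ≫ (biprod.inr : _ ⟶ Z (m + 3) ⊞ Z (m + 2))) ≫
          (biprod.snd : Z (m + 3) ⊞ Z (m + 2) ⟶ _) ≫ ε.hom = 𝟙 _
        simp }
  have hz : ∀ i, i ≤ m + 1 → IsZero ((disks (m := m) T Z hZ).obj i) := by
    rintro (_ | k) hk
    · exact hZ' 0 (by omega)
    · exact biprod_isZero_iff _ _ |>.2 ⟨hZ' _ (by omega), hZ' _ (by omega)⟩
  have hs : ∀ i, i ≠ 0 → i ≤ m + 1 → IsZero ((spike m T Y).obj (i + 1)) := by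
    rintro (_ | k) h₁ hk
    · omega
    · exact spike_isZero Y k (by omega)
  refine h.rotate (P := spike m T Y) ⟨fun i h₁ h₂ =>
    if hi : i = m + 2 then eqToIso (by rw [hi]) ≪≫ e ≪≫ eqToIso (by rw [hi]) else
      IsZero.iso (hz i (by omega)) (hs i (by omega) (by omega)), b, ?_, ?_, ?_⟩ (h.spike_mem Y)
  · exact fun i h₁ h₂ => (hz i (by omega)).eq_of_src _ _
  · beta_reduce
    rw [dif_pos rfl, disks_d, spike_conn]
    change (biprod.lift 0 biprod.fst : Z (m + 2) ⊞ Z (m + 1) ⟶ Z (m + 3) ⊞ Z (m + 2)) ≫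
      (biprod.snd : Z (m + 3) ⊞ Z (m + 2) ⟶ _) ≫ ε.hom = (eqToHom rfl ≫ ((biprod.fst :
        Z (m + 2) ⊞ Z (m + 1) ⟶ _) ≫ ε.hom ≫ (spikeIso m T Y).inv) ≫ eqToHom rfl) ≫
          (spikeIso m T Y).hom
    simp
  · have hd : (spike m T Y).d 1 2 = 0 := ofSucc_d_succ _ _ _ _ _
    rw [hd, T.map_zero, comp_zero, smul_zero]
    exact zero_comp

/-- If the last disk vanishes, then the sum of disks is the left rotation of one whose disks are
placed one position further to the right.  -/
lemma disks_mem_of_shift {Z : ℕ → D} (hZ : ∀ k, (k = 0 ∨ m + 3 ≤ k) → IsZero (Z k))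
    (hZ' : IsZero (Z (m + 2)))
    (hΘ : ∀ (Z' : ℕ → D) (hZ' : ∀ k, (k = 0 ∨ m + 3 ≤ k) → IsZero (Z' k)),
      (∀ k, IsZero (Z k) → IsZero (Z' (k + 1))) → Θ (disks T Z' hZ')) : Θ (disks T Z hZ) := by
  have := h.additive
  let Z' : ℕ → D := fun k => match k with
    | 0 => 0
    | 1 => 0
    | k + 2 => Z (k + 1)
  have hz : ∀ k, (k = 0 ∨ m + 3 ≤ k) → IsZero (Z' k) := by
    rintro (_ | _ | k) hk
    · exact isZero_zero D
    · exact isZero_zero D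
    · by_cases hk' : k = m + 1
      · subst hk'
        exact hZ'
      · exact hZ (k + 1) (by omega)
  let c : ∀ k, Z k ≅ Z' (k + 1) := fun k => match k with
    | 0 => IsZero.iso (hZ 0 (Or.inl rfl)) (isZero_zero D)
    | k + 1 => Iso.refl (Z (k + 1))
  let a : ∀ k, (disks (m := m) T Z hZ).obj (k + 1) ≅ (disks (m := m) T Z' hz).obj (k + 1 + 1) :=
    fun k => biprod.mapIso (c (k + 1)) (c k)
  have hlast : IsZero ((disks (m := m) T Z hZ).obj (m + 3)) :=
    biprod_isZero_iff _ _ |>.2 ⟨hZ _ (by omega), hZ'⟩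
  have hfirst : IsZero ((disks (m := m) T Z' hz).obj 1) :=
    biprod_isZero_iff _ _ |>.2 ⟨isZero_zero D, isZero_zero D⟩
  refine h.rotate (P := disks T Z' hz) ⟨fun i h₁ h₂ => match i, h₁ with
    | k + 1, _ => a k, IsZero.iso hlast (T.map_isZero hfirst), ?_, ?_, ?_⟩ (hΘ Z' hz ?_)
  · rintro (_ | k) h₁ h₂
    · omega
    · rw [disks_d, disks_d]
      change biprod.lift 0 biprod.fst ≫ biprod.map (c (k + 2)).hom (c (k + 1)).hom =
        biprod.map (c (k + 1)).hom (c k).hom ≫ biprod.lift 0 biprod.fst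
      apply biprod.hom_ext <;> simp
  · exact (T.map_isZero hfirst).eq_of_tgt _ _
  · exact hlast.eq_of_src _ _
  · rintro (_ | k) hk
    · exact isZero_zero D
    · exact hk

/-- A sum of disks is the direct sum of the disks in the positions with `p` and of the others. -/
lemma disks_mem_of_cut {Z : ℕ → D} (hZ : ∀ k, (k = 0 ∨ m + 3 ≤ k) → IsZero (Z k)) (p : ℕ → Prop)
    [DecidablePred p]
    (h₁ : Θ (disks T (cut p Z) (fun k hk => cut_isZero (hZ k hk))))
    (h₂ : Θ (disks T (cut (fun k => ¬ p k) Z) (fun k hk => cut_isZero (hZ k hk)))) :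
    Θ (disks T Z hZ) := by
  refine h.iso_closed (sumDesc (disksHom (fromCut p Z)) (disksHom (fromCut (fun k => ¬ p k) Z)))
    (Hom.isIso_of_range _ ?_) (h.sum_closed h₁ h₂)
  rintro (_ | k) hk hk'
  · omega
  have e₁ : ∀ k, fromCut p Z k ≫ toCut (fun k => ¬ p k) Z k = 0 := fun k => by
    by_cases hp : p k
    · exact (cut_isZero_of_not Z (p := fun k => ¬ p k) (not_not.2 hp)).eq_of_tgt _ _
    · exact (cut_isZero_of_not Z hp).eq_of_src _ _
  have e₂ : ∀ k, fromCut (fun k => ¬ p k) Z k ≫ toCut p Z k = 0 := fun k => by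
    by_cases hp : p k
    · exact (cut_isZero_of_not Z (p := fun k => ¬ p k) (not_not.2 hp)).eq_of_src _ _
    · exact (cut_isZero_of_not Z hp).eq_of_tgt _ _
  have e₃ : ∀ k, toCut p Z k ≫ fromCut p Z k +
      toCut (fun k => ¬ p k) Z k ≫ fromCut (fun k => ¬ p k) Z k = 𝟙 _ := fun k => by
    by_cases hp : p k
    · rw [toCut_fromCut Z hp, toCut_fromCut_of_not Z (p := fun k => ¬ p k) (not_not.2 hp),
        add_zero]
    · rw [toCut_fromCut_of_not Z hp, toCut_fromCut Z (p := fun k => ¬ p k) hp, zero_add]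
  refine ⟨biprod.lift (biprod.map (toCut p Z (k + 1)) (toCut p Z k))
    (biprod.map (toCut (fun k => ¬ p k) Z (k + 1)) (toCut (fun k => ¬ p k) Z k)), ?_, ?_⟩
  · change biprod.desc (biprod.map (fromCut p Z (k + 1)) (fromCut p Z k))
      (biprod.map (fromCut (fun k => ¬ p k) Z (k + 1)) (fromCut (fun k => ¬ p k) Z k)) ≫
      biprod.lift (biprod.map (toCut p Z (k + 1)) (toCut p Z k))
        (biprod.map (toCut (fun k => ¬ p k) Z (k + 1)) (toCut (fun k => ¬ p k) Z k)) = 𝟙 _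
    apply biprod.hom_ext' <;> apply biprod.hom_ext' <;> apply biprod.hom_ext <;>
      apply biprod.hom_ext <;>
      simp [reassoc_of% e₁, reassoc_of% e₂,
        reassoc_of% (fromCut_toCut (p := p) Z), reassoc_of% (fromCut_toCut (p := fun k => ¬ p k) Z)]
  · change biprod.lift (biprod.map (toCut p Z (k + 1)) (toCut p Z k))
        (biprod.map (toCut (fun k => ¬ p k) Z (k + 1)) (toCut (fun k => ¬ p k) Z k)) ≫
      biprod.desc (biprod.map (fromCut p Z (k + 1)) (fromCut p Z k))
        (biprod.map (fromCut (fun k => ¬ p k) Z (k + 1)) (fromCut (fun k => ¬ p k) Z k)) = 𝟙 _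
    rw [biprod.lift_desc]
    apply biprod.hom_ext' <;> apply biprod.hom_ext
    · simpa using e₃ (k + 1)
    · simp
    · simp
    · simpa using e₃ k

/-- Sums of disks are obtained from trivial sequences by rotations and direct sums. -/
lemma disks_mem {Z : ℕ → D} (hZ : ∀ k, (k = 0 ∨ m + 3 ≤ k) → IsZero (Z k)) :
    Θ (disks T Z hZ) := by
  have key : ∀ (j : ℕ) (Z : ℕ → D) (hZ : ∀ k, (k = 0 ∨ m + 3 ≤ k) → IsZero (Z k)),
      (∀ k, k + j < m + 3 → IsZero (Z k)) → Θ (disks T Z hZ) := by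
    intro j
    induction j with
    | zero =>
      intro Z hZ hj
      have hz : ∀ k, IsZero (Z k) := fun k => by
        by_cases hk : k < m + 3
        · exact hj k hk
        · exact hZ k (by omega)
      refine h.mem_of_isZero ?_
      rintro (_ | k)
      · exact hz 0
      · exact biprod_isZero_iff _ _ |>.2 ⟨hz _, hz _⟩
    | succ j ih =>
      intro Z hZ hj
      refine h.disks_mem_of_cut hZ (fun k => k = m + 2) ?_ ?_
      · exact h.disks_mem_of_last _ fun k hk => cut_isZero_of_not Z hk
      · refine h.disks_mem_of_shift _ (cut_isZero_of_not Z (not_not.2 rfl)) ?_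
        intro Z' hZ' hZ''
        refine ih Z' hZ' ?_
        rintro (_ | k) hk
        · exact hZ' 0 (Or.inl rfl)
        · exact hZ'' k (cut_isZero (hj k (by omega)))
  exact key (m + 3) Z hZ fun k hk => by omega

/-- Each morphism of a member of the class is a weak cokernel of the preceding one. -/
lemma isWeakExact {P : NSeq (m + 3) T} (hP : Θ P) : P.IsWeakExact := by
  have := h.additive
  have first : ∀ {P : NSeq (m + 3) T}, Θ P → IsWeakCokernel (P.d 1 2) (P.d 2 3) := by
    intro P hP
    constructor
    · have ht : (NSeq.trivial m T (P.obj 1)).d 1 2 = 𝟙 (P.obj 1) := ofSucc_d_succ _ _ _ _ _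
      obtain ⟨φ, h₁, h₂⟩ := h.complete (h.trivial_mem (P.obj 1)) hP (𝟙 (P.obj 1)) (P.d 1 2)
        (by rw [ht]; rfl)
      have := φ.comm 2 3
      rw [h₂] at this
      refine this.symm.trans ?_
      have h₀ : φ.app 3 = 0 := (isZero_zero D).eq_of_src _ _
      rw [h₀]
      exact comp_zero
    · intro V u hu
      let Z : ℕ → D := fun k => match k with
        | 2 => V
        | _ => 0
      have hZ : ∀ k, (k = 0 ∨ m + 3 ≤ k) → IsZero (Z k) := by
        rintro (_ | _ | _ | k) hk
        · exact isZero_zero D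
        · omega
        · omega
        · exact isZero_zero D
      obtain ⟨φ, h₁, h₂⟩ := h.complete hP (h.disks_mem hZ) 0
        (biprod.lift u 0 : _ ⟶ V ⊞ (0 : D)) (by
          rw [zero_comp]
          change P.d 1 2 ≫ (biprod.lift u 0 : _ ⟶ V ⊞ (0 : D)) = 0
          apply biprod.hom_ext <;> simp [hu])
      have key := φ.comm 2 3
      rw [h₂, disks_d] at key
      refine ⟨φ.app 3 ≫ (biprod.snd : (0 : D) ⊞ V ⟶ V), ?_⟩
      replace key := congrArg (fun f => f ≫ (biprod.snd : (0 : D) ⊞ V ⟶ V)) key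
      refine (Category.assoc _ _ _).symm.trans (key.trans ?_)
      change ((biprod.lift u 0 : _ ⟶ V ⊞ (0 : D)) ≫ biprod.lift 0 biprod.fst) ≫ biprod.snd = u
      simp
  have all : ∀ (i : ℕ), 1 ≤ i → i ≤ m + 1 → ∀ {P : NSeq (m + 3) T}, Θ P →
      IsWeakCokernel (P.d i (i + 1)) (P.d (i + 1) (i + 2)) := by
    intro i hi
    induction i, hi using Nat.le_induction with
    | base => intro _ P hP; exact first hP
    | succ i hi ih =>
      intro hi' P hP
      obtain ⟨P', hP'⟩ := exists_leftRotation P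
      have h' := ih (by omega) (h.rotate hP' hP)
      obtain ⟨a, b, e₁, e₂, e₃⟩ := hP'
      have k₁ := e₁ i hi (by omega)
      have k₂ := e₁ (i + 1) (by omega) (by omega)
      refine h'.of_retract (a i (by omega) (by omega)).inv (a i (by omega) (by omega)).hom
        (a (i + 1) (by omega) (by omega)).inv (a (i + 1) (by omega) (by omega)).hom
        (a (i + 2) (by omega) (by omega)).inv (a (i + 2) (by omega) (by omega)).hom ?_ k₁ ?_
        (Iso.inv_hom_id _) (Iso.inv_hom_id _)
      · rw [Iso.comp_inv_eq, Category.assoc, k₁, Iso.inv_hom_id_assoc]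
      · rw [Iso.comp_inv_eq, Category.assoc, k₂, Iso.inv_hom_id_assoc]
  obtain ⟨P', hP'⟩ := exists_leftRotation P
  have h' := all (m + 1) (by omega) le_rfl (h.rotate hP' hP)
  have conn : ∀ {P P' : NSeq (m + 3) T}, Θ P → P.IsLeftRotation P' →
      IsWeakCokernel (P.d (m + 2) (m + 3)) P.conn := by
    rintro P P' hP hP'
    have h' := all (m + 1) (by omega) le_rfl (h.rotate hP' hP)
    obtain ⟨a, b, e₁, e₂, e₃⟩ := hP'
    have k₁ := e₁ (m + 1) (by omega) (by omega)
    refine h'.of_retract (a (m + 1) (by omega) (by omega)).inv (a (m + 1) (by omega) (by omega)).hom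
        (a (m + 2) (by omega) (by omega)).inv (a (m + 2) (by omega) (by omega)).hom
        b.inv b.hom ?_ k₁ ?_ (Iso.inv_hom_id _) (Iso.inv_hom_id _)
    · rw [Iso.comp_inv_eq, Category.assoc, k₁, Iso.inv_hom_id_assoc]
    · rw [Iso.comp_inv_eq, Category.assoc, e₂, Iso.inv_hom_id_assoc]
  refine ⟨fun i hi hi' => all i hi hi' hP, conn hP hP', ?_⟩
  obtain ⟨P'', hP''⟩ := exists_leftRotation P'
  have hc := (conn (h.rotate hP' hP) hP'').1
  obtain ⟨a, b, e₁, e₂, e₃⟩ := hP'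
  have key : P'.d (m + 2) (m + 3) ≫ P'.conn ≫ T.map (a 1 le_rfl (by omega)).hom = 0 := by
    rw [← Category.assoc, hc, zero_comp]
  rw [e₃, Preadditive.comp_zsmul, ← Category.assoc, e₂] at key
  replace key := congrArg (fun f => ((-1 : ℤ) ^ (m + 3)) • f) key
  simp only [neg_one_pow_smul_smul, smul_zero] at key
  rw [← cancel_epi (a (m + 2) (by omega) le_rfl).hom, ← Category.assoc, key, comp_zero]

end IsAngleBase

end Base

/-! ### Direct summands of angles -/

section Summands

variable {D : Type u} [Category.{v} D] [Preadditive D]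

namespace NSeq

section

variable {m : ℕ} {T : D ⥤ D}

lemma IsRetract.refl (W : NSeq (m + 3) T) : IsRetract W W :=
  ⟨Hom.id W, Hom.id W, fun _ => Category.id_comp _⟩

lemma IsRetract.trans {W Q E : NSeq (m + 3) T} (h : IsRetract W Q) (h' : IsRetract Q E) :
    IsRetract W E := by
  obtain ⟨i, p, hip⟩ := h
  obtain ⟨i', p', hip'⟩ := h'
  refine ⟨i.comp i', p'.comp p, fun k => ?_⟩
  simp [reassoc_of% (hip' k), hip]

lemma IsRetract.of_isIso {W Q : NSeq (m + 3) T} (φ : Hom W Q) (h : φ.IsIso) : IsRetract W Q :=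
  ⟨φ, φ.inv h, φ.comp_inv_app h⟩

variable [HasBinaryBiproducts D]

lemma IsRetract.sum {W Q W' Q' : NSeq (m + 3) T} (h : IsRetract W Q) (h' : IsRetract W' Q') :
    IsRetract (W.sum W') (Q.sum Q') := by
  obtain ⟨i, p, hip⟩ := h
  obtain ⟨i', p', hip'⟩ := h'
  refine ⟨sumMap i i', sumMap p p', fun k => ?_⟩
  rw [sumMap_app, sumMap_app]
  change biprod.map (i.app k) (i'.app k) ≫ biprod.map (p.app k) (p'.app k) = 𝟙 _
  apply biprod.hom_ext <;> apply biprod.hom_ext' <;> simp [hip, hip']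

lemma isRetract_sum [T.Additive] (W W' : NSeq (m + 3) T) : IsRetract W (W.sum W') :=
  ⟨sumInl _ _, sumFst _ _, fun k => by
    change (biprod.inl : _ ⟶ W.obj k ⊞ W'.obj k) ≫ biprod.fst = 𝟙 _
    simp⟩

lemma isComplemented_of_isZero {M N : D} (h : IsZero M) (i : M ⟶ N) : IsComplemented i :=
  ⟨N, ⟨biprod.snd, biprod.inr, by
    apply biprod.hom_ext
    · exact h.eq_of_tgt _ _
    · simp, by simp⟩, h.eq_of_src _ _⟩

lemma isComplemented_lift_right {M N Y : D} (i : M ⟶ N) {a : M ⟶ Y} (h : IsComplemented a) :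
    IsComplemented (biprod.lift i a) := by
  obtain ⟨U, e, he⟩ := isComplemented_lift h i
  refine ⟨U, e ≪≫ biprod.braiding _ _, ?_⟩
  rw [Iso.trans_hom, ← Category.assoc, he]
  apply biprod.hom_ext <;> simp

variable [HasZeroObject D]

open scoped ZeroObject

/-- The objects of a sequence, shifted by one. -/
noncomputable def shiftObj (W : NSeq (m + 3) T) : ℕ → D
  | 0 => 0
  | k + 1 => W.obj (k + 2)

omit [HasBinaryBiproducts D] in
lemma shiftObj_isZero (W : NSeq (m + 3) T) :
    ∀ k, (k = 0 ∨ m + 3 ≤ k) → IsZero (shiftObj W k)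
  | 0, _ => isZero_zero D
  | k + 1, h => W.isZero (k + 2) (by omega)

/-- The tautological morphisms to the shifted objects. -/
noncomputable def toShiftObj (W : NSeq (m + 3) T) : ∀ k, W.obj (k + 1) ⟶ shiftObj W k
  | 0 => 0
  | k + 1 => 𝟙 (W.obj (k + 2))

end

end NSeq

open NSeq

variable [HasZeroObject D] [HasBinaryBiproducts D] {m : ℕ} {T : D ⥤ D} {Θ : NSeq (m + 3) T → Prop}

/-- A retract of a member `Q` of the class is a direct summand of a member.  As idempotents need not
split, a complement of `W` exists only in the sum of `Q` and of contractible angles on the objects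
of `W`. -/
lemma IsAngleBase.exists_sum_mem (h : IsAngleBase m T Θ) {W Q : NSeq (m + 3) T} (hQ : Θ Q)
    (hr : IsRetract W Q) : ∃ W', Θ (W.sum W') := by
  have := h.additive
  have hW : W.IsComplex := ((h.isWeakExact hQ).of_retract hr).isComplex
  obtain ⟨i, p, hip⟩ := hr
  -- the inclusion becomes complemented after adding morphisms to contractible angles
  let d : Hom W (disks T (shiftObj W) (shiftObj_isZero W)) := toDisks hW (toShiftObj W)
  let i' := sumLift (sumLift i d) (toSpike hW)
  let p' := ((sumFst (Q.sum (disks T (shiftObj W) (shiftObj_isZero W)))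
    (spike m T (W.obj 1))).comp (sumFst _ _)).comp p
  have hip' : ∀ k, i'.app k ≫ p'.app k = 𝟙 _ := fun k => by
    change biprod.lift (biprod.lift (i.app k) (d.app k)) ((toSpike hW).app k) ≫
      (biprod.fst ≫ biprod.fst) ≫ p.app k = 𝟙 _
    simp [hip]
  have hc : ∀ k, IsComplemented (i'.app k) := fun k => by
    change IsComplemented (biprod.lift (biprod.lift (i.app k) (d.app k)) ((toSpike hW).app k))
    rcases k with _ | _ | k
    · exact isComplemented_of_isZero (W.isZero 0 (Or.inl rfl)) _
    · have : IsIso ((toSpike hW).app (0 + 1)) := inferInstanceAs (IsIso (𝟙 (W.obj 1)))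
      exact isComplemented_lift_of_isIso _ _
    · refine isComplemented_lift (isComplemented_lift_right _ ?_) _
      change IsComplemented (biprod.lift (W.d (k + 1 + 1) (k + 1 + 2) ≫ toShiftObj W (k + 1 + 1))
        (𝟙 (W.obj (k + 2))))
      exact isComplemented_lift_of_isIso _ _
  obtain ⟨U, φ, hφ⟩ := exists_sum_iso_of_retract i' p' hip' hc
  exact ⟨U, h.iso_closed (φ.inv hφ) (φ.inv_isIso hφ) (h.sum_closed
    (h.sum_closed hQ (h.disks_mem _)) (h.spike_mem _))⟩

/-- The class of direct summands of the members of a class. -/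
def Summands (Θ : NSeq (m + 3) T → Prop) (W : NSeq (m + 3) T) : Prop :=
  ∃ W' : NSeq (m + 3) T, Θ (W.sum W')

/-- A class as in `IsAngleBase` which is moreover closed under retracts. -/
structure IsThickBase (m : ℕ) (T : D ⥤ D) (Θ : NSeq (m + 3) T → Prop) : Prop
    extends IsAngleBase m T Θ where
  of_retract : ∀ {W Q : NSeq (m + 3) T}, Θ Q → IsRetract W Q → Θ W

/-- The axioms pass to direct summands, since a direct summand is a retract and conversely by
`IsAngleBase.exists_sum_mem`. -/
lemma IsAngleBase.summands (h : IsAngleBase m T Θ) : IsThickBase m T (Summands Θ) := by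
  have := h.additive
  have ret : ∀ {W : NSeq (m + 3) T}, Summands Θ W → ∃ Q, Θ Q ∧ IsRetract W Q :=
    fun {W} ⟨W', hW'⟩ => ⟨_, hW', isRetract_sum _ _⟩
  have of_ret : ∀ {W Q : NSeq (m + 3) T}, Θ Q → IsRetract W Q → Summands Θ W :=
    fun hQ hr => h.exists_sum_mem hQ hr
  refine { iso_closed := ?_, sum_closed := ?_, trivial_mem := ?_, rotate := ?_, complete := ?_,
           exists_cone := ?_, complete_last := ?_, additive := h.additive,
           isEquivalence := h.isEquivalence, of_retract := ?_ }
  · intro P Q φ hφ hP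
    obtain ⟨P', hP', hr⟩ := ret hP
    exact of_ret hP' ((IsRetract.of_isIso _ (φ.inv_isIso hφ)).trans hr)
  · intro P Q hP hQ
    obtain ⟨P', hP', hr⟩ := ret hP
    obtain ⟨Q', hQ', hr'⟩ := ret hQ
    exact of_ret (h.sum_closed hP' hQ') (hr.sum hr')
  · exact fun Y => of_ret (h.trivial_mem Y) (IsRetract.refl _)
  · intro P P' hPP' hP
    obtain ⟨Q, hQ, hr⟩ := ret hP
    obtain ⟨Q', hQ'⟩ := exists_leftRotation Q
    exact of_ret (h.rotate hQ' hQ) (hr.rotation hPP' hQ')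
  · intro P Q hP hQ a b hab
    obtain ⟨P', hP', i, p, hip⟩ := ret hP
    obtain ⟨Q', hQ', i', p', hip'⟩ := ret hQ
    obtain ⟨φ, h₁, h₂⟩ := h.complete hP' hQ' (p.app 1 ≫ a ≫ i'.app 1) (p.app 2 ≫ b ≫ i'.app 2)
      (by rw [← Category.assoc, p.comm, Category.assoc, ← Category.assoc (P.d 1 2), hab,
        Category.assoc, Category.assoc, Category.assoc, i'.comm])
    refine ⟨(i.comp φ).comp p', ?_, ?_⟩
    · simp [h₁, reassoc_of% (hip 1), hip']
    · simp [h₂, reassoc_of% (hip 2), hip']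
  · intro M N K f g
    obtain ⟨P, Q, hP, hQ, e₁, e₂, a, e₃, φ, k₁, k₂, k₃, hc⟩ := h.exists_cone f g
    exact ⟨P, Q, of_ret hP (IsRetract.refl _), of_ret hQ (IsRetract.refl _), e₁, e₂, a, e₃, φ, k₁,
      k₂, k₃, of_ret hc (IsRetract.refl _)⟩
  · intro P P' Q Q' hP hQ hP' hQ' a b hab
    obtain ⟨E, hE, hr⟩ := ret hP
    obtain ⟨F, hF, hr'⟩ := ret hQ
    obtain ⟨E', hE'⟩ := exists_leftRotation E
    obtain ⟨F', hF'⟩ := exists_leftRotation F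
    obtain ⟨i, p, hip⟩ := hr.rotation hP' hE'
    obtain ⟨i', p', hip'⟩ := hr'.rotation hQ' hF'
    obtain ⟨φ, h₁, h₂⟩ := h.complete_last hE hF hE' hF' (p.app (m + 2) ≫ a ≫ i'.app (m + 2))
      (p.app (m + 3) ≫ b ≫ i'.app (m + 3))
      (by rw [← Category.assoc, p.comm, Category.assoc, ← Category.assoc (P'.d _ _), hab,
        Category.assoc, Category.assoc, Category.assoc, i'.comm])
    refine ⟨(i.comp φ).comp p', ?_, ?_⟩
    · simp [h₁, reassoc_of% (hip (m + 2)), hip']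
    · simp [h₂, reassoc_of% (hip (m + 3)), hip']
  · intro W Q hQ hr
    obtain ⟨E, hE, hr'⟩ := ret hQ
    exact of_ret hE (hr.trans hr')

namespace IsThickBase

variable (h : IsThickBase m T Θ)

include h

/-- A complex is in the class if it is a retract of a member of the class up to homotopy. -/
lemma mem_of_homotopy {E E' : NSeq (m + 3) T} (hE : E.IsComplex) (hE' : Θ E') (α : Hom E E')
    (β : Hom E' E) (s : ∀ k, E.obj (k + 1) ⟶ E.obj k)
    (hs : ∀ k, k ≤ m + 2 → IsIso (α.app (k + 1) ≫ β.app (k + 1) +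
      (E.d (k + 1) (k + 2) ≫ s (k + 1) + s k ≫ E.d k (k + 1)))) : Θ E := by
  have := h.additive
  let a : ∀ k, shiftObj E k ⟶ E.obj k := fun k => match k with
    | 0 => 0
    | k + 1 => s (k + 1)
  have ha : ∀ k, toShiftObj E k ≫ a k = s k := fun k => match k with
    | 0 => (E.isZero 0 (Or.inl rfl)).eq_of_tgt _ _
    | k + 1 => Category.id_comp _
  let i := sumLift α (toDisks (hZ := shiftObj_isZero E) hE (toShiftObj E))
  let p := sumDesc β (fromDisks (hZ := shiftObj_isZero E) hE a)
  refine h.of_retract (h.sum_closed hE' (h.disks_mem (shiftObj_isZero E)))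
    (isRetract_of_isIso i p (Hom.id E) (Hom.comp_isIso (Hom.isIso_of_range _ ?_) (Hom.id_isIso E)))
  rintro (_ | k) h₁ h₂
  · omega
  · have e : (i.comp p).app (k + 1) = α.app (k + 1) ≫ β.app (k + 1) +
        (E.d (k + 1) (k + 2) ≫ s (k + 1) + s k ≫ E.d k (k + 1)) := by
      change biprod.lift (α.app (k + 1))
          (biprod.lift (E.d (k + 1) (k + 2) ≫ toShiftObj E (k + 1)) (toShiftObj E k)) ≫
        biprod.desc (β.app (k + 1)) (biprod.desc (a (k + 1)) (a k ≫ E.d k (k + 1))) = _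
      rw [biprod.lift_desc, biprod.lift_desc, Category.assoc, ha, ← Category.assoc, ha]
    rw [e]
    exact hs k (by omega)

end IsThickBase

end Summands

/-! ### Homotopies -/

section Homotopy

variable {D : Type u} [Category.{v} D] [Preadditive D] {m : ℕ} {T : D ⥤ D}

namespace NSeq

/-- Homotopy of morphisms of sequences, by means of morphisms `W (k + 1) ⟶ V k` which vanish for
`k ≤ 2`. -/
def Hom.Htpy {W V : NSeq (m + 3) T} (φ ψ : Hom W V) : Prop :=
  ∃ s : ∀ k, W.obj (k + 1) ⟶ V.obj k, (∀ k, k ≤ 2 → s k = 0) ∧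
    ∀ k, φ.app (k + 1) - ψ.app (k + 1) = W.d (k + 1) (k + 2) ≫ s (k + 1) + s k ≫ V.d k (k + 1)

lemma Hom.Htpy.symm {W V : NSeq (m + 3) T} {φ ψ : Hom W V} (h : φ.Htpy ψ) : ψ.Htpy φ := by
  obtain ⟨s, h₀, hs⟩ := h
  refine ⟨fun k => -s k, fun k hk => by simp [h₀ k hk], fun k => ?_⟩
  rw [← neg_sub, hs k, Preadditive.comp_neg, Preadditive.neg_comp, neg_add]

lemma Hom.Htpy.trans {W V : NSeq (m + 3) T} {φ ψ χ : Hom W V} (h : φ.Htpy ψ) (h' : ψ.Htpy χ) :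
    φ.Htpy χ := by
  obtain ⟨s, h₀, hs⟩ := h
  obtain ⟨s', h₀', hs'⟩ := h'
  refine ⟨fun k => s k + s' k, fun k hk => by simp [h₀ k hk, h₀' k hk], fun k => ?_⟩
  rw [← sub_add_sub_cancel _ (ψ.app (k + 1)), hs, hs', Preadditive.comp_add, Preadditive.add_comp]
  abel

lemma Hom.Htpy.comp_right {W V U : NSeq (m + 3) T} {φ ψ : Hom W V} (h : φ.Htpy ψ) (χ : Hom V U) :
    (φ.comp χ).Htpy (ψ.comp χ) := by
  obtain ⟨s, h₀, hs⟩ := h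
  refine ⟨fun k => s k ≫ χ.app k, fun k hk => by simp [h₀ k hk], fun k => ?_⟩
  rw [Hom.comp_app, Hom.comp_app, ← Preadditive.sub_comp, hs, Preadditive.add_comp,
    Category.assoc, Category.assoc, Category.assoc, χ.comm]

lemma Hom.Htpy.comp_left {W V U : NSeq (m + 3) T} {φ ψ : Hom W V} (h : φ.Htpy ψ) (χ : Hom U W) :
    (χ.comp φ).Htpy (χ.comp ψ) := by
  obtain ⟨s, h₀, hs⟩ := h
  refine ⟨fun k => χ.app (k + 1) ≫ s k, fun k hk => by simp [h₀ k hk], fun k => ?_⟩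
  rw [Hom.comp_app, Hom.comp_app, ← Preadditive.comp_sub, hs, Preadditive.comp_add,
    ← Category.assoc, ← χ.comm, Category.assoc, Category.assoc]

/-- A morphism from a weakly exact sequence to a complex whose first two components vanish is
null-homotopic up to an error in its last component. -/
lemma Hom.exists_homotopy {W V : NSeq (m + 3) T} (hW : W.IsWeakExact) (hV : V.IsComplex)
    (δ : ∀ k, W.obj k ⟶ V.obj k)
    (hδ : ∀ k, W.d k (k + 1) ≫ δ (k + 1) = δ k ≫ V.d k (k + 1)) (h₁ : δ 1 = 0) (h₂ : δ 2 = 0) :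
    ∃ s : ∀ k, W.obj (k + 1) ⟶ V.obj k, (∀ k, k ≤ 2 → s k = 0) ∧
      (∀ k, k < m + 2 → δ (k + 1) = W.d (k + 1) (k + 2) ≫ s (k + 1) + s k ≫ V.d k (k + 1)) ∧
      W.d (m + 2) (m + 3) ≫ (δ (m + 3) - s (m + 2) ≫ V.d (m + 2) (m + 3)) = 0 := by
  have next : ∀ (s : ∀ k, W.obj (k + 1) ⟶ V.obj k) (K : ℕ),
      (∀ k, k < K + 1 → δ (k + 1) = W.d (k + 1) (k + 2) ≫ s (k + 1) + s k ≫ V.d k (k + 1)) →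
      W.d (K + 1) (K + 2) ≫ (δ (K + 2) - s (K + 1) ≫ V.d (K + 1) (K + 2)) = 0 := by
    intro s K hs
    rw [Preadditive.comp_sub, hδ, hs K (by omega), Preadditive.add_comp, Category.assoc,
      Category.assoc, hV.d_comp, comp_zero, add_zero, sub_self]
  have key : ∀ K, K ≤ m → ∃ s : ∀ k, W.obj (k + 1) ⟶ V.obj k, (∀ k, k ≤ 2 → s k = 0) ∧
      (∀ k, k < K + 2 → δ (k + 1) = W.d (k + 1) (k + 2) ≫ s (k + 1) + s k ≫ V.d k (k + 1)) := by
    intro K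
    induction K with
    | zero =>
      refine fun _ => ⟨fun _ => 0, fun _ _ => rfl, ?_⟩
      rintro (_ | _ | k) hk
      · simp [h₁]
      · simp [h₂]
      · omega
    | succ K ih =>
      intro hK
      obtain ⟨s, hs₀, hs⟩ := ih (by omega)
      obtain ⟨t, ht⟩ := (hW.weakCokernel (K + 2) (by omega) (by omega)).2 _ (next s (K + 1) hs)
      refine ⟨Function.update s (K + 3) t, fun k hk => ?_, fun k hk => ?_⟩
      · rw [Function.update_of_ne (by omega)]
        exact hs₀ k hk
      · by_cases hk' : k = K + 2
        · subst hk'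
          rw [Function.update_self, Function.update_of_ne (by omega)]
          change δ (K + 3) = W.d (K + 3) (K + 4) ≫ t + s (K + 2) ≫ V.d (K + 2) (K + 3)
          rw [ht, sub_add_cancel]
        · rw [Function.update_of_ne (by omega), Function.update_of_ne (by omega)]
          exact hs k (by omega)
  obtain ⟨s, h₀, hs⟩ := key m le_rfl
  exact ⟨s, h₀, hs, next s (m + 1) hs⟩

/-- A morphism `p` which is inverse to `i` on one side in the positions `1` and `2` can be changed
in the last position so as to become inverse to `i` on this side up to homotopy. -/
lemma Hom.exists_htpy_id {W P : NSeq (m + 3) T} (hW : W.IsWeakExact) (i : Hom W P) (p : Hom P W)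
    (h₁ : i.app 1 ≫ p.app 1 = 𝟙 _) (h₂ : i.app 2 ≫ p.app 2 = 𝟙 _) :
    ∃ p' : Hom P W, p'.app 1 = p.app 1 ∧ p'.app 2 = p.app 2 ∧
      (i.comp p').Htpy (Hom.id W) := by
  obtain ⟨s, h₀, hs, hρ⟩ := Hom.exists_homotopy hW hW.isComplex
    (fun k => i.app k ≫ p.app k - 𝟙 _)
    (fun k => by
      rw [Preadditive.comp_sub, ← Category.assoc, i.comm, Category.assoc, p.comm,
        Preadditive.sub_comp, Category.assoc, Category.comp_id, Category.id_comp])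
    (sub_eq_zero.2 h₁) (sub_eq_zero.2 h₂)
  let ρ : W.obj (m + 3) ⟶ W.obj (m + 3) :=
    (i.app (m + 3) ≫ p.app (m + 3) - 𝟙 _) - s (m + 2) ≫ W.d (m + 2) (m + 3)
  have hip : i.app (m + 3) ≫ p.app (m + 3) = 𝟙 _ + s (m + 2) ≫ W.d (m + 2) (m + 3) + ρ := by
    simp only [ρ]
    abel
  obtain ⟨t, ht⟩ := hW.weakCokernel_conn.2 ρ hρ
  have hρc : ρ ≫ W.conn = 0 := by
    have : i.app (m + 3) ≫ p.app (m + 3) ≫ W.conn = W.conn := by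
      rw [← p.comm_conn, ← Category.assoc, ← i.comm_conn, Category.assoc, ← T.map_comp, h₁,
        T.map_id, Category.comp_id]
    simp only [ρ, Preadditive.sub_comp, Category.assoc, this, hW.weakCokernel_conn.1,
      Category.id_comp, comp_zero, sub_self]
  have hρρ : ρ ≫ ρ = 0 := by
    nth_rewrite 2 [← ht]
    rw [← Category.assoc, hρc, zero_comp]
  let app := Function.update p.app (m + 3) (p.app (m + 3) ≫ (𝟙 _ - ρ))
  have happ : ∀ k, k ≠ m + 3 → app k = p.app k := fun k hk => Function.update_of_ne hk _ _
  have happ' : app (m + 3) = p.app (m + 3) ≫ (𝟙 _ - ρ) := Function.update_self _ _ _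
  refine ⟨Hom.mk' app (fun k hk hk' => ?_) ?_, happ 1 (by omega), happ 2 (by omega), s, h₀,
    fun k => ?_⟩
  · rw [happ k (by omega)]
    by_cases hk'' : k = m + 2
    · subst hk''
      rw [happ', ← Category.assoc, p.comm, Category.assoc, Preadditive.comp_sub, hρ,
        Category.comp_id, sub_zero]
    · rw [happ (k + 1) (by omega), p.comm]
  · rw [happ 1 (by omega), happ', p.comm_conn, Category.assoc, Preadditive.sub_comp, hρc,
      Category.id_comp, sub_zero]
  · change i.app (k + 1) ≫ app (k + 1) - 𝟙 _ = _
    by_cases hk : k = m + 2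
    · subst hk
      have hz : s (m + 2 + 1) = 0 := (W.isZero (m + 2 + 1 + 1) (by omega)).eq_of_src _ _
      have e : i.app (m + 3) ≫ app (m + 3) - 𝟙 _ = s (m + 2) ≫ W.d (m + 2) (m + 3) := by
        rw [happ', ← Category.assoc, hip, Preadditive.comp_sub, Category.comp_id,
          Preadditive.add_comp, Preadditive.add_comp, Category.assoc, hρ, hρρ, Category.id_comp,
          comp_zero]
        abel
      rw [hz, comp_zero, zero_add]
      exact e
    · rw [happ (k + 1) (by omega)]
      by_cases hk' : k < m + 2
      · exact hs k hk'
      · exact (W.isZero (k + 1) (by omega)).eq_of_src _ _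

/-- Two weakly exact sequences with the same first morphism are homotopy equivalent, once there are
morphisms in both directions between them. -/
lemma Hom.exists_homotopyEquiv {W P : NSeq (m + 3) T} (hW : W.IsWeakExact) (hP : P.IsWeakExact)
    (i : Hom W P) (p : Hom P W)
    (h₁ : i.app 1 ≫ p.app 1 = 𝟙 _) (h₂ : i.app 2 ≫ p.app 2 = 𝟙 _)
    (h₁' : p.app 1 ≫ i.app 1 = 𝟙 _) (h₂' : p.app 2 ≫ i.app 2 = 𝟙 _) :
    ∃ p' : Hom P W, p'.app 1 = p.app 1 ∧ p'.app 2 = p.app 2 ∧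
      (i.comp p').Htpy (Hom.id W) ∧ (p'.comp i).Htpy (Hom.id P) := by
  obtain ⟨p', e₁, e₂, h⟩ := Hom.exists_htpy_id hW i p h₁ h₂
  obtain ⟨i', e₁', e₂', h'⟩ := Hom.exists_htpy_id hP p' i (by rw [e₁, h₁']) (by rw [e₂, h₂'])
  have k₁ : (i.comp (p'.comp i')).Htpy (i.comp (Hom.id P)) := h'.comp_left i
  have k₂ : ((i.comp p').comp i').Htpy ((Hom.id W).comp i') := h.comp_right i'
  have a₁ : (i.comp p').comp i' = i.comp (p'.comp i') := by
    simp [Hom.comp]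
  have a₂ : i.comp (Hom.id P) = i := by
    simp [Hom.comp, Hom.id]
  have a₃ : (Hom.id W).comp i' = i' := by
    simp [Hom.comp, Hom.id]
  rw [a₂] at k₁
  rw [a₁, a₃] at k₂
  exact ⟨p', e₁, e₂, h, ((k₁.symm.trans k₂).comp_left p').trans h'⟩

end NSeq

end Homotopy

/-! ### Mapping cones of morphisms of angles -/

section Cones

variable {D : Type u} [Category.{v} D] [Preadditive D] [HasZeroObject D] [HasBinaryBiproducts D]
  {m : ℕ} {T : D ⥤ D}

namespace NSeq

section

variable {Y Y' : D} {P Q P' Q' : NSeq (m + 3) T}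

/-- Components of `coneHom`. -/
noncomputable def coneHomApp (y : Y ⟶ Y') (u : ∀ i, P.obj i ⟶ P'.obj i)
    (x : ∀ i, P.obj (i + 1) ⟶ Q'.obj i) (w : ∀ i, Q.obj i ⟶ Q'.obj i) :
    ∀ i, coneObj Y P Q i ⟶ coneObj Y' P' Q' i
  | 0 => 0
  | 1 => y
  | k + 2 => biprod.desc (biprod.lift (u (k + 3)) (x (k + 2))) (biprod.lift 0 (w (k + 2)))

/-- The morphism of cones with components the triangular matrices `[u, 0; x, w]`. -/
noncomputable def coneHom {φ : ∀ i, P.obj i ⟶ Q.obj i} {first : Y ⟶ P.obj 3 ⊞ Q.obj 2}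
    {last : Q.obj (m + 3) ⟶ T.obj Y} {φ' : ∀ i, P'.obj i ⟶ Q'.obj i}
    {first' : Y' ⟶ P'.obj 3 ⊞ Q'.obj 2} {last' : Q'.obj (m + 3) ⟶ T.obj Y'}
    (y : Y ⟶ Y') (u : ∀ i, P.obj i ⟶ P'.obj i)
    (x : ∀ i, P.obj (i + 1) ⟶ Q'.obj i) (w : ∀ i, Q.obj i ⟶ Q'.obj i)
    (h₁ : first ≫ biprod.desc (biprod.lift (u 3) (x 2)) (biprod.lift 0 (w 2)) = y ≫ first')
    (hu : ∀ k, P.d (k + 3) (k + 4) ≫ u (k + 4) = u (k + 3) ≫ P'.d (k + 3) (k + 4))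
    (hw : ∀ k, Q.d (k + 2) (k + 3) ≫ w (k + 3) = w (k + 2) ≫ Q'.d (k + 2) (k + 3))
    (hx : ∀ k, P.d (k + 3) (k + 4) ≫ x (k + 3) + x (k + 2) ≫ Q'.d (k + 2) (k + 3) =
      φ (k + 3) ≫ w (k + 3) - u (k + 3) ≫ φ' (k + 3))
    (hc : last ≫ T.map y = w (m + 3) ≫ last') :
    Hom (cone φ first last) (cone φ' first' last') :=
  Hom.mk' (coneHomApp y u x w)
    (by
      rintro (_ | _ | k) hk hk'
      · omega
      · rw [cone_d_one, cone_d_one]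
        exact h₁
      · rw [cone_d, cone_d]
        change biprod.desc (biprod.lift (-P.d (k + 3) (k + 4)) (φ (k + 3)))
            (biprod.lift 0 (Q.d (k + 2) (k + 3))) ≫
            biprod.desc (biprod.lift (u (k + 4)) (x (k + 3))) (biprod.lift 0 (w (k + 3))) =
          biprod.desc (biprod.lift (u (k + 3)) (x (k + 2))) (biprod.lift 0 (w (k + 2))) ≫
            biprod.desc (biprod.lift (-P'.d (k + 3) (k + 4)) (φ' (k + 3)))
            (biprod.lift 0 (Q'.d (k + 2) (k + 3)))
        apply biprod.hom_ext'
        · rw [biprod.inl_desc_assoc, biprod.inl_desc_assoc, biprod.lift_desc, biprod.lift_desc]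
          apply biprod.hom_ext
          · simp [hu]
          · have e : φ (k + 3) ≫ w (k + 3) = P.d (k + 3) (k + 4) ≫ x (k + 3) +
              x (k + 2) ≫ Q'.d (k + 2) (k + 3) + u (k + 3) ≫ φ' (k + 3) := by
              rw [hx, sub_add_cancel]
            simp only [Preadditive.add_comp, Category.assoc, biprod.lift_snd, e,
              Preadditive.neg_comp]
            abel
        · rw [biprod.inr_desc_assoc, biprod.inr_desc_assoc, biprod.lift_desc, biprod.lift_desc]
          apply biprod.hom_ext
          · simp
          · simp [hw])
    (by
      change ((biprod.snd : P.obj (m + 4) ⊞ Q.obj (m + 3) ⟶ _) ≫ last) ≫ T.map y =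
        biprod.desc (biprod.lift (u (m + 4)) (x (m + 3))) (biprod.lift 0 (w (m + 3))) ≫
          (biprod.snd : P'.obj (m + 4) ⊞ Q'.obj (m + 3) ⟶ _) ≫ last'
      apply biprod.hom_ext'
      · exact (P.isZero (m + 4) (by omega)).eq_of_src _ _
      · simp [hc])

end

lemma redCone_isComplex [T.Additive] {P Q : NSeq (m + 3) T} (hP : P.IsComplex) (hQ : Q.IsComplex)
    (a : P.obj 1 ≅ Q.obj 1) (φ : Hom P Q) (hφ : φ.app 1 = a.hom) : (redCone a φ).IsComplex where
  d_comp i := by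
    rcases i with _ | _ | k
    · exact ((redCone a φ).isZero 0 (Or.inl rfl)).eq_of_src _ _
    · rw [redCone, cone_d_one, cone_d]
      change biprod.lift (-P.d 2 3) (φ.app 2) ≫ biprod.desc (biprod.lift (-P.d 3 4) (φ.app 3))
        (biprod.lift 0 (Q.d 2 3)) = 0
      rw [biprod.lift_desc]
      apply biprod.hom_ext
      · simp [hP.d_comp 2]
      · simp [φ.comm]
    · rw [redCone, cone_d, cone_d]
      change biprod.desc (biprod.lift (-P.d (k + 3) (k + 4)) (φ.app (k + 3)))
          (biprod.lift 0 (Q.d (k + 2) (k + 3))) ≫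
        biprod.desc (biprod.lift (-P.d (k + 4) (k + 5)) (φ.app (k + 4)))
          (biprod.lift 0 (Q.d (k + 3) (k + 4))) = 0
      apply biprod.hom_ext'
      · rw [biprod.inl_desc_assoc, biprod.lift_desc]
        apply biprod.hom_ext
        · simp [hP.d_comp (k + 3)]
        · simp [φ.comm]
      · rw [biprod.inr_desc_assoc, biprod.lift_desc]
        apply biprod.hom_ext
        · simp
        · simp [hQ.d_comp (k + 2)]
  d_conn := by
    rw [redCone, cone_d, cone_conn]
    change biprod.desc (biprod.lift (-P.d (m + 3) (m + 4)) (φ.app (m + 3)))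
        (biprod.lift 0 (Q.d (m + 2) (m + 3))) ≫
      (biprod.snd : P.obj (m + 4) ⊞ Q.obj (m + 3) ⟶ _) ≫ Q.conn ≫ T.map (a.inv ≫ P.d 1 2) = 0
    apply biprod.hom_ext'
    · rw [biprod.inl_desc_assoc, biprod.lift_snd_assoc, ← Category.assoc, ← φ.comm_conn, hφ,
        Category.assoc, ← T.map_comp, Iso.hom_inv_id_assoc, hP.conn_d, comp_zero]
    · rw [biprod.inr_desc_assoc, biprod.lift_snd_assoc, ← Category.assoc, hQ.d_conn, zero_comp,
        comp_zero]
  conn_d := by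
    rw [redCone, cone_d_one, cone_conn]
    have h : P.d 1 2 ≫ biprod.lift (-P.d 2 3) (φ.app 2) = (a.hom ≫ Q.d 1 2) ≫ biprod.inr := by
      apply biprod.hom_ext
      · simp [hP.d_comp 1]
      · simp [φ.comm, hφ]
    change ((biprod.snd : P.obj (m + 4) ⊞ Q.obj (m + 3) ⟶ _) ≫ Q.conn ≫
      T.map (a.inv ≫ P.d 1 2)) ≫ T.map (biprod.lift (-P.d 2 3) (φ.app 2)) = 0
    rw [Category.assoc, Category.assoc, ← T.map_comp, Category.assoc, h, Category.assoc,
      Iso.inv_hom_id_assoc, T.map_comp, ← Category.assoc Q.conn, hQ.conn_d, zero_comp, comp_zero]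

end NSeq

open NSeq

namespace IsThickBase

variable {Θ : NSeq (m + 3) T → Prop} (h : IsThickBase m T Θ)

include h

/-- Angles with isomorphic first morphisms are homotopy equivalent. -/
lemma exists_homotopyEquiv {W P : NSeq (m + 3) T} (hW : Θ W) (hP : Θ P)
    (e₁ : W.obj 1 ≅ P.obj 1) (e₂ : W.obj 2 ≅ P.obj 2) (he : W.d 1 2 ≫ e₂.hom = e₁.hom ≫ P.d 1 2) :
    ∃ (i : Hom W P) (p : Hom P W), i.app 1 = e₁.hom ∧ i.app 2 = e₂.hom ∧ p.app 1 = e₁.inv ∧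
      p.app 2 = e₂.inv ∧ (i.comp p).Htpy (Hom.id W) ∧ (p.comp i).Htpy (Hom.id P) := by
  obtain ⟨i, h₁, h₂⟩ := h.complete hW hP e₁.hom e₂.hom he
  obtain ⟨p, h₁', h₂'⟩ := h.complete hP hW e₁.inv e₂.inv (by
    rw [Iso.eq_inv_comp, ← Category.assoc, ← he, Category.assoc, Iso.hom_inv_id,
      Category.comp_id])
  obtain ⟨p', k₁, k₂, k₃, k₄⟩ := Hom.exists_homotopyEquiv (h.isWeakExact hW) (h.isWeakExact hP) i p
    (by simp [h₁, h₁']) (by simp [h₂, h₂']) (by simp [h₁, h₁']) (by simp [h₂, h₂'])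
  exact ⟨i, p', h₁, h₂, k₁.trans h₁', k₂.trans h₂', k₃, k₄⟩

/-- A commutative square between first morphisms of angles with an isomorphism as its first
component extends to a morphism of angles with mapping cone an angle. -/
lemma exists_redCone {W V : NSeq (m + 3) T} (hW : Θ W) (hV : Θ V) (a : W.obj 1 ≅ V.obj 1)
    (l : W.obj 2 ⟶ V.obj 2) (hl : W.d 1 2 ≫ l = a.hom ≫ V.d 1 2) :
    ∃ φ : Hom W V, φ.app 1 = a.hom ∧ φ.app 2 = l ∧ Θ (redCone a φ) := by
  have := h.additive
  obtain ⟨P, Q, hP, hQ, e₁, e₂, a₀, e₃, φ₀, k₁, k₂, k₃, hE⟩ := h.exists_cone (W.d 1 2) l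
  obtain ⟨i, p, hi₁, hi₂, hp₁, hp₂, ⟨s, hs₀, hs⟩, ⟨r, hr₀, hr⟩⟩ := h.exists_homotopyEquiv hW hP
    e₁.symm e₂.symm (by
      change W.d 1 2 ≫ e₂.inv = e₁.inv ≫ P.d 1 2
      rw [Iso.eq_inv_comp, ← Category.assoc, ← k₁, Category.assoc, Iso.hom_inv_id,
        Category.comp_id])
  have hQd : Q.d 1 2 ≫ e₃.hom = (a₀.inv ≫ e₁.hom ≫ a.hom) ≫ V.d 1 2 := by
    rw [Category.assoc, Category.assoc, ← hl, Iso.eq_inv_comp, ← k₂, ← Category.assoc, ← φ₀.comm,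
      Category.assoc, k₃, ← Category.assoc, k₁, Category.assoc]
  obtain ⟨i', p', hi₁', hi₂', hp₁', hp₂', ⟨s', hs₀', hs'⟩, ⟨r', hr₀', hr'⟩⟩ :=
    h.exists_homotopyEquiv hV hQ (a.symm ≪≫ e₁.symm ≪≫ a₀) e₃.symm (by
      change V.d 1 2 ≫ e₃.inv = (a.inv ≫ e₁.inv ≫ a₀.hom) ≫ Q.d 1 2
      rw [Iso.comp_inv_eq, Category.assoc, hQd]
      simp)
  simp only [Iso.symm_hom, Iso.symm_inv, Iso.trans_hom, Iso.trans_inv,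
    Category.assoc] at hi₁ hi₂ hp₁ hp₂ hi₁' hi₂' hp₁' hp₂'
  simp only [Hom.comp_app, Hom.id_app] at hs hr hs' hr'
  let φ := (i.comp φ₀).comp p'
  have hφ : ∀ k, φ.app k = i.app k ≫ φ₀.app k ≫ p'.app k := fun k => Category.assoc _ _ _
  have hφ₁ : φ.app 1 = a.hom := by simp [hφ, hi₁, k₂, hp₁']
  have hφ₂ : φ.app 2 = l := by simp [hφ, hi₂, hp₂', k₃]
  refine ⟨φ, hφ₁, hφ₂, ?_⟩
  let α : Hom (redCone a φ) (redCone a₀ φ₀) := coneHom (i.app 2) i.app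
    (fun k => i.app (k + 1) ≫ φ₀.app (k + 1) ≫ r' k) i'.app
    (by
      rw [biprod.lift_desc, hr₀' 2 le_rfl]
      apply biprod.hom_ext
      · simp [i.comm]
      · simp [hφ, hi₂', hp₂'])
    (fun k => i.comm _ _) (fun k => i'.comm _ _)
    (fun k => by
      have := hr' (k + 2)
      rw [sub_eq_iff_eq_add] at this
      simp only [hφ, Category.assoc, this, Preadditive.comp_add, Category.comp_id]
      rw [← Category.assoc, i.comm, Category.assoc, ← Category.assoc (P.d _ _), φ₀.comm]
      simp only [Category.assoc]
      abel)
    (by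
      rw [Category.assoc, ← T.map_comp, ← Category.assoc (i'.app _), ← i'.comm_conn,
        Category.assoc V.conn, ← T.map_comp, hi₁']
      simp only [Category.assoc, Iso.hom_inv_id_assoc, i.comm, hi₁])
  let β : Hom (redCone a₀ φ₀) (redCone a φ) := coneHom (p.app 2) p.app
    (fun k => -(r k ≫ φ₀.app k ≫ p'.app k)) p'.app
    (by
      rw [biprod.lift_desc, hr₀ 2 le_rfl]
      apply biprod.hom_ext
      · simp [p.comm]
      · simp [hφ, reassoc_of% hp₂, reassoc_of% hi₂])
    (fun k => p.comm _ _) (fun k => p'.comm _ _)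
    (fun k => by
      have := hr (k + 2)
      rw [sub_eq_iff_eq_add] at this
      have e : p.app (k + 3) ≫ φ.app (k + 3) = P.d (k + 3) (k + 4) ≫ r (k + 3) ≫
          φ₀.app (k + 3) ≫ p'.app (k + 3) + r (k + 2) ≫ P.d (k + 2) (k + 3) ≫ φ₀.app (k + 3) ≫
          p'.app (k + 3) + φ₀.app (k + 3) ≫ p'.app (k + 3) := by
        rw [hφ, ← Category.assoc, this]
        simp only [Preadditive.add_comp, Category.assoc, Category.id_comp]
      rw [e, Preadditive.comp_neg, Preadditive.neg_comp, Category.assoc, Category.assoc, ← p'.comm,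
        ← Category.assoc (φ₀.app (k + 2)), ← φ₀.comm, Category.assoc]
      abel)
    (by
      rw [Category.assoc, ← T.map_comp, ← Category.assoc (p'.app _), ← p'.comm_conn,
        Category.assoc Q.conn, ← T.map_comp, hp₁']
      simp only [Category.assoc, Iso.hom_inv_id_assoc, p.comm, hp₁])
  let σ : ∀ k, (redCone a φ).obj (k + 1) ⟶ (redCone a φ).obj k := fun k => match k with
    | 0 => 0
    | 1 => 0
    | k + 2 => biprod.map (s (k + 3)) (-s' (k + 2))
  refine h.mem_of_homotopy (redCone_isComplex (h.isWeakExact hW).isComplex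
    (h.isWeakExact hV).isComplex a φ hφ₁) hE α β σ ?_
  have tri : ∀ {M N : D} (t : M ⊞ N ⟶ M ⊞ N), biprod.inl ≫ t ≫ biprod.fst = 𝟙 _ →
      biprod.inr ≫ t ≫ biprod.fst = 0 → biprod.inr ≫ t ≫ biprod.snd = 𝟙 _ → IsIso t := by
    intro M N t h₁ h₂ h₃
    have ht : t = biprod.desc (biprod.lift (𝟙 _) (biprod.inl ≫ t ≫ biprod.snd)) biprod.inr := by
      apply biprod.hom_ext' <;> apply biprod.hom_ext <;> simp [h₁, h₂, h₃]
    refine ⟨biprod.desc (biprod.lift (𝟙 _) (-(biprod.inl ≫ t ≫ biprod.snd))) biprod.inr, ?_, ?_⟩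
    · rw [ht]
      apply biprod.hom_ext' <;> apply biprod.hom_ext <;> simp
    · rw [ht]
      apply biprod.hom_ext' <;> apply biprod.hom_ext <;> simp
  have hd : ∀ k, (redCone a φ).d (k + 2) (k + 3) =
      biprod.desc (biprod.lift (-W.d (k + 3) (k + 4)) (φ.app (k + 3)))
        (biprod.lift 0 (V.d (k + 2) (k + 3))) := fun k => cone_d _ _ _ _
  rintro (_ | k) hk
  · have e₀ : σ 0 = 0 := rfl
    have e₁ : σ 1 = 0 := rfl
    have e : α.app 1 ≫ β.app 1 + ((redCone a φ).d 1 2 ≫ σ 1 + σ 0 ≫ (redCone a φ).d 0 1) =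
        𝟙 _ := by
      rw [e₀, e₁, comp_zero, zero_comp, add_zero, add_zero]
      change i.app 2 ≫ p.app 2 = 𝟙 _
      rw [hi₂, hp₂, Iso.inv_hom_id]
    change IsIso (α.app 1 ≫ β.app 1 + ((redCone a φ).d 1 2 ≫ σ 1 + σ 0 ≫ (redCone a φ).d 0 1))
    rw [e]
    infer_instance
  · have e : σ (k + 1) ≫ (redCone a φ).d (k + 1) (k + 2) =
        biprod.desc (biprod.lift (-(s (k + 2) ≫ W.d (k + 2) (k + 3))) (s (k + 2) ≫ φ.app (k + 2)))
          (biprod.lift 0 (-(s' (k + 1) ≫ V.d (k + 1) (k + 2)))) := by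
      rcases k with _ | k
      · have e₁ : σ 1 = 0 := rfl
        have e₂ : s (0 + 2) = 0 := hs₀ _ le_rfl
        have e₃ : s' (0 + 1) = 0 := hs₀' _ (by omega)
        have e₄ : (0 : W.obj 3 ⊞ V.obj 2 ⟶ W.obj 3 ⊞ V.obj 2) =
            biprod.desc (biprod.lift (-(s (0 + 2) ≫ W.d (0 + 2) (0 + 3)))
              (s (0 + 2) ≫ φ.app (0 + 2)))
              (biprod.lift 0 (-(s' (0 + 1) ≫ V.d (0 + 1) (0 + 2)))) := by
          rw [e₂, e₃]
          apply biprod.hom_ext' <;> apply biprod.hom_ext <;> simp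
        exact (congrArg (fun t => t ≫ (redCone a φ).d 1 2) e₁).trans (zero_comp.trans e₄)
      · rw [hd]
        change biprod.map (s (k + 3)) (-s' (k + 2)) ≫
          biprod.desc (biprod.lift (-W.d (k + 3) (k + 4)) (φ.app (k + 3)))
            (biprod.lift 0 (V.d (k + 2) (k + 3))) = _
        apply biprod.hom_ext' <;> apply biprod.hom_ext <;> simp
    rw [e, hd]
    change IsIso (biprod.desc (biprod.lift (i.app (k + 3)) (i.app (k + 3) ≫ φ₀.app (k + 3) ≫
        r' (k + 2))) (biprod.lift 0 (i'.app (k + 2))) ≫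
      biprod.desc (biprod.lift (p.app (k + 3)) (-(r (k + 2) ≫ φ₀.app (k + 2) ≫ p'.app (k + 2))))
        (biprod.lift 0 (p'.app (k + 2))) +
      (biprod.desc (biprod.lift (-W.d (k + 3) (k + 4)) (φ.app (k + 3)))
        (biprod.lift 0 (V.d (k + 2) (k + 3))) ≫ biprod.map (s (k + 3)) (-s' (k + 2)) +
      biprod.desc (biprod.lift (-(s (k + 2) ≫ W.d (k + 2) (k + 3))) (s (k + 2) ≫ φ.app (k + 2)))
        (biprod.lift 0 (-(s' (k + 1) ≫ V.d (k + 1) (k + 2))))))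
    have e₁ := sub_eq_iff_eq_add.1 (hs (k + 2))
    have e₂ := sub_eq_iff_eq_add.1 (hs' (k + 1))
    apply tri
    · simp [e₁]
      abel
    · simp
    · simp [e₂]
      abel

end IsThickBase

end Cones

/-! ### The octahedral condition -/

section Octahedral

variable {D : Type u} [Category.{v} D] [Preadditive D] [HasZeroObject D] [HasBinaryBiproducts D]
  {m : ℕ} {T : D ⥤ D}

namespace NSeq

section

variable {P Q R : NSeq (m + 3) T} (a : P.obj 1 ≅ Q.obj 1) (φ : Hom P Q) (b : P.obj 2 ≅ R.obj 1)
  (χ : Hom (redCone a φ) R)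

/-- The components `Q k ⟶ R k` of a morphism from a cone to `R`. -/
noncomputable def thetaOfCone : ∀ k, Q.obj k ⟶ R.obj k
  | 0 => 0
  | 1 => a.inv ≫ P.d 1 2 ≫ b.hom
  | k + 2 => (biprod.inr : _ ⟶ P.obj (k + 3) ⊞ Q.obj (k + 2)) ≫ χ.app (k + 2)

/-- The components `P (k + 1) ⟶ R k` of a morphism from a cone to `R`. -/
noncomputable def xiOfCone : ∀ k, P.obj (k + 1) ⟶ R.obj k
  | 0 => 0
  | 1 => 0
  | k + 2 => (biprod.inl : _ ⟶ P.obj (k + 3) ⊞ Q.obj (k + 2)) ≫ χ.app (k + 2)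

lemma app_eq_desc (k : ℕ) : χ.app (k + 2) =
    (biprod.desc (xiOfCone a φ χ (k + 2)) (thetaOfCone a φ b χ (k + 2)) :
      P.obj (k + 3) ⊞ Q.obj (k + 2) ⟶ _) := by
  apply biprod.hom_ext'
  · exact (biprod.inl_desc _ _).symm
  · exact (biprod.inr_desc _ _).symm

variable {c : Q.obj 2 ≅ R.obj 2}

/-- The morphism from the octahedral sequence to the second reduced cone. -/
noncomputable def octToConeApp : ∀ k, octObj P Q R k ⟶ coneObj (P.obj 3 ⊞ Q.obj 2) (redCone a φ) R k
  | 0 => 0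
  | 1 => biprod.lift (-𝟙 _) 0
  | 2 => biprod.lift (biprod.map (-𝟙 (P.obj 4)) (𝟙 (Q.obj 3))) 0
  | k + 3 => biprod.lift (biprod.lift (((-1 : ℤ) ^ k) • biprod.fst) (biprod.snd ≫ biprod.fst))
      ((biprod.snd : P.obj (k + 5) ⊞ (Q.obj (k + 4) ⊞ R.obj (k + 3)) ⟶ _) ≫ biprod.snd)

/-- The morphism from the second reduced cone to the octahedral sequence. -/
noncomputable def coneToOctApp (c : Q.obj 2 ≅ R.obj 2) :
    ∀ k, coneObj (P.obj 3 ⊞ Q.obj 2) (redCone a φ) R k ⟶ octObj P Q R k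
  | 0 => 0
  | 1 => biprod.desc (-𝟙 _) 0
  | 2 => biprod.desc (biprod.map (-𝟙 (P.obj 4)) (𝟙 (Q.obj 3)))
      (biprod.lift 0 (c.inv ≫ Q.d 2 3))
  | k + 3 => (biprod.lift (((-1 : ℤ) ^ k) • (biprod.fst ≫ biprod.fst))
      (biprod.lift (biprod.fst ≫ biprod.snd) biprod.snd) :
        (P.obj (k + 5) ⊞ Q.obj (k + 4)) ⊞ R.obj (k + 3) ⟶ _)

end

end NSeq

open NSeq

namespace IsThickBase

variable {Θ : NSeq (m + 3) T → Prop} (h : IsThickBase m T Θ)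

include h

/-- The octahedral sequence is, up to signs, a direct summand of the reduced mapping cone of a
morphism from the reduced mapping cone of `φ : P ⟶ Q` to `R`. -/
lemma octahedral {P Q R : NSeq (m + 3) T} (hP : Θ P) (hQ : Θ Q) (hR : Θ R)
    (a : P.obj 1 ≅ Q.obj 1) (b : P.obj 2 ≅ R.obj 1) (c : Q.obj 2 ≅ R.obj 2)
    (habc : P.d 1 2 ≫ b.hom ≫ R.d 1 2 = a.hom ≫ Q.d 1 2 ≫ c.hom) : HasOct Θ P Q R a b c := by
  have := h.additive
  obtain ⟨φ, hφ₁, hφ₂, hE⟩ := h.exists_redCone hP hQ a (b.hom ≫ R.d 1 2 ≫ c.inv) (by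
    rw [← Category.assoc b.hom, ← Category.assoc, habc]
    simp)
  have hd₁ : (redCone a φ).d 1 2 = biprod.lift (-P.d 2 3) (φ.app 2) := cone_d_one _ _ _
  have hd : ∀ k, (redCone a φ).d (k + 2) (k + 3) =
      biprod.desc (biprod.lift (-P.d (k + 3) (k + 4)) (φ.app (k + 3)))
        (biprod.lift 0 (Q.d (k + 2) (k + 3))) := fun k => cone_d _ _ _ _
  let b' : (redCone a φ).obj 1 ≅ R.obj 1 := b
  obtain ⟨χ, hχ₁, hχ₂, hE'⟩ := h.exists_redCone hE hR b'
    ((biprod.snd : P.obj 3 ⊞ Q.obj 2 ⟶ _) ≫ c.hom) (by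
      rw [hd₁]
      change biprod.lift (-P.d 2 3) (φ.app 2) ≫ (biprod.snd : P.obj 3 ⊞ Q.obj 2 ⟶ _) ≫ c.hom =
        b.hom ≫ R.d 1 2
      simp [hφ₂])
  let ξ := xiOfCone a φ χ
  let θ := thetaOfCone a φ b χ
  have hχ : ∀ k, χ.app (k + 2) = (biprod.desc (ξ (k + 2)) (θ (k + 2)) :
      P.obj (k + 3) ⊞ Q.obj (k + 2) ⟶ _) := app_eq_desc a φ b χ
  have hθ₂ : θ 2 = c.hom := by
    have e : ∀ t : P.obj 3 ⊞ Q.obj 2 ⟶ R.obj 2, t = biprod.snd ≫ c.hom →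
        biprod.inr ≫ t = c.hom := by
      rintro _ rfl
      simp
    exact e _ hχ₂
  have hξ₂ : ξ 2 = 0 := by
    have e : ∀ t : P.obj 3 ⊞ Q.obj 2 ⟶ R.obj 2, t = biprod.snd ≫ c.hom →
        biprod.inl ≫ t = 0 := by
      rintro _ rfl
      simp
    exact e _ hχ₂
  have comm : ∀ k, biprod.desc (biprod.lift (-P.d (k + 3) (k + 4)) (φ.app (k + 3)))
        (biprod.lift 0 (Q.d (k + 2) (k + 3))) ≫ biprod.desc (ξ (k + 3)) (θ (k + 3)) =
      biprod.desc (ξ (k + 2)) (θ (k + 2)) ≫ R.d (k + 2) (k + 3) := fun k => by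
    have := χ.comm (k + 2) (k + 3)
    have hχ' : χ.app (k + 3) = (biprod.desc (ξ (k + 3)) (θ (k + 3)) :
      P.obj (k + 4) ⊞ Q.obj (k + 3) ⟶ _) := hχ (k + 1)
    rw [hχ', hχ k, hd] at this
    exact this
  have hθ : ∀ k, Q.d (k + 2) (k + 3) ≫ θ (k + 3) = θ (k + 2) ≫ R.d (k + 2) (k + 3) := fun k => by
    have := congrArg (fun t => biprod.inr ≫ t) (comm k)
    simpa using this
  let Θ' : Hom Q R := Hom.mk' θ
    (by
      rintro (_ | _ | k) hk hk'
      · omega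
      · change Q.d 1 2 ≫ θ 2 = (a.inv ≫ P.d 1 2 ≫ b.hom) ≫ R.d 1 2
        rw [hθ₂, Category.assoc, Iso.eq_inv_comp, Category.assoc, habc]
      · exact hθ k)
    (by
      have := χ.comm_conn
      rw [hχ₁, hχ (m + 1)] at this
      change ((biprod.snd : P.obj (m + 4) ⊞ Q.obj (m + 3) ⟶ _) ≫ Q.conn ≫
        T.map (a.inv ≫ P.d 1 2)) ≫ T.map b.hom = biprod.desc (ξ (m + 3)) (θ (m + 3)) ≫ R.conn
        at this
      replace this := congrArg (fun t => biprod.inr ≫ t) this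
      simp only [Category.assoc, biprod.inr_snd_assoc, biprod.inr_desc_assoc] at this
      rw [← this, ← T.map_comp]
      change Q.conn ≫ T.map (a.inv ≫ P.d 1 2 ≫ b.hom) = _
      rw [Category.assoc])
  refine ⟨φ, Θ', fun k => ((-1 : ℤ) ^ k) • ξ k, hφ₁, hφ₂, rfl, hθ₂, ?_⟩
  have hO₁ : (oct b φ.app Θ'.app fun k => ((-1 : ℤ) ^ k) • ξ k).d 1 2 =
    biprod.lift (P.d 3 4) (φ.app 3) := ofSucc_d_succ _ _ _ _ _
  have hO₂ : (oct b φ.app Θ'.app fun k => ((-1 : ℤ) ^ k) • ξ k).d 2 3 =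
    biprod.desc (biprod.lift (-P.d 4 5) (biprod.lift (φ.app 4) (((-1 : ℤ) ^ 3) • ξ 3)))
      (biprod.lift 0 (biprod.lift (-Q.d 3 4) (θ 3))) := ofSucc_d_succ _ _ _ _ _
  have hO : ∀ k, (oct b φ.app Θ'.app fun k => ((-1 : ℤ) ^ k) • ξ k).d (k + 3) (k + 4) =
    biprod.desc
      (biprod.lift (-P.d (k + 5) (k + 6))
        (biprod.lift (((-1 : ℤ) ^ (k + 5)) • φ.app (k + 5)) (((-1 : ℤ) ^ (k + 4)) • ξ (k + 4))))
      (biprod.desc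
        (biprod.lift 0 (biprod.lift (-Q.d (k + 4) (k + 5)) (θ (k + 4))))
        (biprod.lift 0 (biprod.lift 0 (R.d (k + 3) (k + 4))))) :=
    fun k => ofSucc_d_succ _ _ _ _ _
  have hF₁ : (redCone b' χ).d 1 2 = biprod.lift
      (-biprod.desc (biprod.lift (-P.d 3 4) (φ.app 3)) (biprod.lift 0 (Q.d 2 3)))
      (biprod.desc (ξ 2) (θ 2)) := by
    refine (cone_d_one _ _ _).trans ?_
    rw [hd, hχ 0]
    rfl
  have hF : ∀ k, (redCone b' χ).d (k + 2) (k + 3) =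
      biprod.desc (biprod.lift (-biprod.desc (biprod.lift (-P.d (k + 4) (k + 5)) (φ.app (k + 4)))
          (biprod.lift 0 (Q.d (k + 3) (k + 4)))) (biprod.desc (ξ (k + 3)) (θ (k + 3))))
        (biprod.lift 0 (R.d (k + 2) (k + 3))) := fun k => by
    refine (cone_d _ _ _ _).trans ?_
    rw [hd (k + 1), hχ (k + 1)]
    rfl
  have hc : ∀ {Z : D} (t : Q.obj 2 ⟶ Z), R.conn ≫ T.map (b.inv ≫ φ.app 2 ≫ t) = 0 := fun t => by
    have : b.inv ≫ φ.app 2 ≫ t = R.d 1 2 ≫ c.inv ≫ t := by simp [hφ₂]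
    rw [this, T.map_comp, ← Category.assoc, (h.isWeakExact hR).conn_d, zero_comp]
  let i : Hom (oct b φ.app Θ'.app fun k => ((-1 : ℤ) ^ k) • ξ k) (redCone b' χ) :=
    Hom.mk' (octToConeApp a φ)
      (by
        rintro (_ | _ | _ | k) hk hk'
        · omega
        · rw [hO₁, hF₁]
          change biprod.lift (P.d 3 4) (φ.app 3) ≫
              biprod.lift (biprod.map (-𝟙 (P.obj 4)) (𝟙 (Q.obj 3))) 0 =
            biprod.lift (-𝟙 _) 0 ≫ biprod.lift
              (-biprod.desc (biprod.lift (-P.d 3 4) (φ.app 3)) (biprod.lift 0 (Q.d 2 3)))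
              (biprod.desc (ξ 2) (θ 2))
          apply biprod.hom_ext
          · apply biprod.hom_ext <;> simp
          · simp [hξ₂]
        · rw [hO₂, hF]
          change biprod.desc (biprod.lift (-P.d 4 5)
                (biprod.lift (φ.app 4) (((-1 : ℤ) ^ 3) • ξ 3)))
              (biprod.lift 0 (biprod.lift (-Q.d 3 4) (θ 3))) ≫
              biprod.lift (biprod.lift (((-1 : ℤ) ^ 0) • biprod.fst) (biprod.snd ≫ biprod.fst))
                ((biprod.snd : P.obj 5 ⊞ (Q.obj 4 ⊞ R.obj 3) ⟶ _) ≫ biprod.snd) =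
            biprod.lift (biprod.map (-𝟙 (P.obj 4)) (𝟙 (Q.obj 3))) 0 ≫
              biprod.desc (biprod.lift (-biprod.desc (biprod.lift (-P.d 4 5) (φ.app 4))
                (biprod.lift 0 (Q.d 3 4))) (biprod.desc (ξ 3) (θ 3)))
                (biprod.lift 0 (R.d 2 3))
          apply biprod.hom_ext' <;> apply biprod.hom_ext <;> try apply biprod.hom_ext
          all_goals simp [pow_succ]
        · rw [hO, hF]
          change biprod.desc
              (biprod.lift (-P.d (k + 5) (k + 6))
                (biprod.lift (((-1 : ℤ) ^ (k + 5)) • φ.app (k + 5))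
                  (((-1 : ℤ) ^ (k + 4)) • ξ (k + 4))))
              (biprod.desc
                (biprod.lift 0 (biprod.lift (-Q.d (k + 4) (k + 5)) (θ (k + 4))))
                (biprod.lift 0 (biprod.lift 0 (R.d (k + 3) (k + 4))))) ≫
              biprod.lift (biprod.lift (((-1 : ℤ) ^ (k + 1)) • biprod.fst)
                (biprod.snd ≫ biprod.fst))
                ((biprod.snd : P.obj (k + 6) ⊞ (Q.obj (k + 5) ⊞ R.obj (k + 4)) ⟶ _) ≫
                  biprod.snd) =
            biprod.lift (biprod.lift (((-1 : ℤ) ^ k) • biprod.fst) (biprod.snd ≫ biprod.fst))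
              ((biprod.snd : P.obj (k + 5) ⊞ (Q.obj (k + 4) ⊞ R.obj (k + 3)) ⟶ _) ≫ biprod.snd) ≫
            biprod.desc (biprod.lift (-biprod.desc (biprod.lift (-P.d (k + 5) (k + 6))
              (φ.app (k + 5))) (biprod.lift 0 (Q.d (k + 4) (k + 5))))
                (biprod.desc (ξ (k + 4)) (θ (k + 4))))
              (biprod.lift 0 (R.d (k + 3) (k + 4)))
          apply biprod.hom_ext' <;> try apply biprod.hom_ext'
          all_goals
            apply biprod.hom_ext <;> try apply biprod.hom_ext
          all_goals simp [pow_succ])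
      (by
        change (((biprod.snd ≫ biprod.snd :
            P.obj (m + 5) ⊞ (Q.obj (m + 4) ⊞ R.obj (m + 3)) ⟶ R.obj (m + 3)) ≫
            R.conn ≫ T.map b.inv ≫ T.map (P.d 2 3))) ≫
            T.map (biprod.lift (-𝟙 _) 0 : _ ⟶ P.obj 3 ⊞ Q.obj 2) =
          biprod.lift (biprod.lift (((-1 : ℤ) ^ m) • biprod.fst) (biprod.snd ≫ biprod.fst))
              ((biprod.snd : P.obj (m + 5) ⊞ (Q.obj (m + 4) ⊞ R.obj (m + 3)) ⟶ _) ≫ biprod.snd) ≫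
            (biprod.snd : (P.obj (m + 5) ⊞ Q.obj (m + 4)) ⊞ R.obj (m + 3) ⟶ _) ≫
              R.conn ≫ T.map (b.inv ≫ (redCone a φ).d 1 2)
        rw [hd₁]
        change _ = _ ≫ _ ≫ R.conn ≫ T.map (b.inv ≫ biprod.lift (-P.d 2 3) (φ.app 2))
        have e : biprod.lift (-P.d 2 3) (φ.app 2) = P.d 2 3 ≫ biprod.lift (-𝟙 _) 0 +
          φ.app 2 ≫ biprod.inr := by apply biprod.hom_ext <;> simp
        rw [e, Preadditive.comp_add, T.map_add, Preadditive.comp_add, hc, add_zero]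
        simp)
  let p : Hom (redCone b' χ) (oct b φ.app Θ'.app fun k => ((-1 : ℤ) ^ k) • ξ k) :=
    Hom.mk' (coneToOctApp a φ c)
      (by
        rintro (_ | _ | _ | k) hk hk'
        · omega
        · rw [hO₁, hF₁]
          change biprod.lift
              (-biprod.desc (biprod.lift (-P.d 3 4) (φ.app 3)) (biprod.lift 0 (Q.d 2 3)))
              (biprod.desc (ξ 2) (θ 2)) ≫
              biprod.desc (biprod.map (-𝟙 (P.obj 4)) (𝟙 (Q.obj 3)))
                (biprod.lift 0 (c.inv ≫ Q.d 2 3)) =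
            biprod.desc (-𝟙 _) 0 ≫ biprod.lift (P.d 3 4) (φ.app 3)
          apply biprod.hom_ext' <;> apply biprod.hom_ext <;> simp [hξ₂, hθ₂]
        · rw [hO₂, hF]
          change biprod.desc (biprod.lift (-biprod.desc (biprod.lift (-P.d 4 5) (φ.app 4))
                (biprod.lift 0 (Q.d 3 4))) (biprod.desc (ξ 3) (θ 3)))
                (biprod.lift 0 (R.d 2 3)) ≫
              (biprod.lift (((-1 : ℤ) ^ 0) • (biprod.fst ≫ biprod.fst))
                (biprod.lift (biprod.fst ≫ biprod.snd) biprod.snd) :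
                  (P.obj 5 ⊞ Q.obj 4) ⊞ R.obj 3 ⟶ _) =
            biprod.desc (biprod.map (-𝟙 (P.obj 4)) (𝟙 (Q.obj 3)))
              (biprod.lift 0 (c.inv ≫ Q.d 2 3)) ≫
            biprod.desc (biprod.lift (-P.d 4 5)
                (biprod.lift (φ.app 4) (((-1 : ℤ) ^ 3) • ξ 3)))
              (biprod.lift 0 (biprod.lift (-Q.d 3 4) (θ 3)))
          have h₁ : Q.d 2 3 ≫ Q.d 3 4 = 0 := (h.isWeakExact hQ).isComplex.d_comp 2
          have h₂ : Q.d 2 3 ≫ θ 3 = c.hom ≫ R.d 2 3 := by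
            rw [← hθ₂]
            exact hθ 0
          apply biprod.hom_ext' <;> try apply biprod.hom_ext'
          all_goals
            apply biprod.hom_ext <;> try apply biprod.hom_ext
          all_goals simp [pow_succ, h₁, h₂]
        · rw [hO, hF]
          change 
            biprod.desc (biprod.lift (-biprod.desc (biprod.lift (-P.d (k + 5) (k + 6))
              (φ.app (k + 5))) (biprod.lift 0 (Q.d (k + 4) (k + 5))))
                (biprod.desc (ξ (k + 4)) (θ (k + 4))))
              (biprod.lift 0 (R.d (k + 3) (k + 4))) ≫
              (biprod.lift (((-1 : ℤ) ^ (k + 1)) • (biprod.fst ≫ biprod.fst))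
                (biprod.lift (biprod.fst ≫ biprod.snd) biprod.snd) :
                  (P.obj (k + 6) ⊞ Q.obj (k + 5)) ⊞ R.obj (k + 4) ⟶ _) =
            (biprod.lift (((-1 : ℤ) ^ k) • (biprod.fst ≫ biprod.fst))
              (biprod.lift (biprod.fst ≫ biprod.snd) biprod.snd) :
                (P.obj (k + 5) ⊞ Q.obj (k + 4)) ⊞ R.obj (k + 3) ⟶ _) ≫
            biprod.desc
              (biprod.lift (-P.d (k + 5) (k + 6))
                (biprod.lift (((-1 : ℤ) ^ (k + 5)) • φ.app (k + 5))
                  (((-1 : ℤ) ^ (k + 4)) • ξ (k + 4))))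
              (biprod.desc
                (biprod.lift 0 (biprod.lift (-Q.d (k + 4) (k + 5)) (θ (k + 4))))
                (biprod.lift 0 (biprod.lift 0 (R.d (k + 3) (k + 4)))))
          apply biprod.hom_ext' <;> try apply biprod.hom_ext'
          all_goals
            apply biprod.hom_ext <;> try apply biprod.hom_ext
          all_goals simp [pow_succ, smul_smul, ← mul_pow])
      (by
        change ((biprod.snd : (P.obj (m + 5) ⊞ Q.obj (m + 4)) ⊞ R.obj (m + 3) ⟶ _) ≫
              R.conn ≫ T.map (b.inv ≫ (redCone a φ).d 1 2)) ≫
            T.map (biprod.desc (-𝟙 _) 0 : P.obj 3 ⊞ Q.obj 2 ⟶ _) =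
          (biprod.lift (((-1 : ℤ) ^ m) • (biprod.fst ≫ biprod.fst))
              (biprod.lift (biprod.fst ≫ biprod.snd) biprod.snd) :
                (P.obj (m + 5) ⊞ Q.obj (m + 4)) ⊞ R.obj (m + 3) ⟶ _) ≫
          ((biprod.snd ≫ biprod.snd :
            P.obj (m + 5) ⊞ (Q.obj (m + 4) ⊞ R.obj (m + 3)) ⟶ R.obj (m + 3)) ≫
            R.conn ≫ T.map b.inv ≫ T.map (P.d 2 3))
        rw [hd₁]
        change ((biprod.snd : (P.obj (m + 5) ⊞ Q.obj (m + 4)) ⊞ R.obj (m + 3) ⟶ _) ≫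
              R.conn ≫ T.map (b.inv ≫ biprod.lift (-P.d 2 3) (φ.app 2))) ≫
            T.map (biprod.desc (-𝟙 _) 0 : P.obj 3 ⊞ Q.obj 2 ⟶ _) = _
        rw [Category.assoc, Category.assoc, ← T.map_comp, Category.assoc, biprod.lift_desc]
        simp)
  refine h.of_retract hE' ⟨i, p, ?_⟩
  rintro (_ | _ | _ | k)
  · exact (isZero_zero D).eq_of_src _ _
  · change biprod.lift (-𝟙 (P.obj 3)) (0 : _ ⟶ Q.obj 2) ≫ biprod.desc (-𝟙 _) 0 = 𝟙 (P.obj 3)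
    simp
  · change (biprod.lift (biprod.map (-𝟙 (P.obj 4)) (𝟙 (Q.obj 3))) 0 ≫
      biprod.desc (biprod.map (-𝟙 (P.obj 4)) (𝟙 (Q.obj 3)))
      (biprod.lift 0 (c.inv ≫ Q.d 2 3))) = 𝟙 (P.obj 4 ⊞ Q.obj 3)
    apply biprod.hom_ext' <;> apply biprod.hom_ext <;> simp
  · change biprod.lift (biprod.lift (((-1 : ℤ) ^ k) • biprod.fst) (biprod.snd ≫ biprod.fst))
      ((biprod.snd : P.obj (k + 5) ⊞ (Q.obj (k + 4) ⊞ R.obj (k + 3)) ⟶ _) ≫ biprod.snd) ≫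
      (biprod.lift (((-1 : ℤ) ^ k) • (biprod.fst ≫ biprod.fst))
        (biprod.lift (biprod.fst ≫ biprod.snd) biprod.snd) :
          (P.obj (k + 5) ⊞ Q.obj (k + 4)) ⊞ R.obj (k + 3) ⟶ _) = 𝟙 _
    apply biprod.hom_ext <;> try apply biprod.hom_ext
    all_goals simp [smul_smul, ← mul_pow]

end IsThickBase

end Octahedral

/-! ### Inverse rotation -/

section InverseRotation

variable {D : Type u} [Category.{v} D] [Preadditive D] [HasZeroObject D] [HasBinaryBiproducts D]
  {m : ℕ} {T : D ⥤ D}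

open NSeq

omit [HasZeroObject D] [HasBinaryBiproducts D] in
/-- A rotation of a sequence which is weakly exact together with its own rotation: then the sequence
itself is weakly exact. -/
lemma NSeq.IsLeftRotation.isWeakExact [T.Additive] [T.Full] [T.Faithful]
    {P P' P'' : NSeq (m + 3) T} (h : P.IsLeftRotation P') (h' : P'.IsLeftRotation P'')
    (hP' : P'.IsWeakExact) (hP'' : P''.IsWeakExact) : P.IsWeakExact := by
  obtain ⟨a, b, e₁, e₂, e₃⟩ := h
  obtain ⟨a', b', e₁', e₂', e₃'⟩ := h'
  have k₁ : ∀ (i) (h₁ : 1 ≤ i) (h₂ : i + 1 ≤ m + 2), P.d (i + 1) (i + 2) ≫ (a (i + 1) (by omega)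
      (by omega)).inv = (a i (by omega) (by omega)).inv ≫ P'.d i (i + 1) := fun i h₁ h₂ => by
    rw [Iso.comp_inv_eq, Category.assoc, e₁ i h₁ h₂, Iso.inv_hom_id_assoc]
  have k₂ : P.conn ≫ b.inv = (a (m + 2) (by omega) le_rfl).inv ≫ P'.d (m + 2) (m + 3) := by
    rw [Iso.comp_inv_eq, Category.assoc, e₂, Iso.inv_hom_id_assoc]
  have c₁ : IsWeakCokernel P'.conn (T.map (P'.d 1 2)) := by
    refine hP''.weakCokernel_conn.of_retract (a' (m + 2) (by omega) le_rfl).inv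
      (a' (m + 2) (by omega) le_rfl).hom b'.inv b'.hom
      (signIso (m + 3) (T.mapIso (a' 1 le_rfl (by omega)))).inv
      (signIso (m + 3) (T.mapIso (a' 1 le_rfl (by omega)))).hom ?_ e₂' ?_ (Iso.inv_hom_id _)
      (Iso.inv_hom_id _)
    · rw [Iso.comp_inv_eq, Category.assoc, e₂', Iso.inv_hom_id_assoc]
    · rw [Iso.comp_inv_eq, Category.assoc, Iso.eq_inv_comp]
      change _ = P''.conn ≫ (((-1 : ℤ) ^ (m + 3)) • T.map (a' 1 le_rfl (by omega)).hom)
      rw [Preadditive.comp_zsmul, e₃', neg_one_pow_smul_smul]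
  have c₂ : IsWeakCokernel (T.map (P.d 1 2)) (T.map (P.d 2 3)) := by
    refine c₁.of_retract (signIso (m + 3) b).inv (signIso (m + 3) b).hom
      (T.mapIso (a 1 le_rfl (by omega))).inv (T.mapIso (a 1 le_rfl (by omega))).hom
      (T.mapIso (a 2 (by omega) (by omega))).inv (T.mapIso (a 2 (by omega) (by omega))).hom
      ?_ ?_ ?_ (Iso.inv_hom_id _) (Iso.inv_hom_id _)
    · rw [Iso.comp_inv_eq, Category.assoc, Iso.eq_inv_comp]
      change (((-1 : ℤ) ^ (m + 3)) • b.hom) ≫ _ = P'.conn ≫ T.map (a 1 le_rfl (by omega)).hom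
      rw [e₃, Preadditive.zsmul_comp]
    · change P'.conn ≫ T.map (a 1 le_rfl (by omega)).hom = (((-1 : ℤ) ^ (m + 3)) • b.hom) ≫ _
      rw [e₃, Preadditive.zsmul_comp]
    · change T.map (P.d 2 3) ≫ T.map (a 2 (by omega) (by omega)).inv =
        T.map (a 1 le_rfl (by omega)).inv ≫ T.map (P'.d 1 2)
      rw [← T.map_comp, ← T.map_comp]
      exact congrArg T.map (k₁ 1 le_rfl (by omega))
  refine ⟨?_, ?_, ?_⟩
  · intro i hi hi'
    by_cases h₁ : i = 1
    · subst h₁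
      refine ⟨T.map_injective ?_, fun Z u hu => ?_⟩
      · rw [T.map_comp, T.map_zero]
        exact c₂.1
      · obtain ⟨t, ht⟩ := c₂.2 (T.map u) (by rw [← T.map_comp, hu, T.map_zero])
        refine ⟨T.preimage t, T.map_injective ?_⟩
        rw [T.map_comp, T.map_preimage]
        exact ht
    · obtain ⟨j, rfl⟩ : ∃ j, i = j + 2 := ⟨i - 2, by omega⟩
      exact (hP'.weakCokernel (j + 1) (by omega) (by omega)).of_retract
        (a (j + 1) (by omega) (by omega)).inv (a (j + 1) (by omega) (by omega)).hom
        (a (j + 2) (by omega) (by omega)).inv (a (j + 2) (by omega) (by omega)).hom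
        (a (j + 3) (by omega) (by omega)).inv (a (j + 3) (by omega) (by omega)).hom
        (k₁ (j + 1) (by omega) (by omega)) (e₁ (j + 1) (by omega) (by omega))
        (k₁ (j + 2) (by omega) (by omega)) (Iso.inv_hom_id _) (Iso.inv_hom_id _)
  · exact (hP'.weakCokernel (m + 1) (by omega) (by omega)).of_retract
      (a (m + 1) (by omega) (by omega)).inv (a (m + 1) (by omega) (by omega)).hom
      (a (m + 2) (by omega) (by omega)).inv (a (m + 2) (by omega) (by omega)).hom b.inv b.hom
      (k₁ (m + 1) (by omega) (by omega)) (e₁ (m + 1) (by omega) (by omega)) k₂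
      (Iso.inv_hom_id _) (Iso.inv_hom_id _)
  · have key : P'.d (m + 2) (m + 3) ≫ P'.conn ≫ T.map (a 1 le_rfl (by omega)).hom = 0 := by
      rw [← Category.assoc, hP'.weakCokernel_conn.1, zero_comp]
    rw [e₃, Preadditive.comp_zsmul, ← Category.assoc, e₂] at key
    replace key := congrArg (fun f => ((-1 : ℤ) ^ (m + 3)) • f) key
    simp only [neg_one_pow_smul_smul, smul_zero] at key
    rw [← cancel_epi (a (m + 2) (by omega) le_rfl).hom, ← Category.assoc, key, comp_zero]

namespace IsThickBase

variable {Θ : NSeq (m + 3) T → Prop} (h : IsThickBase m T Θ)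

include h

/-- Commutative squares on the last morphisms of angles extend to morphisms of angles. -/
lemma complete_conn {P V : NSeq (m + 3) T} (hP : Θ P) (hV : Θ V) (x : P.obj 1 ⟶ V.obj 1)
    (y : P.obj (m + 3) ⟶ V.obj (m + 3)) (hxy : P.conn ≫ T.map x = y ≫ V.conn) :
    ∃ φ : Hom P V, φ.app 1 = x ∧ φ.app (m + 3) = y := by
  have := h.isEquivalence
  obtain ⟨P', hP'⟩ := exists_leftRotation P
  obtain ⟨V', hV'⟩ := exists_leftRotation V
  have hP'' := hP'
  have hV'' := hV'
  obtain ⟨a, b, e⟩ := hP'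
  obtain ⟨a', b', e'⟩ := hV'
  obtain ⟨ψ, h₁, h₂⟩ := h.complete_last hP hV hP'' hV''
    ((a (m + 2) (by omega) le_rfl).hom ≫ y ≫ (a' (m + 2) (by omega) le_rfl).inv)
    (b.hom ≫ T.map x ≫ b'.inv) (by
      rw [← Category.assoc, e.2.1, Category.assoc, Category.assoc, Category.assoc,
        ← Category.assoc P.conn, hxy, Category.assoc]
      congr 2
      rw [Iso.comp_inv_eq, Category.assoc, e'.2.1, Iso.inv_hom_id_assoc])
  obtain ⟨φ, h₃, h₄⟩ := IsRotationBy.exists_hom_of_rotation e e' ψ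
  refine ⟨φ, T.map_injective ?_, ?_⟩
  · rw [h₄, h₂]
    simp
  · refine (h₃ (m + 2) (by omega) le_rfl).trans ?_
    rw [h₁]
    simp

/-- Commutative squares on the first morphisms extend for sequences whose rotations are angles. -/
lemma complete_of_rotation {P P' V V' : NSeq (m + 3) T} (hPP' : P.IsLeftRotation P')
    (hVV' : V.IsLeftRotation V') (hP : Θ P') (hV : Θ V') (x : P.obj 1 ⟶ V.obj 1)
    (y : P.obj 2 ⟶ V.obj 2) (hxy : P.d 1 2 ≫ y = x ≫ V.d 1 2) :
    ∃ φ : Hom P V, φ.app 1 = x ∧ φ.app 2 = y := by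
  have := h.isEquivalence
  obtain ⟨a, b, e⟩ := hPP'
  obtain ⟨a', b', e'⟩ := hVV'
  obtain ⟨ψ, h₁, h₂⟩ := h.complete_conn hP hV
    ((a 1 le_rfl (by omega)).hom ≫ y ≫ (a' 1 le_rfl (by omega)).inv)
    (b.hom ≫ T.map x ≫ b'.inv) (by
      rw [T.map_comp, T.map_comp, ← Category.assoc, e.2.2,
        ← cancel_mono (T.map (a' 1 le_rfl (by omega)).hom)]
      simp only [Category.assoc]
      rw [e'.2.2, ← T.map_comp (a' 1 le_rfl (by omega)).inv, Iso.inv_hom_id, T.map_id,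
        Category.comp_id, Preadditive.comp_zsmul, Preadditive.comp_zsmul, Preadditive.comp_zsmul,
        Preadditive.zsmul_comp, Category.assoc, ← T.map_comp, hxy, Iso.inv_hom_id_assoc,
        T.map_comp])
  obtain ⟨φ, h₃, h₄⟩ := IsRotationBy.exists_hom_of_rotation e e' ψ
  refine ⟨φ, T.map_injective ?_, ?_⟩
  · rw [h₄, h₂]
    simp
  · refine (h₃ 1 le_rfl (by omega)).trans ?_
    rw [h₁]
    simp

lemma exists_first {X Y : D} (f : X ⟶ Y) : ∃ P : NSeq (m + 3) T, Θ P ∧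
    ∃ (e₁ : P.obj 1 ≅ X) (e₂ : P.obj 2 ≅ Y), P.d 1 2 ≫ e₂.hom = e₁.hom ≫ f := by
  obtain ⟨P, _, hP, _, e₁, e₂, _, _, _, hf, _⟩ := h.exists_cone f (𝟙 Y)
  exact ⟨P, hP, e₁, e₂, hf⟩

/-- The class is closed under inverse rotation: a sequence whose rotation is an angle is a homotopy
retract of an angle with the same first morphism. -/
lemma rotate_inv {P P' : NSeq (m + 3) T} (hPP' : P.IsLeftRotation P') (hP' : Θ P') : Θ P := by
  have := h.additive
  have := h.isEquivalence
  obtain ⟨V, hV, e₁, e₂, he⟩ := h.exists_first (P.d 1 2)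
  obtain ⟨V', hVV'⟩ := exists_leftRotation V
  obtain ⟨P'', hPP''⟩ := exists_leftRotation P'
  have hV' := h.rotate hVV' hV
  have hPw : P.IsWeakExact := hPP'.isWeakExact hPP'' (h.isWeakExact hP')
    (h.isWeakExact (h.rotate hPP'' hP'))
  obtain ⟨α, hα₁, hα₂⟩ := h.complete_of_rotation hPP' hVV' hP' hV' e₁.inv e₂.inv (by
    rw [Iso.eq_inv_comp, ← Category.assoc, ← he, Category.assoc, Iso.hom_inv_id,
      Category.comp_id])
  obtain ⟨β, hβ₁, hβ₂⟩ := h.complete_of_rotation hVV' hPP' hV' hP' e₁.hom e₂.hom he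
  obtain ⟨β', -, -, s, -, hs⟩ := Hom.exists_htpy_id hPw α β (by rw [hα₁, hβ₁, Iso.inv_hom_id])
    (by rw [hα₂, hβ₂, Iso.inv_hom_id])
  refine h.mem_of_homotopy hPw.isComplex hV α β' (fun k => -s k) fun k _ => ?_
  have e : α.app (k + 1) ≫ β'.app (k + 1) +
      (P.d (k + 1) (k + 2) ≫ (-s (k + 1)) + (-s k) ≫ P.d k (k + 1)) = 𝟙 _ := by
    have := hs k
    rw [sub_eq_iff_eq_add] at this
    refine (congrArg (· + _) this).trans ?_
    change _ + 𝟙 _ + _ = _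
    rw [Preadditive.comp_neg, Preadditive.neg_comp]
    abel
  rw [e]
  infer_instance

/-- A class as in `IsThickBase` satisfies all axioms of an `n`-angulated category. -/
theorem isNAngulated : IsNAngulated m T Θ where
  iso_closed := h.iso_closed
  sum_closed := h.sum_closed
  trivial_mem := h.trivial_mem
  exists_first := h.exists_first
  rotate := h.rotate
  complete := h.complete
  octahedral := h.octahedral
  additive := h.additive
  isEquivalence := h.isEquivalence
  rotate_inv := h.rotate_inv
  summand_closed := by
    have := h.additive
    exact fun {_ _} hPQ => h.of_retract hPQ (isRetract_sum _ _)

end IsThickBase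

end InverseRotation

/-! ### The quotient category -/

section QuotientBasics

variable {A : Type u} [Category.{v} A] [Preadditive A] [HasZeroObject A] [HasBinaryBiproducts A]
  {C X : ObjectProperty A}

namespace QuotCat

section

variable {M N K : A} {hM : C M} {hN : C N} {hK : C K}

omit [HasZeroObject A] [HasBinaryBiproducts A] in
lemma homMk_comp (f : M ⟶ N) (g : N ⟶ K) :
    (homMk (f ≫ g) : (mk M hM : QuotCat C X) ⟶ mk K hK) =
      homMk (hN := hN) f ≫ homMk g :=
  (quotFunctor C X).map_comp (ObjectProperty.homMk f : (⟨M, hM⟩ : C.FullSubcategory) ⟶ ⟨N, hN⟩)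
    (ObjectProperty.homMk g : (⟨N, hN⟩ : C.FullSubcategory) ⟶ ⟨K, hK⟩)

omit [HasZeroObject A] [HasBinaryBiproducts A] in
lemma homMk_id : (homMk (𝟙 M) : (mk M hM : QuotCat C X) ⟶ mk M hM) = 𝟙 _ :=
  (quotFunctor C X).map_id _

omit [HasZeroObject A] [HasBinaryBiproducts A] in
lemma exists_homMk (φ : (mk M hM : QuotCat C X) ⟶ mk N hN) : ∃ f : M ⟶ N, homMk f = φ := by
  obtain ⟨f, hf⟩ := (quotFunctor C X).map_surjective φ
  exact ⟨f.hom, hf⟩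

variable [IsAdditiveSubcategory X]

lemma homMk_eq_iff (f g : M ⟶ N) :
    (homMk f : (mk M hM : QuotCat C X) ⟶ mk N hN) = homMk g ↔
      ∃ (Z : A) (_ : X Z) (p : M ⟶ Z) (q : Z ⟶ N), f - g = p ≫ q :=
  Quotient.functor_map_eq_iff _ _ _

lemma homMk_zero : (homMk 0 : (mk M hM : QuotCat C X) ⟶ mk N hN) = 0 :=
  (quotFunctor C X).map_zero _ _

lemma homMk_add (f g : M ⟶ N) :
    (homMk (f + g) : (mk M hM : QuotCat C X) ⟶ mk N hN) = homMk f + homMk g :=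
  (quotFunctor C X).map_add (f := (ObjectProperty.homMk f :
    (⟨M, hM⟩ : C.FullSubcategory) ⟶ ⟨N, hN⟩)) (g := ObjectProperty.homMk g)

lemma homMk_neg (f : M ⟶ N) :
    (homMk (-f) : (mk M hM : QuotCat C X) ⟶ mk N hN) = -homMk f :=
  (quotFunctor C X).map_neg (f := (ObjectProperty.homMk f :
    (⟨M, hM⟩ : C.FullSubcategory) ⟶ ⟨N, hN⟩))

lemma homMk_sub (f g : M ⟶ N) :
    (homMk (f - g) : (mk M hM : QuotCat C X) ⟶ mk N hN) = homMk f - homMk g := by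
  rw [sub_eq_add_neg, homMk_add, homMk_neg, ← sub_eq_add_neg]

lemma homMk_eq_zero_iff (f : M ⟶ N) :
    (homMk f : (mk M hM : QuotCat C X) ⟶ mk N hN) = 0 ↔
      ∃ (Z : A) (_ : X Z) (p : M ⟶ Z) (q : Z ⟶ N), f = p ≫ q := by
  rw [← homMk_zero, homMk_eq_iff, sub_zero]

lemma mk_isZero (h : X M) : IsZero (mk M hM : QuotCat C X) := by
  rw [IsZero.iff_id_eq_zero, ← homMk_id, homMk_eq_zero_iff]
  exact ⟨M, h, 𝟙 M, 𝟙 M, (Category.comp_id _).symm⟩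

lemma mk_isZero_of_isZero (h : IsZero M) : IsZero (mk M hM : QuotCat C X) :=
  mk_isZero (IsAdditiveSubcategory.zero_mem h)

end

/-- The image in `C/X` of an isomorphism. -/
@[simps]
def mapIso {M N : A} (hM : C M) (hN : C N) (e : M ≅ N) :
    (mk M hM : QuotCat C X) ≅ mk N hN where
  hom := homMk e.hom
  inv := homMk e.inv
  hom_inv_id := by rw [← homMk_comp, e.hom_inv_id, homMk_id]
  inv_hom_id := by rw [← homMk_comp, e.inv_hom_id, homMk_id]

variable [IsAdditiveSubcategory C] [IsAdditiveSubcategory X]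

/-- The quotient functor preserves binary biproducts. -/
@[simps]
noncomputable def biprodIso {M N : A} (hM : C M) (hN : C N) (hMN : C (M ⊞ N)) :
    (mk (M ⊞ N) hMN : QuotCat C X) ≅ mk M hM ⊞ mk N hN where
  hom := biprod.lift (homMk biprod.fst) (homMk biprod.snd)
  inv := biprod.desc (homMk biprod.inl) (homMk biprod.inr)
  hom_inv_id := by
    rw [biprod.lift_desc, ← homMk_comp, ← homMk_comp, ← homMk_add, biprod.total, homMk_id]
  inv_hom_id := by
    apply biprod.hom_ext' <;> apply biprod.hom_ext
    · simp [← homMk_comp, homMk_id]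
    · simp [← homMk_comp, homMk_zero]
    · simp [← homMk_comp, homMk_zero]
    · simp [← homMk_comp, homMk_id]

end QuotCat

end QuotientBasics

/-! ### The connecting morphisms of standard angles -/

section Delta

variable {A : Type u} [Category.{v} A] [Preadditive A] [HasZeroObject A] [HasBinaryBiproducts A]
variable {m : ℕ} {S : A ⥤ A} [S.Additive] {C X : ObjectProperty A} {R : NSeq (m + 3) S → Prop}
  [IsAdditiveSubcategory X]

open NSeq QuotCat

open scoped ZeroObject

/-- Sum of morphisms of sequences. -/
def NSeq.Hom.add {P Q : NSeq (m + 3) S} (φ ψ : Hom P Q) : Hom P Q where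
  app i := φ.app i + ψ.app i
  comm i j := by rw [Preadditive.comp_add, Preadditive.add_comp, φ.comm, ψ.comm]
  comm_conn := by
    rw [S.map_add, Preadditive.comp_add, Preadditive.add_comp, φ.comm_conn, ψ.comm_conn]

variable (hR : IsRightSuspended m S C X R)

include hR

/-- Morphisms from a sequence with `X`-monic first morphism to an approximation sequence which agree
in the first position agree in the last position modulo `X`. -/
lemma homMk_app_last_eq {P : NSeq (m + 3) S} (hP : R P) (hP' : IsXMonic C X (P.d 1 2)) {N : A}
    (Q : ApproxSeq C X R N) (φ ψ : Hom P Q.seq) (h : φ.app 1 = ψ.app 1)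
    {hPn : C (P.obj (m + 3))} {hQn : C (Q.seq.obj (m + 3))} :
    (homMk (φ.app (m + 3)) : (mk _ hPn : QuotCat C X) ⟶ mk _ hQn) = homMk (ψ.app (m + 3)) := by
  rw [homMk_eq_iff]
  exact ApproxSeq.factor_of_factor hR hP hP' Q φ ψ
    ⟨0, IsAdditiveSubcategory.zero_mem (isZero_zero A), 0, 0, by rw [h, sub_self, zero_comp]⟩

omit [S.Additive] [IsAdditiveSubcategory X] in
/-- A sequence with `X`-monic first morphism maps to each approximation sequence, with prescribed
first component.  -/
lemma exists_toApprox {P : NSeq (m + 3) S} (hP : R P) (hP' : IsXMonic C X (P.d 1 2)) {N : A}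
    (Q : ApproxSeq C X R N) (f : P.obj 1 ⟶ Q.seq.obj 1) : ∃ φ : Hom P Q.seq, φ.app 1 = f := by
  obtain ⟨b, hb⟩ := hP'.2.2 (Q.mem_X 2 le_rfl (by omega)) (f ≫ Q.seq.d 1 2)
  obtain ⟨φ, h₁, -⟩ := hR.complete hP Q.mem f b hb
  exact ⟨φ, h₁⟩

variable (fix : ∀ M : A, C M → ApproxSeq C X R M)

/-- The suspension of the class of `f` can be computed by *any* morphism of approximation sequences
over `f`.  -/
lemma susp_map {M N : A} (hM : C M) (hN : C N) (f : M ⟶ N)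
    (φ : Hom (fix M hM).seq (fix N hN).seq)
    (h : φ.app 1 = (fix M hM).e.hom ≫ f ≫ (fix N hN).e.inv) :
    (susp hR fix).map (homMk f : (mk M hM : QuotCat C X) ⟶ mk N hN) =
      (homMk (φ.app (m + 3)) : mk _ (ApproxSeq.mem_last hR _) ⟶ mk _ _) :=
  homMk_app_last_eq hR (fix M hM).mem (fix M hM).monic (fix N hN) _ _
    ((ApproxSeq.exists_lift hR (fix M hM) (fix N hN) f).choose_spec.trans h.symm)

lemma susp_additive : (susp hR fix).Additive where
  map_add := by
    rintro ⟨⟨M, hM⟩⟩ ⟨⟨N, hN⟩⟩ f g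
    obtain ⟨f, rfl⟩ := exists_homMk f
    obtain ⟨g, rfl⟩ := exists_homMk g
    obtain ⟨φ, hφ⟩ := ApproxSeq.exists_lift hR (fix M hM) (fix N hN) f
    obtain ⟨ψ, hψ⟩ := ApproxSeq.exists_lift hR (fix M hM) (fix N hN) g
    rw [← homMk_add, susp_map hR fix hM hN f φ hφ, susp_map hR fix hM hN g ψ hψ,
      susp_map hR fix hM hN (f + g) (φ.add ψ) ?_]
    · exact homMk_add _ _
    · change φ.app 1 + ψ.app 1 = _
      rw [hφ, hψ, Preadditive.add_comp, Preadditive.comp_add]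

variable [IsAdditiveSubcategory C]

omit [IsAdditiveSubcategory C] in
/-- The class of the last component of a morphism from a sequence to the fixed approximation
sequence, composed with the image of a morphism under the suspension. -/
lemma last_comp_susp_map {P : NSeq (m + 3) S} (hP : R P) (hP' : IsXMonic C X (P.d 1 2))
    {M N : A} (hM : C M) (hN : C N) (f : M ⟶ N) (hPn : C (P.obj (m + 3)))
    (φ : Hom P (fix M hM).seq) (ψ : Hom P (fix N hN).seq)
    (h : ψ.app 1 = φ.app 1 ≫ (fix M hM).e.hom ≫ f ≫ (fix N hN).e.inv) :
    (homMk (φ.app (m + 3)) : (mk _ hPn : QuotCat C X) ⟶ mk _ (ApproxSeq.mem_last hR _)) ≫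
      (susp hR fix).map (homMk f : (mk M hM : QuotCat C X) ⟶ mk N hN) =
      homMk (ψ.app (m + 3)) := by
  obtain ⟨l, hl⟩ := ApproxSeq.exists_lift hR (fix M hM) (fix N hN) f
  rw [susp_map hR fix hM hN f l hl]
  refine (homMk_comp (hN := ApproxSeq.mem_last hR _) (φ.app (m + 3)) (l.app (m + 3))).symm.trans ?_
  refine homMk_app_last_eq hR hP hP' (fix N hN) (φ.comp l) ψ ?_
  rw [h, ← hl]
  rfl

variable {P Q : NSeq (m + 3) S} {hPC : ∀ i, C (P.obj i)} {hQC : ∀ i, C (Q.obj i)}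
  {φ : Hom P (fix (P.obj 1) (hPC 1)).seq} {ψ : Hom Q (fix (Q.obj 1) (hQC 1)).seq}

/-- A morphism of sequences induces a morphism of standard angles. -/
def toQuotHom (hP : R P) (hP' : IsXMonic C X (P.d 1 2))
    (hφ : φ.app 1 = (fix (P.obj 1) (hPC 1)).e.inv) (hψ : ψ.app 1 = (fix (Q.obj 1) (hQC 1)).e.inv)
    (ζ : Hom P Q) :
    Hom (toQuot hR fix P hPC (φ.app (m + 3))) (toQuot hR fix Q hQC (ψ.app (m + 3))) where
  app i := homMk (ζ.app i)
  comm i j := by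
    change (homMk (P.d i j) ≫ homMk (ζ.app j) : (mk _ (hPC i) : QuotCat C X) ⟶ mk _ (hQC j)) =
      homMk (ζ.app i) ≫ homMk (Q.d i j)
    rw [← homMk_comp, ← homMk_comp, ζ.comm]
  comm_conn := by
    refine (last_comp_susp_map hR fix hP hP' (hPC 1) (hQC 1) (ζ.app 1) (hPC _) φ (ζ.comp ψ)
      ?_).trans (homMk_comp (ζ.app (m + 3)) (ψ.app (m + 3)))
    rw [Hom.comp_app, hψ, hφ, Iso.inv_hom_id_assoc]

end Delta

/-! ### Cones in a right suspended category -/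

section StrictCone

variable {A : Type u} [Category.{v} A] [Preadditive A] [HasZeroObject A] [HasBinaryBiproducts A]
variable {m : ℕ} {S : A ⥤ A} {C X : ObjectProperty A} {R : NSeq (m + 3) S → Prop}

open NSeq

open scoped ZeroObject

/-- Components of `toCone`. -/
noncomputable def NSeq.toConeApp {Y : A} {B T : NSeq (m + 3) S} (σ : T.obj 1 ⟶ Y) :
    ∀ k, T.obj k ⟶ coneObj Y B T k
  | 0 => 0
  | 1 => σ
  | _ + 2 => biprod.inr

/-- The morphism from the target of `u` to a cone of `u`. -/
noncomputable def NSeq.toCone {Y : A} {B T : NSeq (m + 3) S} (σ : T.obj 1 ⟶ Y)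
    (u : ∀ k, B.obj k ⟶ T.obj k) {first : Y ⟶ B.obj 3 ⊞ T.obj 2}
    (h : σ ≫ first = T.d 1 2 ≫ biprod.inr) : Hom T (cone u first (T.conn ≫ S.map σ)) :=
  Hom.mk' (toConeApp σ)
    (by
      rintro (_ | _ | k) hk hk'
      · omega
      · rw [cone_d_one]
        exact h.symm
      · rw [cone_d]
        change T.d (k + 2) (k + 3) ≫ (biprod.inr : _ ⟶ B.obj (k + 4) ⊞ T.obj (k + 3)) =
          (biprod.inr : _ ⟶ B.obj (k + 3) ⊞ T.obj (k + 2)) ≫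
            biprod.desc (biprod.lift (-B.d (k + 3) (k + 4)) (u (k + 3)))
              (biprod.lift 0 (T.d (k + 2) (k + 3)))
        apply biprod.hom_ext <;> simp)
    (by
      change T.conn ≫ S.map σ = (biprod.inr : _ ⟶ B.obj (m + 4) ⊞ T.obj (m + 3)) ≫
        biprod.snd ≫ T.conn ≫ S.map σ
      simp)

/-- Components of the comparison of the octahedral sequence at the rows
`graph y`, `B ⊕ graph (0 ⟶ T₂)` and `T ⊕ graph (B₂ ⟶ 0)` with a cone of a morphism from `B`
to `T`. -/
noncomputable def octToCone {Y : A} {B T : NSeq (m + 3) S} (y : B.obj 1 ⟶ Y) :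
    ∀ k, octObj (graph m S y) (B.sum (graph m S (0 : (0 : A) ⟶ T.obj 2)))
      (T.sum (graph m S (0 : B.obj 2 ⟶ (0 : A)))) k ⟶ coneObj Y B T k
  | 0 => 0
  | 1 => 𝟙 Y
  | 2 => (biprod.snd : (0 : A) ⊞ (B.obj 3 ⊞ T.obj 2) ⟶ _)
  | k + 3 => (biprod.snd : (graph m S y).obj (k + 5) ⊞
      ((B.obj (k + 4) ⊞ (graph m S (0 : (0 : A) ⟶ T.obj 2)).obj (k + 4)) ⊞
      (T.obj (k + 3) ⊞ (graph m S (0 : B.obj 2 ⟶ (0 : A))).obj (k + 3))) ⟶ _) ≫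
      biprod.map biprod.fst biprod.fst

section Auxiliary

omit [HasZeroObject A] in
lemma theta_three_aux {B₂ B₃ T₂ T₃ Z H H' : A} (b : B₂ ⟶ B₃) (f : B₃ ⊞ T₂ ⟶ T₃ ⊞ H')
    (l : B₂ ⟶ T₂) (t : T₂ ⟶ T₃) (h : B₂ ⊞ H ⟶ H')
    (key : biprod.map b (biprod.desc 0 (-𝟙 _) : Z ⊞ T₂ ⟶ T₂) ≫ f =
      biprod.lift (biprod.desc l (-biprod.snd : Z ⊞ T₂ ⟶ _))
        (biprod.fst ≫ (biprod.inl : _ ⟶ B₂ ⊞ H)) ≫ biprod.map t h) :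
    biprod.inr ≫ f ≫ biprod.fst = t := by
  simpa using congrArg (fun t => (biprod.inr ≫ biprod.inr) ≫ t ≫ biprod.fst) key

omit [HasZeroObject A] in
lemma octToCone_two_aux {P P' B B' G' T T' H : A} (hP : IsZero P)
    (p : P ⟶ P' ⊞ ((B' ⊞ G') ⊞ (T' ⊞ H))) (b : B ⟶ B') (g : T ⟶ G') (f : B ⊞ T ⟶ T' ⊞ H)
    (t : T ⟶ T') (ht : biprod.inr ≫ f ≫ biprod.fst = t) :
    biprod.desc p (biprod.lift 0 (biprod.lift (-biprod.map b g) f)) ≫ biprod.snd ≫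
      biprod.map biprod.fst biprod.fst =
    biprod.snd ≫ biprod.desc (biprod.lift (-b) (biprod.inl ≫ f ≫ biprod.fst))
      (biprod.lift 0 t) := by
  apply biprod.hom_ext'
  · exact hP.eq_of_src _ _
  · apply biprod.hom_ext' <;> apply biprod.hom_ext <;> simp [ht]

omit [HasZeroObject A] in
lemma octToCone_aux {P P' B B' G G' T T' H H' : A} (hP : IsZero P) (hG : IsZero G)
    (hH : IsZero H) (p : P ⟶ P' ⊞ ((B' ⊞ G') ⊞ (T' ⊞ H'))) (b : B ⟶ B') (g : G ⟶ G')
    (f : B ⊞ G ⟶ T' ⊞ H') (t : T ⟶ T') (h : H ⟶ H') :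
    biprod.desc p (biprod.desc (biprod.lift 0 (biprod.lift (-biprod.map b g) f))
        (biprod.lift 0 (biprod.lift 0 (biprod.map t h)))) ≫ biprod.snd ≫
      biprod.map biprod.fst biprod.fst =
    (biprod.snd ≫ biprod.map biprod.fst biprod.fst) ≫
      biprod.desc (biprod.lift (-b) (biprod.inl ≫ f ≫ biprod.fst)) (biprod.lift 0 t) := by
  apply biprod.hom_ext'
  · exact hP.eq_of_src _ _
  · apply biprod.hom_ext' <;> apply biprod.hom_ext'
    · apply biprod.hom_ext <;> simp
    · exact hG.eq_of_src _ _
    · apply biprod.hom_ext <;> simp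
    · exact hH.eq_of_src _ _

omit [HasZeroObject A] in
lemma octToCone_conn_aux {P T T₁ H H₁ K Y : A} (hP : IsZero P) (hH : IsZero H)
    (t : T ⟶ S.obj T₁) (h : H ⟶ S.obj H₁) (β : T₁ ⊞ H₁ ⟶ K) (y : K ⟶ Y) (B G : A) :
    (((biprod.snd ≫ biprod.snd : P ⊞ ((B ⊞ G) ⊞ (T ⊞ H)) ⟶ _) ≫
      biprod.desc (t ≫ S.map biprod.inl) (h ≫ S.map biprod.inr) ≫ S.map β ≫ S.map y) ≫
        S.map (𝟙 Y)) =
    (biprod.snd ≫ biprod.map biprod.fst biprod.fst) ≫ biprod.snd ≫ t ≫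
      S.map (biprod.inl ≫ β ≫ y) := by
  apply biprod.hom_ext'
  · exact hP.eq_of_src _ _
  · apply biprod.hom_ext'
    · simp
    · apply biprod.hom_ext'
      · simp
      · exact hH.eq_of_src _ _

end Auxiliary

variable [S.Additive] [IsAdditiveSubcategory C] (hR : IsRightSuspended m S C X R)

include hR

/-- The source of all mapping cones: given sequences `B` and `T` in `R`, the second with `X`-monic
first morphism, morphisms `y : B₁ ⟶ Y` and `l : B₂ ⟶ T₂`, and an isomorphism `β : B₁ ⊞ Y ≅ T₁ ⊞ B₂`
compatible with `g₁`, the octahedral condition, at the rows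
`graph y`, `B ⊕ graph (0 ⟶ T₂)` and `T ⊕ graph (B₂ ⟶ 0)`, gives a morphism `B ⟶ T` whose mapping
cone, with its first two terms replaced by `Y`, is in `R`. -/
lemma exists_cone_mem {B T : NSeq (m + 3) S} (hB : R B) (hT : R T)
    (hTm : IsXMonic C X (T.d 1 2)) (hB₁ : C (B.obj 1)) (hB₂ : C (B.obj 2)) {Y : A} (hY : C Y)
    (y : B.obj 1 ⟶ Y) (β : B.obj 1 ⊞ Y ≅ T.obj 1 ⊞ B.obj 2)
    (hβ : biprod.lift (𝟙 _) y ≫ β.hom ≫ biprod.snd = B.d 1 2) (l : B.obj 2 ⟶ T.obj 2)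
    (hl : (biprod.lift (𝟙 _) y ≫ β.hom ≫ biprod.fst) ≫ T.d 1 2 = B.d 1 2 ≫ l) :
    ∃ u : Hom B T, u.app 1 = biprod.lift (𝟙 _) y ≫ β.hom ≫ biprod.fst ∧ u.app 2 = l ∧
      R (cone u.app (biprod.lift (-(biprod.inr ≫ β.hom ≫ biprod.snd) ≫ B.d 2 3)
          ((biprod.inr ≫ β.hom ≫ biprod.snd) ≫ l - (biprod.inr ≫ β.hom ≫ biprod.fst) ≫ T.d 1 2))
        (T.conn ≫ S.map (biprod.inl ≫ β.inv ≫ biprod.desc y (-𝟙 Y)))) ∧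
      IsXMonic C X (biprod.lift (-(biprod.inr ≫ β.hom ≫ biprod.snd) ≫ B.d 2 3)
          ((biprod.inr ≫ β.hom ≫ biprod.snd) ≫ l -
            (biprod.inr ≫ β.hom ≫ biprod.fst) ≫ T.d 1 2)) := by
  have hC₀ : C (0 : A) := IsAdditiveSubcategory.zero_mem (isZero_zero A)
  have hT₂ : C (T.obj 2) := hTm.2.1
  let G := graph m S (0 : (0 : A) ⟶ T.obj 2)
  let G' := graph m S (0 : B.obj 2 ⟶ (0 : A))
  let a : B.obj 1 ≅ B.obj 1 ⊞ (0 : A) :=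
    { hom := biprod.inl
      inv := biprod.fst
      inv_hom_id := by
        apply biprod.hom_ext
        · simp
        · exact (isZero_zero A).eq_of_tgt _ _ }
  let c : B.obj 2 ⊞ ((0 : A) ⊞ T.obj 2) ≅ T.obj 2 ⊞ (B.obj 2 ⊞ (0 : A)) :=
    { hom := biprod.lift (biprod.desc l (-biprod.snd)) (biprod.fst ≫ biprod.inl)
      inv := biprod.lift (biprod.snd ≫ biprod.fst)
        ((biprod.snd ≫ biprod.fst ≫ l - biprod.fst) ≫ biprod.inr)
      hom_inv_id := by
        apply biprod.hom_ext
        · simp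
        · apply biprod.hom_ext
          · exact (isZero_zero A).eq_of_tgt _ _
          · apply biprod.hom_ext'
            · simp
            · simp
      inv_hom_id := by
        apply biprod.hom_ext
        · apply biprod.hom_ext'
          · simp [Preadditive.sub_comp, biprod.lift_desc]
          · simp [Preadditive.sub_comp, biprod.lift_desc]
        · apply biprod.hom_ext
          · simp
          · exact (isZero_zero A).eq_of_tgt _ _ }
  have hG₁ : G.d 1 2 = (biprod.lift (𝟙 _) 0 : (0 : A) ⟶ (0 : A) ⊞ T.obj 2) :=
    ofSucc_d_succ _ _ _ _ _
  have hG₂ : G.d 2 3 = (biprod.desc 0 (-𝟙 _) : (0 : A) ⊞ T.obj 2 ⟶ T.obj 2) :=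
    ofSucc_d_succ _ _ _ _ _
  have hG₁' : G'.d 1 2 = (biprod.lift (𝟙 _) 0 : B.obj 2 ⟶ B.obj 2 ⊞ (0 : A)) :=
    ofSucc_d_succ _ _ _ _ _
  have hP₁ : (graph m S y).d 1 2 = biprod.lift (𝟙 _) y := ofSucc_d_succ _ _ _ _ _
  have hP₂ : (graph m S y).d 2 3 = biprod.desc y (-𝟙 Y) := ofSucc_d_succ _ _ _ _ _
  have hmonic : IsXMonic C X (biprod.map (T.d 1 2)
      (biprod.lift (𝟙 _) 0 : B.obj 2 ⟶ B.obj 2 ⊞ (0 : A))) := by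
    refine ⟨IsAdditiveSubcategory.biprod_mem hTm.1 hB₂, IsAdditiveSubcategory.biprod_mem hT₂
      (IsAdditiveSubcategory.biprod_mem hB₂ hC₀), fun Z hZ g => ?_⟩
    obtain ⟨t, ht⟩ := hTm.2.2 hZ (biprod.inl ≫ g)
    refine ⟨biprod.desc t (biprod.fst ≫ biprod.inr ≫ g), ?_⟩
    apply biprod.hom_ext' <;> simp [ht]
  have hsq : biprod.lift (𝟙 _) y ≫ β.hom ≫ biprod.map (T.d 1 2)
      (biprod.lift (𝟙 _) 0 : B.obj 2 ⟶ B.obj 2 ⊞ (0 : A)) =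
        a.hom ≫ biprod.map (B.d 1 2) (biprod.lift (𝟙 _) 0) ≫ c.hom := by
    apply biprod.hom_ext
    · simpa [a, c] using hl
    · apply biprod.hom_ext
      · simpa [a, c] using hβ
      · exact (isZero_zero A).eq_of_tgt _ _
  obtain ⟨φ, θ, ψ, hφ₁, hφ₂, hθ₁, hθ₂, hO, hOm⟩ := hR.octahedral (hR.graph_mem y hB₁ hY)
    (hR.sum_closed hB (hR.graph_mem (0 : (0 : A) ⟶ T.obj 2) hC₀ hT₂))
    (hR.sum_closed hT (hR.graph_mem (0 : B.obj 2 ⟶ (0 : A)) hB₂ hC₀)) a β c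
    (by
      rw [hP₁]
      change biprod.lift (𝟙 _) y ≫ β.hom ≫ biprod.map (T.d 1 2) (G'.d 1 2) =
        a.hom ≫ biprod.map (B.d 1 2) (G.d 1 2) ≫ c.hom
      rw [hG₁, hG₁']
      exact hsq)
    (by
      rw [hP₁]
      exact ⟨hB₁, IsAdditiveSubcategory.biprod_mem hB₁ hY, fun Z hZ (g : B.obj 1 ⟶ Z) =>
        ⟨(biprod.fst : B.obj 1 ⊞ Y ⟶ _) ≫ g,
          (biprod.lift_fst_assoc (𝟙 _) y g).trans (Category.id_comp g)⟩⟩)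
    (by
      change IsXMonic C X (biprod.map (T.d 1 2) (G'.d 1 2))
      rw [hG₁']
      exact hmonic)
  let u : Hom B T := ((sumInl B G).comp θ).comp (sumFst T G')
  have hu : ∀ k, u.app k = (biprod.inl : _ ⟶ B.obj k ⊞ G.obj k) ≫ θ.app k ≫
      (biprod.fst : T.obj k ⊞ G'.obj k ⟶ _) := fun k => Category.assoc _ _ _
  have hu₁ : u.app 1 = biprod.lift (𝟙 _) y ≫ β.hom ≫ biprod.fst := by
    rw [hu, hθ₁, hP₁]
    change biprod.inl ≫ ((biprod.fst : B.obj 1 ⊞ (0 : A) ⟶ _) ≫ biprod.lift (𝟙 _) y ≫ β.hom) ≫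
      biprod.fst = _
    simp
  have hu₂ : u.app 2 = l := by
    rw [hu, hθ₂]
    change biprod.inl ≫ biprod.lift (biprod.desc l (-biprod.snd : (0 : A) ⊞ T.obj 2 ⟶ _))
      (biprod.fst ≫ (biprod.inl : _ ⟶ B.obj 2 ⊞ (0 : A))) ≫ biprod.fst = l
    simp
  have hφ₃ : ∀ f : Y ⟶ B.obj 3 ⊞ T.obj 2, f = φ.app 3 →
      f = biprod.lift (-(biprod.inr ≫ β.hom ≫ biprod.snd) ≫ B.d 2 3)
          ((biprod.inr ≫ β.hom ≫ biprod.snd) ≫ l -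
            (biprod.inr ≫ β.hom ≫ biprod.fst) ≫ T.d 1 2) := by
    intro f hf
    have key := φ.comm 2 3
    rw [← hf, hφ₂, hP₂] at key
    replace key : biprod.desc y (-𝟙 Y) ≫ f = (β.hom ≫ biprod.map (T.d 1 2)
      (biprod.lift (𝟙 _) 0 : B.obj 2 ⟶ B.obj 2 ⊞ (0 : A)) ≫
      biprod.lift (biprod.snd ≫ biprod.fst)
        ((biprod.snd ≫ biprod.fst ≫ l - biprod.fst) ≫
          (biprod.inr : T.obj 2 ⟶ (0 : A) ⊞ T.obj 2))) ≫
        biprod.map (B.d 2 3) (biprod.desc 0 (-𝟙 _) : (0 : A) ⊞ T.obj 2 ⟶ T.obj 2) := by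
      rw [← hG₁', ← hG₂]
      exact key
    replace key := congrArg (fun t => biprod.inr ≫ t) key
    simp only [biprod.inr_desc_assoc, Preadditive.neg_comp, Category.id_comp] at key
    rw [neg_eq_iff_eq_neg] at key
    rw [key]
    apply biprod.hom_ext
    · simp
    · simp [Preadditive.sub_comp, Preadditive.comp_sub, neg_add_eq_sub]
  have hθ₃ : ∀ f : B.obj 3 ⊞ T.obj 2 ⟶ T.obj 3 ⊞ (0 : A), f = θ.app 3 →
      biprod.inr ≫ f ≫ biprod.fst = T.d 2 3 := by
    intro f hf
    have key := θ.comm 2 3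
    rw [← hf, hθ₂] at key
    refine theta_three_aux (Z := (0 : A)) (B.d 2 3) f l (T.d 2 3)
      (G'.d 2 3 : B.obj 2 ⊞ (0 : A) ⟶ (0 : A)) ?_
    rw [← hG₂]
    exact key
  let first : Y ⟶ B.obj 3 ⊞ T.obj 2 := biprod.lift (-(biprod.inr ≫ β.hom ≫ biprod.snd) ≫ B.d 2 3)
      ((biprod.inr ≫ β.hom ≫ biprod.snd) ≫ l - (biprod.inr ≫ β.hom ≫ biprod.fst) ≫ T.d 1 2)
  let last : T.obj (m + 3) ⟶ S.obj Y :=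
    T.conn ≫ S.map (biprod.inl ≫ β.inv ≫ biprod.desc y (-𝟙 Y))
  have hO₁ : (oct (m := m) (P := graph m S y) (Q := B.sum G) (R := T.sum G') β φ.app θ.app ψ).d
      1 2 = biprod.lift ((graph m S y).d 3 4) (φ.app 3) := ofSucc_d_succ _ _ _ _ _
  have hP0 : ∀ k, IsZero ((graph m S y).obj (k + 4)) := fun k => isZero_zero A
  have hG0 : ∀ k, IsZero (G.obj (k + 4)) := fun k => isZero_zero A
  have hG0' : ∀ k, IsZero (G'.obj (k + 3)) := fun k => by cases k <;> exact isZero_zero A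
  have hO₂ : (oct (m := m) (P := graph m S y) (Q := B.sum G) (R := T.sum G') β φ.app θ.app ψ).d
      2 3 = biprod.desc
      (biprod.lift (-(graph m S y).d 4 5) (biprod.lift (φ.app 4) (ψ 3)))
      (biprod.lift 0 (biprod.lift (-(B.sum G).d 3 4) (θ.app 3))) := ofSucc_d_succ _ _ _ _ _
  have hO₃ : ∀ k, (oct (m := m) (P := graph m S y) (Q := B.sum G) (R := T.sum G') β φ.app θ.app
      ψ).d (k + 3) (k + 4) = biprod.desc
      (biprod.lift (-(graph m S y).d (k + 5) (k + 6))
        (biprod.lift (((-1 : ℤ) ^ (k + 5)) • φ.app (k + 5)) (ψ (k + 4))))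
      (biprod.desc
        (biprod.lift 0 (biprod.lift (-(B.sum G).d (k + 4) (k + 5)) (θ.app (k + 4))))
        (biprod.lift 0 (biprod.lift 0 ((T.sum G').d (k + 3) (k + 4))))) :=
    fun k => ofSucc_d_succ _ _ _ _ _
  let e : Hom (oct (m := m) (P := graph m S y) (Q := B.sum G) (R := T.sum G') β φ.app θ.app ψ)
      (cone u.app first last) := Hom.mk' (octToCone y)
    (by
      rintro (_ | _ | _ | k) hk hk'
      · omega
      · rw [hO₁, cone_d_one]
        exact (biprod.lift_snd _ _).trans ((hφ₃ _ rfl).trans (Category.id_comp first).symm)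
      · rw [hO₂, cone_d]
        obtain ⟨f, hf⟩ : ∃ f : B.obj 3 ⊞ T.obj 2 ⟶ T.obj 3 ⊞ (0 : A), f = θ.app 3 := ⟨_, rfl⟩
        have e₁ := hθ₃ f hf
        have e₂ : u.app 3 = biprod.inl ≫ f ≫ biprod.fst := by
          rw [hu, hf]
          rfl
        rw [e₂, ← hf]
        exact octToCone_two_aux (hP0 0) (biprod.lift (-(graph m S y).d 4 5)
          (biprod.lift (φ.app 4) (ψ 3))) (B.d 3 4) (G.d 3 4) f (T.d 2 3) e₁
      · rw [hO₃, cone_d, hu]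
        exact octToCone_aux (hP0 (k + 1)) (hG0 k) (hG0' k)
          (biprod.lift (-(graph m S y).d (k + 5) (k + 6))
            (biprod.lift (((-1 : ℤ) ^ (k + 5)) • φ.app (k + 5)) (ψ (k + 4))))
          (B.d (k + 4) (k + 5)) (G.d (k + 4) (k + 5)) (θ.app (k + 4)) (T.d (k + 3) (k + 4))
          (G'.d (k + 3) (k + 4)))
    (by
      have hP₂' : ((graph m S y).d 2 3 : B.obj 1 ⊞ Y ⟶ Y) = biprod.desc y (-𝟙 Y) := hP₂
      have key := octToCone_conn_aux (S := S) (hP0 (m + 1)) (hG0' m) T.conn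
        (G'.conn : G'.obj (m + 3) ⟶ S.obj (B.obj 2)) β.inv ((graph m S y).d 2 3)
        (B.obj (m + 4)) (G.obj (m + 4))
      rw [hP₂'] at key
      change ((biprod.snd ≫ biprod.snd) ≫
          biprod.desc (T.conn ≫ S.map biprod.inl) (G'.conn ≫ S.map biprod.inr) ≫
          S.map β.inv ≫ S.map ((graph m S y).d 2 3)) ≫ S.map (𝟙 Y) = _
      rw [hP₂]
      exact key)
  have he : e.IsIso := by
    rintro (_ | _ | _ | k)
    · exact ⟨0, (isZero_zero A).eq_of_src _ _, (isZero_zero A).eq_of_src _ _⟩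
    · exact inferInstanceAs (IsIso (𝟙 Y))
    · refine ⟨(biprod.inr : _ ⟶ (graph m S y).obj 4 ⊞ (B.obj 3 ⊞ T.obj 2)), ?_, ?_⟩
      · change (biprod.snd : (graph m S y).obj 4 ⊞ (B.obj 3 ⊞ T.obj 2) ⟶ _) ≫ biprod.inr = 𝟙 _
        apply biprod.hom_ext'
        · exact (hP0 0).eq_of_src _ _
        · simp
      · exact biprod.inr_snd
    · refine ⟨biprod.map biprod.inl biprod.inl ≫ (biprod.inr : _ ⟶ (graph m S y).obj (k + 5) ⊞
              ((B.obj (k + 4) ⊞ G.obj (k + 4)) ⊞ (T.obj (k + 3) ⊞ G'.obj (k + 3)))), ?_, ?_⟩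
      · change ((biprod.snd : (graph m S y).obj (k + 5) ⊞
              ((B.obj (k + 4) ⊞ G.obj (k + 4)) ⊞ (T.obj (k + 3) ⊞ G'.obj (k + 3))) ⟶ _) ≫
            biprod.map biprod.fst biprod.fst) ≫ biprod.map biprod.inl biprod.inl ≫ biprod.inr = 𝟙 _
        apply biprod.hom_ext'
        · exact (hP0 (k + 1)).eq_of_src _ _
        · apply biprod.hom_ext' <;> apply biprod.hom_ext'
          · simp
          · exact (hG0 k).eq_of_src _ _
          · simp
          · exact (hG0' k).eq_of_src _ _
      · change (biprod.map biprod.inl biprod.inl ≫ (biprod.inr : _ ⟶ (graph m S y).obj (k + 5) ⊞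
              ((B.obj (k + 4) ⊞ G.obj (k + 4)) ⊞ (T.obj (k + 3) ⊞ G'.obj (k + 3))))) ≫
              biprod.snd ≫ biprod.map biprod.fst biprod.fst = 𝟙 _
        apply biprod.hom_ext' <;> apply biprod.hom_ext <;> simp
  refine ⟨u, hu₁, hu₂, hR.iso_closed e he hO, hY, IsAdditiveSubcategory.biprod_mem
    ((hR.isRightCSeq hB).mem 3 le_rfl (by omega)) hT₂, fun Z hZ g => ?_⟩
  rw [hO₁] at hOm
  obtain ⟨t, ht⟩ := hOm.2.2 hZ g
  refine ⟨(biprod.inr : _ ⟶ (0 : A) ⊞ (B.obj 3 ⊞ T.obj 2)) ≫ t, ?_⟩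
  rw [← ht, ← hφ₃ (φ.app 3) rfl]
  refine (Category.assoc _ _ _).symm.trans (congrArg (fun f => f ≫ t) ?_)
  change _ = (biprod.lift ((graph m S y).d 3 4) (φ.app 3) : Y ⟶ (0 : A) ⊞ (B.obj 3 ⊞ T.obj 2))
  apply biprod.hom_ext
  · exact (isZero_zero A).eq_of_tgt _ _
  · exact (Category.assoc _ _ _).trans ((congrArg (fun t => φ.app 3 ≫ t) biprod.inr_snd).trans
      ((Category.comp_id _).trans (biprod.lift_snd _ _).symm))

omit [S.Additive] [IsAdditiveSubcategory C] in
/-- The morphism `σ` which occurs in `exists_cone_mem`, composed with the first morphism of the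
cone. -/
lemma sigma_comp_first {B T : NSeq (m + 3) S} (hB : R B) {Y : A}
    (y : B.obj 1 ⟶ Y) (β : B.obj 1 ⊞ Y ≅ T.obj 1 ⊞ B.obj 2)
    (hβ : biprod.lift (𝟙 _) y ≫ β.hom ≫ biprod.snd = B.d 1 2) (l : B.obj 2 ⟶ T.obj 2)
    (hl : (biprod.lift (𝟙 _) y ≫ β.hom ≫ biprod.fst) ≫ T.d 1 2 = B.d 1 2 ≫ l) :
    (biprod.inl ≫ β.inv ≫ biprod.desc y (-𝟙 Y)) ≫
      biprod.lift (-(biprod.inr ≫ β.hom ≫ biprod.snd) ≫ B.d 2 3)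
          ((biprod.inr ≫ β.hom ≫ biprod.snd) ≫ l - (biprod.inr ≫ β.hom ≫ biprod.fst) ≫ T.d 1 2) =
      T.d 1 2 ≫ biprod.inr := by
  have e : (biprod.inl : _ ⟶ T.obj 1 ⊞ B.obj 2) = (biprod.inl ≫ β.inv ≫ biprod.fst) ≫
      biprod.lift (𝟙 _) y ≫ β.hom - (biprod.inl ≫ β.inv ≫ biprod.desc y (-𝟙 Y)) ≫
      biprod.inr ≫ β.hom := by
    rw [← cancel_mono β.inv, Preadditive.sub_comp]
    simp only [Category.assoc, Iso.hom_inv_id, Category.comp_id]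
    rw [← Preadditive.comp_sub, ← Preadditive.comp_sub]
    have : biprod.fst ≫ biprod.lift (𝟙 _) y - biprod.desc y (-𝟙 Y) ≫ biprod.inr =
        𝟙 (B.obj 1 ⊞ Y) := by
      apply biprod.hom_ext' <;> apply biprod.hom_ext <;> simp [Preadditive.sub_comp]
    rw [this, Category.comp_id]
  have e₁ := congrArg (fun t => t ≫ biprod.fst) e
  have e₂ := congrArg (fun t => t ≫ biprod.snd) e
  simp only [biprod.inl_fst, biprod.inl_snd, Preadditive.sub_comp, Category.assoc] at e₁ e₂
  rw [hβ, eq_comm, sub_eq_zero] at e₂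
  have h₂₃ := ((hR.isRightCSeq hB).weakCokernel 1 le_rfl (by omega)).1
  apply biprod.hom_ext
  · simp only [Category.assoc, biprod.lift_fst, Preadditive.comp_neg,
      biprod.inr_fst, comp_zero]
    rw [neg_eq_zero, ← Category.assoc β.hom]
    have := congrArg (fun t => t ≫ B.d 2 3) e₂
    simp only [Category.assoc] at this
    rw [Category.assoc, ← this, h₂₃, comp_zero, comp_zero, comp_zero]
  · have k₁ := congrArg (fun t => t ≫ T.d 1 2) e₁
    have k₂ := congrArg (fun t => t ≫ l) e₂
    simp only [Category.assoc, Preadditive.sub_comp, Category.id_comp] at k₁ k₂ hl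
    simp only [Category.assoc, biprod.lift_snd, biprod.inr_snd, Category.comp_id,
      Preadditive.comp_sub]
    rw [← k₂, ← hl]
    exact k₁.symm

end StrictCone

/-! ### Cones of standard angles -/

section StandardCone

variable {A : Type u} [Category.{v} A] [Preadditive A] [HasZeroObject A] [HasBinaryBiproducts A]
variable {m : ℕ} {S : A ⥤ A} [S.Additive] {C X : ObjectProperty A} {R : NSeq (m + 3) S → Prop}
  [IsAdditiveSubcategory X] [IsAdditiveSubcategory C]

open NSeq QuotCat

open scoped ZeroObject

omit [IsAdditiveSubcategory C] in
lemma QuotCat.homMk_fst_isIso {M N : A} {hM : C M} {hMN : C (M ⊞ N)} (h : X N) :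
    IsIso (homMk (biprod.fst : M ⊞ N ⟶ M) : (mk _ hMN : QuotCat C X) ⟶ mk _ hM) := by
  refine ⟨homMk biprod.inl, ?_, ?_⟩
  · rw [← homMk_comp, ← homMk_id, homMk_eq_iff]
    refine ⟨N, h, -biprod.snd, biprod.inr, ?_⟩
    rw [Preadditive.neg_comp, ← biprod.total]
    abel
  · rw [← homMk_comp, biprod.inl_fst, homMk_id]

omit [IsAdditiveSubcategory C] in
lemma QuotCat.homMk_snd_isIso {M N : A} {hN : C N} {hMN : C (M ⊞ N)} (h : X M) :
    IsIso (homMk (biprod.snd : M ⊞ N ⟶ N) : (mk _ hMN : QuotCat C X) ⟶ mk _ hN) := by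
  refine ⟨homMk biprod.inr, ?_, ?_⟩
  · rw [← homMk_comp, ← homMk_id, homMk_eq_iff]
    refine ⟨M, h, -biprod.fst, biprod.inl, ?_⟩
    rw [Preadditive.neg_comp, ← biprod.total]
    abel
  · rw [← homMk_comp, biprod.inr_snd, homMk_id]

omit [IsAdditiveSubcategory C] in
lemma QuotCat.hom_ext_inl {M N : A} {hM : C M} {hMN : C (M ⊞ N)} (hN : X N) {Z : QuotCat C X}
    {f g : (mk (M ⊞ N) hMN : QuotCat C X) ⟶ Z}
    (h : homMk (hM := hM) biprod.inl ≫ f = homMk biprod.inl ≫ g) : f = g := by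
  have := homMk_fst_isIso (hM := hM) (hMN := hMN) hN
  have e : inv (homMk (biprod.fst : M ⊞ N ⟶ M) : (mk _ hMN : QuotCat C X) ⟶ mk _ hM) =
      homMk biprod.inl :=
    IsIso.inv_eq_of_inv_hom_id (by rw [← homMk_comp, biprod.inl_fst, homMk_id])
  rw [← e] at h
  exact (cancel_epi _).1 h

omit [IsAdditiveSubcategory C] in
lemma QuotCat.hom_ext_inr {M N : A} {hN : C N} {hMN : C (M ⊞ N)} (hM : X M) {Z : QuotCat C X}
    {f g : (mk (M ⊞ N) hMN : QuotCat C X) ⟶ Z}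
    (h : homMk (hM := hN) biprod.inr ≫ f = homMk biprod.inr ≫ g) : f = g := by
  have := homMk_snd_isIso (hN := hN) (hMN := hMN) hM
  have e : inv (homMk (biprod.snd : M ⊞ N ⟶ N) : (mk _ hMN : QuotCat C X) ⟶ mk _ hN) =
      homMk biprod.inr :=
    IsIso.inv_eq_of_inv_hom_id (by rw [← homMk_comp, biprod.inr_snd, homMk_id])
  rw [← e] at h
  exact (cancel_epi _).1 h

lemma QuotCat.homMk_lift {K M N : A} {hK : C K} {hM : C M} {hN : C N} {hMN : C (M ⊞ N)}
    (f : K ⟶ M) (g : K ⟶ N) :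
    (homMk (biprod.lift (-f) g) : (mk _ hK : QuotCat C X) ⟶ mk _ hMN) ≫
      (biprodIso hM hN hMN).hom = biprod.lift (-homMk f) (homMk g) := by
  rw [biprodIso_hom]
  apply biprod.hom_ext
  · rw [Category.assoc, biprod.lift_fst, biprod.lift_fst, ← homMk_comp, biprod.lift_fst, homMk_neg]
  · rw [Category.assoc, biprod.lift_snd, biprod.lift_snd, ← homMk_comp, biprod.lift_snd]

/-- The matrices of a cone are preserved by the quotient functor. -/
lemma QuotCat.homMk_desc_lift {M N M' N' : A} {hM : C M} {hN : C N} {hM' : C M'} {hN' : C N'}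
    {hMN : C (M ⊞ N)} {hMN' : C (M' ⊞ N')} (f : M ⟶ M') (g : M ⟶ N') (h : N ⟶ N') :
    (homMk (biprod.desc (biprod.lift (-f) g) (biprod.lift 0 h)) :
      (mk _ hMN : QuotCat C X) ⟶ mk _ hMN') ≫ (biprodIso hM' hN' hMN').hom =
    (biprodIso hM hN hMN).hom ≫ biprod.desc (biprod.lift (-homMk f) (homMk g))
      (biprod.lift 0 (homMk h)) := by
  rw [biprodIso_hom, biprodIso_hom, biprod.lift_desc]
  apply biprod.hom_ext
  · simp only [Category.assoc, biprod.lift_fst, Preadditive.add_comp, comp_zero, add_zero,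
      Preadditive.comp_neg, ← homMk_comp, ← homMk_neg]
    congr 2
    apply biprod.hom_ext' <;> simp
  · simp only [Category.assoc, biprod.lift_snd, Preadditive.add_comp, ← homMk_comp, ← homMk_add]
    congr 2
    apply biprod.hom_ext' <;> simp

omit [S.Additive] in
lemma NSeq.redCone_d_one {P Q : NSeq (m + 3) S} (a : P.obj 1 ≅ Q.obj 1) (φ : Hom P Q) :
    (redCone a φ).d 1 2 = biprod.lift (-P.d 2 3) (φ.app 2) := cone_d_one _ _ _

omit [S.Additive] in
lemma NSeq.redCone_d {P Q : NSeq (m + 3) S} (a : P.obj 1 ≅ Q.obj 1) (φ : Hom P Q) (k : ℕ) :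
    (redCone a φ).d (k + 2) (k + 3) =
      biprod.desc (biprod.lift (-P.d (k + 3) (k + 4)) (φ.app (k + 3)))
        (biprod.lift 0 (Q.d (k + 2) (k + 3))) := cone_d _ _ _ _

omit [S.Additive] [IsAdditiveSubcategory X] in
/-- All objects of a sequence in `R` are in `C` if its first morphism is `X`-monic: for the first
two this is part of the definition of `X`-monic morphisms.  -/
lemma mem_of_monic (hR : IsRightSuspended m S C X R) {P : NSeq (m + 3) S} (hP : R P)
    (hP' : IsXMonic C X (P.d 1 2)) (i : ℕ) :
    C (P.obj i) := by
  by_cases h : i = 0 ∨ m + 3 < i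
  · exact IsAdditiveSubcategory.zero_mem (P.isZero i h)
  · obtain rfl | rfl | h' : i = 1 ∨ i = 2 ∨ 3 ≤ i := by omega
    · exact hP'.1
    · exact hP'.2.1
    · exact (hR.isRightCSeq hP).mem i h' (by omega)

variable (hR : IsRightSuspended m S C X R) (fix : ∀ M : A, C M → ApproxSeq C X R M)

include hR in
omit [IsAdditiveSubcategory C] in
omit [S.Additive] [IsAdditiveSubcategory X] in
/-- A morphism to the fixed approximation sequence over the identity; its last component is the
connecting morphism of a standard angle. -/
lemma exists_toQuot {P : NSeq (m + 3) S} (hP : R P) (hP' : IsXMonic C X (P.d 1 2)) :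
    ∃ φ : Hom P (fix (P.obj 1) hP'.1).seq, φ.app 1 = (fix (P.obj 1) hP'.1).e.inv :=
  exists_toApprox hR hP hP' _ _

variable {P Q : NSeq (m + 3) S} {hPC : ∀ i, C (P.obj i)} {hQC : ∀ i, C (Q.obj i)}
  {φ : Hom P (fix (P.obj 1) (hPC 1)).seq} {ψ : Hom Q (fix (Q.obj 1) (hQC 1)).seq}

variable {hR fix} in
lemma isStandard_toQuot (hP : R P) (hP' : IsXMonic C X (P.d 1 2))
    (hφ : φ.app 1 = (fix (P.obj 1) (hPC 1)).e.inv) :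
    IsStandard hR fix (toQuot hR fix P hPC (φ.app (m + 3))) :=
  ⟨P, hPC, φ, hP, hP', hφ, Hom.id _, Hom.id_isIso _⟩

/-- The last components of the comparison of a strict cone with the cone in the quotient. -/
lemma homMk_inr_comp_conn (hQ : R Q) (hQ' : IsXMonic C X (Q.d 1 2))
    (hψ : ψ.app 1 = (fix (Q.obj 1) (hQC 1)).e.inv) {Y : A} (hY : C Y) (σ : Q.obj 1 ⟶ Y)
    (u : ∀ i, P.obj i ⟶ Q.obj i) {first : Y ⟶ P.obj 3 ⊞ Q.obj 2}
    (h : σ ≫ first = Q.d 1 2 ≫ biprod.inr)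
    {hE : ∀ i, C ((cone u first (Q.conn ≫ S.map σ)).obj i)}
    {χ : Hom (cone u first (Q.conn ≫ S.map σ)) (fix Y hY).seq}
    (hχ : χ.app 1 = (fix Y hY).e.inv) :
    (homMk (ψ.app (m + 3)) : (mk _ (hQC (m + 3)) : QuotCat C X) ⟶ _) ≫
      (susp hR fix).map (homMk σ : (mk _ (hQC 1) : QuotCat C X) ⟶ mk Y hY) =
    homMk (hN := hE (m + 3)) (biprod.inr : Q.obj (m + 3) ⟶ P.obj (m + 4) ⊞ Q.obj (m + 3)) ≫
      homMk (hN := ApproxSeq.mem_last hR _) (χ.app (m + 3)) :=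
  (toQuotHom hR fix (Q := cone u first (Q.conn ≫ S.map σ)) (hQC := hE) hQ hQ' hψ hχ
    (toCone σ u h)).comm_conn

/-- The components of the comparison of a strict cone with the cone in the quotient. -/
noncomputable def toQuotConeApp (a : P.obj 1 ≅ Q.obj 1) (u : Hom P Q)
    (hE : ∀ i, C ((redCone a u).obj i)) (χ) :
    ∀ i, (toQuot hR fix (redCone a u) hE χ).obj i ⟶
      coneObj (mk _ (hPC 2)) (toQuot hR fix P hPC (φ.app (m + 3)))
        (toQuot hR fix Q hQC (ψ.app (m + 3))) i
  | 0 => 0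
  | 1 => 𝟙 _
  | k + 2 => (biprodIso (hPC (k + 3)) (hQC (k + 2)) (hE (k + 2))).hom

/-- The quotient functor maps a reduced mapping cone to a reduced mapping cone. -/
lemma isStandard_redCone (hP : R P) (hP' : IsXMonic C X (P.d 1 2)) (hQ : R Q)
    (hQ' : IsXMonic C X (Q.d 1 2)) (hφ : φ.app 1 = (fix (P.obj 1) (hPC 1)).e.inv)
    (hψ : ψ.app 1 = (fix (Q.obj 1) (hQC 1)).e.inv) (a : P.obj 1 ≅ Q.obj 1) (u : Hom P Q)
    (hu : u.app 1 = a.hom) (hE : R (redCone a u)) (hE' : IsXMonic C X ((redCone a u).d 1 2)) :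
    IsStandard hR fix (redCone (P := toQuot hR fix P hPC (φ.app (m + 3)))
      (Q := toQuot hR fix Q hQC (ψ.app (m + 3))) (mapIso (hPC 1) (hQC 1) a)
      (toQuotHom hR fix hP hP' hφ hψ u)) := by
  have hEC := mem_of_monic hR hE hE'
  obtain ⟨χ, hχ⟩ := exists_toApprox hR hE hE' (fix (P.obj 2) (hPC 2)) (fix (P.obj 2) (hPC 2)).e.inv
  refine ⟨redCone a u, hEC, χ, hE, hE', hχ, Hom.mk' (toQuotConeApp hR fix a u hEC _) ?_ ?_, ?_⟩
  · rintro (_ | _ | k) hk hk'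
    · omega
    · refine Eq.trans ?_ (congrArg (fun t => 𝟙 _ ≫ t)
        (redCone_d_one (P := toQuot hR fix P hPC (φ.app (m + 3)))
        (Q := toQuot hR fix Q hQC (ψ.app (m + 3))) (mapIso (hPC 1) (hQC 1) a)
        (toQuotHom hR fix hP hP' hφ hψ u)).symm)
      refine Eq.trans ?_ (Category.id_comp _).symm
      refine Eq.trans (congrArg (fun t => homMk (hM := hEC 1) (hN := hEC 2) t ≫
        (biprodIso (hPC 3) (hQC 2) (hEC 2)).hom) (redCone_d_one a u)) ?_
      exact homMk_lift _ _
    · refine Eq.trans ?_ (congrArg (fun t => (biprodIso (hPC (k + 3)) (hQC (k + 2))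
        (hEC (k + 2))).hom ≫ t) (redCone_d (P := toQuot hR fix P hPC (φ.app (m + 3)))
        (Q := toQuot hR fix Q hQC (ψ.app (m + 3))) (mapIso (hPC 1) (hQC 1) a)
        (toQuotHom hR fix hP hP' hφ hψ u) k).symm)
      refine Eq.trans (congrArg (fun t => homMk (hM := hEC (k + 2)) (hN := hEC (k + 3)) t ≫
        (biprodIso (hPC (k + 4)) (hQC (k + 3)) (hEC (k + 3))).hom) (redCone_d a u k)) ?_
      exact homMk_desc_lift _ _ _
  · have key := homMk_inr_comp_conn hR fix (P := P) (Q := Q) hQ hQ' hψ (hPC 2) (a.inv ≫ P.d 1 2)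
      u.app (first := biprod.lift (-P.d 2 3) (u.app 2)) (by
        have h₀ := ((hR.isRightCSeq hP).weakCokernel 1 le_rfl (by omega)).1
        have h₁ := u.comm 1 2
        apply biprod.hom_ext
        · simp [h₀]
        · simp [h₁, hu]) (hE := hEC) hχ
    rw [homMk_comp (hN := hPC 1)] at key
    change homMk (χ.app (m + 3)) ≫ (susp hR fix).map (𝟙 (mk _ (hPC 2))) =
      (biprodIso (hPC (m + 4)) (hQC (m + 3)) (hEC (m + 3))).hom ≫ biprod.snd ≫
        homMk (ψ.app (m + 3)) ≫ (susp hR fix).map (homMk a.inv ≫ homMk (P.d 1 2))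
    rw [CategoryTheory.Functor.map_id, key]
    refine (Category.comp_id _).trans (Eq.trans ?_ (biprod.lift_snd_assoc _ _ _).symm)
    refine hom_ext_inr (hN := hQC (m + 3)) (hMN := hEC (m + 3))
      (IsAdditiveSubcategory.zero_mem (P.isZero (m + 4) (by omega))) ?_
    have e : (homMk biprod.inr : (mk _ (hQC (m + 3)) : QuotCat C X) ⟶ mk _ (hEC (m + 3))) ≫
        homMk (biprod.snd : P.obj (m + 4) ⊞ Q.obj (m + 3) ⟶ Q.obj (m + 3)) =
        𝟙 (mk _ (hQC (m + 3))) := by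
      refine (homMk_comp (hN := hEC (m + 3)) _ _).symm.trans ?_
      rw [← homMk_id]
      exact congrArg homMk biprod.inr_snd
    exact (Category.id_comp _).symm.trans ((congrArg (fun t => t ≫ homMk biprod.inr ≫
      homMk (χ.app (m + 3))) e).symm.trans (Category.assoc _ _ _))
  · rintro (_ | _ | k)
    · exact ⟨0, (NSeq.isZero _ 0 (Or.inl rfl)).eq_of_src _ _,
        (NSeq.isZero _ 0 (Or.inl rfl)).eq_of_src _ _⟩
    · exact inferInstanceAs (IsIso (𝟙 _))
    · exact inferInstanceAs (IsIso (biprodIso (hPC (k + 3)) (hQC (k + 2)) (hEC (k + 2))).hom)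

omit [IsAdditiveSubcategory X] in
/-- Reduced mapping cones in a right suspended category: the case `Y = P₂` of
`exists_cone_mem`. -/
lemma exists_redCone_mem (hR : IsRightSuspended m S C X R) (hP : R P)
    (hP' : IsXMonic C X (P.d 1 2)) (hQ : R Q)
    (hQ' : IsXMonic C X (Q.d 1 2)) (a : P.obj 1 ≅ Q.obj 1) (l : P.obj 2 ⟶ Q.obj 2)
    (hl : a.hom ≫ Q.d 1 2 = P.d 1 2 ≫ l) :
    ∃ u : Hom P Q, u.app 1 = a.hom ∧ u.app 2 = l ∧ R (redCone a u) ∧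
      IsXMonic C X ((redCone a u).d 1 2) := by
  let β : P.obj 1 ⊞ P.obj 2 ≅ Q.obj 1 ⊞ P.obj 2 := biprod.mapIso a (Iso.refl _)
  have h₁ : biprod.lift (𝟙 _) (P.d 1 2) ≫ β.hom ≫ biprod.fst = a.hom := by simp [β]
  have h₂ : (biprod.inr : P.obj 2 ⟶ _) ≫ β.hom ≫ biprod.snd = 𝟙 _ := by simp [β]
  have h₃ : (biprod.inr : P.obj 2 ⟶ _) ≫ β.hom ≫ biprod.fst = 0 := by simp [β]
  have h₄ : (biprod.inl : Q.obj 1 ⟶ _) ≫ β.inv ≫ biprod.desc (P.d 1 2) (-𝟙 _) =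
    a.inv ≫ P.d 1 2 := by simp [β]
  obtain ⟨u, hu₁, hu₂, h, h'⟩ := exists_cone_mem hR hP hQ hQ' hP'.1 hP'.2.1 hP'.2.1 (P.d 1 2) β
    (by simp [β]) l (by rw [h₁, hl])
  have e : redCone a u = cone u.app (biprod.lift (-P.d 2 3) (u.app 2))
    (Q.conn ≫ S.map (a.inv ≫ P.d 1 2)) := rfl
  simp only [h₂, h₃, h₄, zero_comp, sub_zero, Category.id_comp, ← hu₂] at h h'
  refine ⟨u, hu₁.trans h₁, hu₂, h, ?_⟩
  rw [redCone_d_one]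
  exact h'

end StandardCone

/-! ### Generalized rotations -/

section RotationAlong

variable {D : Type u} [Category.{v} D] [Preadditive D] {m : ℕ} {T : D ⥤ D}

namespace NSeq

/-- `W` is isomorphic to the sequence `Y ⟶ V₃ ⟶ ⋯ ⟶ Vₙ ⟶ T K ⟶ T Y` with morphisms `τ ≫ v₂`, `v₃`,
…, `vₙ ≫ T κ` and `(-1)ⁿ T σ`.  For `τ = 1`, `κ = 1` and `σ = v₁` this is the left rotation of
`V`. -/
def IsRotationAlong (V W : NSeq (m + 3) T) {Y K : D} (τ : Y ⟶ V.obj 2) (κ : V.obj 1 ⟶ K)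
    (σ : K ⟶ Y) : Prop :=
  ∃ (a₁ : W.obj 1 ≅ Y) (a : ∀ i, 2 ≤ i → i ≤ m + 2 → (W.obj i ≅ V.obj (i + 1)))
    (b : W.obj (m + 3) ≅ T.obj K),
    W.d 1 2 ≫ (a 2 le_rfl (by omega)).hom = a₁.hom ≫ τ ≫ V.d 2 3 ∧
    (∀ i (h₁ : 2 ≤ i) (h₂ : i + 1 ≤ m + 2),
      W.d i (i + 1) ≫ (a (i + 1) (by omega) h₂).hom =
        (a i h₁ (by omega)).hom ≫ V.d (i + 1) (i + 2)) ∧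
    W.d (m + 2) (m + 3) ≫ b.hom = (a (m + 2) (by omega) le_rfl).hom ≫ V.conn ≫ T.map κ ∧
    W.conn ≫ T.map a₁.hom = ((-1 : ℤ) ^ (m + 3)) • (b.hom ≫ T.map σ)

lemma IsLeftRotation.isRotationAlong {V W : NSeq (m + 3) T} (h : V.IsLeftRotation W) :
    IsRotationAlong V W (𝟙 _) (𝟙 _) (V.d 1 2) := by
  obtain ⟨a, b, h₁, h₂, h₃⟩ := h
  refine ⟨a 1 le_rfl (by omega), fun i hi hi' => a i (by omega) hi', b, ?_, fun i hi hi' =>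
    h₁ i (by omega) hi', ?_, h₃⟩
  · rw [Category.id_comp]
    exact h₁ 1 le_rfl (by omega)
  · rw [T.map_id, Category.comp_id]
    exact h₂

lemma IsRotationAlong.of_hom {V V' W : NSeq (m + 3) T} {Y K : D} {τ : Y ⟶ V.obj 2}
    {κ : V.obj 1 ⟶ K} {σ : K ⟶ Y} (h : IsRotationAlong V W τ κ σ) (φ : Hom V' V) (hφ : φ.IsIso) :
    IsRotationAlong V' W (τ ≫ (φ.inv hφ).app 2) (φ.app 1 ≫ κ) σ := by
  obtain ⟨a₁, a, b, h₁, h₂, h₃, h₄⟩ := h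
  have : ∀ i, CategoryTheory.IsIso (φ.app i) := hφ
  refine ⟨a₁, fun i hi hi' => a i hi hi' ≪≫ (asIso (φ.app (i + 1))).symm, b, ?_, fun i hi hi' => ?_,
    ?_, h₄⟩
  · rw [Iso.trans_hom, reassoc_of% h₁, Iso.symm_hom, asIso_inv, Category.assoc,
      ← (φ.inv hφ).comm]
    rfl
  · rw [Iso.trans_hom, Iso.trans_hom, reassoc_of% h₂ i hi hi', Iso.symm_hom, asIso_inv,
      Iso.symm_hom, asIso_inv, Category.assoc]
    congr 1
    exact (φ.inv hφ).comm (i + 1) (i + 2)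
  · rw [h₃, Iso.trans_hom, Category.assoc, Iso.symm_hom, asIso_inv, T.map_comp,
      reassoc_of% φ.comm_conn, IsIso.inv_hom_id_assoc]

lemma IsRotationAlong.of_iso [T.Additive] {V W : NSeq (m + 3) T} {Y K Y' K' : D} {τ : Y ⟶ V.obj 2}
    {κ : V.obj 1 ⟶ K} {σ : K ⟶ Y} (h : IsRotationAlong V W τ κ σ) (y : Y ≅ Y') (k : K ≅ K') :
    IsRotationAlong V W (y.inv ≫ τ) (κ ≫ k.hom) (k.inv ≫ σ ≫ y.hom) := by
  obtain ⟨a₁, a, b, h₁, h₂, h₃, h₄⟩ := h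
  refine ⟨a₁ ≪≫ y, a, b ≪≫ T.mapIso k, ?_, h₂, ?_, ?_⟩
  · rw [h₁]
    simp
  · rw [Iso.trans_hom, reassoc_of% h₃]
    simp
  · rw [Iso.trans_hom, T.map_comp, reassoc_of% h₄, Preadditive.zsmul_comp]
    simp only [Category.assoc, ← T.map_comp, Iso.trans_hom, Functor.mapIso_hom, k.hom_inv_id_assoc]

end NSeq

end RotationAlong

section StrictRotation

variable {A : Type u} [Category.{v} A] [Preadditive A] [HasZeroObject A] [HasBinaryBiproducts A]
variable {m : ℕ} {S : A ⥤ A} [S.Additive] {C X : ObjectProperty A} {R : NSeq (m + 3) S → Prop}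
  [IsAdditiveSubcategory X] [IsAdditiveSubcategory C]

open NSeq QuotCat

open scoped ZeroObject

/-- A standard angle which comes from a sequence whose morphism `fₙ₋₁` is `X`-epic. -/
def IsBistandard (hR : IsRightSuspended m S C X R)
    (fix : ∀ M : A, C M → ApproxSeq C X R M) (W : NSeq (m + 3) (susp hR fix)) : Prop :=
  ∃ (P : NSeq (m + 3) S) (hP : ∀ i, C (P.obj i))
    (φ : NSeq.Hom P (fix (P.obj 1) (hP 1)).seq),
    R P ∧ IsXMonic C X (P.d 1 2) ∧ IsXEpic C X (P.d (m + 2) (m + 3)) ∧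
    φ.app 1 = (fix (P.obj 1) (hP 1)).e.inv ∧
    ∃ α : NSeq.Hom (toQuot hR fix P hP (φ.app (m + 3))) W, α.IsIso

lemma IsBistandard.isStandard {hR : IsRightSuspended m S C X R}
    {fix : ∀ M : A, C M → ApproxSeq C X R M} {W : NSeq (m + 3) (susp hR fix)}
    (h : IsBistandard hR fix W) : IsStandard hR fix W := by
  obtain ⟨P, hP, φ, h₁, h₂, -, h₃, h₄⟩ := h
  exact ⟨P, hP, φ, h₁, h₂, h₃, h₄⟩

section Auxiliary

variable {B B' T T' : A} {hB : C B} {hB' : C B'} {hT : C T} {hT' : C T'} {hBT : C (B ⊞ T)}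
  {hBT' : C (B' ⊞ T')}

omit [HasZeroObject A] in
lemma rotation_epic_aux {B B' T T' Z : A} (hB' : IsZero B') (d : B ⟶ B') (u : B ⟶ T')
    (t : T ⟶ T') (w : Z ⟶ T) (g : Z ⟶ B' ⊞ T') (h : w ≫ t = g ≫ biprod.snd) :
    (w ≫ biprod.inr) ≫ biprod.desc (biprod.lift (-d) u) (biprod.lift 0 t) = g := by
  apply biprod.hom_ext
  · exact hB'.eq_of_tgt _ _
  · rw [← h]
    simp

lemma zsmul_comp_comp {D : Type*} [Category* D] [Preadditive D] {P Q U V : D} (n : ℤ) (f : P ⟶ Q)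
    (g : Q ⟶ U) (h : U ⟶ V) (k : Q ⟶ V) (e : g ≫ h = k) :
    (n • (f ≫ g)) ≫ h = n • (f ≫ k) := by
  rw [Preadditive.zsmul_comp, Category.assoc, e]

lemma zsmul_comp_comp_zsmul {D : Type*} [Category* D] [Preadditive D] {P Q U V : D} {n n' : ℤ}
    (f : P ⟶ Q) (g : Q ⟶ U) (h : U ⟶ V) (k : Q ⟶ V) (e : g ≫ h = n' • k) (hn : n * n' = 1) :
    (n • (f ≫ g)) ≫ h = f ≫ k := by
  rw [Preadditive.zsmul_comp, Category.assoc, e, Preadditive.comp_zsmul, smul_smul, hn, one_smul]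

omit [IsAdditiveSubcategory C] in
lemma rotation_first_aux {Y B₂ : A} {hY : C Y} {hB₂ : C B₂} (τ : Y ⟶ B₂) (d : B₂ ⟶ B) (g : Y ⟶ T)
    {Z : QuotCat C X} (α : mk B hB ⟶ Z) :
    (homMk (biprod.lift (-τ ≫ d) g) : (mk Y hY : QuotCat C X) ⟶ mk _ hBT) ≫
      ((-1 : ℤ) ^ 1 • (homMk biprod.fst ≫ α)) = (homMk τ ≫ homMk (hM := hB₂) d) ≫ α := by
  rw [Preadditive.comp_zsmul, ← Category.assoc, ← homMk_comp, ← homMk_comp, biprod.lift_fst,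
    homMk_neg]
  simp

omit [IsAdditiveSubcategory C] in
lemma rotation_mid_aux (hTX : X T) (d : B ⟶ B') (u : B ⟶ T') (t : T ⟶ T') (k : ℕ)
    {Z : QuotCat C X} (α : mk B' hB' ⟶ Z) :
    (homMk (biprod.desc (biprod.lift (-d) u) (biprod.lift 0 t)) :
      (mk _ hBT : QuotCat C X) ⟶ mk _ hBT') ≫ ((-1 : ℤ) ^ (k + 1) • (homMk biprod.fst ≫ α)) =
      ((-1 : ℤ) ^ k • (homMk (hN := hB) biprod.fst ≫ homMk d ≫ α)) := by
  refine hom_ext_inl (hM := hB) hTX ?_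
  simp only [Preadditive.comp_zsmul, ← Category.assoc, ← homMk_comp, biprod.inl_desc,
    biprod.lift_fst, homMk_neg, biprod.inl_fst, Category.id_comp, Preadditive.neg_comp]
  rw [pow_succ, mul_neg_one, neg_smul, smul_neg, neg_neg]

omit [IsAdditiveSubcategory C] in
lemma rotation_last_aux (hTX : X T) (d : B ⟶ B') (u : B ⟶ T') (t : T ⟶ T') (k : ℕ)
    {Z : QuotCat C X} (α : mk T' hT' ⟶ Z) :
    (homMk (biprod.desc (biprod.lift (-d) u) (biprod.lift 0 t)) :
      (mk _ hBT : QuotCat C X) ⟶ mk _ hBT') ≫ ((-1 : ℤ) ^ k • (homMk biprod.snd ≫ α)) =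
      ((-1 : ℤ) ^ k • (homMk (hN := hB) biprod.fst ≫ homMk u ≫ α)) := by
  refine hom_ext_inl (hM := hB) hTX ?_
  simp only [Preadditive.comp_zsmul, ← Category.assoc, ← homMk_comp, biprod.inl_desc,
    biprod.lift_snd, biprod.inl_fst, Category.id_comp]

end Auxiliary

variable (hR : IsRightSuspended m S C X R) (fix : ∀ M : A, C M → ApproxSeq C X R M)

omit [IsAdditiveSubcategory C] in
/-- The last component of the comparison of a fixed approximation sequence with the fixed
omit [IsAdditiveSubcategory C] in
approximation sequence of its first term is an isomorphism. -/
lemma last_comp_susp_map_fix {K : A} (hK : C K) (hK₁ : C ((fix K hK).seq.obj 1))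
    (ψ : Hom (fix K hK).seq (fix ((fix K hK).seq.obj 1) hK₁).seq)
    (hψ : ψ.app 1 = (fix ((fix K hK).seq.obj 1) hK₁).e.inv) :
    (homMk (ψ.app (m + 3)) : (mk _ (ApproxSeq.mem_last hR _) : QuotCat C X) ⟶
      mk _ (ApproxSeq.mem_last hR _)) ≫
      (susp hR fix).map (homMk (fix K hK).e.hom : (mk _ hK₁ : QuotCat C X) ⟶
        QuotCat.mk K hK) = 𝟙 _ := by
  rw [← homMk_id]
  exact last_comp_susp_map hR fix (fix K hK).mem (fix K hK).monic hK₁ hK (fix K hK).e.hom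
    (ApproxSeq.mem_last hR _) ψ (Hom.id _) (by simp [hψ])

/-- Generalized rotations of a standard angle are standard, if the data along which the angle is
rotated come from the category itself. -/
lemma isBistandard_of_isRotationAlong
    (hfix : ∀ M hM, IsXEpic C X ((fix M hM).seq.d (m + 2) (m + 3)))
    {B : NSeq (m + 3) S} (hB : R B) (hB' : IsXMonic C X (B.d 1 2)) {hBC : ∀ i, C (B.obj i)}
    {φ : Hom B (fix (B.obj 1) (hBC 1)).seq} (hφ : φ.app 1 = (fix (B.obj 1) (hBC 1)).e.inv)
    {Y K : A} (hY : C Y) (hK : C K) (y : B.obj 1 ⟶ Y) (β : B.obj 1 ⊞ Y ≅ K ⊞ B.obj 2)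
    (hβ : biprod.lift (𝟙 _) y ≫ β.hom ≫ biprod.snd = B.d 1 2) {W : NSeq (m + 3) (susp hR fix)}
    (hW : IsRotationAlong (toQuot hR fix B hBC (φ.app (m + 3))) W
      (homMk (biprod.inr ≫ β.hom ≫ biprod.snd) : QuotCat.mk Y hY ⟶ QuotCat.mk _ _)
      (homMk (biprod.lift (𝟙 _) y ≫ β.hom ≫ biprod.fst) : QuotCat.mk _ _ ⟶ QuotCat.mk K hK)
      (homMk (biprod.inl ≫ β.inv ≫ biprod.desc y (-𝟙 Y)))) : IsBistandard hR fix W := by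
  let β' : B.obj 1 ⊞ Y ≅ (fix K hK).seq.obj 1 ⊞ B.obj 2 :=
    β ≪≫ biprod.mapIso (fix K hK).e.symm (Iso.refl _)
  have hβ₁ : β'.hom ≫ biprod.fst = (β.hom ≫ biprod.fst) ≫ (fix K hK).e.inv := by simp [β']
  have hβ₂ : β'.hom ≫ biprod.snd = β.hom ≫ biprod.snd := by simp [β']
  have hβ₃ : biprod.inl ≫ β'.inv = (fix K hK).e.hom ≫ biprod.inl ≫ β.inv := by simp [β']
  obtain ⟨l, hl⟩ := hB'.2.2 ((fix K hK).mem_X 2 le_rfl (by omega))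
    ((biprod.lift (𝟙 _) y ≫ β'.hom ≫ biprod.fst) ≫ (fix K hK).seq.d 1 2)
  obtain ⟨u, hu₁, -, hE, hE'⟩ := exists_cone_mem hR hB (fix K hK).mem (fix K hK).monic hB'.1
    hB'.2.1 hY y β' (by rw [hβ₂, hβ]) l hl.symm
  have hσ := sigma_comp_first hR hB y β' (by rw [hβ₂, hβ]) l hl.symm
  rw [hβ₂] at hE hE' hσ
  obtain ⟨g, hg⟩ : ∃ g, g = (biprod.inr ≫ β.hom ≫ biprod.snd) ≫ l -
    (biprod.inr ≫ β'.hom ≫ biprod.fst) ≫ (fix K hK).seq.d 1 2 := ⟨_, rfl⟩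
  rw [← hg] at hE hE' hσ
  obtain ⟨first, hfirst⟩ : ∃ f : Y ⟶ B.obj 3 ⊞ (fix K hK).seq.obj 2, f =
    biprod.lift (-(biprod.inr ≫ β.hom ≫ biprod.snd) ≫ B.d 2 3) g := ⟨_, rfl⟩
  obtain ⟨σ, hσ'⟩ : ∃ f, f = biprod.inl ≫ β'.inv ≫ biprod.desc y (-𝟙 Y) := ⟨_, rfl⟩
  rw [← hσ', ← hfirst] at hE hσ
  rw [← hfirst] at hE'
  have hTC := mem_of_monic hR (fix K hK).mem (fix K hK).monic
  obtain ⟨ψ, hψ⟩ := exists_toQuot hR fix (fix K hK).mem (fix K hK).monic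
  have hd₁ := cone_d_one u.app first ((fix K hK).seq.conn ≫ S.map σ)
  have hd := cone_d u.app first ((fix K hK).seq.conn ≫ S.map σ)
  have hEm := hE'
  rw [← hd₁] at hEm
  have hEC := mem_of_monic hR hE hEm
  obtain ⟨χ, hχ⟩ := exists_toApprox hR hE hEm (fix Y hY) (fix Y hY).e.inv
  have key := homMk_inr_comp_conn hR fix (P := B) (hQC := hTC) (ψ := ψ) (fix K hK).mem
    (fix K hK).monic hψ hY _ u.app hσ
    (hE := hEC) hχ
  have key₂ := last_comp_susp_map_fix hR fix hK (hTC 1) ψ hψ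
  have hu := (toQuotHom hR fix (hQC := hTC) (ψ := ψ) hB hB' hφ hψ u).comm_conn
  have key₃ : (homMk (biprod.inr : (fix K hK).seq.obj (m + 3) ⟶ B.obj (m + 4) ⊞ _) :
      (QuotCat.mk _ (hTC (m + 3)) : QuotCat C X) ⟶ QuotCat.mk _ (hEC (m + 3))) ≫
      homMk (hN := ApproxSeq.mem_last hR _) (χ.app (m + 3)) =
      (susp hR fix).map (homMk (biprod.inl ≫ β.inv ≫ biprod.desc y (-𝟙 Y)) :
        (QuotCat.mk K hK : QuotCat C X) ⟶ QuotCat.mk Y hY) := by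
    rw [← key, hσ', ← Category.assoc biprod.inl, hβ₃, Category.assoc, Category.assoc,
      homMk_comp (hN := hK), Functor.map_comp]
    exact (Category.assoc _ _ _).symm.trans ((congrArg (fun t => t ≫ (susp hR fix).map _)
      key₂).trans (Category.id_comp _))
  have key₄ : (homMk (φ.app (m + 3)) : (QuotCat.mk _ (hBC (m + 3)) : QuotCat C X) ⟶ _) ≫
      (susp hR fix).map (homMk (biprod.lift (𝟙 _) y ≫ β.hom ≫ biprod.fst) :
        (QuotCat.mk _ (hBC 1) : QuotCat C X) ⟶ QuotCat.mk K hK) =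
      (homMk (u.app (m + 3)) : QuotCat.mk _ (hBC (m + 3)) ⟶ QuotCat.mk _ (hTC (m + 3))) := by
    have e : biprod.lift (𝟙 _) y ≫ β.hom ≫ biprod.fst = u.app 1 ≫ (fix K hK).e.hom := by
      rw [hu₁, hβ₁]
      simp
    rw [e, homMk_comp (hN := hTC 1), Functor.map_comp]
    refine (Category.assoc _ _ _).symm.trans ?_
    refine (congrArg (fun t => t ≫ (susp hR fix).map (homMk (fix K hK).e.hom)) hu).trans ?_
    refine (Category.assoc _ _ _).trans ?_
    exact (congrArg (fun t => homMk (u.app (m + 3)) ≫ t) key₂).trans (Category.comp_id _)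
  obtain ⟨a₁, a, b, h₁, h₂, h₃, h₄⟩ := hW
  have hXT : ∀ k, k ≤ m → X ((fix K hK).seq.obj (k + 2)) := fun k hk =>
    (fix K hK).mem_X _ (by omega) (by omega)
  obtain ⟨app, happ, happ'⟩ := exists_components (P := toQuot hR fix _ hEC (χ.app (m + 3)))
    (Q := W) (fun i hi hi' => match i, hi, hi' with
      | 1, _, _ => a₁.inv
      | k + 2, _, hk => ((-1 : ℤ) ^ (k + 1)) • ((homMk (hN := hBC (k + 3)) (biprod.fst :
          B.obj (k + 3) ⊞ (fix K hK).seq.obj (k + 2) ⟶ _) :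
          QuotCat.mk _ (hEC (k + 2)) ⟶ _) ≫ (a (k + 2) (by omega) hk).inv))
    (((-1 : ℤ) ^ (m + 1)) • ((homMk (hN := hTC (m + 3)) (biprod.snd :
          B.obj (m + 4) ⊞ (fix K hK).seq.obj (m + 3) ⟶ _) :
          QuotCat.mk _ (hEC (m + 3)) ⟶ _) ≫ b.inv))
  have happ₁ := happ 1 le_rfl (by omega)
  have happ₂ := fun k hk => happ (k + 2) (by omega) hk
  dsimp only at happ₁ happ₂
  refine ⟨_, hEC, χ, hE, hEm, ?_, hχ, Hom.mk' app ?_ ?_, Hom.isIso_of_range _ ?_⟩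
  · refine ⟨hEC _, hEC _, fun Z hZ t => ?_⟩
    obtain ⟨w, hw⟩ := (hfix K hK).2.2 hZ (t ≫ (biprod.snd : B.obj (m + 4) ⊞ _ ⟶ _))
    refine ⟨w ≫ (biprod.inr : _ ⟶ B.obj (m + 3) ⊞ (fix K hK).seq.obj (m + 2)), ?_⟩
    refine (congrArg (fun d => (w ≫ (biprod.inr : _ ⟶ B.obj (m + 3) ⊞ (fix K hK).seq.obj (m + 2))) ≫
      d) (hd m)).trans ?_
    exact rotation_epic_aux (B.isZero (m + 4) (by omega)) _ _ _ w t hw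
  · rintro (_ | _ | k) hk hk'
    · omega
    · rw [happ₁, happ₂ 0 (by omega)]
      refine (congrArg (fun d => homMk (hM := hEC 1) (hN := hEC 2) d ≫
        (((-1 : ℤ) ^ (0 + 1)) • ((homMk (hN := hBC 3) (biprod.fst :
          B.obj 3 ⊞ (fix K hK).seq.obj 2 ⟶ _) :
          QuotCat.mk _ (hEC 2) ⟶ _) ≫ (a 2 (by omega) (by omega)).inv)))
          (hd₁.trans hfirst)).trans ?_
      refine (rotation_first_aux (hB₂ := hBC 2) (biprod.inr ≫ β.hom ≫ biprod.snd) (B.d 2 3) g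
        (a 2 (by omega) (by omega)).inv).trans ?_
      have e : a₁.inv ≫ W.d 1 2 = (homMk (biprod.inr ≫ β.hom ≫ biprod.snd) ≫
          (toQuot hR fix B hBC (φ.app (m + 3))).d 2 3) ≫ (a 2 le_rfl (by omega)).inv := by
        rw [Iso.inv_comp_eq, ← Category.assoc, Iso.eq_comp_inv]
        exact h₁
      exact e.symm
    · by_cases hk₂ : k + 3 ≤ m + 2
      · have e₁ : app (k + 1 + 1 + 1) = _ := happ₂ (k + 1) hk₂
        have e₂ : app (k + 1 + 1) = _ := happ₂ k (by omega)
        rw [e₁, e₂]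
        refine (congrArg (fun d => homMk (hM := hEC (k + 2)) (hN := hEC (k + 3)) d ≫
          (((-1 : ℤ) ^ (k + 1 + 1)) • ((homMk (hN := hBC (k + 4)) (biprod.fst :
            B.obj (k + 4) ⊞ (fix K hK).seq.obj (k + 3) ⟶ _) :
            QuotCat.mk _ (hEC (k + 3)) ⟶ _) ≫ (a (k + 3) (by omega) hk₂).inv))) (hd k)).trans ?_
        refine (rotation_mid_aux (hB := hBC (k + 3)) (hXT k (by omega)) _ _ _ (k + 1) _).trans ?_
        have e : (a (k + 2) (by omega) (by omega)).inv ≫ W.d (k + 2) (k + 3) =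
            (toQuot hR fix B hBC (φ.app (m + 3))).d (k + 3) (k + 4) ≫
              (a (k + 3) (by omega) hk₂).inv := by
          rw [Iso.inv_comp_eq, ← Category.assoc, Iso.eq_comp_inv]
          exact h₂ (k + 2) (by omega) hk₂
        exact (zsmul_comp_comp _ _ _ _ _ e).symm
      · obtain rfl : k = m := by omega
        have e₂ : app (k + 1 + 1) = _ := happ₂ k (by omega)
        have e₁ : app (k + 1 + 1 + 1) = _ := happ'
        rw [e₁, e₂]
        refine (congrArg (fun d => homMk (hM := hEC (k + 2)) (hN := hEC (k + 3)) d ≫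
          (((-1 : ℤ) ^ (k + 1)) • ((homMk (hN := hTC (k + 3)) (biprod.snd :
            B.obj (k + 4) ⊞ (fix K hK).seq.obj (k + 3) ⟶ _) :
            QuotCat.mk _ (hEC (k + 3)) ⟶ _) ≫ b.inv))) (hd k)).trans ?_
        refine (rotation_last_aux (hB := hBC (k + 3)) (hXT k (by omega)) _ _ _ (k + 1) _).trans ?_
        have e : (a (k + 2) (by omega) (by omega)).inv ≫ W.d (k + 2) (k + 3) =
            homMk (hM := hBC (k + 3)) (hN := hTC (k + 3)) (u.app (k + 3)) ≫ b.inv := by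
          refine (Iso.inv_comp_eq _).2 (((Iso.eq_comp_inv b).2 (h₃.trans ?_)).trans
            (Category.assoc _ _ _))
          exact congrArg (fun t => (a (k + 2) (by omega) (by omega)).hom ≫ t) key₄
        exact (zsmul_comp_comp _ _ _ _ _ e).symm
  · rw [happ₁, happ']
    have e : b.inv ≫ W.conn = ((-1 : ℤ) ^ (m + 3)) • ((susp hR fix).map
        (homMk (biprod.inl ≫ β.inv ≫ biprod.desc y (-𝟙 Y))) ≫ (susp hR fix).map a₁.inv) := by
      rw [Iso.inv_comp_eq, Preadditive.comp_zsmul, ← Category.assoc, ← Preadditive.zsmul_comp, ← h₄,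
        Category.assoc, ← Functor.map_comp, Iso.hom_inv_id, CategoryTheory.Functor.map_id,
        Category.comp_id]
    refine Eq.trans ?_ (zsmul_comp_comp_zsmul _ _ _ _ e (by
      rw [← pow_add, show m + 1 + (m + 3) = 2 * (m + 2) by omega, pow_mul, neg_one_sq,
        one_pow])).symm
    refine hom_ext_inr (hN := hTC (m + 3)) (hMN := hEC (m + 3))
      (IsAdditiveSubcategory.zero_mem (B.isZero (m + 4) (by omega))) ?_
    have e₁ : (homMk biprod.inr : (QuotCat.mk _ (hTC (m + 3)) : QuotCat C X) ⟶
        QuotCat.mk _ (hEC (m + 3))) ≫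
        homMk (biprod.snd : B.obj (m + 4) ⊞ (fix K hK).seq.obj (m + 3) ⟶ _) =
        𝟙 (QuotCat.mk _ (hTC (m + 3))) := by
      refine (homMk_comp (hN := hEC (m + 3)) _ _).symm.trans ?_
      rw [← homMk_id]
      exact congrArg homMk biprod.inr_snd
    refine (Category.assoc _ _ _).symm.trans ((congrArg (fun t => t ≫ (susp hR fix).map a₁.inv)
      key₃).trans ?_)
    exact (Category.id_comp _).symm.trans ((congrArg (fun t => t ≫ (susp hR fix).map
      (homMk (biprod.inl ≫ β.inv ≫ biprod.desc y (-𝟙 Y))) ≫ (susp hR fix).map a₁.inv)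
      e₁).symm.trans (Category.assoc _ _ _))
  · rintro (_ | _ | k) hk hk'
    · omega
    · change CategoryTheory.IsIso (app 1)
      rw [happ₁]
      exact (inferInstance : CategoryTheory.IsIso a₁.symm.hom)
    · by_cases hk₂ : k + 2 ≤ m + 2
      · have : CategoryTheory.IsIso (homMk biprod.fst : (QuotCat.mk _ (hEC (k + 2)) : QuotCat C X) ⟶
          QuotCat.mk _ (hBC (k + 3))) := homMk_fst_isIso (hM := hBC (k + 3))
            (hMN := hEC (k + 2)) (hXT k (by omega))
        have e : app (k + 1 + 1) = _ := happ₂ k hk₂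
        change CategoryTheory.IsIso (app (k + 1 + 1))
        rw [e]
        exact (inferInstance : CategoryTheory.IsIso (signIso (k + 1)
          (asIso (homMk biprod.fst : QuotCat.mk _ (hEC (k + 2)) ⟶ QuotCat.mk _ (hBC (k + 3))) ≪≫
            (a (k + 2) (by omega) hk₂).symm)).hom)
      · obtain rfl : k = m + 1 := by omega
        have : CategoryTheory.IsIso (homMk biprod.snd : (QuotCat.mk _ (hEC (m + 3)) : QuotCat C X) ⟶
          QuotCat.mk _ (hTC (m + 3))) := homMk_snd_isIso (hN := hTC (m + 3)) (hMN := hEC (m + 3))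
          (IsAdditiveSubcategory.zero_mem (P := X) (B.isZero (m + 4) (by omega)))
        change CategoryTheory.IsIso (app (m + 3))
        rw [happ']
        exact (inferInstance : CategoryTheory.IsIso (signIso (m + 1)
          (asIso (homMk biprod.snd : QuotCat.mk _ (hEC (m + 3)) ⟶ QuotCat.mk _ (hTC (m + 3))) ≪≫
            b.symm)).hom)

end StrictRotation

/-! ### Axioms for the standard angles -/

section StandardAxioms

variable {A : Type u} [Category.{v} A] [Preadditive A] [HasZeroObject A] [HasBinaryBiproducts A]
variable {m : ℕ} {S : A ⥤ A} [S.Additive] {C X : ObjectProperty A} {R : NSeq (m + 3) S → Prop}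
  [IsAdditiveSubcategory X] [IsAdditiveSubcategory C]

open NSeq QuotCat

open scoped ZeroObject

namespace IsStandard

variable {hR : IsRightSuspended m S C X R} {fix : ∀ M : A, C M → ApproxSeq C X R M}
  {V W : NSeq (m + 3) (susp hR fix)}

lemma of_isIso (h : IsStandard hR fix V) (φ : Hom V W) (hφ : φ.IsIso) : IsStandard hR fix W := by
  obtain ⟨P, hP, χ, h₁, h₂, h₃, α, hα⟩ := h
  exact ⟨P, hP, χ, h₁, h₂, h₃, α.comp φ, Hom.comp_isIso hα hφ⟩

lemma sum (hV : IsStandard hR fix V) (hW : IsStandard hR fix W) :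
    IsStandard hR fix (V.sum W) := by
  have := susp_additive hR fix
  obtain ⟨P, hP, φ, h₁, h₂, h₃, α, hα⟩ := hV
  obtain ⟨Q, hQ, ψ, h₁', h₂', h₃', β, hβ⟩ := hW
  have hPQ : ∀ i, C ((P.sum Q).obj i) := fun i =>
    IsAdditiveSubcategory.biprod_mem (hP i) (hQ i)
  have hm : IsXMonic C X ((P.sum Q).d 1 2) := by
    refine ⟨hPQ 1, hPQ 2, fun Z hZ (g : P.obj 1 ⊞ Q.obj 1 ⟶ Z) => ?_⟩
    obtain ⟨s, hs⟩ := h₂.2.2 hZ (biprod.inl ≫ g)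
    obtain ⟨t, ht⟩ := h₂'.2.2 hZ (biprod.inr ≫ g)
    refine ⟨(biprod.desc s t : P.obj 2 ⊞ Q.obj 2 ⟶ Z), ?_⟩
    change biprod.map (P.d 1 2) (Q.d 1 2) ≫ biprod.desc s t = g
    apply biprod.hom_ext' <;> simp [hs, ht]
  have hR' := hR.sum_closed h₁ h₁'
  obtain ⟨χ, hχ⟩ := exists_toApprox hR hR' hm (fix _ (hPQ 1)) (fix _ (hPQ 1)).e.inv
  have h : IsStandard hR fix (toQuot hR fix _ hPQ (χ.app (m + 3))) := isStandard_toQuot hR' hm hχ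
  refine (h.of_isIso (sumLift (toQuotHom hR fix hR' hm hχ h₃ (sumFst P Q))
    (toQuotHom hR fix hR' hm hχ h₃' (sumSnd P Q))) fun i => ?_).of_isIso (sumMap α β)
    (sumMap_isIso hα hβ)
  exact inferInstanceAs (IsIso (biprodIso (hP i) (hQ i) (hPQ i)).hom)

end IsStandard

lemma isStandard_trivial (hR : IsRightSuspended m S C X R)
    (fix : ∀ M : A, C M → ApproxSeq C X R M) (M : QuotCat C X) :
    IsStandard hR fix (trivial m (susp hR fix) M) := by
  obtain ⟨⟨M, hM⟩⟩ := M
  have h₀ : C (0 : A) := IsAdditiveSubcategory.zero_mem (isZero_zero A)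
  have hG := hR.graph_mem (0 : M ⟶ (0 : A)) hM h₀
  have hd : (graph m S (0 : M ⟶ (0 : A))).d 1 2 = (biprod.lift (𝟙 _) 0 : M ⟶ M ⊞ (0 : A)) :=
    ofSucc_d_succ _ _ _ _ _
  have hm : IsXMonic C X ((graph m S (0 : M ⟶ (0 : A))).d 1 2) := by
    rw [hd]
    exact ⟨hM, IsAdditiveSubcategory.biprod_mem hM h₀, fun Z hZ (g : M ⟶ Z) =>
      ⟨(biprod.fst : M ⊞ (0 : A) ⟶ _) ≫ g, (biprod.lift_fst_assoc (𝟙 _) _ g).trans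
        (Category.id_comp g)⟩⟩
  have hC := mem_of_monic hR hG hm
  have hz : ∀ k, IsZero ((graph m S (0 : M ⟶ (0 : A))).obj (k + 3)) := fun k => by
    cases k <;> exact isZero_zero A
  obtain ⟨χ, hχ⟩ := exists_toApprox hR hG hm (fix _ (hC 1)) (fix _ (hC 1)).e.inv
  have hiso := homMk_fst_isIso (C := C) (X := X) (hM := hM) (hMN := hC 2)
    (IsAdditiveSubcategory.zero_mem (isZero_zero A))
  have h : IsStandard hR fix (toQuot hR fix _ hC (χ.app (m + 3))) := isStandard_toQuot hG hm hχ
  refine h.of_isIso (W := trivial m (susp hR fix) (QuotCat.mk M hM)) (Hom.mk' (fun i => match i with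
    | 0 => 0
    | 1 => 𝟙 _
    | 2 => (homMk (biprod.fst : M ⊞ (0 : A) ⟶ M) : QuotCat.mk _ (hC 2) ⟶ QuotCat.mk _ hM)
    | _ + 3 => 0) ?_ ?_) ?_
  · rintro (_ | _ | k) hk hk'
    · omega
    · have e : (trivial m (susp hR fix) (QuotCat.mk M hM)).d 1 2 = 𝟙 _ :=
        ofSucc_d_succ _ _ _ _ _
      have e' : (homMk (biprod.lift (𝟙 _) 0) : (QuotCat.mk M hM : QuotCat C X) ⟶
          QuotCat.mk _ (hC 2)) ≫ homMk (hN := hM) (biprod.fst : M ⊞ (0 : A) ⟶ M) = 𝟙 _ := by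
        refine (homMk_comp (hN := hC 2) _ _).symm.trans ?_
        rw [← homMk_id]
        exact congrArg homMk (biprod.lift_fst _ _)
      refine (congrArg (fun d => homMk (hM := hC 1) (hN := hC 2) d ≫
        homMk (hN := hM) (biprod.fst : M ⊞ (0 : A) ⟶ M)) hd).trans (e'.trans ?_)
      exact ((congrArg (fun t => 𝟙 _ ≫ t) e).trans (Category.id_comp _)).symm
    · exact (isZero_zero (QuotCat C X)).eq_of_tgt _ _
  · exact (mk_isZero_of_isZero (hM := hC (m + 3)) (hz m)).eq_of_src _ _
  · rintro (_ | _ | _ | k)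
    · exact ⟨0, (NSeq.isZero _ 0 (Or.inl rfl)).eq_of_src _ _,
        (NSeq.isZero _ 0 (Or.inl rfl)).eq_of_src _ _⟩
    · exact inferInstanceAs (IsIso (𝟙 _))
    · exact hiso
    · exact ⟨0, (mk_isZero_of_isZero (hM := hC (k + 3)) (hz k)).eq_of_src _ _,
        (isZero_zero (QuotCat C X)).eq_of_src _ _⟩

variable {hR : IsRightSuspended m S C X R} {fix : ∀ M : A, C M → ApproxSeq C X R M}

lemma conj_comp {D : Type*} [Category* D] {P Q V W : D} {i : V ⟶ P} {j : P ⟶ V} (a : V ⟶ W)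
    {k : W ⟶ Q} {l : Q ⟶ W} (h : i ≫ j = 𝟙 _) (h' : k ≫ l = 𝟙 _) :
    (i ≫ j ≫ a ≫ k) ≫ l = a := by
  rw [Category.assoc, Category.assoc, Category.assoc, h', reassoc_of% h, Category.comp_id]

lemma conj_square {D : Type*} [Category* D] {P P' Q Q' V V' W W' : D} {d : P ⟶ P'} {d' : Q ⟶ Q'}
    {v : V ⟶ V'} {w : W ⟶ W'} {i : P ⟶ V} {i' : P' ⟶ V'} {j : W ⟶ Q} {j' : W' ⟶ Q'} {a : V ⟶ W}
    {a' : V' ⟶ W'} (h₁ : d ≫ i' = i ≫ v) (h₂ : w ≫ j' = j ≫ d') (h : v ≫ a' = a ≫ w) :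
    d ≫ i' ≫ a' ≫ j' = (i ≫ a ≫ j) ≫ d' := by
  rw [reassoc_of% h₁, reassoc_of% h, h₂, Category.assoc, Category.assoc]

/-- Commutative squares of `C/X` on the first morphisms of standard angles extend.  Such a square
commutes in `C` up to a morphism which factors through `X`, hence through the `X`-monic first
morphism, and can be corrected. -/
lemma IsStandard.complete {V W : NSeq (m + 3) (susp hR fix)} (hV : IsStandard hR fix V)
    (hW : IsStandard hR fix W) (a : V.obj 1 ⟶ W.obj 1) (b : V.obj 2 ⟶ W.obj 2)
    (h : V.d 1 2 ≫ b = a ≫ W.d 1 2) : ∃ φ : Hom V W, φ.app 1 = a ∧ φ.app 2 = b := by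
  obtain ⟨P, hP, φ, h₁, h₂, h₃, α, hα⟩ := hV
  obtain ⟨Q, hQ, ψ, h₁', h₂', h₃', β, hβ⟩ := hW
  obtain ⟨a', ha'⟩ := exists_homMk (hM := hP 1) (hN := hQ 1) (α.app 1 ≫ a ≫ (β.inv hβ).app 1)
  obtain ⟨b', hb'⟩ := exists_homMk (hM := hP 2) (hN := hQ 2) (α.app 2 ≫ b ≫ (β.inv hβ).app 2)
  have e : homMk (hM := hP 1) (hN := hQ 2) (X := X) (P.d 1 2 ≫ b') = homMk (a' ≫ Q.d 1 2) := by
    rw [homMk_comp (hN := hP 2), homMk_comp (hN := hQ 1), ha', hb']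
    exact conj_square (α.comm 1 2) ((β.inv hβ).comm 1 2) h
  obtain ⟨Z, hZ, p, q, hpq⟩ := (homMk_eq_iff _ _).1 e
  obtain ⟨r, hr⟩ := h₂.2.2 hZ p
  obtain ⟨ζ, hζ₁, hζ₂⟩ := hR.complete h₁ h₁' a' (b' - r ≫ q) (by
    rw [Preadditive.comp_sub, ← Category.assoc, hr, ← hpq]
    abel)
  have hb'' : homMk (hM := hP 2) (hN := hQ 2) (X := X) (b' - r ≫ q) = homMk b' := by
    rw [homMk_eq_iff]
    exact ⟨Z, hZ, -r, q, by rw [Preadditive.neg_comp]; abel⟩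
  refine ⟨((α.inv hα).comp (toQuotHom hR fix h₁ h₂ h₃ h₃' ζ)).comp β, ?_, ?_⟩
  · change ((α.inv hα).app 1 ≫ homMk (ζ.app 1)) ≫ β.app 1 = a
    rw [hζ₁]
    exact (congrArg (fun t => ((α.inv hα).app 1 ≫ t) ≫ β.app 1) ha').trans
      (conj_comp _ (α.inv_comp_app hα 1) (β.inv_comp_app hβ 1))
  · change ((α.inv hα).app 2 ≫ homMk (ζ.app 2)) ≫ β.app 2 = b
    rw [hζ₂]
    exact (congrArg (fun t => ((α.inv hα).app 2 ≫ t) ≫ β.app 2) (hb''.trans hb')).trans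
      (conj_comp _ (α.inv_comp_app hα 2) (β.inv_comp_app hβ 2))

/-- Left rotations of standard angles are standard: the case of `isBistandard_of_isRotationAlong`
where `y` is the first morphism.  -/
lemma IsStandard.isBistandard_of_isLeftRotation
    (hfix : ∀ M hM, IsXEpic C X ((fix M hM).seq.d (m + 2) (m + 3)))
    {V W : NSeq (m + 3) (susp hR fix)} (hV : IsStandard hR fix V) (hVW : V.IsLeftRotation W) :
    IsBistandard hR fix W := by
  have := susp_additive hR fix
  obtain ⟨P, hP, φ, h₁, h₂, h₃, α, hα⟩ := hV
  have : ∀ i, IsIso (α.app i) := hα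
  refine isBistandard_of_isRotationAlong hR fix hfix (hBC := hP) (φ := φ) h₁ h₂ h₃ (hP 2) (hP 1)
    (P.d 1 2) (Iso.refl _)
    (by simp) ?_
  have key := (hVW.isRotationAlong.of_hom α hα).of_iso (asIso (α.app 2)).symm (asIso (α.app 1)).symm
  have e₁ : (asIso (α.app 2)).symm.inv ≫ 𝟙 (V.obj 2) ≫ (α.inv hα).app 2 =
      homMk (biprod.inr ≫ (Iso.refl (P.obj 1 ⊞ P.obj 2)).hom ≫ biprod.snd) := by
    rw [Iso.refl_hom, Category.id_comp, Category.id_comp, biprod.inr_snd, homMk_id]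
    exact α.comp_inv_app hα 2
  have e₂ : (α.app 1 ≫ 𝟙 (V.obj 1)) ≫ (asIso (α.app 1)).symm.hom =
      homMk (biprod.lift (𝟙 _) (P.d 1 2) ≫ (Iso.refl (P.obj 1 ⊞ P.obj 2)).hom ≫ biprod.fst) := by
    rw [Iso.refl_hom, Category.comp_id, Category.id_comp, biprod.lift_fst, homMk_id]
    exact α.comp_inv_app hα 1
  have e₃ : (asIso (α.app 1)).symm.inv ≫ V.d 1 2 ≫ (asIso (α.app 2)).symm.hom =
      homMk (biprod.inl ≫ (Iso.refl (P.obj 1 ⊞ P.obj 2)).inv ≫ biprod.desc (P.d 1 2) (-𝟙 _)) := by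
    rw [Iso.refl_inv, Category.id_comp, biprod.inl_desc]
    have e₁ := α.comm 1 2
    refine (Category.assoc _ _ _).symm.trans ((congrArg (fun t => t ≫ (asIso (α.app 2)).symm.hom)
      e₁).symm.trans ((Category.assoc _ _ _).trans ?_))
    exact (congrArg (fun t => (toQuot hR fix P hP (φ.app (m + 3))).d 1 2 ≫ t)
      (α.comp_inv_app hα 2)).trans (Category.comp_id _)
  rw [← e₁, ← e₂, ← e₃]
  exact key

/-- Any two composable morphisms of `C/X` are covered by a morphism of standard angles with standard
reduced cone. -/
lemma exists_standard_cone {M N K : QuotCat C X} (f : M ⟶ N) (g : N ⟶ K) :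
    ∃ P Q : NSeq (m + 3) (susp hR fix), IsStandard hR fix P ∧ IsStandard hR fix Q ∧
    ∃ (e₁ : P.obj 1 ≅ M) (e₂ : P.obj 2 ≅ N) (a : P.obj 1 ≅ Q.obj 1) (e₃ : Q.obj 2 ≅ K)
      (φ : NSeq.Hom P Q), P.d 1 2 ≫ e₂.hom = e₁.hom ≫ f ∧ φ.app 1 = a.hom ∧
      φ.app 2 ≫ e₃.hom = e₂.hom ≫ g ∧ IsStandard hR fix (NSeq.redCone a φ) := by
  obtain ⟨⟨M, hM⟩⟩ := M
  obtain ⟨⟨N, hN⟩⟩ := N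
  obtain ⟨⟨K, hK⟩⟩ := K
  obtain ⟨f, rfl⟩ := exists_homMk (hM := hM) (hN := hN) f
  obtain ⟨g, rfl⟩ := exists_homMk (hM := hN) (hN := hK) g
  obtain ⟨P, hP, e₁, e₂, he⟩ := hR.exists_cone (fix M hM) f hM hN
  obtain ⟨Q, hQ, e₁', e₂', he'⟩ := hR.exists_cone (fix M hM) (f ≫ g) hM hK
  have hX₂ : X ((fix M hM).seq.obj 2) := (fix M hM).mem_X 2 le_rfl (by omega)
  have hmonic : ∀ {P : NSeq (m + 3) S} {N : A} (hN : C N) (f : M ⟶ N) (e₁ : P.obj 1 ≅ M)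
      (e₂ : P.obj 2 ≅ (fix M hM).seq.obj 2 ⊞ N),
      P.d 1 2 ≫ e₂.hom = e₁.hom ≫ biprod.lift ((fix M hM).e.inv ≫ (fix M hM).seq.d 1 2) f →
      IsXMonic C X (P.d 1 2) := by
    intro P N hN f e₁ e₂ he
    refine ⟨IsAdditiveSubcategory.iso_mem e₁.symm hM, IsAdditiveSubcategory.iso_mem e₂.symm
      (IsAdditiveSubcategory.biprod_mem (fix M hM).monic.2.1 hN), fun Z hZ t => ?_⟩
    obtain ⟨s, hs⟩ := (fix M hM).monic.2.2 hZ ((fix M hM).e.hom ≫ e₁.inv ≫ t)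
    refine ⟨e₂.hom ≫ biprod.fst ≫ s, ?_⟩
    rw [reassoc_of% he, biprod.lift_fst_assoc, Category.assoc, hs]
    simp
  have hP' := hmonic hN f e₁ e₂ he
  have hQ' := hmonic hK _ e₁' e₂' he'
  have hPC := mem_of_monic hR hP hP'
  have hQC := mem_of_monic hR hQ hQ'
  obtain ⟨φ, hφ⟩ := exists_toQuot hR fix hP hP'
  obtain ⟨ψ, hψ⟩ := exists_toQuot hR fix hQ hQ'
  obtain ⟨u, hu₁, hu₂, hE, hE'⟩ := exists_redCone_mem hR hP hP' hQ hQ' (e₁ ≪≫ e₁'.symm)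
    (e₂.hom ≫ biprod.map (𝟙 _) g ≫ e₂'.inv) (by
      rw [← cancel_mono e₂'.hom]
      simp only [Category.assoc, Iso.inv_hom_id, Category.comp_id, he', reassoc_of% he,
        Iso.trans_hom, Iso.symm_hom, Iso.inv_hom_id_assoc]
      congr 1
      apply biprod.hom_ext <;> simp)
  have hXN : C ((fix M hM).seq.obj 2 ⊞ N) :=
    IsAdditiveSubcategory.biprod_mem (fix M hM).monic.2.1 hN
  have hXK : C ((fix M hM).seq.obj 2 ⊞ K) :=
    IsAdditiveSubcategory.biprod_mem (fix M hM).monic.2.1 hK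
  have i₁ := homMk_snd_isIso (hN := hN) (hMN := hXN) hX₂
  have i₂ := homMk_snd_isIso (hN := hK) (hMN := hXK) hX₂
  refine ⟨toQuot hR fix P hPC (φ.app (m + 3)), toQuot hR fix Q hQC (ψ.app (m + 3)),
    isStandard_toQuot hP hP' hφ, isStandard_toQuot hQ hQ' hψ, mapIso (hPC 1) hM e₁,
    mapIso (hPC 2) hXN e₂ ≪≫ asIso (homMk biprod.snd), mapIso (hPC 1) (hQC 1) (e₁ ≪≫ e₁'.symm),
    mapIso (hQC 2) hXK e₂' ≪≫ asIso (homMk biprod.snd), toQuotHom hR fix hP hP' hφ hψ u, ?_, ?_, ?_,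
    isStandard_redCone hR fix hP hP' hQ hQ' hφ hψ _ u hu₁ hE hE'⟩
  · change homMk (hM := hPC 1) (hN := hPC 2) (P.d 1 2) ≫ homMk (hN := hXN) e₂.hom ≫
      homMk (hN := hN) biprod.snd = homMk (hM := hPC 1) (hN := hM) e₁.hom ≫ homMk f
    simp only [← homMk_comp, reassoc_of% he, biprod.lift_snd]
  · exact congrArg homMk hu₁
  · change homMk (hM := hPC 2) (hN := hQC 2) (u.app 2) ≫ homMk (hN := hXK) e₂'.hom ≫
      homMk (hN := hK) biprod.snd = (homMk (hN := hXN) e₂.hom ≫ homMk (hN := hN) biprod.snd) ≫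
        homMk g
    rw [hu₂]
    simp only [← homMk_comp, Category.assoc, Iso.inv_hom_id_assoc, biprod.map_snd]

end StandardAxioms

/-! ### Left sequences -/

section Left

variable {A : Type u} [Category.{v} A] [Preadditive A] {m : ℕ} {Ω S : A ⥤ A} (adj : Ω ⊣ S)

open Opposite

namespace NSeq

lemma eqToHom_comp_app {P Q : NSeq (m + 3) S} (φ : ∀ i, P.obj i ⟶ Q.obj i) {i j : ℕ} (h : i = j) :
    eqToHom (congrArg P.obj h) ≫ φ j = φ i ≫ eqToHom (congrArg Q.obj h) := by
  subst h
  simp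

lemma d_comp_eqToHom {B : Type*} [Category* B] [Preadditive B] {T : B ⥤ B} (Q : NSeq (m + 3) T)
    {i i' j j' : ℕ} (h : i = j) (h' : i' = j') :
    Q.d i i' ≫ eqToHom (congrArg Q.obj h') = eqToHom (congrArg Q.obj h) ≫ Q.d j j' := by
  subst h h'
  simp

/-- The morphism of left sequences attached to a morphism of sequences. -/
def toLeftHom {P Q : NSeq (m + 3) S} (φ : Hom P Q) : Hom (Q.toLeft adj) (P.toLeft adj) where
  app j := (φ.app (m + 4 - j)).op
  comm i j := congrArg Quiver.Hom.op (φ.comm (m + 4 - j) (m + 4 - i)).symm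
  comm_conn := by
    apply Quiver.Hom.unop_inj
    change Ω.map (φ.app (m + 3)) ≫ (adj.homEquiv _ _).symm Q.conn ≫ eqToHom _ =
      ((adj.homEquiv _ _).symm P.conn ≫ eqToHom _) ≫ φ.app (m + 4 - (m + 3))
    rw [Category.assoc, eqToHom_comp_app φ.app (show 1 = m + 4 - (m + 3) by omega),
      ← Category.assoc, ← adj.homEquiv_naturality_left_symm, ← φ.comm_conn,
      adj.homEquiv_naturality_right_symm, Category.assoc]

/-- A morphism of left sequences comes from a morphism of sequences, with the adjunction applied to
the square on the connecting morphisms.  -/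
lemma exists_hom_of_toLeft {P Q : NSeq (m + 3) S} (ψ : Hom (Q.toLeft adj) (P.toLeft adj)) :
    ∃ φ : Hom P Q, φ.app (m + 2) = (ψ.app 2).unop ∧ φ.app (m + 3) = (ψ.app 1).unop := by
  let c : ∀ i j, m + 4 - j = i → (P.obj i ⟶ Q.obj i) := fun i j h =>
    eqToHom (congrArg P.obj h.symm) ≫ (ψ.app j).unop ≫ eqToHom (congrArg Q.obj h)
  have hc : ∀ j, c (m + 4 - j) j rfl = (ψ.app j).unop := fun j =>
    (Category.id_comp _).trans (Category.comp_id _)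
  have hcomm : ∀ i i' j j' (h : m + 4 - j = i) (h' : m + 4 - j' = i'),
      P.d i i' ≫ c i' j' h' = c i j h ≫ Q.d i i' := by
    rintro i i' j j' rfl rfl
    rw [hc, hc]
    exact congrArg Quiver.Hom.unop (ψ.comm j' j).symm
  let app : ∀ i, P.obj i ⟶ Q.obj i := fun i => if h : i ≤ m + 4 then c i (m + 4 - i) (by omega)
    else 0
  have happ : ∀ i (h : i ≤ m + 4), app i = c i (m + 4 - i) (by omega) := fun i h => dif_pos h
  have happ' : ∀ i j (h : m + 4 - j = i) (_ : j ≤ m + 4), app i = c i j h := by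
    intro i j h hj
    obtain rfl : m + 4 - i = j := by omega
    exact happ i (by omega)
  have h₁ : app (m + 3) = (ψ.app 1).unop := (happ' (m + 3) 1 rfl (by omega)).trans (hc 1)
  refine ⟨Hom.mk' app ?_ ?_, (happ' (m + 2) 2 rfl (by omega)).trans (hc 2), h₁⟩
  · intro i hi hi'
    rw [happ i (by omega), happ (i + 1) (by omega)]
    exact hcomm _ _ _ _ (by omega) (by omega)
  · have key := congrArg Quiver.Hom.unop ψ.comm_conn
    have e : 1 = m + 4 - (m + 3) := by omega
    replace key : Ω.map (app (m + 3)) ≫ (adj.homEquiv _ _).symm Q.conn ≫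
        eqToHom (congrArg Q.obj e) =
      ((adj.homEquiv _ _).symm P.conn ≫ eqToHom (congrArg P.obj e)) ≫ (ψ.app (m + 3)).unop := by
      rw [h₁]
      exact key
    rw [happ' 1 (m + 3) (by omega) (by omega)]
    apply (adj.homEquiv _ _).symm.injective
    rw [adj.homEquiv_naturality_right_symm, adj.homEquiv_naturality_left_symm]
    have aux : ∀ g : P.obj (m + 4 - (m + 3)) ⟶ Q.obj (m + 4 - (m + 3)),
        Ω.map (app (m + 3)) ≫ (adj.homEquiv _ _).symm Q.conn ≫ eqToHom (congrArg Q.obj e) =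
          ((adj.homEquiv _ _).symm P.conn ≫ eqToHom (congrArg P.obj e)) ≫ g →
        (adj.homEquiv _ _).symm P.conn ≫ eqToHom (congrArg P.obj e) ≫ g ≫
          eqToHom (congrArg Q.obj e.symm) =
            Ω.map (app (m + 3)) ≫ (adj.homEquiv _ _).symm Q.conn := by
      intro g hg
      rw [Category.assoc] at hg
      rw [← reassoc_of% hg]
      simp
    exact aux _ key

/-- The sequence `A₁ ⟶ ⋯ ⟶ Aₙ ⟶ S A₁` attached to a left sequence `Ω Aₙ ⟶ A₁ ⟶ ⋯ ⟶ Aₙ`. -/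
def fromLeft (Q : NSeq (A := Aᵒᵖ) (m + 3) Ω.op) : NSeq (m + 3) S where
  obj i := unop (Q.obj (m + 4 - i))
  d i j := (Q.d (m + 4 - j) (m + 4 - i)).unop
  shape i j h := by
    apply Quiver.Hom.op_inj
    by_cases hi : m + 4 ≤ i
    · exact (Q.isZero _ (by omega)).eq_of_tgt _ _
    · by_cases hj : m + 4 ≤ j
      · exact (Q.isZero _ (by omega)).eq_of_src _ _
      · exact Q.shape _ _ (by omega)
  isZero i h := (Q.isZero (m + 4 - i) (by omega)).unop
  conn := eqToHom (congrArg (fun i => unop (Q.obj i)) (show m + 4 - (m + 3) = 1 by omega)) ≫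
    adj.homEquiv (unop (Q.obj 1)) (unop (Q.obj (m + 3))) Q.conn.unop

omit [Preadditive A] in
lemma fromLeft_conn_aux {M M' N N' : A} (q : Ω.obj M ⟶ N) (h : M = M') (h' : N = N') :
    Ω.map (eqToHom h) ≫ (adj.homEquiv M' N).symm (eqToHom h.symm ≫ adj.homEquiv M N q) ≫
      eqToHom h' = q ≫ eqToHom h' := by
  subst h h'
  simp

/-- `toLeft` and `fromLeft` are inverse to each other up to the identification of `m + 4 - (m + 4 -
j)` with `j`.  -/
lemma exists_toLeft_fromLeft (Q : NSeq (A := Aᵒᵖ) (m + 3) Ω.op) :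
    ∃ α : Hom ((fromLeft adj Q).toLeft adj) Q, α.IsIso := by
  let app : ∀ j, ((fromLeft adj Q).toLeft adj).obj j ⟶ Q.obj j := fun j => if h : j ≤ m + 4 then
    eqToHom (congrArg Q.obj (show m + 4 - (m + 4 - j) = j by omega)) else 0
  have happ : ∀ j (h : j ≤ m + 4), app j = eqToHom (congrArg Q.obj
    (show m + 4 - (m + 4 - j) = j by omega)) := fun j h => dif_pos h
  refine ⟨Hom.mk' app ?_ ?_, Hom.isIso_of_range _ ?_⟩
  · intro j hj hj'
    rw [happ j (by omega), happ (j + 1) (by omega)]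
    exact d_comp_eqToHom Q (by omega) (by omega)
  · rw [happ 1 (by omega), happ (m + 3) (by omega)]
    apply Quiver.Hom.unop_inj
    have e₁ : unop (Q.obj 1) = unop (Q.obj (m + 4 - (m + 3))) :=
      congrArg (fun i => unop (Q.obj i)) (by omega)
    have e₂ : unop (Q.obj (m + 3)) = unop (Q.obj (m + 4 - (m + 4 - (m + 3)))) :=
      congrArg (fun i => unop (Q.obj i)) (by omega)
    refine Eq.trans ?_ ((fromLeft_conn_aux adj Q.conn.unop e₁ e₂).trans ?_)
    · exact congrArg (fun t => Ω.map t ≫ (adj.homEquiv _ _).symm _ ≫ eqToHom e₂)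
        (eqToHom_unop _)
    · exact congrArg (fun t => Q.conn.unop ≫ t) (eqToHom_unop _).symm
  · intro j hj hj'
    change CategoryTheory.IsIso (app j)
    rw [happ j (by omega)]
    exact (eqToIso (congrArg Q.obj (show m + 4 - (m + 4 - j) = j by omega))).isIso_hom

end NSeq

end Left

/-! ### Frobenius prile categories -/

section Prile

variable {A : Type u} [Category.{v} A] [Preadditive A] [HasZeroObject A] [HasBinaryBiproducts A]
  {m : ℕ} {Ω S : A ⥤ A} {adj : Ω ⊣ S} {C X : ObjectProperty A}
  {L : NSeq (A := Aᵒᵖ) (m + 3) Ω.op → Prop} {R : NSeq (m + 3) S → Prop}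

open NSeq QuotCat Opposite

namespace FrobeniusPrile

variable (F : FrobeniusPrile m adj C X L R)

include F

/-- In a Frobenius prile category, a commutative square between the morphisms `fₙ₋₁` extends to a
morphism of sequences. -/
lemma complete_last {P Q : NSeq (m + 3) S} (hP : R P) (hQ : R Q) (hPC : ∀ i, C (P.obj i))
    (hQC : ∀ i, C (Q.obj i)) (a : P.obj (m + 2) ⟶ Q.obj (m + 2)) (b : P.obj (m + 3) ⟶ Q.obj (m + 3))
    (h : P.d (m + 2) (m + 3) ≫ b = a ≫ Q.d (m + 2) (m + 3)) :
    ∃ φ : Hom P Q, φ.app (m + 2) = a ∧ φ.app (m + 3) = b := by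
  obtain ⟨ψ, h₁, h₂⟩ := F.left.complete ((F.exchange Q hQC).2 hQ) ((F.exchange P hPC).2 hP)
    b.op a.op (congrArg Quiver.Hom.op h.symm)
  obtain ⟨φ, h₃, h₄⟩ := exists_hom_of_toLeft adj ψ
  exact ⟨φ, h₃.trans (congrArg Quiver.Hom.unop h₂), h₄.trans (congrArg Quiver.Hom.unop h₁)⟩

/-- In a Frobenius prile category, a morphism of sequences whose last component factors through
`fₙ₋₁` has a first component which factors through `f₁`. -/
lemma factor_first {P Q : NSeq (m + 3) S} (hP : R P) (hQ : R Q) (hPC : ∀ i, C (P.obj i))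
    (hQC : ∀ i, C (Q.obj i)) (hX : ∀ i, 2 ≤ i → i ≤ m + 2 → X (P.obj i)) (φ : Hom P Q)
    (w : P.obj (m + 3) ⟶ Q.obj (m + 2)) (h : w ≫ Q.d (m + 2) (m + 3) = φ.app (m + 3)) :
    ∃ r : P.obj 2 ⟶ Q.obj 1, P.d 1 2 ≫ r = φ.app 1 := by
  obtain ⟨t, ht⟩ := F.left.factor ((F.exchange Q hQC).2 hQ) ((F.exchange P hPC).2 hP)
    (fun i hi hi' => hX (m + 4 - i) (by omega) (by omega)) (toLeftHom adj φ)
    ⟨w.op, congrArg Quiver.Hom.op h⟩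
  have e₂ : m + 4 - (m + 2) = 2 := by omega
  have e₁ : m + 4 - (m + 3) = 1 := by omega
  have key : ∀ i j, i = 1 → j = 2 → (∃ r : P.obj j ⟶ Q.obj i, P.d i j ≫ r = φ.app i) →
      ∃ r : P.obj 2 ⟶ Q.obj 1, P.d 1 2 ≫ r = φ.app 1 := by
    rintro i j rfl rfl h
    exact h
  exact key _ _ e₁ e₂ ⟨t.unop, congrArg Quiver.Hom.unop ht⟩

variable [S.Additive] [IsAdditiveSubcategory C] [IsAdditiveSubcategory X]

/-- A morphism `𝔾 M ⟶ 𝔾 N` is the last component of a morphism of fixed sequences, because `fₙ₋₁` in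
the sequence of `N` is a right `X`-approximation and squares on these morphisms extend. -/
lemma susp_full : (susp F.right F.fixR).Full where
  map_surjective := by
    rintro ⟨⟨M, hM⟩⟩ ⟨⟨N, hN⟩⟩ g
    obtain ⟨g, rfl⟩ := exists_homMk (hM := ApproxSeq.mem_last F.right (F.fixR M hM))
      (hN := ApproxSeq.mem_last F.right (F.fixR N hN)) g
    obtain ⟨a, ha⟩ := (F.epic_fixR N hN).2.2 ((F.fixR M hM).mem_X (m + 2) (by omega) le_rfl)
      ((F.fixR M hM).seq.d (m + 2) (m + 3) ≫ g)
    obtain ⟨φ, -, hφ⟩ := F.complete_last (F.fixR M hM).mem (F.fixR N hN).mem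
      (mem_of_monic F.right (F.fixR M hM).mem (F.fixR M hM).monic)
      (mem_of_monic F.right (F.fixR N hN).mem (F.fixR N hN).monic) a g ha.symm
    refine ⟨homMk ((F.fixR M hM).e.inv ≫ φ.app 1 ≫ (F.fixR N hN).e.hom), ?_⟩
    rw [← hφ]
    exact susp_map F.right F.fixR hM hN _ φ (by simp)

/-- If `𝔾 f = 0`, then the last component of a morphism over `f` factors through the right
`X`-approximation `fₙ₋₁`, so that `f` factors through `X` by the dual of the axiom on lifts of last
components. -/
lemma susp_faithful : (susp F.right F.fixR).Faithful where
  map_injective := by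
    have := susp_additive F.right F.fixR
    rintro ⟨⟨M, hM⟩⟩ ⟨⟨N, hN⟩⟩ f g h
    rw [← sub_eq_zero, ← Functor.map_sub] at h
    rw [← sub_eq_zero]
    obtain ⟨f, hf⟩ := exists_homMk (hM := hM) (hN := hN) (f - g)
    obtain ⟨φ, hφ⟩ := ApproxSeq.exists_lift F.right (F.fixR M hM) (F.fixR N hN) f
    change (susp F.right F.fixR).map (_ : QuotCat.mk M hM ⟶ QuotCat.mk N hN) = 0 at h
    change (_ : QuotCat.mk M hM ⟶ QuotCat.mk N hN) = 0
    rw [← hf] at h ⊢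
    rw [susp_map F.right F.fixR hM hN f φ hφ] at h
    obtain ⟨Z, hZ, p, q, e⟩ := (homMk_eq_zero_iff _).1 h
    obtain ⟨w, hw⟩ := (F.epic_fixR N hN).2.2 hZ q
    obtain ⟨r, hr⟩ := F.factor_first (F.fixR M hM).mem (F.fixR N hN).mem
      (mem_of_monic F.right (F.fixR M hM).mem (F.fixR M hM).monic)
      (mem_of_monic F.right (F.fixR N hN).mem (F.fixR N hN).monic) (F.fixR M hM).mem_X φ (p ≫ w)
      (by rw [Category.assoc, hw, e])
    rw [homMk_eq_zero_iff]
    refine ⟨_, (F.fixR M hM).mem_X 2 le_rfl (by omega), (F.fixR M hM).e.inv ≫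
      (F.fixR M hM).seq.d 1 2, r ≫ (F.fixR N hN).e.hom, ?_⟩
    rw [Category.assoc, reassoc_of% hr, hφ]
    simp

/-- The fixed left sequence of `N` is, via the adjunction, an approximation sequence which ends in
`N`.  -/
lemma susp_essSurj : (susp F.right F.fixR).EssSurj where
  mem_essImage := by
    rintro ⟨⟨N, hN⟩⟩
    let Q := F.fixL N hN
    let P := fromLeft adj Q.seq
    have hQC : ∀ i, C (unop (Q.seq.obj i)) := by
      intro i
      by_cases h : i = 0 ∨ m + 3 < i
      · exact IsAdditiveSubcategory.zero_mem (Q.seq.isZero i h).unop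
      · obtain rfl | rfl | h' : i = 1 ∨ i = 2 ∨ 3 ≤ i := by omega
        · exact Q.monic.1
        · exact Q.monic.2.1
        · exact (F.left.isRightCSeq Q.mem).mem i h' (by omega)
    have hPC : ∀ i, C (P.obj i) := fun i => hQC _
    obtain ⟨α, hα⟩ := exists_toLeft_fromLeft adj Q.seq
    have hP : R P := (F.exchange P hPC).1 (F.left.iso_closed (α.inv hα) (α.inv_isIso hα) Q.mem)
    have hP' : IsXMonic C X (P.d 1 2) := F.monic_fixL N hN
    let P' : ApproxSeq C X R (P.obj 1) :=
      { seq := P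
        mem := hP
        e := Iso.refl _
        mem_X := fun i hi hi' => Q.mem_X (m + 4 - i) (by omega) (by omega)
        monic := hP' }
    obtain ⟨φ, hφ⟩ := exists_toApprox F.right hP hP' (F.fixR _ (hPC 1)) (F.fixR _ (hPC 1)).e.inv
    obtain ⟨ψ, hψ⟩ := exists_toApprox F.right (F.fixR _ (hPC 1)).mem (F.fixR _ (hPC 1)).monic P'
      (F.fixR _ (hPC 1)).e.hom
    have hφn : (homMk (φ.app (m + 3)) : (QuotCat.mk _ (hPC (m + 3)) : QuotCat C X) ⟶
        QuotCat.mk _ (ApproxSeq.mem_last F.right _)) ≫ homMk (hN := hPC (m + 3)) (ψ.app (m + 3)) =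
        𝟙 _ := by
      rw [← homMk_comp, ← homMk_id]
      exact homMk_app_last_eq F.right hP hP' P' (φ.comp ψ) (Hom.id _)
        (by rw [Hom.comp_app, hφ, hψ, Iso.inv_hom_id]; rfl)
    have hψn : (homMk (hN := hPC (m + 3)) (ψ.app (m + 3)) : (QuotCat.mk _
        (ApproxSeq.mem_last F.right (F.fixR _ (hPC 1))) : QuotCat C X) ⟶ _) ≫
        homMk (φ.app (m + 3)) = 𝟙 _ := by
      rw [← homMk_comp, ← homMk_id]
      exact homMk_app_last_eq F.right (F.fixR _ (hPC 1)).mem (F.fixR _ (hPC 1)).monic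
        (F.fixR _ (hPC 1)) (ψ.comp φ) (Hom.id _)
        (by rw [Hom.comp_app, hφ, hψ, Iso.hom_inv_id]; rfl)
    have hNe : N = unop (op N) := rfl
    let e : P.obj (m + 3) ≅ N := eqToIso (congrArg (fun i => unop (Q.seq.obj i))
      (show m + 4 - (m + 3) = 1 by omega)) ≪≫ Q.e.symm.unop
    exact ⟨QuotCat.mk (P.obj 1) (hPC 1), ⟨({ hom := homMk (ψ.app (m + 3))
                                             inv := homMk (φ.app (m + 3))
                                             hom_inv_id := hψn
                                             inv_hom_id := hφn } :
      (QuotCat.mk _ (ApproxSeq.mem_last F.right (F.fixR _ (hPC 1))) : QuotCat C X) ≅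
        QuotCat.mk (P.obj (m + 3)) (hPC (m + 3))) ≪≫ mapIso (hPC (m + 3)) hN e⟩⟩

lemma susp_isEquivalence : (susp F.right F.fixR).IsEquivalence where
  faithful := F.susp_faithful
  full := F.susp_full
  essSurj := F.susp_essSurj

/-- The dual of `IsStandard.complete`: the square is corrected by means of the `X`-epic morphisms
`fₙ₋₁`, and then extended in the left suspended structure. -/
lemma complete_last_of_isBistandard {V W : NSeq (m + 3) (susp F.right F.fixR)}
    (hV : IsBistandard F.right F.fixR V) (hW : IsBistandard F.right F.fixR W)
    (a : V.obj (m + 2) ⟶ W.obj (m + 2)) (b : V.obj (m + 3) ⟶ W.obj (m + 3))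
    (h : V.d (m + 2) (m + 3) ≫ b = a ≫ W.d (m + 2) (m + 3)) :
    ∃ φ : Hom V W, φ.app (m + 2) = a ∧ φ.app (m + 3) = b := by
  obtain ⟨P, hP, φ, h₁, h₂, -, h₃, α, hα⟩ := hV
  obtain ⟨Q, hQ, ψ, h₁', h₂', h₄, h₃', β, hβ⟩ := hW
  obtain ⟨a', ha'⟩ := exists_homMk (hM := hP (m + 2)) (hN := hQ (m + 2))
    (α.app (m + 2) ≫ a ≫ (β.inv hβ).app (m + 2))
  obtain ⟨b', hb'⟩ := exists_homMk (hM := hP (m + 3)) (hN := hQ (m + 3))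
    (α.app (m + 3) ≫ b ≫ (β.inv hβ).app (m + 3))
  have e : homMk (hM := hP (m + 2)) (hN := hQ (m + 3)) (X := X) (P.d (m + 2) (m + 3) ≫ b') =
      homMk (a' ≫ Q.d (m + 2) (m + 3)) := by
    rw [homMk_comp (hN := hP (m + 3)), homMk_comp (hN := hQ (m + 2)), ha', hb']
    exact conj_square (α.comm _ _) ((β.inv hβ).comm _ _) h
  obtain ⟨Z, hZ, p, q, hpq⟩ := (homMk_eq_iff _ _).1 e
  obtain ⟨r, hr⟩ := h₄.2.2 hZ q
  obtain ⟨ζ, hζ₁, hζ₂⟩ := F.complete_last h₁ h₁' hP hQ (a' + p ≫ r) b' (by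
    rw [Preadditive.add_comp, Category.assoc, hr, ← hpq]
    abel)
  have ha'' : homMk (hM := hP (m + 2)) (hN := hQ (m + 2)) (X := X) (a' + p ≫ r) = homMk a' := by
    rw [homMk_eq_iff]
    exact ⟨Z, hZ, p, r, by abel⟩
  refine ⟨((α.inv hα).comp (toQuotHom F.right F.fixR h₁ h₂ h₃ h₃' ζ)).comp β, ?_, ?_⟩
  · change ((α.inv hα).app (m + 2) ≫ homMk (ζ.app (m + 2))) ≫ β.app (m + 2) = a
    rw [hζ₁]
    exact (congrArg (fun t => ((α.inv hα).app (m + 2) ≫ t) ≫ β.app (m + 2)) (ha''.trans ha')).trans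
      (conj_comp _ (α.inv_comp_app hα _) (β.inv_comp_app hβ _))
  · change ((α.inv hα).app (m + 3) ≫ homMk (ζ.app (m + 3))) ≫ β.app (m + 3) = b
    rw [hζ₂]
    exact (congrArg (fun t => ((α.inv hα).app (m + 3) ≫ t) ≫ β.app (m + 3)) hb').trans
      (conj_comp _ (α.inv_comp_app hα _) (β.inv_comp_app hβ _))

/-- The standard angles of a Frobenius prile category satisfy the conditions which guarantee that
their direct summands form an `n`-angulated category. -/
lemma isAngleBase : IsAngleBase m (susp F.right F.fixR) (IsStandard F.right F.fixR) where
  iso_closed φ hφ h := h.of_isIso φ hφ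
  sum_closed h h' := h.sum h'
  trivial_mem := isStandard_trivial F.right F.fixR
  rotate h hP := (hP.isBistandard_of_isLeftRotation F.epic_fixR h).isStandard
  complete := IsStandard.complete
  exists_cone := exists_standard_cone
  complete_last hP hQ h h' a b := F.complete_last_of_isBistandard
    (hP.isBistandard_of_isLeftRotation F.epic_fixR h)
    (hQ.isBistandard_of_isLeftRotation F.epic_fixR h') a b
  additive := susp_additive F.right F.fixR
  isEquivalence := F.susp_isEquivalence

end FrobeniusPrile

end Prile

/-! ### Rotations along data in the quotient category -/

section Splitting

variable {D : Type u} [Category.{v} D] [Preadditive D] [HasBinaryBiproducts D]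

/-- A split epimorphism is the projection of a direct sum, with prescribed section, if idempotents
split. -/
lemma exists_biprod_iso_of_section [IsIdempotentComplete D] {M N : D} (r : M ⟶ N) (s : N ⟶ M)
    (h : s ≫ r = 𝟙 N) :
    ∃ (K : D) (β : M ≅ K ⊞ N), β.hom ≫ biprod.snd = r ∧ biprod.inr ≫ β.inv = s := by
  obtain ⟨K, ι, π, h₁, h₂⟩ := IsIdempotentComplete.idempotents_split M (𝟙 M - r ≫ s) (by
    simp [Preadditive.sub_comp, Preadditive.comp_sub, reassoc_of% h])
  have hιr : ι ≫ r = 0 := by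
    have := congrArg (fun t => ι ≫ t ≫ r) h₂
    simp only [Category.assoc, reassoc_of% h₁, Preadditive.sub_comp, Category.id_comp, h,
      Category.comp_id, sub_self, comp_zero] at this
    exact this
  have hsπ : s ≫ π = 0 := by
    have := congrArg (fun t => s ≫ t ≫ π) h₂
    simp only [Category.assoc, h₁, Preadditive.sub_comp, Category.id_comp, reassoc_of% h,
      Category.comp_id, sub_self, Preadditive.comp_sub] at this
    exact this
  refine ⟨K, ⟨biprod.lift π r, biprod.desc ι s, ?_, ?_⟩, by simp, by simp⟩
  · rw [biprod.lift_desc, h₂]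
    abel
  · apply biprod.hom_ext' <;> apply biprod.hom_ext <;> simp [h₁, hιr, hsπ, h]

/-- Two complements of the same split epimorphism, for the same section, are isomorphic. -/
lemma exists_complement_iso {M K K' N : D} (β : M ≅ K ⊞ N) (β' : M ≅ K' ⊞ N)
    (h₁ : β.hom ≫ biprod.snd = β'.hom ≫ biprod.snd)
    (h₂ : biprod.inr ≫ β.inv = biprod.inr ≫ β'.inv) :
    ∃ k : K ≅ K', β'.hom ≫ biprod.fst = β.hom ≫ biprod.fst ≫ k.hom ∧
      biprod.inl ≫ β'.inv = k.inv ≫ biprod.inl ≫ β.inv := by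
  have key : ∀ {K K' : D} (β : M ≅ K ⊞ N) (β' : M ≅ K' ⊞ N),
      biprod.inr ≫ β.inv = biprod.inr ≫ β'.inv →
      β'.hom ≫ biprod.fst = β.hom ≫ biprod.fst ≫ biprod.inl ≫ β.inv ≫ β'.hom ≫ biprod.fst := by
    intro K K' β β' h
    have e : biprod.fst ≫ biprod.inl = 𝟙 (K ⊞ N) - biprod.snd ≫ biprod.inr := by
      rw [← biprod.total]
      abel
    rw [reassoc_of% e, Preadditive.sub_comp, Preadditive.comp_sub, Category.id_comp,
      Category.assoc, reassoc_of% h]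
    simp
  refine ⟨⟨biprod.inl ≫ β.inv ≫ β'.hom ≫ biprod.fst, biprod.inl ≫ β'.inv ≫ β.hom ≫ biprod.fst,
    ?_, ?_⟩, key β β' h₂, ?_⟩
  · rw [Category.assoc, Category.assoc, Category.assoc, ← key β' β h₂.symm]
    simp
  · rw [Category.assoc, Category.assoc, Category.assoc, ← key β β' h₂]
    simp
  · have e : biprod.fst ≫ biprod.inl = 𝟙 (K ⊞ N) - biprod.snd ≫ biprod.inr := by
      rw [← biprod.total]
      abel
    simp only [Category.assoc]
    rw [reassoc_of% e, Preadditive.sub_comp, Preadditive.comp_sub, Preadditive.comp_sub,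
      Preadditive.comp_sub]
    simp [reassoc_of% h₁]

end Splitting

section QuotientRotation

variable {A : Type u} [Category.{v} A] [Preadditive A] [HasZeroObject A] [HasBinaryBiproducts A]
variable {C X : ObjectProperty A} [IsAdditiveSubcategory X] [IsAdditiveSubcategory C]

open NSeq QuotCat

/-- A split epimorphism of `C/X` lifts to a split epimorphism of `C` after adding an object of `X`
to its source.  The kernel of the latter is then a complement, if idempotents split. -/
lemma exists_strict_splitting [IsIdempotentComplete A] {M Y N : A} {hM : C M} {hY : C Y}
    {hN : C N} (r : M ⟶ N) (t : Y ⟶ N) (s : N ⟶ M ⊞ Y)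
    (h : (homMk (s ≫ biprod.desc r t) : (mk N hN : QuotCat C X) ⟶ mk N hN) = 𝟙 _) (hX : X ≤ C) :
    ∃ (Z : A) (_ : X Z) (a : N ⟶ Z) (b : Z ⟶ N) (K : A) (_ : C K) (β : M ⊞ (Y ⊞ Z) ≅ K ⊞ N),
      β.hom ≫ biprod.snd = biprod.desc r (biprod.desc t b) ∧
      biprod.inr ≫ β.inv = biprod.lift (s ≫ biprod.fst) (biprod.lift (s ≫ biprod.snd) a) := by
  rw [← homMk_id, homMk_eq_iff] at h
  obtain ⟨Z, hZ, a, b, h⟩ := h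
  -- `s` is a section up to the morphism `a ≫ b`, which is compensated for by the summand `Z`
  obtain ⟨K, β, h₁, h₂⟩ := exists_biprod_iso_of_section (biprod.desc r (biprod.desc t (-b)))
    (biprod.lift (s ≫ biprod.fst) (biprod.lift (s ≫ biprod.snd) a)) (by
      have e : s ≫ biprod.desc r t = (s ≫ biprod.fst) ≫ r + (s ≫ biprod.snd) ≫ t := by
        rw [biprod.desc_eq]
        simp
      rw [biprod.lift_desc, biprod.lift_desc, Preadditive.comp_neg, ← h, e]
      abel)
  refine ⟨Z, hZ, a, -b, K, ?_, β, h₁, h₂⟩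
  exact IsAdditiveSubcategory.summand_mem (IsAdditiveSubcategory.iso_mem β
    (IsAdditiveSubcategory.biprod_mem hM (IsAdditiveSubcategory.biprod_mem hY (hX _ hZ))))

/-- The data along which a sequence of `C/X` is rotated come, up to isomorphism, from `C`. -/
lemma exists_strict_rotation_data [IsIdempotentComplete A] (hX : X ≤ C) {B₁ B₂ Y : A} {hB₁ : C B₁}
    {hB₂ : C B₂} {hY : C Y} {V₁ V₂ K : QuotCat C X} (α₁ : mk B₁ hB₁ ≅ V₁) (α₂ : mk B₂ hB₂ ≅ V₂)
    (g : B₁ ⟶ B₂) (v : V₁ ⟶ V₂) (hv : homMk g ≫ α₂.hom = α₁.hom ≫ v) (y : V₁ ⟶ mk Y hY)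
    (β : V₁ ⊞ mk Y hY ≅ K ⊞ V₂) (hβ : biprod.lift (𝟙 _) y ≫ β.hom ≫ biprod.snd = v) :
    ∃ (Y' K' : A) (hY' : C Y') (hK' : C K') (y' : B₁ ⟶ Y') (β' : B₁ ⊞ Y' ≅ K' ⊞ B₂)
      (j : mk Y hY ≅ (mk Y' hY' : QuotCat C X)) (k : K ≅ mk K' hK'),
      biprod.lift (𝟙 _) y' ≫ β'.hom ≫ biprod.snd = g ∧
      j.inv ≫ (biprod.inr ≫ β.hom ≫ biprod.snd) ≫ α₂.inv =
        homMk (biprod.inr ≫ β'.hom ≫ biprod.snd) ∧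
      (α₁.hom ≫ biprod.lift (𝟙 _) y ≫ β.hom ≫ biprod.fst) ≫ k.hom =
        homMk (biprod.lift (𝟙 _) y' ≫ β'.hom ≫ biprod.fst) ∧
      k.inv ≫ (biprod.inl ≫ β.inv ≫ biprod.desc y (-𝟙 _)) ≫ j.hom =
        homMk (biprod.inl ≫ β'.inv ≫ biprod.desc y' (-𝟙 Y')) := by
  obtain ⟨y₀, hy₀⟩ := exists_homMk (α₁.hom ≫ y)
  obtain ⟨t, ht⟩ := exists_homMk ((biprod.inr ≫ β.hom ≫ biprod.snd) ≫ α₂.inv)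
  have hMY : C (B₁ ⊞ Y) := IsAdditiveSubcategory.biprod_mem hB₁ hY
  obtain ⟨s, hs⟩ := exists_homMk (hN := hMY) (α₂.hom ≫ biprod.inr ≫ β.inv ≫
    biprod.map α₁.inv (𝟙 _) ≫ (biprodIso hB₁ hY hMY).inv)
  have hr : (biprodIso (X := X) hB₁ hY hMY).inv ≫ homMk (hN := hB₂) (biprod.desc (g - y₀ ≫ t) t) =
      biprod.map α₁.hom (𝟙 _) ≫ β.hom ≫ biprod.snd ≫ α₂.inv := by
    have e : homMk (hM := hB₁) (hN := hB₂) (X := X) g = α₁.hom ≫ v ≫ α₂.inv := by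
      rw [← reassoc_of% hv, Iso.hom_inv_id, Category.comp_id]
    have e' : v = (biprod.inl + y ≫ biprod.inr) ≫ β.hom ≫ biprod.snd := by
      rw [← hβ, biprod.lift_eq, Category.id_comp]
    rw [biprodIso_inv]
    apply biprod.hom_ext'
    · rw [biprod.inl_desc_assoc, ← homMk_comp, biprod.inl_desc, homMk_sub, homMk_comp (hN := hY),
        hy₀, ht, e, e']
      simp [Preadditive.add_comp, Preadditive.comp_add]
    · rw [biprod.inr_desc_assoc, ← homMk_comp, biprod.inr_desc, ht]
      simp
  obtain ⟨Z, hZ, a, b, K', hK', β', h₁, h₂⟩ := exists_strict_splitting (C := C) (X := X)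
    (hM := hB₁) (hY := hY) (hN := hB₂) (g - y₀ ≫ t) t s (by
      rw [homMk_comp (hN := hMY), hs]
      simp only [Category.assoc]
      rw [hr]
      have e : biprod.map α₁.inv (𝟙 (mk Y hY)) ≫ biprod.map α₁.hom (𝟙 _) = 𝟙 _ := by
        apply biprod.hom_ext' <;> simp
      rw [reassoc_of% e]
      simp) hX
  have hr₁ : homMk (hM := hB₁) (hN := hB₂) (X := X) (g - y₀ ≫ t) =
      α₁.hom ≫ biprod.inl ≫ β.hom ≫ biprod.snd ≫ α₂.inv := by
    have := congrArg (fun t => biprod.inl ≫ t) hr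
    rw [biprodIso_inv] at this
    simp only [biprod.inl_desc_assoc, ← homMk_comp, biprod.inl_desc] at this
    rw [this]
    simp
  have hYZ : C (Y ⊞ Z) := IsAdditiveSubcategory.biprod_mem hY (hX _ hZ)
  have hMYZ : C (B₁ ⊞ (Y ⊞ Z)) := IsAdditiveSubcategory.biprod_mem hB₁ hYZ
  have hKN : C (K' ⊞ B₂) := IsAdditiveSubcategory.biprod_mem hK' hB₂
  let j : mk Y hY ≅ (mk (Y ⊞ Z) hYZ : QuotCat C X) :=
    ⟨homMk biprod.inl, homMk biprod.fst, by rw [← homMk_comp, biprod.inl_fst, homMk_id],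
      hom_ext_inl (hM := hY) hZ (by
        rw [← Category.assoc, ← homMk_comp, biprod.inl_fst, homMk_id, Category.id_comp,
          Category.comp_id])⟩
  let γ : V₁ ⊞ mk Y hY ≅ mk K' hK' ⊞ V₂ := biprod.mapIso α₁.symm j ≪≫
    (biprodIso hB₁ hYZ hMYZ).symm ≪≫ mapIso hMYZ hKN β' ≪≫ biprodIso hK' hB₂ hKN ≪≫
      biprod.mapIso (Iso.refl _) α₂
  obtain ⟨k, hk₁, hk₂⟩ := exists_complement_iso β γ (by
    apply biprod.hom_ext'
    · have : γ.hom ≫ biprod.snd = biprod.map α₁.inv j.hom ≫ (biprodIso hB₁ hYZ hMYZ).inv ≫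
          homMk (hN := hB₂) (β'.hom ≫ biprod.snd) ≫ α₂.hom := by
        simp [γ, homMk_comp (hN := hKN)]
      rw [this, biprodIso_inv, h₁]
      simp only [biprod.inl_map_assoc, biprod.inl_desc_assoc]
      rw [← Category.assoc (homMk _), ← homMk_comp, biprod.inl_desc, hr₁]
      simp
    · have : γ.hom ≫ biprod.snd = biprod.map α₁.inv j.hom ≫ (biprodIso hB₁ hYZ hMYZ).inv ≫
          homMk (hN := hB₂) (β'.hom ≫ biprod.snd) ≫ α₂.hom := by
        simp [γ, homMk_comp (hN := hKN)]
      rw [this, biprodIso_inv, h₁]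
      simp only [biprod.inr_map_assoc, biprod.inr_desc_assoc]
      change _ = (homMk biprod.inl : QuotCat.mk Y hY ⟶ QuotCat.mk (Y ⊞ Z) hYZ) ≫ _
      rw [← Category.assoc (homMk biprod.inr), ← homMk_comp, biprod.inr_desc,
        ← Category.assoc (homMk _), ← homMk_comp, biprod.inl_desc, ht]
      simp) (by
    have : biprod.inr ≫ γ.inv = α₂.inv ≫ homMk (hM := hB₂) (biprod.inr ≫ β'.inv) ≫
        (biprodIso hB₁ hYZ hMYZ).hom ≫ biprod.map α₁.hom j.inv := by
      simp [γ, homMk_comp (hN := hKN)]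
    rw [this, h₂, biprodIso_hom]
    have hs₁ : homMk (hM := hB₂) (hN := hB₁) (X := X) (s ≫ biprod.fst) =
        α₂.hom ≫ biprod.inr ≫ β.inv ≫ biprod.fst ≫ α₁.inv := by
      rw [homMk_comp (hN := hMY), hs]
      have e : (biprodIso hB₁ hY hMY).inv ≫ homMk (X := X) (hN := hB₁) biprod.fst =
          biprod.fst := by
        rw [Iso.inv_comp_eq]
        simp
      simp only [Category.assoc, e, biprod.map_fst]
    have hs₂ : homMk (hM := hB₂) (hN := hY) (X := X) (s ≫ biprod.snd) =
        α₂.hom ≫ biprod.inr ≫ β.inv ≫ biprod.snd := by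
      rw [homMk_comp (hN := hMY), hs]
      have e : (biprodIso hB₁ hY hMY).inv ≫ homMk (X := X) (hN := hY) biprod.snd =
          biprod.snd := by
        rw [Iso.inv_comp_eq]
        simp
      simp only [Category.assoc, e, biprod.map_snd, Category.comp_id]
    apply biprod.hom_ext
    · simp only [Category.assoc, biprod.map_fst, biprod.lift_fst_assoc]
      rw [← Category.assoc (homMk _), ← homMk_comp, biprod.lift_fst, hs₁]
      simp
    · simp only [Category.assoc, biprod.map_snd, biprod.lift_snd_assoc]
      rw [← Category.assoc (homMk _), ← homMk_comp, biprod.lift_snd]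
      change _ = α₂.inv ≫ _ ≫ (homMk biprod.fst : QuotCat.mk (Y ⊞ Z) hYZ ⟶ QuotCat.mk Y hY)
      rw [← homMk_comp, biprod.lift_fst, hs₂]
      simp)
  refine ⟨Y ⊞ Z, K', hYZ, hK', biprod.lift y₀ 0, β', j, k, ?_, ?_, ?_, ?_⟩
  · rw [h₁]
    simp
  · refine hom_ext_inl (hM := hY) hZ ?_
    rw [← homMk_comp, h₁, biprod.inr_desc, biprod.inl_desc, ← Category.assoc, ← homMk_comp,
      biprod.inl_fst, homMk_id, Category.id_comp, ht]
  · have e : γ.hom ≫ biprod.fst = biprod.map α₁.inv j.hom ≫ (biprodIso hB₁ hYZ hMYZ).inv ≫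
        homMk (hN := hK') (β'.hom ≫ biprod.fst) := by
      simp [γ, homMk_comp (hN := hKN)]
    have e' : α₁.hom ≫ biprod.lift (𝟙 _) y ≫ biprod.map α₁.inv j.hom ≫
        (biprodIso hB₁ hYZ hMYZ).inv = homMk (biprod.lift (𝟙 _) (biprod.lift y₀ 0)) := by
      simp only [← Category.assoc]
      rw [Iso.comp_inv_eq, biprodIso_hom]
      apply biprod.hom_ext
      · simp [← homMk_comp, homMk_id]
      · simp only [Category.assoc, biprod.map_snd, biprod.lift_snd_assoc, biprod.lift_snd,
          ← homMk_comp]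
        rw [← Category.assoc, ← hy₀]
        refine (homMk_comp (hN := hY) y₀ biprod.inl).symm.trans ?_
        congr 1
        apply biprod.hom_ext <;> simp
    simp only [Category.assoc]
    rw [← hk₁, e, reassoc_of% e', ← homMk_comp]
  · have e : biprod.inl ≫ γ.inv = homMk (hM := hK') (biprod.inl ≫ β'.inv) ≫
        (biprodIso hB₁ hYZ hMYZ).hom ≫ biprod.map α₁.hom j.inv := by
      simp [γ, homMk_comp (hN := hKN)]
    have e' : (biprodIso (X := X) hB₁ hYZ hMYZ).hom ≫ biprod.map α₁.hom j.inv ≫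
        biprod.desc y (-𝟙 _) ≫ j.hom = homMk (biprod.desc (biprod.lift y₀ 0) (-𝟙 _)) := by
      rw [← Iso.eq_inv_comp, biprodIso_inv]
      apply biprod.hom_ext'
      · simp only [biprod.inl_map_assoc, biprod.inl_desc_assoc, ← homMk_comp, biprod.inl_desc]
        rw [← Category.assoc, ← hy₀]
        refine (homMk_comp (hN := hY) y₀ biprod.inl).symm.trans ?_
        congr 1
        apply biprod.hom_ext <;> simp
      · simp [← homMk_comp, homMk_id, homMk_neg]
    simp only [Category.assoc]
    rw [← reassoc_of% hk₂, reassoc_of% e, e', ← homMk_comp]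
    simp only [Category.assoc]

variable {m : ℕ} {S : A ⥤ A} [S.Additive] {R : NSeq (m + 3) S → Prop}
  {hR : IsRightSuspended m S C X R} {fix : ∀ M : A, C M → ApproxSeq C X R M}

/-- If idempotents split, the standard angles are closed under the generalized rotations along
arbitrary data in `C/X`. -/
lemma IsStandard.of_isRotationAlong [IsIdempotentComplete A] (hX : X ≤ C)
    (hfix : ∀ M hM, IsXEpic C X ((fix M hM).seq.d (m + 2) (m + 3)))
    {V W : NSeq (m + 3) (susp hR fix)} (hV : IsStandard hR fix V) {Y K : QuotCat C X}
    (y : V.obj 1 ⟶ Y) (β : V.obj 1 ⊞ Y ≅ K ⊞ V.obj 2)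
    (hβ : biprod.lift (𝟙 _) y ≫ β.hom ≫ biprod.snd = V.d 1 2)
    (hVW : IsRotationAlong V W (biprod.inr ≫ β.hom ≫ biprod.snd)
      (biprod.lift (𝟙 _) y ≫ β.hom ≫ biprod.fst) (biprod.inl ≫ β.inv ≫ biprod.desc y (-𝟙 Y))) :
    IsStandard hR fix W := by
  have := susp_additive hR fix
  obtain ⟨B, hBC, φ, h₁, h₂, h₃, α, hα⟩ := hV
  obtain ⟨⟨Y, hY⟩⟩ := Y
  let α₁ : (QuotCat.mk _ (hBC 1) : QuotCat C X) ≅ V.obj 1 := @asIso _ _ _ _ (α.app 1) (hα 1)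
  let α₂ : (QuotCat.mk _ (hBC 2) : QuotCat C X) ≅ V.obj 2 := @asIso _ _ _ _ (α.app 2) (hα 2)
  obtain ⟨Y', K', hY', hK', y', β', j, k, hβ', e₁, e₂, e₃⟩ := exists_strict_rotation_data hX
    (hB₁ := hBC 1) (hB₂ := hBC 2) (hY := hY) α₁ α₂ (B.d 1 2) (V.d 1 2) (α.comm 1 2) y β hβ
  refine (isBistandard_of_isRotationAlong hR fix hfix (hBC := hBC) (φ := φ) h₁ h₂ h₃ hY' hK' y' β'
    hβ' ?_).isStandard
  rw [← e₁, ← e₂, ← e₃]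
  exact (hVW.of_hom α hα).of_iso j k

end QuotientRotation

/-! ### Direct sums with disks -/

section StableMembership

variable {D : Type u} [Category.{v} D] [Preadditive D] [HasZeroObject D] [HasBinaryBiproducts D]
  {m : ℕ} {T : D ⥤ D} {Θ : NSeq (m + 3) T → Prop}

open NSeq

open scoped ZeroObject

omit [HasZeroObject D] in
lemma NSeq.exists_disks_sum_iso {Z Z' : ℕ → D} (hZ : ∀ k, (k = 0 ∨ m + 3 ≤ k) → IsZero (Z k))
    (hZ' : ∀ k, (k = 0 ∨ m + 3 ≤ k) → IsZero (Z' k)) :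
    ∃ (hZZ' : ∀ k, (k = 0 ∨ m + 3 ≤ k) → IsZero (Z k ⊞ Z' k))
      (φ : Hom ((disks T Z hZ).sum (disks T Z' hZ')) (disks T (fun k => Z k ⊞ Z' k) hZZ')),
      φ.IsIso := by
  refine ⟨fun k hk => (biprod_isZero_iff _ _).2 ⟨hZ k hk, hZ' k hk⟩,
    sumDesc (disksHom fun k => biprod.inl) (disksHom fun k => biprod.inr),
    Hom.isIso_of_range _ ?_⟩
  rintro (_ | k) h₁ h₂
  · omega
  · refine ⟨(biprod.lift (biprod.map biprod.fst biprod.fst) (biprod.map biprod.snd biprod.snd) :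
      (Z (k + 1) ⊞ Z' (k + 1)) ⊞ (Z k ⊞ Z' k) ⟶ (Z (k + 1) ⊞ Z k) ⊞ (Z' (k + 1) ⊞ Z' k)), ?_, ?_⟩
    · change biprod.desc (biprod.map (biprod.inl : Z (k + 1) ⟶ Z (k + 1) ⊞ Z' (k + 1))
        (biprod.inl : Z k ⟶ Z k ⊞ Z' k)) (biprod.map biprod.inr biprod.inr) ≫
        biprod.lift (biprod.map biprod.fst biprod.fst) (biprod.map biprod.snd biprod.snd) = 𝟙 _
      apply biprod.hom_ext' <;> apply biprod.hom_ext' <;> apply biprod.hom_ext <;>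
        apply biprod.hom_ext <;> simp
    · change biprod.lift (biprod.map biprod.fst biprod.fst) (biprod.map biprod.snd biprod.snd) ≫
        biprod.desc (biprod.map (biprod.inl : Z (k + 1) ⟶ Z (k + 1) ⊞ Z' (k + 1))
        (biprod.inl : Z k ⟶ Z k ⊞ Z' k)) (biprod.map biprod.inr biprod.inr) = 𝟙 _
      apply biprod.hom_ext' <;> apply biprod.hom_ext' <;> apply biprod.hom_ext <;>
        apply biprod.hom_ext <;> simp

omit [HasZeroObject D] [HasBinaryBiproducts D] in
/-- The correction data in a single position for a retraction `i ≫ p = 1`, where `e' = 1 - p ≫ i`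
factors as `d ≫ b`. -/
lemma exists_disk_data {M N N' : D} (i : M ⟶ N) (p : N ⟶ M) (hip : i ≫ p = 𝟙 M) {M' : D}
    (i' : M' ⟶ N') (p' : N' ⟶ M') (hip' : i' ≫ p' = 𝟙 M') (d : N ⟶ N') (e : M ⟶ M')
    (hi : i ≫ d = e ≫ i') (hp : d ≫ p' = p ≫ e) (b : N' ⟶ N) (hb : d ≫ b = 𝟙 N - p ≫ i) :
    ∃ (a : N ⟶ N) (c : N' ⟶ N), a ≫ p = 0 ∧ i' ≫ c = 0 ∧ i ≫ a = 0 ∧ (d ≫ c) ≫ p = 0 ∧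
      a ≫ d ≫ c + p ≫ i = 𝟙 N ∧ p ≫ i + (d ≫ c) ≫ a = 𝟙 N := by
  have hc : d ≫ (𝟙 N' - p' ≫ i') ≫ b = 𝟙 N - p ≫ i := by
    rw [← Category.assoc, Preadditive.comp_sub, Category.comp_id, reassoc_of% hp, ← hi,
      Preadditive.sub_comp, Category.assoc, Category.assoc, hb]
    simp [Preadditive.comp_sub, reassoc_of% hip]
  refine ⟨𝟙 N - p ≫ i, (𝟙 N' - p' ≫ i') ≫ b, ?_, ?_, ?_, ?_, ?_, ?_⟩
  · simp [Preadditive.sub_comp, hip]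
  · simp [Preadditive.sub_comp, Preadditive.comp_sub, reassoc_of% hip']
  · simp [Preadditive.comp_sub, reassoc_of% hip]
  · rw [hc]
    simp [Preadditive.sub_comp, hip]
  · rw [hc]
    simp [Preadditive.sub_comp, Preadditive.comp_sub, reassoc_of% hip]
  · rw [hc]
    simp [Preadditive.sub_comp, Preadditive.comp_sub, reassoc_of% hip]

omit [HasZeroObject D] in
/-- One composite of the comparison matrices in `IsAngleBase.exists_sum_disks_mem`. -/
lemma retract_disk_inclusion {V P Z₁ Z₂ Z₁' Z₂' : D} {i : V ⟶ P} {p : P ⟶ V} {u : Z₁ ⟶ Z₂}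
    {v : Z₂ ⟶ Z₁} {a : Z₁ ⟶ P} {x : P ⟶ Z₁} {u' : Z₁' ⟶ Z₂'} {v' : Z₂' ⟶ Z₁'} {a' : Z₁' ⟶ P}
    {c' : P ⟶ Z₁'} (hip : i ≫ p = 𝟙 _) (hix : i ≫ x = 0) (hic' : i ≫ c' = 0) (hap : a ≫ p = 0)
    (hax : a ≫ x + u ≫ v = 𝟙 _) (hac' : a ≫ c' = 0) (hap' : a' ≫ p = 0) (hax' : a' ≫ x = 0)
    (hac : a' ≫ c' + u' ≫ v' = 𝟙 _) :
    biprod.desc (i ≫ biprod.inl) (biprod.lift (biprod.desc a a') (biprod.map u u')) ≫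
      biprod.desc (biprod.lift p (biprod.lift x c')) (biprod.map v v' ≫ biprod.inr) = 𝟙 _ := by
  apply biprod.hom_ext'
  · simp only [biprod.inl_desc_assoc, Category.assoc, biprod.inl_desc, Category.comp_id]
    apply biprod.hom_ext
    · simp [hip]
    · apply biprod.hom_ext <;> simp [hix, hic']
  · apply biprod.hom_ext'
    · apply biprod.hom_ext
      · simp [biprod.lift_desc, hap]
      · apply biprod.hom_ext <;> simp [biprod.lift_desc, hax, hac']
    · apply biprod.hom_ext
      · simp [biprod.lift_desc, hap']
      · apply biprod.hom_ext <;> simp [biprod.lift_desc, hax', hac]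

omit [HasZeroObject D] in
/-- The other composite of the comparison matrices in `IsAngleBase.exists_sum_disks_mem`. -/
lemma retract_disk_projection {V P Z₁ Z₂ Z₁' Z₂' : D} {i : V ⟶ P} {p : P ⟶ V} {u : Z₁ ⟶ Z₂}
    {v : Z₂ ⟶ Z₁} {a : Z₁ ⟶ P} {x : P ⟶ Z₁} {u' : Z₁' ⟶ Z₂'} {v' : Z₂' ⟶ Z₁'} {a' : Z₁' ⟶ P}
    {c' : P ⟶ Z₁'} (hpi : p ≫ i + x ≫ a = 𝟙 _) (hca : c' ≫ a' = 0) (hxu : x ≫ u = 0)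
    (hcu : c' ≫ u' = 0) (hva : v ≫ a = 0) (hva' : v' ≫ a' = 0) (hvu : v ≫ u = 𝟙 _)
    (hvu' : v' ≫ u' = 𝟙 _) :
    biprod.desc (biprod.lift p (biprod.lift x c')) (biprod.map v v' ≫ biprod.inr) ≫
      biprod.desc (i ≫ biprod.inl) (biprod.lift (biprod.desc a a') (biprod.map u u')) = 𝟙 _ := by
  apply biprod.hom_ext'
  · simp only [biprod.inl_desc_assoc, biprod.lift_desc, Category.comp_id]
    apply biprod.hom_ext
    · simp [biprod.lift_desc, hca, hpi]
    · apply biprod.hom_ext <;> simp [hxu, hcu]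
  · apply biprod.hom_ext'
    · apply biprod.hom_ext
      · simp [hva]
      · apply biprod.hom_ext <;> simp [hvu]
    · apply biprod.hom_ext
      · simp [hva']
      · apply biprod.hom_ext <;> simp [hvu']

/-- If `V` is a retract of a member of `Θ`, and agrees with it in the positions `≤ k`, then `V`
becomes a member of `Θ` after adding contractible sequences: by adding a contractible sequence on
both sides, `k` is increased by one. -/
lemma IsAngleBase.exists_sum_disks_mem (h : IsAngleBase m T Θ) (j : ℕ) :
    ∀ (k : ℕ) (_ : 1 ≤ k) (_ : k + j = m + 2) {V P : NSeq (m + 3) T} (_ : Θ P) (i : Hom V P)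
      (p : Hom P V) (_ : ∀ l, i.app l ≫ p.app l = 𝟙 _)
      (_ : ∀ l, l ≤ k → p.app l ≫ i.app l = 𝟙 _),
      ∃ (Z : ℕ → D) (hZ : ∀ k, (k = 0 ∨ m + 3 ≤ k) → IsZero (Z k)), Θ (V.sum (disks T Z hZ)) := by
  have := h.additive
  induction j with
  | zero =>
    rintro _ hk rfl V P hP i p hip hpi
    have hPe := h.isWeakExact hP
    -- the idempotent `1 - p ≫ i` in the last position factors through the connecting morphism and
    -- is annihilated by it, hence vanishes
    have key : p.app (m + 3) ≫ i.app (m + 3) = 𝟙 _ := by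
      obtain ⟨t, ht⟩ := hPe.weakCokernel_conn.2 (𝟙 _ - p.app (m + 3) ≫ i.app (m + 3)) (by
        rw [Preadditive.comp_sub, ← Category.assoc, p.comm, Category.assoc, i.comm,
          ← Category.assoc, hpi _ (by omega), Category.id_comp, Category.comp_id, sub_self])
      have h₁ : (𝟙 _ - p.app (m + 3) ≫ i.app (m + 3)) ≫ P.conn = 0 := by
        rw [Preadditive.sub_comp, Category.assoc, ← i.comm_conn, ← Category.assoc, ← p.comm_conn,
          Category.assoc, ← T.map_comp, hpi 1 hk, T.map_id, Category.comp_id, Category.id_comp,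
          sub_self]
      have h₂ : (𝟙 _ - p.app (m + 3) ≫ i.app (m + 3)) ≫ (𝟙 _ - p.app (m + 3) ≫ i.app (m + 3)) =
          𝟙 _ - p.app (m + 3) ≫ i.app (m + 3) := by
        simp [Preadditive.sub_comp, Preadditive.comp_sub, reassoc_of% hip]
      rw [← sub_eq_zero, ← neg_sub, neg_eq_zero, ← h₂]
      nth_rewrite 2 [← ht]
      rw [← Category.assoc, h₁, zero_comp]
    have hz : ∀ k, (k = 0 ∨ m + 3 ≤ k) → IsZero ((fun _ => 0 : ℕ → D) k) := fun k _ => isZero_zero D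
    refine ⟨_, hz, h.sum_closed (h.iso_closed p (Hom.isIso_of_range _ fun l h₁ h₂ => ?_) hP)
      (h.disks_mem hz)⟩
    by_cases hl : l ≤ m + 2
    · exact ⟨i.app l, hpi l (by omega), hip l⟩
    · obtain rfl : l = m + 3 := by omega
      exact ⟨i.app (m + 3), key, hip _⟩
  | succ j ih =>
    intro k hk hkj V P hP i p hip hpi
    have hPe := h.isWeakExact hP
    have hP' := hPe.isComplex
    obtain ⟨b, hb⟩ := (hPe.weakCokernel k hk (by omega)).2
      (𝟙 _ - p.app (k + 1) ≫ i.app (k + 1)) (by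
        rw [Preadditive.comp_sub, ← Category.assoc, p.comm, Category.assoc, i.comm,
          ← Category.assoc, hpi _ (by omega), Category.id_comp, Category.comp_id, sub_self])
    -- in the position `k + 1` the disk on `P (k + 1)` is added to `V`, and the one on `V (k + 1)`
    -- is added to `P`
    have data : ∀ l, ∃ (Z₁ Z₂ : D) (u : Z₁ ⟶ Z₂) (v : Z₂ ⟶ Z₁) (a : Z₁ ⟶ P.obj l)
        (c : P.obj (l + 1) ⟶ Z₁), v ≫ u = 𝟙 _ ∧ a ≫ p.app l = 0 ∧ i.app (l + 1) ≫ c = 0 ∧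
        v ≫ a = 0 ∧ (P.d l (l + 1) ≫ c) ≫ u = 0 ∧ a ≫ P.d l (l + 1) ≫ c + u ≫ v = 𝟙 _ ∧
        (l ≠ k + 1 → IsZero Z₁ ∧ IsZero Z₂) ∧
        (l ≤ k + 1 → p.app l ≫ i.app l + (P.d l (l + 1) ≫ c) ≫ a = 𝟙 _) := by
      intro l
      by_cases hl : l = k + 1
      · subst hl
        obtain ⟨a, c, h₁, h₂, h₃, h₄, h₅, h₆⟩ := exists_disk_data (i.app (k + 1)) (p.app (k + 1))
          (hip _) (i.app (k + 2)) (p.app (k + 2)) (hip _) (P.d (k + 1) (k + 2))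
          (V.d (k + 1) (k + 2)) (i.comm _ _).symm (p.comm _ _) b hb
        exact ⟨P.obj (k + 1), V.obj (k + 1), p.app _, i.app _, a, c, hip _, h₁, h₂, h₃, h₄, h₅,
          fun h => absurd rfl h, fun _ => h₆⟩
      · refine ⟨0, 0, 0, 0, 0, 0, ?_, by simp, by simp, by simp, by simp, ?_,
          fun _ => ⟨isZero_zero D, isZero_zero D⟩, fun h => ?_⟩
        · exact (isZero_zero D).eq_of_src _ _
        · exact (isZero_zero D).eq_of_src _ _
        · rw [hpi l (by omega)]
          simp
    choose Z₁ Z₂ u v a c hvu hap hic hva hdcu hadc hZ hpi' using data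
    have hZ₁ : ∀ l, (l = 0 ∨ m + 3 ≤ l) → IsZero (Z₁ l) := fun l hl => (hZ l (by omega)).1
    have hZ₂ : ∀ l, (l = 0 ∨ m + 3 ≤ l) → IsZero (Z₂ l) := fun l hl => (hZ l (by omega)).2
    let i' : Hom (V.sum (disks T Z₁ hZ₁)) (P.sum (disks T Z₂ hZ₂)) :=
      sumDesc (i.comp (sumInl _ _)) (sumLift (fromDisks hP' a) (disksHom u))
    let p' : Hom (P.sum (disks T Z₂ hZ₂)) (V.sum (disks T Z₁ hZ₁)) :=
      sumDesc (sumLift p (toDisks hP' c)) ((disksHom v).comp (sumInr _ _))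
    obtain ⟨Z, hZ', hmem⟩ := ih (k + 1) (by omega) (by omega)
      (h.sum_closed hP (h.disks_mem hZ₂)) i' p' (by
        rintro (_ | l)
        · exact (NSeq.isZero _ 0 (Or.inl rfl)).eq_of_src _ _
        · change biprod.desc
            (i.app (l + 1) ≫ (biprod.inl : _ ⟶ P.obj (l + 1) ⊞ (Z₂ (l + 1) ⊞ Z₂ l)))
            (biprod.lift (biprod.desc (a (l + 1)) (a l ≫ P.d l (l + 1)))
              (biprod.map (u (l + 1)) (u l))) ≫
            biprod.desc (biprod.lift (p.app (l + 1)) (biprod.lift (P.d (l + 1) (l + 2) ≫ c (l + 1))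
              (c l))) (biprod.map (v (l + 1)) (v l) ≫
                (biprod.inr : _ ⟶ V.obj (l + 1) ⊞ (Z₁ (l + 1) ⊞ Z₁ l))) = 𝟙 _
          have hz : a (l + 1) ≫ c l = 0 := by
            by_cases hl : l = k + 1
            · exact (hZ (l + 1) (by omega)).1.eq_of_src _ _
            · exact (hZ l hl).1.eq_of_tgt _ _
          exact retract_disk_inclusion (hip _)
            (by rw [← Category.assoc, ← i.comm, Category.assoc, hic, comp_zero]) (hic _) (hap _)
            (hadc _) hz (by rw [Category.assoc, p.comm, ← Category.assoc, hap, zero_comp])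
            (by
              rcases l with _ | l
              · exact (hZ 0 (by omega)).1.eq_of_src _ _
              · rw [Category.assoc, ← Category.assoc (P.d _ _), hP'.d_comp, zero_comp, comp_zero])
            ((congrArg (· + u l ≫ v l) (Category.assoc _ _ _)).trans (hadc l))) (by
        rintro (_ | l) hl
        · exact (NSeq.isZero _ 0 (Or.inl rfl)).eq_of_src _ _
        · change biprod.desc
            (biprod.lift (p.app (l + 1)) (biprod.lift (P.d (l + 1) (l + 2) ≫ c (l + 1))
              (c l))) (biprod.map (v (l + 1)) (v l) ≫
                (biprod.inr : _ ⟶ V.obj (l + 1) ⊞ (Z₁ (l + 1) ⊞ Z₁ l))) ≫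
            biprod.desc (i.app (l + 1) ≫ (biprod.inl : _ ⟶ P.obj (l + 1) ⊞ (Z₂ (l + 1) ⊞ Z₂ l)))
            (biprod.lift (biprod.desc (a (l + 1)) (a l ≫ P.d l (l + 1)))
              (biprod.map (u (l + 1)) (u l))) = 𝟙 _
          have hz := (hZ l (by omega)).1
          exact retract_disk_projection (hpi' (l + 1) hl) (by
            rw [hz.eq_zero_of_src (a l ≫ P.d l (l + 1)), comp_zero])
            (hdcu _) (hz.eq_zero_of_src (u l) ▸ comp_zero) (hva _)
            (by rw [← Category.assoc, hva, zero_comp]) (hvu _) (hvu _))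
    obtain ⟨hs, φ, hφ⟩ := exists_disks_sum_iso (T := T) hZ₁ hZ'
    exact ⟨_, hs, h.iso_closed (sumMap (Hom.id V) φ) (sumMap_isIso (Hom.id_isIso V) hφ)
      (h.iso_closed (sumAssoc _ _ _) (sumAssoc_isIso _ _ _) hmem)⟩

/-- The objects of a sequence in the positions `3, 4, …`, shifted by one.  The sum of disks on these
objects vanishes in the position `1`. -/
noncomputable def shiftTail (W : NSeq (m + 3) T) : ℕ → D
  | 0 => 0
  | 1 => 0
  | k + 2 => W.obj (k + 3)

omit [HasBinaryBiproducts D] in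
lemma shiftTail_isZero (W : NSeq (m + 3) T) :
    ∀ k, (k = 0 ∨ m + 3 ≤ k) → IsZero (shiftTail W k)
  | 0, _ => isZero_zero D
  | 1, _ => isZero_zero D
  | k + 2, h => W.isZero (k + 3) (by omega)

/-- A summand of a member of `Θ` becomes a member of `Θ` after adding contractible sequences. -/
lemma IsAngleBase.exists_sum_disks_mem_of_summands (h : IsAngleBase m T Θ) {W : NSeq (m + 3) T}
    (hW : Summands Θ W) :
    ∃ (Z : ℕ → D) (hZ : ∀ k, (k = 0 ∨ m + 3 ≤ k) → IsZero (Z k)), Θ (W.sum (disks T Z hZ)) := by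
  have := h.additive
  obtain ⟨P, _, hP, _, e₁, e₂, _, _, _, he, _⟩ := h.exists_cone (W.d 1 2) (𝟙 _)
  have hP' : Summands Θ P := ⟨P, h.sum_closed hP hP⟩
  have hWe := (h.summands.isWeakExact hW).isComplex
  obtain ⟨i, p, hi₁, hi₂, hp₁, hp₂, ⟨s, hs₀, hs⟩, -⟩ := h.summands.exists_homotopyEquiv hW hP'
    e₁.symm e₂.symm (by
      rw [Iso.symm_hom, Iso.symm_hom, Iso.eq_inv_comp, ← Category.assoc, ← he, Category.assoc,
        Iso.hom_inv_id, Category.comp_id])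
  -- the homotopy from `i ≫ p` to the identity is absorbed by adding disks to `P`, which makes `W` a
  -- retract without changing `P` in the first position
  have hz := shiftTail_isZero W
  let b : ∀ k, W.obj (k + 1) ⟶ shiftTail W k := fun k => match k with
    | 0 => 0
    | 1 => 0
    | k + 2 => 𝟙 (W.obj (k + 3))
  let a : ∀ k, shiftTail W k ⟶ W.obj k := fun k => match k with
    | 0 => 0
    | 1 => 0
    | k + 2 => -s (k + 2)
  have hba : ∀ k, b k ≫ a k = -s k := fun k => match k with
    | 0 => by rw [hs₀ 0 (by omega), neg_zero]; exact zero_comp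
    | 1 => by rw [hs₀ 1 (by omega), neg_zero]; exact zero_comp
    | k + 2 => Category.id_comp _
  refine h.exists_sum_disks_mem (m + 1) 1 le_rfl (by omega)
    (h.sum_closed hP (h.disks_mem hz)) (sumLift i (toDisks hWe b)) (sumDesc p (fromDisks hWe a))
    ?_ ?_
  · rintro (_ | k)
    · exact (NSeq.isZero _ 0 (Or.inl rfl)).eq_of_src _ _
    · change biprod.lift (i.app (k + 1)) (biprod.lift (W.d (k + 1) (k + 2) ≫ b (k + 1)) (b k)) ≫
        biprod.desc (p.app (k + 1)) (biprod.desc (a (k + 1)) (a k ≫ W.d k (k + 1))) = 𝟙 _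
      rw [biprod.lift_desc, biprod.lift_desc, Category.assoc, hba, ← Category.assoc (b k), hba]
      have e : i.app (k + 1) ≫ p.app (k + 1) - 𝟙 _ = _ := hs k
      rw [sub_eq_iff_eq_add.1 e, Preadditive.comp_neg, Preadditive.neg_comp]
      abel
  · rintro (_ | _ | k) hk
    · exact (NSeq.isZero _ 0 (Or.inl rfl)).eq_of_src _ _
    · change biprod.desc (p.app 1) (biprod.desc (a 1) (a 0 ≫ W.d 0 1)) ≫
        biprod.lift (i.app 1) (biprod.lift (W.d 1 2 ≫ b 1) (b 0)) =
          𝟙 (P.obj 1 ⊞ ((0 : D) ⊞ (0 : D)))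
      have h₀ : IsZero ((0 : D) ⊞ (0 : D)) :=
        (biprod_isZero_iff _ _).2 ⟨isZero_zero D, isZero_zero D⟩
      apply biprod.hom_ext'
      · apply biprod.hom_ext
        · simp only [biprod.inl_desc_assoc, Category.assoc, biprod.lift_fst, hi₁, hp₁,
            Iso.symm_inv, Iso.symm_hom, Iso.hom_inv_id]
          exact ((congrArg (· ≫ biprod.fst) (Category.comp_id _)).trans biprod.inl_fst).symm
        · exact h₀.eq_of_tgt _ _
      · exact h₀.eq_of_src _ _
    · omega

end StableMembership

/-! ### Cancellation of disks -/

section Cancellation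

variable {D : Type u} [Category.{v} D] [Preadditive D] [HasZeroObject D] [HasBinaryBiproducts D]
  {m : ℕ} {T : D ⥤ D} {Θ : NSeq (m + 3) T → Prop}

open NSeq

open scoped ZeroObject

/-- `Θ` is closed under the generalized rotations `IsRotationAlong` given by an object `Y`, a
morphism `y : V₁ ⟶ Y` and a decomposition of `V₁ ⊞ Y` in which the first morphism of `V` is the
composite of `(1, y)` with the projection to `V₂`. -/
def IsClosedUnderRotationAlong (Θ : NSeq (m + 3) T → Prop) : Prop :=
  ∀ {V W : NSeq (m + 3) T} (_ : Θ V) {Y K : D} (y : V.obj 1 ⟶ Y) (β : V.obj 1 ⊞ Y ≅ K ⊞ V.obj 2),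
    biprod.lift (𝟙 _) y ≫ β.hom ≫ biprod.snd = V.d 1 2 →
    IsRotationAlong V W (biprod.inr ≫ β.hom ≫ biprod.snd)
      (biprod.lift (𝟙 _) y ≫ β.hom ≫ biprod.fst) (biprod.inl ≫ β.inv ≫ biprod.desc y (-𝟙 Y)) → Θ W

/-- The objects of `disks` after a left rotation which absorbs the disk in the positions `1, 2`. -/
def shiftDisks (Z : ℕ → D) : ℕ → D
  | 0 => Z 0
  | k + 1 => Z (k + 2)

omit [Preadditive D] [HasZeroObject D] [HasBinaryBiproducts D] in
lemma shiftDisks_isZero {Z : ℕ → D} (hZ : ∀ k, (k = 0 ∨ m + 3 ≤ k) → IsZero (Z k)) :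
    ∀ k, (k = 0 ∨ m + 3 ≤ k) → IsZero (shiftDisks Z k)
  | 0, _ => hZ 0 (Or.inl rfl)
  | k + 1, h => hZ (k + 2) (by omega)

/-- The decomposition along which the sum of a sequence and of disks is rotated. -/
noncomputable def absorbIso (W₁ W₂ Z₀ Z₁ Z₂ : D) (h : IsZero Z₀) :
    (W₁ ⊞ (Z₁ ⊞ Z₀)) ⊞ (W₂ ⊞ Z₂) ≅ W₁ ⊞ (W₂ ⊞ (Z₂ ⊞ Z₁)) where
  hom := biprod.lift (biprod.fst ≫ biprod.fst) (biprod.lift (biprod.snd ≫ biprod.fst)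
    (biprod.lift (biprod.snd ≫ biprod.snd) (biprod.fst ≫ biprod.snd ≫ biprod.fst)))
  inv := biprod.lift (biprod.lift biprod.fst (biprod.lift (biprod.snd ≫ biprod.snd ≫ biprod.snd) 0))
    (biprod.lift (biprod.snd ≫ biprod.fst) (biprod.snd ≫ biprod.snd ≫ biprod.fst))
  hom_inv_id := by
    apply biprod.hom_ext <;> apply biprod.hom_ext <;> try apply biprod.hom_ext
    all_goals first | exact h.eq_of_tgt _ _ | simp
  inv_hom_id := by
    apply biprod.hom_ext <;> try apply biprod.hom_ext <;> try apply biprod.hom_ext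
    all_goals simp

omit [HasZeroObject D] in
lemma absorb_first_aux {W₁ W₂ W₂' W₃ Z₀ Z₁ Z₂ Z₃ : D} {w : W₁ ⟶ W₂'} {a₁ : W₁ ≅ W₂}
    {a₂ : W₂' ≅ W₃} {w' : W₂ ⟶ W₃} (h : w ≫ a₂.hom = a₁.hom ≫ w') (f : Z₂ ⊞ Z₀ ≅ Z₂)
    (hf : f.hom = biprod.fst) :
    biprod.map w (biprod.lift 0 biprod.fst : Z₂ ⊞ Z₀ ⟶ Z₃ ⊞ Z₂) ≫
        (biprod.mapIso a₂ (Iso.refl (Z₃ ⊞ Z₂))).hom =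
      (biprod.mapIso a₁ f).hom ≫ biprod.lift biprod.fst (biprod.lift biprod.snd 0) ≫
        biprod.map w' (biprod.lift 0 biprod.fst : Z₂ ⊞ Z₁ ⟶ Z₃ ⊞ Z₂) := by
  apply biprod.hom_ext <;> try apply biprod.hom_ext
  all_goals simp [h, hf]

omit [HasZeroObject D] in
/-- Rotating the sum of a sequence `W` and of disks gives the sum of the rotation of `W` and of
the rotated disks, without the disk in the first position. -/
lemma sum_disks_mem_of_isLeftRotation [T.Additive] (hΘ : IsClosedUnderRotationAlong Θ)
    {W W' : NSeq (m + 3) T} (hW : W.IsLeftRotation W') {Z : ℕ → D}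
    {hZ : ∀ k, (k = 0 ∨ m + 3 ≤ k) → IsZero (Z k)} (h : Θ (W.sum (disks T Z hZ))) :
    Θ (W'.sum (disks T (shiftDisks Z) (shiftDisks_isZero hZ))) := by
  have hZ₀ : IsZero (Z 0) := hZ 0 (Or.inl rfl)
  have hZn : IsZero (Z (m + 3)) := hZ (m + 3) (Or.inr le_rfl)
  let y : W.obj 1 ⊞ (Z 1 ⊞ Z 0) ⟶ W.obj 2 ⊞ Z 2 := biprod.fst ≫ W.d 1 2 ≫ biprod.inl
  let β := absorbIso (W.obj 1) (W.obj 2) (Z 0) (Z 1) (Z 2) hZ₀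
  have hβ : biprod.lift (𝟙 _) y ≫ β.hom ≫ biprod.snd =
      biprod.map (W.d 1 2) (biprod.lift 0 biprod.fst : Z 1 ⊞ Z 0 ⟶ Z 2 ⊞ Z 1) := by
    apply biprod.hom_ext <;> try apply biprod.hom_ext
    all_goals simp [β, y, absorbIso]
  have hd : (W.sum (disks T Z hZ)).d 1 2 =
      biprod.map (W.d 1 2) (biprod.lift 0 biprod.fst : Z 1 ⊞ Z 0 ⟶ Z 2 ⊞ Z 1) :=
    congrArg (biprod.map (W.d 1 2)) (disks_d 0)
  have hτ : biprod.inr ≫ β.hom ≫ biprod.snd =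
      (biprod.lift biprod.fst (biprod.lift biprod.snd 0) : W.obj 2 ⊞ Z 2 ⟶ _) := by
    apply biprod.hom_ext <;> try apply biprod.hom_ext
    all_goals simp [β, absorbIso]
  have hκ : biprod.lift (𝟙 _) y ≫ β.hom ≫ biprod.fst = biprod.fst := by simp [β, absorbIso]
  have hσ : biprod.inl ≫ β.inv ≫ biprod.desc y (-𝟙 _) = W.d 1 2 ≫ biprod.inl := by
    apply biprod.hom_ext <;> simp [β, absorbIso, y, biprod.lift_desc]
  suffices key : IsRotationAlong (W.sum (disks T Z hZ))
      (W'.sum (disks T (shiftDisks Z) (shiftDisks_isZero hZ))) (Y := W.obj 2 ⊞ Z 2) (K := W.obj 1)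
      (biprod.lift biprod.fst (biprod.lift biprod.snd 0) : W.obj 2 ⊞ Z 2 ⟶ W.obj 2 ⊞ (Z 2 ⊞ Z 1))
      (biprod.fst : W.obj 1 ⊞ (Z 1 ⊞ Z 0) ⟶ W.obj 1) (W.d 1 2 ≫ biprod.inl) by
    refine hΘ (Y := W.obj 2 ⊞ Z 2) (K := W.obj 1) h y β (hβ.trans hd.symm) ?_
    rw [← hτ, ← hκ, ← hσ] at key
    exact key
  obtain ⟨a, b, h₁, h₂, h₃⟩ := hW
  have hfst : ∀ {M N : D} (hN : IsZero N), IsIso (biprod.fst : M ⊞ N ⟶ M) := fun {M N} hN =>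
    ⟨biprod.inl, by
      apply biprod.hom_ext
      · simp
      · exact hN.eq_of_tgt _ _, biprod.inl_fst⟩
  let f₁ : Z 2 ⊞ Z 0 ≅ Z 2 := @asIso _ _ _ _ biprod.fst (hfst hZ₀)
  have hZ' : IsZero (Z (m + 4) ⊞ Z (m + 3)) := (biprod_isZero_iff _ _).2 ⟨hZ _ (by omega), hZn⟩
  let fn : W'.obj (m + 3) ⊞ (Z (m + 4) ⊞ Z (m + 3)) ≅ W'.obj (m + 3) :=
    @asIso _ _ _ _ biprod.fst (hfst hZ')
  refine ⟨biprod.mapIso (a 1 le_rfl (by omega)) f₁, fun i hi hi' => match i, hi, hi' with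
    | k + 2, hi, hi' => biprod.mapIso (a (k + 2) (by omega) hi') (Iso.refl (Z (k + 3) ⊞ Z (k + 2))),
    fn ≪≫ b, ?_, ?_, ?_, ?_⟩
  · have e₁ : (W'.sum (disks T (shiftDisks Z) (shiftDisks_isZero hZ))).d 1 2 =
        biprod.map (W'.d 1 2) (biprod.lift 0 biprod.fst : Z 2 ⊞ Z 0 ⟶ Z 3 ⊞ Z 2) :=
      congrArg (biprod.map (W'.d 1 2)) (disks_d 0)
    have e₂ : (W.sum (disks T Z hZ)).d 2 3 =
        biprod.map (W.d 2 3) (biprod.lift 0 biprod.fst : Z 2 ⊞ Z 1 ⟶ Z 3 ⊞ Z 2) :=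
      congrArg (biprod.map (W.d 2 3)) (disks_d 1)
    have := absorb_first_aux (h₁ 1 le_rfl (by omega)) (Z₁ := Z 1) (Z₂ := Z 2) (Z₃ := Z 3) f₁ rfl
    rw [← e₁, ← e₂] at this
    exact this
  · rintro (_ | _ | k) hk hk'
    · omega
    · omega
    · have e₁ : (W'.sum (disks T (shiftDisks Z) (shiftDisks_isZero hZ))).d (k + 2) (k + 3) =
          biprod.map (W'.d (k + 2) (k + 3))
            (biprod.lift 0 biprod.fst : Z (k + 3) ⊞ Z (k + 2) ⟶ Z (k + 4) ⊞ Z (k + 3)) :=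
        congrArg (biprod.map (W'.d (k + 2) (k + 3))) (disks_d (k + 1))
      have e₂ : (W.sum (disks T Z hZ)).d (k + 3) (k + 4) =
          biprod.map (W.d (k + 3) (k + 4))
            (biprod.lift 0 biprod.fst : Z (k + 3) ⊞ Z (k + 2) ⟶ Z (k + 4) ⊞ Z (k + 3)) :=
        congrArg (biprod.map (W.d (k + 3) (k + 4))) (disks_d (k + 2))
      have : biprod.map (W'.d (k + 2) (k + 3))
          (biprod.lift 0 biprod.fst : Z (k + 3) ⊞ Z (k + 2) ⟶ Z (k + 4) ⊞ Z (k + 3)) ≫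
          biprod.map (a (k + 3) (by omega) hk').hom (𝟙 _) =
          biprod.map (a (k + 2) (by omega) (by omega)).hom (𝟙 _) ≫ biprod.map (W.d (k + 3) (k + 4))
            (biprod.lift 0 biprod.fst : Z (k + 3) ⊞ Z (k + 2) ⟶ Z (k + 4) ⊞ Z (k + 3)) := by
        apply biprod.hom_ext' <;> simp [reassoc_of% h₁ (k + 2) (by omega) hk']
      rw [← e₁, ← e₂] at this
      exact this
  · have aux : ∀ x : Z (m + 3) ⊞ Z (m + 2) ⟶ Z (m + 4) ⊞ Z (m + 3),
      biprod.map (W'.d (m + 2) (m + 3)) x ≫ biprod.fst ≫ b.hom =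
      biprod.map (a (m + 2) (by omega) le_rfl).hom (𝟙 (Z (m + 3) ⊞ Z (m + 2))) ≫
        biprod.desc (W.conn ≫ T.map (biprod.inl : _ ⟶ W.obj 1 ⊞ (Z 1 ⊞ Z 0)))
          ((0 : Z (m + 3) ⊞ Z (m + 2) ⟶ T.obj (Z 1 ⊞ Z 0)) ≫ T.map biprod.inr) ≫
            T.map biprod.fst := by
      intro x
      rw [biprod.map_fst_assoc, h₂]
      apply biprod.hom_ext' <;> simp [← T.map_comp]
    exact aux _
  · change biprod.desc (W'.conn ≫ T.map (biprod.inl : _ ⟶ W'.obj 1 ⊞ (Z 2 ⊞ Z 0)))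
        ((0 : Z (m + 4) ⊞ Z (m + 3) ⟶ T.obj (Z 2 ⊞ Z 0)) ≫ T.map biprod.inr) ≫
          T.map (biprod.map (a 1 le_rfl (by omega)).hom biprod.fst) =
      ((-1 : ℤ) ^ (m + 3)) • ((biprod.fst ≫ b.hom) ≫ T.map (W.d 1 2 ≫ biprod.inl))
    apply biprod.hom_ext'
    · rw [biprod.inl_desc_assoc, Category.assoc, ← T.map_comp, biprod.inl_map, T.map_comp,
        reassoc_of% h₃, T.map_comp, Preadditive.zsmul_comp, Preadditive.comp_zsmul]
      simp
    · exact hZ'.eq_of_src _ _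

/-- The class `Θ` is closed under direct summands, if it is closed under generalized rotations. -/
lemma IsAngleBase.mem_of_summands (h : IsAngleBase m T Θ) (hΘ : IsClosedUnderRotationAlong Θ)
    {W : NSeq (m + 3) T} (hW : Summands Θ W) : Θ W := by
  have := h.additive
  have := h.isEquivalence
  -- the last `j` disks can be made to vanish: if this is so for the inverse rotation of `W`,
  -- rotating back absorbs the first disk and shifts the others, so that one more vanishes
  have key : ∀ j (W : NSeq (m + 3) T), Summands Θ W → ∃ (Z : ℕ → D)
      (hZ : ∀ k, (k = 0 ∨ m + 3 ≤ k) → IsZero (Z k)), (∀ k, m + 3 ≤ k + j → IsZero (Z k)) ∧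
      Θ (W.sum (disks T Z hZ)) := by
    intro j
    induction j with
    | zero =>
      intro W hW
      obtain ⟨Z, hZ, hWZ⟩ := h.exists_sum_disks_mem_of_summands hW
      exact ⟨Z, hZ, fun k hk => hZ k (Or.inr hk), hWZ⟩
    | succ j ih =>
      intro W hW
      obtain ⟨V, hVW⟩ := exists_isLeftRotation W
      obtain ⟨Z, hZ, hZ', hVZ⟩ := ih V (h.summands.rotate_inv hVW hW)
      refine ⟨_, _, ?_, sum_disks_mem_of_isLeftRotation hΘ hVW hVZ⟩
      rintro (_ | k) hk
      · exact hZ 0 (Or.inl rfl)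
      · exact hZ' (k + 2) (by omega)
  obtain ⟨Z, hZ, hZ', hWZ⟩ := key (m + 3) W hW
  refine h.iso_closed (sumFst W (disks T Z hZ)) (Hom.isIso_of_range _ ?_) hWZ
  rintro (_ | k) hk hk'
  · omega
  · have hz : IsZero (Z (k + 1) ⊞ Z k) :=
      (biprod_isZero_iff _ _).2 ⟨hZ' _ (by omega), hZ' _ (by omega)⟩
    refine ⟨(biprod.inl : _ ⟶ W.obj (k + 1) ⊞ (Z (k + 1) ⊞ Z k)), ?_, biprod.inl_fst⟩
    change biprod.fst ≫ biprod.inl = 𝟙 (W.obj (k + 1) ⊞ (Z (k + 1) ⊞ Z k))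
    apply biprod.hom_ext
    · simp
    · exact hz.eq_of_tgt _ _

end Cancellation

end NAng

theorem theorem5p4 {A : Type u} [Category.{v} A] [Preadditive A] [HasZeroObject A]
    [HasBinaryBiproducts A] (m : ℕ) (Ω S : A ⥤ A) [Ω.Additive] [S.Additive] (adj : Ω ⊣ S)
    (C X : ObjectProperty A) [NAng.IsAdditiveSubcategory C] [NAng.IsAdditiveSubcategory X]
    (L : NAng.NSeq (A := Aᵒᵖ) (m + 3) Ω.op → Prop) (R : NAng.NSeq (m + 3) S → Prop)
    (F : NAng.FrobeniusPrile m adj C X L R) :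
    NAng.IsNAngulated m (NAng.susp F.right F.fixR) (NAng.IsAngle F.right F.fixR) ∧
    (IsIdempotentComplete A →
      NAng.IsNAngulated m (NAng.susp F.right F.fixR) (NAng.IsStandard F.right F.fixR)) := by
  refine ⟨F.isAngleBase.summands.isNAngulated, fun h => ?_⟩
  have hΘ : NAng.IsClosedUnderRotationAlong (NAng.IsStandard F.right F.fixR) :=
    fun hV _ _ y β hβ hVW => hV.of_isRotationAlong F.le F.epic_fixR y β hβ hVW
  have e : NAng.Summands (NAng.IsStandard F.right F.fixR) = NAng.IsStandard F.right F.fixR :=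
    funext fun W => propext ⟨F.isAngleBase.mem_of_summands hΘ, fun hW => ⟨W, hW.sum hW⟩⟩
  exact e ▸ F.isAngleBase.summands.isNAngulated
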